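/- **Setting.** Fix an integer $k\ge 2$. Functions are radial profiles on $(0,\infty)$, $\langle f\mid g\rangle=\int_0^\infty fg\,r\,dr$, $\|f\|_{L^2}^2=\langle f\mid f\rangle$, $\|\varphi\|_H^2=\int_0^\infty\big((\partial_r\varphi)^2+k^2\varphi^2/r^2\big)r\,dr$, and $\|(\varphi_0,\varphi_1)\|_{\mathcal H_0}^2=\|\varphi_0\|_H^2+\|\varphi_1\|_{L^2}^2$. For $\lambda>0$ put $\varphi_\lambda(r)=\varphi(r/\lambda)$ and $\varphi_{\underline\lambda}(r)=\lambda^{-1}\varphi(r/\lambda)$. The energy is $\mathcal E(\varphi_0,\varphi_1)=\pi\int_0^\infty\big(\varphi_1^2+(\partial_r\varphi_0)^2+k^2\sin^2\varphi_0/r^2\big)r\,dr$, and $\mathcal H_0$ is the set of pairs of finite energy with $\varphi_0\to0$ at $r=0$ and $r=\infty$. Let $Q(r)=2\arctan r^k$, $\Lambda Q=r\partial_rQ$, $\kappa=\|\Lambda Q\|_{L^2}^2$ $(=2\pi/\sin(\pi/k))$, and $$\mathbf d_+(\varphi_0,\varphi_1)=\inf_{\lambda,\mu>0}\Big(\|(\varphi_0-(Q_\lambda-Q_\mu),\varphi_1)\|_{\mathcal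 H_0}^2+(\lambda/\mu)^k\Big).$$ A solution on a (nondegenerate) time interval $J$ is a pair $\vec\psi=(\psi,\psi_t)$ with values in $\mathcal H_0$, continuous in time with values in $H\times L^2$, that solves weakly $$\psi_{tt}-\psi_{rr}-\tfrac1r\psi_r+k^2\frac{\sin2\psi}{2r^2}=0 .$$ **Auxiliary functions.** $\mathcal Z$ is smooth with compact support, $\langle\mathcal Z\mid\Lambda Q\rangle>0$ and $|\mathcal Z(r)|\lesssim r^k$ for $r\le1$. $\chi$ is a smooth cutoff with $\chi(r)=1$ for $r\le1$ and $\chi(r)=0$ for $r\ge2$. For $c,R>0$, and a constant $K>0$ that is fixed once and for all, a function $q\in C^{3,1}((0,\infty))$ is called $(c,R)$-admissible if: $q(r)=\frac12r^2$ for $r\le R$; $q$ is constant on $[\widetilde R,\infty)$ for some $\widetilde R>R$; $|q'(r)|\le Kr$ and $|q''(r)|\le K$; $q''\ge-c$ and $q'/r\ge-c$; $\big(\partial_r^2+\frac1r\partial_r\big)^2q\le c\,r^{-2}$ (almost everywhere); $|r(q'/r)'|\le c$. For such $q$, $$[\mathcal A_0(\lambda)g](r)=\Big(\tfrac1{2\lambda}q''(\tfrac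 r\lambda)+\tfrac1{2r}q'(\tfrac r\lambda)\Big)g(r)+q'(\tfrac r\lambda)\,\partial_rg(r).$$ **Modulation parameters.** Given a constant $C>0$ and a solution $\vec\psi$ on $J$, modulation parameters are $C^1$ functions $\lambda,\mu:J\to(0,\infty)$ such that $g(t)=\psi(t)-Q_{\lambda(t)}+Q_{\mu(t)}$ satisfies, for all $t\in J$, $$\langle\mathcal Z_{\underline{\lambda(t)}}\mid g(t)\rangle=\langle\mathcal Z_{\underline{\mu(t)}}\mid g(t)\rangle=0,\qquad \|(g(t),\psi_t(t))\|_{\mathcal H_0}^2+(\lambda(t)/\mu(t))^k\le C\,\mathbf d_+(\vec\psi(t)).$$ Put $$b(t)=-\langle\Lambda Q_{\underline{\lambda(t)}}\mid\psi_t(t)\rangle-\langle\psi_t(t)\mid\mathcal A_0(\lambda(t))g(t)\rangle,\qquad \zeta(t)=\lambda(t)-\frac1\kappa\big\langle\chi_{\mu(t)}\Lambda Q_{\underline{\lambda(t)}}\mid g(t)\big\rangle .$$ **Proposition (Modulation Control, Part 2).** There is a constant $C_0>0$ depending only on $k$ (and the fixed constant $K$) such that the following holds for all $\mathcal Z$,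 $\chi$ as above and every $0<\delta<1-2^{-1/(k-1)}$. There are $c_1,R_1>0$ such that for all $0<c\le c_1$, all $R\ge R_1$, every $(c,R)$-admissible $q$, and all $C,\eta_0>0$ there is $\eta_1\in(0,\eta_0)$ with the following property. Let $\vec\psi$ be a solution on $J$ with $\mathcal E(\vec\psi(t))=2\mathcal E(Q,0)$ and $\mathbf d_+(\vec\psi(t))\le\eta_1$ for all $t\in J$, and let $\lambda,\mu$ be modulation parameters of $\vec\psi$ with constant $C$. Then $\zeta$ is $C^1$ on $J$ and for all $t\in J$ $$\Big|\frac{\zeta}{\lambda}-1\Big|\le\delta,\qquad |\kappa\zeta'-b|\le\delta\frac{\lambda^{k/2}}{\mu^{k/2}}\le2\delta\frac{\zeta^{k/2}}{\mu^{k/2}},$$ $$|b|\le4\sqrt{\kappa k}\Big(\frac\lambda\mu\Big)^{k/2}+\delta\frac{\lambda^{k/2}}{\mu^{k/2}}\le10\sqrt{\kappa k}\,\frac{\zeta^{k/2}}{\mu^{k/2}}.$$ In addition, $b$ is locally Lipschitz on $J$ (hence differentiable almost everywhere), and at every $t\in J$ at which $b$ is differentiable $$|b'|\le C_0\frac{\lambda^{k-1}}{\mu^k}\le2C_0\frac{\zeta^{k-1}}{\mu^k},\qquad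 b'\ge8k^2\frac{\lambda^{k-1}}{\mu^k}-\delta\frac{\lambda^{k-1}}{\mu^k}\ge2k^2\frac{\zeta^{k-1}}{\mu^k}.$$ -/

import Mathlib

open Set Filter Topology MeasureTheory
open scoped ContDiff NNReal

namespace WaveMapTwoBubble

noncomputable section

/-! Radial functions on the plane are represented by their profile `r ↦ φ r`, `r > 0`
(values at `r ≤ 0` are never used). -/

/-- The pairing `⟨f | g⟩ = ∫₀^∞ f g r dr`. -/
def pair (f g : ℝ → ℝ) : ℝ := ∫ r in Ioi (0 : ℝ), f r * g r * r

/-- `‖f‖_{L²}² = ∫₀^∞ f² r dr`. -/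
def l2Sq (f : ℝ → ℝ) : ℝ := ∫ r in Ioi (0 : ℝ), f r ^ 2 * r

/-- `‖φ‖_H² = ∫₀^∞ ((∂_r φ)² + k² φ² / r²) r dr`. -/
def hSq (k : ℕ) (φ : ℝ → ℝ) : ℝ :=
  ∫ r in Ioi (0 : ℝ), (deriv φ r ^ 2 + (k : ℝ) ^ 2 * φ r ^ 2 / r ^ 2) * r

/-- `f ∈ L²((0,∞), r dr)`. -/
structure MemL2 (f : ℝ → ℝ) : Prop where
  aestronglyMeasurable : AEStronglyMeasurable f (volume.restrict (Ioi (0 : ℝ)))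
  integrable : IntegrableOn (fun r => f r ^ 2 * r) (Ioi (0 : ℝ))

/-- `φ ∈ H`. The weak derivative of an element of `H` is locally integrable on `(0,∞)`, so such a
function is locally absolutely continuous there and its weak derivative is the a.e. derivative
`deriv φ`. -/
structure MemH (φ : ℝ → ℝ) : Prop where
  absolutelyContinuous : ∀ a b : ℝ, 0 < a → a ≤ b → AbsolutelyContinuousOnInterval φ a b
  integrable_deriv : IntegrableOn (fun r => deriv φ r ^ 2 * r) (Ioi (0 : ℝ))
  integrable_hardy : IntegrableOn (fun r => φ r ^ 2 / r) (Ioi (0 : ℝ))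

/-- The energy class `𝓗₀`: finite energy and `φ₀ → 0` at `r = 0` and at `r = ∞`. Given these
limits, `sin² φ₀` and `φ₀²` are comparable near `0` and `∞`, so finite energy is the same as
`(φ₀, φ₁) ∈ H × L²`. -/
structure MemH0 (φ₀ φ₁ : ℝ → ℝ) : Prop where
  memH : MemH φ₀
  memL2 : MemL2 φ₁
  tendsto_zero : Tendsto φ₀ (𝓝[>] 0) (𝓝 0)
  tendsto_atTop : Tendsto φ₀ atTop (𝓝 0)

/-- The energy `2π · ½ ∫₀^∞ (φ₁² + (∂_r φ₀)² + k² sin² φ₀ / r²) r dr`. -/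
def energy (k : ℕ) (φ₀ φ₁ : ℝ → ℝ) : ℝ :=
  2 * Real.pi * (1 / 2) * ∫ r in Ioi (0 : ℝ),
    (φ₁ r ^ 2 + deriv φ₀ r ^ 2 + (k : ℝ) ^ 2 * Real.sin (φ₀ r) ^ 2 / r ^ 2) * r

/-- The harmonic map `Q(r) = 2 arctan (r^k)`. -/
def Q (k : ℕ) (r : ℝ) : ℝ := 2 * Real.arctan (r ^ k)

/-- `φ_λ(r) = φ(r/λ)`. -/
def rescale (l : ℝ) (φ : ℝ → ℝ) (r : ℝ) : ℝ := φ (r / l)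

/-- `φ_{\underline λ}(r) = λ⁻¹ φ(r/λ)`. -/
def rescaleL2 (l : ℝ) (φ : ℝ → ℝ) (r : ℝ) : ℝ := 1 / l * φ (r / l)

/-- `ΛQ = r ∂_r Q`. -/
def LambdaQ (k : ℕ) (r : ℝ) : ℝ := r * deriv (Q k) r

/-- `κ = ‖ΛQ‖_{L²}²`. -/
def kappa (k : ℕ) : ℝ := l2Sq (LambdaQ k)

/-- The remainder `φ₀ - (Q_λ - Q_μ)`. -/
def remainder (k : ℕ) (l m : ℝ) (φ₀ : ℝ → ℝ) (r : ℝ) : ℝ :=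
  φ₀ r - (rescale l (Q k) r - rescale m (Q k) r)

/-- The proximity
`d₊(φ₀, φ₁) = inf_{λ, μ > 0} (‖(φ₀ - (Q_λ - Q_μ), φ₁)‖_{H × L²}² + (λ/μ)^k)`. -/
def dPlus (k : ℕ) (φ₀ φ₁ : ℝ → ℝ) : ℝ :=
  sInf {d : ℝ | ∃ l m : ℝ, 0 < l ∧ 0 < m ∧
    d = hSq k (remainder k l m φ₀) + l2Sq φ₁ + (l / m) ^ k}

/-- `(ψ, ψ_t)` is a solution on the time interval `J`, with values in `𝓗₀`, of
`ψ_tt - ψ_rr - ψ_r / r + k² sin (2ψ) / (2 r²) = 0`: it is continuous in time with values in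
`H × L²`, and the equation (as a first order system) holds weakly, against all test functions in
`C_c^∞((0,∞))` (these are dense in `H`, so nothing is lost at `r = 0`). -/
structure IsWaveMap (k : ℕ) (J : Set ℝ) (ψ ψt : ℝ → ℝ → ℝ) : Prop where
  memH0 : ∀ t ∈ J, MemH0 (ψ t) (ψt t)
  continuous : ∀ t₀ ∈ J, Tendsto
    (fun t => hSq k (fun r => ψ t r - ψ t₀ r) + l2Sq (fun r => ψt t r - ψt t₀ r)) (𝓝[J] t₀) (𝓝 0)
  velocity : ∀ φ : ℝ → ℝ, ContDiff ℝ ∞ φ → HasCompactSupport φ → tsupport φ ⊆ Ioi 0 →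
    ∀ t ∈ J, HasDerivWithinAt (fun s => pair (ψ s) φ) (pair (ψt t) φ) J t
  equation : ∀ φ : ℝ → ℝ, ContDiff ℝ ∞ φ → HasCompactSupport φ → tsupport φ ⊆ Ioi 0 →
    ∀ t ∈ J, HasDerivWithinAt (fun s => pair (ψt s) φ)
      (-(∫ r in Ioi (0 : ℝ), deriv (ψ t) r * deriv φ r * r)
        - ∫ r in Ioi (0 : ℝ), (k : ℝ) ^ 2 * Real.sin (2 * ψ t r) / (2 * r ^ 2) * φ r * r) J t

/-- The function `𝒵` that fixes the modulation parameters: smooth, compactly supported,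
`∫₀^∞ 𝒵 ΛQ r dr > 0`, and `|𝒵(r)| ≲ r^k` for `r ≤ 1`. -/
structure IsModulationProfile (k : ℕ) (Z : ℝ → ℝ) : Prop where
  contDiff : ContDiff ℝ ∞ Z
  hasCompactSupport : HasCompactSupport Z
  pair_pos : 0 < pair Z (LambdaQ k)
  vanishing : ∃ M : ℝ, ∀ r : ℝ, 0 < r → r ≤ 1 → |Z r / r ^ k| ≤ M

/-- A smooth radial cutoff, equal to `1` for `r ≤ 1` and supported in `r ≤ 2`. -/
structure IsCutoff (χ : ℝ → ℝ) : Prop where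
  contDiff : ContDiff ℝ ∞ χ
  eq_one : ∀ r : ℝ, 0 ≤ r → r ≤ 1 → χ r = 1
  eq_zero : ∀ r : ℝ, 2 ≤ r → χ r = 0

/-- The modulation parameters of a solution: `C¹` scales `λ, μ > 0` such that
`g = ψ - Q_λ + Q_μ` satisfies `⟨𝒵_{\underline λ} | g⟩ = ⟨𝒵_{\underline μ} | g⟩ = 0` and
`‖(g, ψ_t)‖² + (λ/μ)^k ≤ C d₊(ψ, ψ_t)`. (The reverse inequality, with constant `1`, is part of
the definition of `d₊`.) -/
structure IsModulation (k : ℕ) (Z : ℝ → ℝ) (C : ℝ) (J : Set ℝ) (ψ ψt : ℝ → ℝ → ℝ)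
    (lam mu : ℝ → ℝ) : Prop where
  contDiffOn_lam : ContDiffOn ℝ 1 lam J
  contDiffOn_mu : ContDiffOn ℝ 1 mu J
  lam_pos : ∀ t ∈ J, 0 < lam t
  mu_pos : ∀ t ∈ J, 0 < mu t
  orthogonal_lam : ∀ t ∈ J,
    pair (rescaleL2 (lam t) Z) (remainder k (lam t) (mu t) (ψ t)) = 0
  orthogonal_mu : ∀ t ∈ J,
    pair (rescaleL2 (mu t) Z) (remainder k (lam t) (mu t) (ψ t)) = 0
  bound : ∀ t ∈ J, hSq k (remainder k (lam t) (mu t) (ψ t)) + l2Sq (ψt t) + (lam t / mu t) ^ k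
    ≤ C * dPlus k (ψ t) (ψt t)

/-- The radial Laplacian `q'' + q' / r` of the plane. -/
def radialLaplacian (q : ℝ → ℝ) (r : ℝ) : ℝ := deriv (deriv q) r + deriv q r / r

/-- The truncations `q = q_{c,R}` of `r² / 2` used in the virial correction. `K` is the bound,
independent of `c` and `R`, on `|q'| / r` and `|q''|`. Since `q` is only `C^{3,1}`, its fourth
derivative exists almost everywhere. -/
structure IsVirialWeight (c R K : ℝ) (q : ℝ → ℝ) : Prop where
  contDiffOn : ContDiffOn ℝ 3 q (Ioi 0)
  lipschitz : ∃ L : ℝ≥0, LipschitzOnWith L (iteratedDeriv 3 q) (Ioi 0)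
  eq_half_sq : ∀ r : ℝ, 0 < r → r ≤ R → q r = 1 / 2 * r ^ 2
  eq_const : ∃ R' : ℝ, R < R' ∧ ∃ m : ℝ, ∀ r : ℝ, R' ≤ r → q r = m
  abs_deriv_le : ∀ r : ℝ, 0 < r → |deriv q r| ≤ K * r
  abs_deriv2_le : ∀ r : ℝ, 0 < r → |deriv (deriv q) r| ≤ K
  deriv2_ge : ∀ r : ℝ, 0 < r → -c ≤ deriv (deriv q) r
  deriv_div_ge : ∀ r : ℝ, 0 < r → -c ≤ 1 / r * deriv q r
  bilaplacian_le : ∀ᵐ r : ℝ, 0 < r → radialLaplacian (radialLaplacian q) r ≤ c / r ^ 2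
  multiplier_le : ∀ r : ℝ, 0 < r → |r * deriv (fun s => deriv q s / s) r| ≤ c

/-- The operator `𝓐₀(λ)`:
`g ↦ (q''(r/λ) / (2λ) + q'(r/λ) / (2r)) g + q'(r/λ) ∂_r g`. -/
def A0 (q : ℝ → ℝ) (l : ℝ) (g : ℝ → ℝ) (r : ℝ) : ℝ :=
  (1 / (2 * l) * deriv (deriv q) (r / l) + 1 / (2 * r) * deriv q (r / l)) * g r
    + deriv q (r / l) * deriv g r

/-- `b(t) = -⟨ΛQ_{\underline{λ(t)}} | ψ_t(t)⟩ - ⟨ψ_t(t) | 𝓐₀(λ(t)) g(t)⟩`, where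
`g = ψ - Q_λ + Q_μ`. -/
def bFun (k : ℕ) (q : ℝ → ℝ) (ψ ψt : ℝ → ℝ → ℝ) (lam mu : ℝ → ℝ) (t : ℝ) : ℝ :=
  -pair (rescaleL2 (lam t) (LambdaQ k)) (ψt t)
    - pair (ψt t) (A0 q (lam t) (remainder k (lam t) (mu t) (ψ t)))

/-- `ζ(t) = λ(t) - κ⁻¹ ⟨χ_{μ(t)} ΛQ_{\underline{λ(t)}} | g(t)⟩`, where `g = ψ - Q_λ + Q_μ`. -/
def zetaFun (k : ℕ) (χ : ℝ → ℝ) (ψ : ℝ → ℝ → ℝ) (lam mu : ℝ → ℝ) (t : ℝ) : ℝ :=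
  lam t - 1 / kappa k *
    pair (fun r => rescale (mu t) χ r * rescaleL2 (lam t) (LambdaQ k) r)
      (remainder k (lam t) (mu t) (ψ t))

end

end WaveMapTwoBubble

open WaveMapTwoBubble

/-!
Write `g = ψ - (Q_λ - Q_μ)` and `s = (λ/μ)^k`. Everything follows from three facts.

**Size.** At energy `2 𝓔(Q)` the energy expansion about a two-bubble gives `‖ψ_t‖² + ⟨𝓛 g | g⟩ ≤ 16
k s + o(s)`, where `𝓛` is the operator linearized about `Q_λ - Q_μ`. Under the two orthogonality
conditions `𝓛` is coercive (`exists_coercive`): cut `g` between the scales with a weight that varies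
slowly in `log r`, use on each side the factorization `∫ (∂_r g - k cos Q_λ g / r)² r dr` of the
one-bubble form, and exclude its kernel `ΛQ_λ` by orthogonality. Hence `‖g‖_H² ≲ s` and `‖ψ_t‖² ≤
(16 k + ν) s` (`exists_energy_control`). Together with `b = -⟨ΛQ_λ / λ | ψ_t⟩ + O(‖ψ_t‖ ‖g‖_H)` and
`‖ΛQ_λ / λ‖² = κ` this gives the bound for `|b|`.

**Speed of the scales.** Differentiating the orthogonality conditions gives a nondegenerate linear
system for `λ'` and `μ'`, so `|λ'| + |μ'| ≲ ‖ψ_t‖` (`exists_abs_deriv_scales_le`). Differentiating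
`⟨χ_μ ΛQ_λ / λ | g⟩` along `∂_t g = ψ_t + (λ'/λ) ΛQ_λ - (μ'/μ) ΛQ_μ`, the `λ'` term cancels the one
of `κ λ'` up to the cutoff, and `κ ζ' - b` is small (`IsWaveMap.abs_kappa_mul_sub_bFun_le`).

**The virial identity.** For fixed scales the derivative of `b` is `1/λ` times `virInt`, an integral
in `g` alone (`hasDerivWithinAt_frozen`). Since `g` is only a curve in the energy space, the
identity is proved for increments over short time intervals, whose time integrals are regular in
`r`, and summed (`inner_sub_eq_integral_of_increments`). The static estimate
`exists_virial_estimate` expands `virInt`: the interaction of the bubbles contributes `8 k² s`, the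
quadratic terms form, up to small errors, the quadratic form of `𝓛` with the weight `(q'' + q'/r) /
2`. That weight lies between `-c` and `K` and varies slowly, by the bound on the bilaplacian, so the
weighted form is at least `-δ s` and at most `(K (16 k + 1) + δ) s`. This gives both bounds on `b'`,
with `C₀ = 8 k² + K (16 k + 1) + 1`. The motion of the scales adds an error bounded by a small
multiple of `‖ψ_t‖ (|λ'| + |μ'|) / λ`: `𝓐₀(λ)` is the generator of scaling for `r ≤ R λ`, so that
the terms in `(λ'/λ) ΛQ_λ` cancel there and leave a tail of size `1 / R`
(`IsWaveMap.exists_hasDerivWithinAt_bFun`). `exists_modulation_control` fixes the constants.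
-/

namespace WaveMapTwoBubble

/-! ### Locally absolutely continuous functions on the half-line -/

/-- Local absolute continuity on `(0,∞)`. -/
def LocAC (F : ℝ → ℝ) : Prop :=
  ∀ a b : ℝ, 0 < a → a ≤ b → AbsolutelyContinuousOnInterval F a b

namespace LocAC

variable {F G : ℝ → ℝ}

lemma mul (hF : LocAC F) (hG : LocAC G) : LocAC (fun r => F r * G r) :=
  fun a b ha hab => (hF a b ha hab).fun_mul (hG a b ha hab)

lemma add (hF : LocAC F) (hG : LocAC G) : LocAC (fun r => F r + G r) :=
  fun a b ha hab => (hF a b ha hab).fun_add (hG a b ha hab)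

lemma sub (hF : LocAC F) (hG : LocAC G) : LocAC (fun r => F r - G r) :=
  fun a b ha hab => (hF a b ha hab).fun_sub (hG a b ha hab)

lemma const_mul (c : ℝ) (hF : LocAC F) : LocAC (fun r => c * F r) :=
  fun a b ha hab => (hF a b ha hab).const_mul c

lemma continuousOn (hF : LocAC F) : ContinuousOn F (Ioi 0) := by
  intro x hx
  have hx0 : (0:ℝ) < x := hx
  have h := (hF (x / 2) (2 * x) (by positivity) (by linarith)).continuousOn
  rw [uIcc_of_le (by linarith)] at h
  exact (h.continuousAt (Icc_mem_nhds (by linarith) (by linarith))).continuousWithinAt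

lemma of_hasDerivAt {F' : ℝ → ℝ} (h : ∀ r, 0 < r → HasDerivAt F (F' r) r)
    (hc : ContinuousOn F' (Ioi 0)) : LocAC F := by
  intro a b ha hab
  have hsub : Icc a b ⊆ Ioi 0 := fun x hx => lt_of_lt_of_le ha hx.1
  obtain ⟨C, hC⟩ := isCompact_Icc.exists_bound_of_continuousOn (hc.mono hsub)
  have hC0 : 0 ≤ C := (norm_nonneg _).trans (hC a (left_mem_Icc.2 hab))
  have : LipschitzOnWith (Real.toNNReal C) F (uIcc a b) := by
    rw [uIcc_of_le hab]
    refine (convex_Icc a b).lipschitzOnWith_of_nnnorm_hasDerivWithin_le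
      (f' := F') (fun x hx => (h x (hsub hx)).hasDerivWithinAt) (fun x hx => ?_)
    rw [← NNReal.coe_le_coe, coe_nnnorm, Real.coe_toNNReal C hC0]
    exact hC x hx
  exact this.absolutelyContinuousOnInterval

lemma ae_differentiableAt (hF : LocAC F) : ∀ᵐ r : ℝ, 0 < r → DifferentiableAt ℝ F r := by
  have h : ∀ n : ℕ, ∀ᵐ r : ℝ, r ∈ uIcc (1 / ((n:ℝ) + 1)) ((n:ℝ) + 1) →
      DifferentiableAt ℝ F r := fun n =>
    (hF _ _ (by positivity) (by
      rw [div_le_iff₀ (by positivity)]; nlinarith [(Nat.cast_nonneg n : (0:ℝ) ≤ n)])).ae_differentiableAt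
  rw [← ae_all_iff] at h
  filter_upwards [h] with r hr hr0
  obtain ⟨n, hn⟩ := exists_nat_ge (max r (1 / r))
  refine hr n ?_
  have h1 : r ≤ n := (le_max_left _ _).trans hn
  have h2 : 1 / r ≤ n := (le_max_right _ _).trans hn
  have h3 : 1 / ((n:ℝ) + 1) ≤ r := by
    rw [div_le_iff₀ (by positivity)]
    rw [div_le_iff₀ hr0] at h2
    nlinarith
  rw [uIcc_of_le (by linarith)]
  exact ⟨h3, by linarith⟩

lemma integral_deriv (hF : LocAC F) {a b : ℝ} (ha : 0 < a) (hb : 0 < b) :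
    ∫ x in a..b, deriv F x = F b - F a := by
  rcases le_total a b with h | h
  · exact (hF a b ha h).integral_deriv_eq_sub
  · exact (hF b a hb h).symm.integral_deriv_eq_sub

lemma intervalIntegrable_deriv (hF : LocAC F) {a b : ℝ} (ha : 0 < a) (hb : 0 < b) :
    IntervalIntegrable (deriv F) volume a b := by
  rcases le_total a b with h | h
  · exact (hF a b ha h).intervalIntegrable_deriv
  · exact (hF b a hb h).symm.intervalIntegrable_deriv

lemma lipschitz_comp {φ : ℝ → ℝ} {C : ℝ≥0} (hφ : LipschitzWith C φ) (hF : LocAC F) :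
    LocAC (fun r => φ (F r)) := by
  intro a b ha hab
  have h := hF a b ha hab
  rw [absolutelyContinuousOnInterval_iff] at h ⊢
  intro ε hε
  obtain ⟨δ, hδ, H⟩ := h (ε / (C + 1)) (by positivity)
  refine ⟨δ, hδ, fun E hE hlt => ?_⟩
  have h1 := H E hE hlt
  calc ∑ i ∈ Finset.range E.1, dist (φ (F (E.2 i).1)) (φ (F (E.2 i).2))
      ≤ ∑ i ∈ Finset.range E.1, (C + 1 : ℝ) * dist (F (E.2 i).1) (F (E.2 i).2) := by
        refine Finset.sum_le_sum fun i _ => (hφ.dist_le_mul _ _).trans ?_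
        gcongr; linarith
    _ = (C + 1 : ℝ) * ∑ i ∈ Finset.range E.1, dist (F (E.2 i).1) (F (E.2 i).2) := by
        rw [Finset.mul_sum]
    _ < (C + 1 : ℝ) * (ε / (C + 1)) := by gcongr
    _ = ε := by field_simp

lemma const (c : ℝ) : LocAC (fun _ => c) :=
  of_hasDerivAt (F' := fun _ => 0) (fun r _ => hasDerivAt_const r c) continuousOn_const

end LocAC

lemma not_integrableOn_inv_Ioo {δ : ℝ} (hδ : 0 < δ) :
    ¬ IntegrableOn (fun x : ℝ => x⁻¹) (Ioo 0 δ) := by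
  intro h
  have : IntervalIntegrable (fun x : ℝ => x⁻¹) volume 0 δ := by
    rw [intervalIntegrable_iff_integrableOn_Ioo_of_le hδ.le]; exact h
  rw [intervalIntegrable_inv_iff] at this
  rcases this with h | h
  · exact hδ.ne h
  · exact h left_mem_uIcc

/-- A function with integrable derivative has limits at `0` and `∞`; if `F / r` is integrable as
well, both limits vanish, because `1 / r` is integrable at neither end. -/
lemma tendsto_zero_of_integrable {F : ℝ → ℝ} (hF : LocAC F) (hd : IntegrableOn (deriv F) (Ioi 0))
    (hi : IntegrableOn (fun r => F r / r) (Ioi 0)) :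
    Tendsto F (𝓝[>] 0) (𝓝 0) ∧ Tendsto F atTop (𝓝 0) := by
  have hm : AEStronglyMeasurable (fun x : ℝ => x⁻¹) (volume.restrict (Ioi (0:ℝ))) := by fun_prop
  have h1 : Tendsto F atTop (𝓝 (F 1 + ∫ r in Ioi (1:ℝ), deriv F r)) := by
    have := (intervalIntegral_tendsto_integral_Ioi 1
      (hd.mono_set (Ioi_subset_Ioi zero_le_one)) tendsto_id).const_add (F 1)
    refine this.congr' ?_
    filter_upwards [eventually_gt_atTop 0] with x hx
    rw [id, hF.integral_deriv one_pos hx]; ring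
  have h2 : Tendsto F (𝓝[>] 0) (𝓝 (F 1 - ∫ r in Ioc (0:ℝ) 1, deriv F r)) := by
    have hii : IntegrableOn (deriv F) (uIcc 0 1) := by
      rw [uIcc_of_le zero_le_one, integrableOn_Icc_iff_integrableOn_Ioc]
      exact hd.mono_set (fun x hx => hx.1)
    have hc := intervalIntegral.continuousOn_primitive_interval_left hii
    have := (hc 0 left_mem_uIcc).tendsto
    rw [intervalIntegral.integral_of_le zero_le_one, uIcc_of_le zero_le_one] at this
    have h3 := (this.mono_left (nhdsWithin_mono 0 Ioc_subset_Icc_self)).const_sub (F 1)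
    rw [nhdsWithin_Ioc_eq_nhdsGT zero_lt_one] at h3
    refine h3.congr' ?_
    filter_upwards [self_mem_nhdsWithin] with x hx
    rw [hF.integral_deriv hx one_pos]; ring
  have key : ∀ (L : ℝ) (x : ℝ), 0 < x → |L| / 2 < |F x| → L ≠ 0 →
      ‖x⁻¹‖ ≤ (2 / |L|) * ‖F x / x‖ := by
    intro L x hx h hL
    have hL' : 0 < |L| := abs_pos.2 hL
    rw [norm_inv, norm_div, Real.norm_eq_abs, Real.norm_eq_abs, abs_of_pos hx, inv_eq_one_div,
      ← mul_div_assoc, div_le_div_iff_of_pos_right hx, div_mul_eq_mul_div, le_div_iff₀ hL']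
    linarith
  have L1 : F 1 + ∫ r in Ioi (1:ℝ), deriv F r = 0 := by
    by_contra hL
    set L := F 1 + ∫ r in Ioi (1:ℝ), deriv F r
    have hev := h1.abs.eventually_const_lt (half_lt_self (abs_pos.2 hL))
    obtain ⟨A, hA⟩ := (hev.and (eventually_gt_atTop 0)).exists_forall_of_atTop
    have hA0 : 0 < A := (hA A le_rfl).2
    refine not_integrableOn_Ioi_inv (a := A) ?_
    have hsub : Ioi A ⊆ Ioi (0:ℝ) := by gcongr
    refine ((hi.mono_set hsub).norm.const_mul (2 / |L|)).mono (hm.mono_measure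
      (Measure.restrict_mono hsub le_rfl)) ?_
    filter_upwards [ae_restrict_mem measurableSet_Ioi] with x hx
    refine (key L x (hsub hx) (hA x (le_of_lt hx)).1 hL).trans (le_abs_self _)
  have L2 : F 1 - ∫ r in Ioc (0:ℝ) 1, deriv F r = 0 := by
    by_contra hL
    set L := F 1 - ∫ r in Ioc (0:ℝ) 1, deriv F r
    have hev := h2.abs.eventually_const_lt (half_lt_self (abs_pos.2 hL))
    obtain ⟨A, hA0, hA⟩ := mem_nhdsGT_iff_exists_Ioo_subset.1 hev
    refine not_integrableOn_inv_Ioo hA0 ?_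
    have hsub : Ioo 0 A ⊆ Ioi (0:ℝ) := fun x hx => hx.1
    refine ((hi.mono_set hsub).norm.const_mul (2 / |L|)).mono (hm.mono_measure
      (Measure.restrict_mono hsub le_rfl)) ?_
    filter_upwards [ae_restrict_mem measurableSet_Ioo] with x hx
    refine (key L x hx.1 (hA hx) hL).trans (le_abs_self _)
  rw [L1] at h1
  rw [L2] at h2
  exact ⟨h2, h1⟩

lemma LocAC.sub_eq_integral_Ioi {F : ℝ → ℝ} (hF : LocAC F) (hd : IntegrableOn (deriv F) (Ioi 0))
    {a b : ℝ} (h0 : Tendsto F (𝓝[>] 0) (𝓝 a)) (h1 : Tendsto F atTop (𝓝 b)) :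
    ∫ r in Ioi (0:ℝ), deriv F r = b - a := by
  have e1 : Tendsto (fun x => ∫ r in x..1, deriv F r) (𝓝[>] 0) (𝓝 (F 1 - a)) := by
    refine (h0.const_sub (F 1)).congr' ?_
    filter_upwards [self_mem_nhdsWithin] with x hx
    rw [hF.integral_deriv hx one_pos]
  have e1' : Tendsto (fun x => ∫ r in x..1, deriv F r) (𝓝[>] 0)
      (𝓝 (∫ r in (0:ℝ)..1, deriv F r)) := by
    have hii : IntegrableOn (deriv F) (uIcc 0 1) := by
      rw [uIcc_of_le zero_le_one, integrableOn_Icc_iff_integrableOn_Ioc]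
      exact hd.mono_set (fun x hx => hx.1)
    have := ((intervalIntegral.continuousOn_primitive_interval_left hii) 0 left_mem_uIcc).tendsto
    rw [uIcc_of_le zero_le_one] at this
    have h3 := this.mono_left (nhdsWithin_mono 0 Ioc_subset_Icc_self)
    rwa [nhdsWithin_Ioc_eq_nhdsGT zero_lt_one] at h3
  have e2 : Tendsto (fun x => ∫ r in (1:ℝ)..x, deriv F r) atTop (𝓝 (b - F 1)) := by
    refine (h1.sub_const (F 1)).congr' ?_
    filter_upwards [eventually_gt_atTop 0] with x hx
    rw [hF.integral_deriv one_pos hx]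
  have e2' := intervalIntegral_tendsto_integral_Ioi 1
      (hd.mono_set (Ioi_subset_Ioi zero_le_one)) tendsto_id
  have : Ioc (0:ℝ) 1 ∪ Ioi 1 = Ioi 0 := by norm_num
  rw [← this, setIntegral_union (Set.Ioc_disjoint_Ioi le_rfl) measurableSet_Ioi
    (hd.mono_set (fun x hx => hx.1)) (hd.mono_set (Ioi_subset_Ioi zero_le_one)),
    ← intervalIntegral.integral_of_le zero_le_one, tendsto_nhds_unique e1' e1,
    tendsto_nhds_unique e2' e2]
  ring

lemma integral_deriv_eq_zero {F : ℝ → ℝ} (hF : LocAC F) (hd : IntegrableOn (deriv F) (Ioi 0))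
    (hi : IntegrableOn (fun r => F r / r) (Ioi 0)) : ∫ r in Ioi (0:ℝ), deriv F r = 0 := by
  obtain ⟨h0, h1⟩ := tendsto_zero_of_integrable hF hd hi
  rw [hF.sub_eq_integral_Ioi hd h0 h1, sub_zero]

/-- The version of `integral_deriv_eq_zero` for a prescribed a.e. derivative. -/
lemma integral_eq_zero_of_ae_hasDerivAt {F F' : ℝ → ℝ} (hF : LocAC F)
    (hd : ∀ᵐ r : ℝ, 0 < r → HasDerivAt F (F' r) r) (hi' : IntegrableOn F' (Ioi 0))
    (hi : IntegrableOn (fun r => F r / r) (Ioi 0)) : ∫ r in Ioi (0:ℝ), F' r = 0 := by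
  have h : deriv F =ᵐ[volume.restrict (Ioi 0)] F' := by
    rw [EventuallyEq, ae_restrict_iff' measurableSet_Ioi]
    filter_upwards [hd] with r hr h0 using (hr h0).deriv
  rw [← integral_congr_ae h]
  exact integral_deriv_eq_zero hF (hi'.congr h.symm) hi

lemma LocAC.aesm {F : ℝ → ℝ} (hF : LocAC F) :
    AEStronglyMeasurable F (volume.restrict (Ioi (0:ℝ))) :=
  hF.continuousOn.aestronglyMeasurable measurableSet_Ioi

/-! ### Weak derivatives -/

/-- Test functions on `(0,∞)`. -/
structure IsTest (φ : ℝ → ℝ) : Prop where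
  contDiff : ContDiff ℝ ∞ φ
  hasCompactSupport : HasCompactSupport φ
  tsupport_subset : tsupport φ ⊆ Ioi 0

lemma IsTest.exists_Icc {φ : ℝ → ℝ} (h : IsTest φ) :
    ∃ a b : ℝ, 0 < a ∧ a < b ∧ tsupport φ ⊆ Ioo a b ∧ ∀ r, r ∉ Ioo a b → φ r = 0 := by
  rcases (tsupport φ).eq_empty_or_nonempty with he | hne
  · refine ⟨1, 2, one_pos, one_lt_two, by simp [he], fun r _ => ?_⟩
    exact image_eq_zero_of_notMem_tsupport (by simp [he])
  · have hc : IsCompact (tsupport φ) := h.hasCompactSupport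
    obtain ⟨a, ha, ha'⟩ := hc.exists_isLeast hne
    obtain ⟨b, hb, hb'⟩ := hc.exists_isGreatest hne
    have ha0 : 0 < a := h.tsupport_subset ha
    have hab : a ≤ b := hb' ha
    have hs : tsupport φ ⊆ Ioo (a / 2) (b + 1) := fun x hx =>
      ⟨by linarith [ha' hx], by linarith [hb' hx]⟩
    exact ⟨a / 2, b + 1, by linarith, by linarith, hs, fun r hr =>
      image_eq_zero_of_notMem_tsupport fun hx => hr (hs hx)⟩

lemma IsTest.locAC {φ : ℝ → ℝ} (h : IsTest φ) : LocAC φ :=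
  LocAC.of_hasDerivAt (fun r _ => ((h.contDiff.differentiable (by simp)) r).hasDerivAt)
    ((h.contDiff.continuous_deriv (by simp)).continuousOn)

lemma IsTest.deriv {φ : ℝ → ℝ} (h : IsTest φ) : IsTest (deriv φ) := by
  refine ⟨?_, h.hasCompactSupport.deriv, (tsupport_deriv_subset (𝕜 := ℝ)).trans h.tsupport_subset⟩
  have := h.contDiff
  rw [show (∞ : WithTop ℕ∞) = ∞ + 1 from rfl, contDiff_succ_iff_deriv] at this
  exact this.2.2

lemma IsTest.integrable_mul {φ f : ℝ → ℝ} (h : IsTest φ) (hf : LocallyIntegrableOn f (Ioi 0)) :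
    IntegrableOn (fun r => f r * φ r) (Ioi 0) := by
  obtain ⟨a, b, ha, hab, hs, h0⟩ := h.exists_Icc
  have h1 : IntegrableOn f (Icc a b) :=
    hf.integrableOn_compact_subset (fun x hx => lt_of_lt_of_le ha hx.1) isCompact_Icc
  have h2 : IntegrableOn (fun r => f r * φ r) (Icc a b) :=
    h1.mul_continuousOn h.contDiff.continuous.continuousOn isCompact_Icc
  have h3 : IntegrableOn (fun r => f r * φ r) univ := by
    refine h2.of_forall_sdiff_eq_zero MeasurableSet.univ fun x hx => ?_
    rw [h0 x fun hh => hx.2 (Ioo_subset_Icc_self hh), mul_zero]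
  exact h3.mono_set (subset_univ _)

/-- Integration by parts against a test function. -/
lemma LocAC.integral_mul_deriv_test {G φ : ℝ → ℝ} (hG : LocAC G) (h : IsTest φ) :
    ∫ r in Ioi (0:ℝ), G r * deriv φ r = -∫ r in Ioi (0:ℝ), deriv G r * φ r := by
  obtain ⟨a, b, ha, hab, hs, h0⟩ := h.exists_Icc
  obtain ⟨a', b', ha', hab', hs', h0'⟩ := h.deriv.exists_Icc
  have hd0 : ∀ r, r ∉ Ioo a b → _root_.deriv φ r = 0 := fun r hr => by
    refine image_eq_zero_of_notMem_tsupport fun hx => hr (hs ?_)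
    exact (tsupport_deriv_subset (𝕜 := ℝ)) hx
  have red : ∀ f : ℝ → ℝ, (∀ r, r ∉ Ioo a b → f r = 0) →
      ∫ r in Ioi (0:ℝ), f r = ∫ r in a..b, f r := by
    intro f hf
    rw [intervalIntegral.integral_of_le hab.le]
    have hsub : Ioc a b ⊆ Ioi (0:ℝ) := fun x hx => ha.trans hx.1
    exact setIntegral_eq_of_subset_of_forall_sdiff_eq_zero measurableSet_Ioi hsub
      fun x hx => hf x fun hh => hx.2 ⟨hh.1, hh.2.le⟩
  rw [red _ fun r hr => by rw [hd0 r hr, mul_zero], red _ fun r hr => by rw [h0 r hr, mul_zero],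
    (hG a b ha hab.le).integral_mul_deriv_eq_deriv_mul (h.locAC a b ha hab.le),
    h0 a (by simp), h0 b (by simp)]
  simp

lemma ae_eq_zero_of_test {f : ℝ → ℝ} (hf : LocallyIntegrableOn f (Ioi 0))
    (h : ∀ φ, IsTest φ → ∫ r in Ioi (0:ℝ), f r * φ r = 0) : ∀ᵐ r : ℝ, 0 < r → f r = 0 := by
  refine isOpen_Ioi.ae_eq_zero_of_integral_contDiff_smul_eq_zero hf fun φ h1 h2 h3 => ?_
  rw [← h φ ⟨h1, h2, h3⟩]
  have h0 : ∀ x, x ∉ Ioi (0:ℝ) → φ x • f x = 0 := fun x hx => by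
    rw [image_eq_zero_of_notMem_tsupport fun hh => hx (h3 hh), zero_smul]
  rw [← setIntegral_eq_integral_of_forall_compl_eq_zero h0]
  simp [mul_comm]

lemma exists_isTest_integral_one : ∃ θ, IsTest θ ∧ ∫ r in Ioi (0:ℝ), θ r = 1 := by
  let f : ContDiffBump (2:ℝ) := ⟨1/2, 1, by norm_num, by norm_num⟩
  have hs : tsupport (f.normed volume) ⊆ Ioi 0 := by
    rw [f.tsupport_normed_eq, Real.closedBall_eq_Icc]
    intro x hx
    have : (2:ℝ) - 1 ≤ x := hx.1
    exact lt_of_lt_of_le (by norm_num) this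
  refine ⟨f.normed volume, ⟨f.contDiff_normed, f.hasCompactSupport_normed, hs⟩, ?_⟩
  rw [setIntegral_eq_integral_of_forall_compl_eq_zero
    fun x hx => image_eq_zero_of_notMem_tsupport fun hh => hx (hs hh)]
  exact f.integral_normed

lemma exists_isTest_primitive {η : ℝ → ℝ} (h : IsTest η) (h0 : ∫ r in Ioi (0:ℝ), η r = 0) :
    ∃ H, IsTest H ∧ deriv H = η := by
  obtain ⟨a, b, ha, hab, hs, hz⟩ := h.exists_Icc
  have hc : Continuous η := h.contDiff.continuous
  have hd : ∀ x, HasDerivAt (fun x => ∫ r in a..x, η r) (η x) x := fun x =>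
    intervalIntegral.integral_hasDerivAt_right (hc.intervalIntegrable _ _)
      (hc.stronglyMeasurableAtFilter _ _) hc.continuousAt
  have hd' : deriv (fun x => ∫ r in a..x, η r) = η := funext fun x => (hd x).deriv
  have hsupp : ∀ x, x ∉ Icc a b → ∫ r in a..x, η r = 0 := by
    intro x hx
    rcases lt_or_ge x a with hxa | hxa
    · refine intervalIntegral.integral_zero_ae (ae_of_all _ fun r hr => hz r fun hh => ?_)
      rw [uIoc_of_ge hxa.le] at hr
      exact absurd hr.2 (not_le.2 hh.1)
    · have hbx : b < x := by by_contra hh; exact hx ⟨hxa, not_lt.1 hh⟩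
      rw [intervalIntegral.integral_of_le hxa, ← h0]
      have hsub : Ioc a x ⊆ Ioi (0:ℝ) := fun y hy => ha.trans hy.1
      exact (setIntegral_eq_of_subset_of_forall_sdiff_eq_zero measurableSet_Ioi hsub
        fun y hy => hz y fun hh => hy.2 ⟨hh.1, (hh.2.trans hbx).le⟩).symm
  have hts : tsupport (fun x => ∫ r in a..x, η r) ⊆ Icc a b :=
    closure_minimal (fun x hx => by_contra fun hh => hx (hsupp x hh)) isClosed_Icc
  refine ⟨fun x => ∫ r in a..x, η r, ⟨?_, ?_, hts.trans fun x hx => lt_of_lt_of_le ha hx.1⟩, hd'⟩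
  · rw [show (∞ : WithTop ℕ∞) = ∞ + 1 from rfl, contDiff_succ_iff_deriv]
    exact ⟨fun x => (hd x).differentiableAt, by simp, by rw [hd']; exact h.contDiff⟩
  · exact isCompact_Icc.of_isClosed_subset (isClosed_tsupport _) hts

lemma IsTest.sub_const_mul {φ θ : ℝ → ℝ} (h : IsTest φ) (h' : IsTest θ) (c : ℝ) :
    IsTest (fun r => φ r - c * θ r) := by
  have hsub : tsupport (fun r => φ r - c * θ r) ⊆ tsupport φ ∪ tsupport θ := by
    refine closure_minimal (fun x hx => ?_) ((isClosed_tsupport _).union (isClosed_tsupport _))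
    by_contra hh
    rw [mem_union, not_or] at hh
    refine hx ?_
    simp only [image_eq_zero_of_notMem_tsupport hh.1, image_eq_zero_of_notMem_tsupport hh.2]
    ring
  refine ⟨h.contDiff.sub (contDiff_const.mul h'.contDiff), ?_,
    hsub.trans (union_subset h.tsupport_subset h'.tsupport_subset)⟩
  exact (IsCompact.union h.hasCompactSupport h'.hasCompactSupport).of_isClosed_subset
    (isClosed_tsupport _) hsub

/-- A function with a locally integrable weak derivative has a locally absolutely continuous
representative. -/
lemma exists_locAC_of_weak_deriv {f g : ℝ → ℝ} (hf : LocallyIntegrableOn f (Ioi 0))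
    (hg : LocallyIntegrableOn g (Ioi 0))
    (h : ∀ φ, IsTest φ → ∫ r in Ioi (0:ℝ), f r * deriv φ r = -∫ r in Ioi (0:ℝ), g r * φ r) :
    ∃ F, LocAC F ∧ (∀ᵐ r : ℝ, 0 < r → F r = f r) ∧
      ∀ᵐ r : ℝ, 0 < r → HasDerivAt F (g r) r := by
  have hgi : ∀ a b : ℝ, 0 < a → 0 < b → IntervalIntegrable g volume a b := fun a b ha hb =>
    intervalIntegrable_iff.2 ((hg.integrableOn_compact_subset
      (fun x hx => lt_of_lt_of_le (lt_min ha hb) hx.1) isCompact_uIcc).mono_set uIoc_subset_uIcc)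
  let G : ℝ → ℝ := fun r => ∫ s in (1:ℝ)..r, g s
  have hG : LocAC G := by
    intro a b ha hab
    have hm : 0 < min a 1 := lt_min ha one_pos
    have hM : 0 < max b 1 := by positivity
    have hle : min a 1 ≤ max b 1 := by norm_num
    refine ((hgi _ _ hm hM).absolutelyContinuousOnInterval_intervalIntegral
      (c := 1) ?_).mono ?_
    · rw [uIcc_of_le hle]; exact ⟨min_le_right _ _, le_max_right _ _⟩
    · rw [uIcc_of_le hle, uIcc_of_le hab]
      exact Icc_subset_Icc (min_le_left _ _) (le_max_left _ _)
  have hGd : ∀ᵐ r : ℝ, 0 < r → HasDerivAt G (g r) r := by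
    have h1 : ∀ n : ℕ, ∀ᵐ r : ℝ, r ∈ uIcc (1 / ((n:ℝ) + 1)) ((n:ℝ) + 1) →
        HasDerivAt G (g r) r := fun n => by
      have h2 := (hgi (1 / ((n:ℝ) + 1)) ((n:ℝ) + 1) (by positivity)
        (by positivity)).ae_hasDerivAt_integral
      filter_upwards [h2] with x hx hxm
      refine hx hxm 1 ?_
      have : 1 / ((n:ℝ) + 1) ≤ 1 := by
        rw [div_le_iff₀ (by positivity)]; linarith [(Nat.cast_nonneg n : (0:ℝ) ≤ n)]
      rw [uIcc_of_le (by linarith)]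
      exact ⟨this, by linarith [(Nat.cast_nonneg n : (0:ℝ) ≤ n)]⟩
    rw [← ae_all_iff] at h1
    filter_upwards [h1] with r hr hr0
    obtain ⟨n, hn⟩ := exists_nat_ge (max r (1 / r))
    refine hr n ?_
    have h1 : r ≤ n := (le_max_left _ _).trans hn
    have h2 : 1 / r ≤ n := (le_max_right _ _).trans hn
    have h3 : 1 / ((n:ℝ) + 1) ≤ r := by
      rw [div_le_iff₀ (by positivity)]
      rw [div_le_iff₀ hr0] at h2
      nlinarith
    rw [uIcc_of_le (by linarith)]
    exact ⟨h3, by linarith⟩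
  have hGl : LocallyIntegrableOn G (Ioi 0) :=
    hG.continuousOn.locallyIntegrableOn measurableSet_Ioi
  obtain ⟨θ, hθ, hθ1⟩ := exists_isTest_integral_one
  have hfG : LocallyIntegrableOn (fun r => f r - G r) (Ioi 0) := hf.sub hGl
  have horth : ∀ φ, IsTest φ → ∫ r in Ioi (0:ℝ), (f r - G r) * deriv φ r = 0 := by
    intro φ hφ
    simp_rw [sub_mul]
    rw [integral_sub (hφ.deriv.integrable_mul hf) (hφ.deriv.integrable_mul hGl), h φ hφ,
      hG.integral_mul_deriv_test hφ]
    have : ∫ r in Ioi (0:ℝ), deriv G r * φ r = ∫ r in Ioi (0:ℝ), g r * φ r := by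
      refine setIntegral_congr_ae measurableSet_Ioi ?_
      filter_upwards [hGd] with r hr h0
      rw [(hr h0).deriv]
    rw [this]; ring
  set c := ∫ r in Ioi (0:ℝ), (f r - G r) * θ r with hc
  have hzero : ∀ᵐ r : ℝ, 0 < r → (f r - G r) - c = 0 := by
    refine ae_eq_zero_of_test (hfG.sub
      (continuousOn_const.locallyIntegrableOn measurableSet_Ioi)) fun φ hφ => ?_
    set C := ∫ r in Ioi (0:ℝ), φ r with hC
    have one_int : ∀ ψ, IsTest ψ → IntegrableOn ψ (Ioi 0) := fun ψ hψ => by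
      simpa using hψ.integrable_mul (f := fun _ => 1)
        (continuousOn_const.locallyIntegrableOn measurableSet_Ioi)
    have hη := hφ.sub_const_mul hθ C
    obtain ⟨H, hH, hHd⟩ := exists_isTest_primitive hη (by
      rw [integral_sub (one_int φ hφ) ((one_int θ hθ).const_mul C), integral_const_mul, hθ1]; ring)
    have h1 := horth H hH
    rw [hHd] at h1
    have e1 : ∀ r, (f r - G r) * (φ r - C * θ r) = (f r - G r) * φ r - C * ((f r - G r) * θ r) :=
      fun r => by ring
    simp_rw [e1] at h1
    rw [integral_sub (hφ.integrable_mul hfG) ((hθ.integrable_mul hfG).const_mul C),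
      integral_const_mul, ← hc] at h1
    simp_rw [sub_mul _ c]
    rw [integral_sub (hφ.integrable_mul hfG) ((one_int φ hφ).const_mul c), integral_const_mul,
      ← hC]
    linarith
  refine ⟨fun r => G r + c, hG.add (LocAC.const c), ?_, ?_⟩
  · filter_upwards [hzero] with r hr h0
    linarith [hr h0]
  · filter_upwards [hGd] with r hr h0 using (hr h0).add_const c

/-! ### Integrals over the half-line -/

section HalfLine
variable {f g : ℝ → ℝ} {a b A B r : ℝ}

lemma abs_mul_le (ha : |a| ≤ A) (hb : |b| ≤ B) : |a * b| ≤ A * B := by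
  rw [abs_mul]; exact mul_le_mul ha hb (abs_nonneg _) ((abs_nonneg _).trans ha)

lemma abs_mul_le_right (c : ℝ) (ha : |a| ≤ A) : |a * c| ≤ A * |c| := abs_mul_le ha le_rfl

lemma abs_div_le (hr : 0 < r) (ha : |a| ≤ A) : |a / r| ≤ A / r := by
  rw [abs_div, abs_of_pos hr]; gcongr

lemma abs_div_le_mul_abs_div (h : |a| ≤ A * |b|) : |a / r| ≤ A * |b / r| := by
  rw [abs_div, abs_div, ← mul_div_assoc]
  exact div_le_div_of_nonneg_right h (abs_nonneg r)

lemma ae_Ioi {p : ℝ → Prop} (h : ∀ r, 0 < r → p r) : ∀ᵐ r ∂(volume.restrict (Ioi (0:ℝ))), p r :=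
  (ae_restrict_iff' measurableSet_Ioi).2 (ae_of_all _ h)

lemma integral_congr_Ioi (h : ∀ r, 0 < r → f r = g r) :
    ∫ r in Ioi (0:ℝ), f r = ∫ r in Ioi (0:ℝ), g r := setIntegral_congr_fun measurableSet_Ioi h

lemma integrableOn_of_abs_le (hg : IntegrableOn g (Ioi 0))
    (hf : AEMeasurable f (volume.restrict (Ioi (0:ℝ)))) (h : ∀ r, 0 < r → |f r| ≤ g r) :
    IntegrableOn f (Ioi 0) := hg.mono' hf.aestronglyMeasurable (ae_Ioi h)

lemma abs_integral_le_of_abs_le (hg : IntegrableOn g (Ioi 0)) (h : ∀ r, 0 < r → |f r| ≤ g r) :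
    |∫ r in Ioi (0:ℝ), f r| ≤ ∫ r in Ioi (0:ℝ), g r := by
  rw [← Real.norm_eq_abs]; exact norm_integral_le_of_norm_le hg (ae_Ioi h)

/-- `f` is integrable on `(0, ∞)` with integral `a`. -/
def HasInt (f : ℝ → ℝ) (a : ℝ) : Prop :=
  IntegrableOn f (Ioi 0) ∧ ∫ r in Ioi (0:ℝ), f r = a

namespace HasInt

lemma add (hf : HasInt f a) (hg : HasInt g b) : HasInt (fun r => f r + g r) (a + b) :=
  ⟨hf.1.add hg.1, by rw [← hf.2, ← hg.2]; exact integral_add hf.1 hg.1⟩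

lemma sub (hf : HasInt f a) (hg : HasInt g b) : HasInt (fun r => f r - g r) (a - b) :=
  ⟨hf.1.sub hg.1, by rw [← hf.2, ← hg.2]; exact integral_sub hf.1 hg.1⟩

lemma const_mul (c : ℝ) (hf : HasInt f a) : HasInt (fun r => c * f r) (c * a) :=
  ⟨hf.1.const_mul c, by rw [← hf.2]; exact integral_const_mul c _⟩

lemma of_integrable (hf : IntegrableOn f (Ioi 0)) : HasInt f (∫ r in Ioi (0:ℝ), f r) := ⟨hf, rfl⟩

lemma congr (hf : HasInt f a) (h : ∀ᵐ r : ℝ, 0 < r → g r = f r) : HasInt g a := by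
  have h' : g =ᵐ[volume.restrict (Ioi (0:ℝ))] f := (ae_restrict_iff' measurableSet_Ioi).2 h
  exact ⟨hf.1.congr h'.symm, by rw [← hf.2]; exact integral_congr_ae h'⟩

end HasInt

lemma hasInt_of_hasDerivAt_of_nonneg {F : ℝ → ℝ} (hc : Continuous F)
    (hd : ∀ r ∈ Ioi (0:ℝ), HasDerivAt F (f r) r) (hn : ∀ r ∈ Ioi (0:ℝ), 0 ≤ f r)
    (ht : Tendsto F atTop (𝓝 A)) (h : A - F 0 = a) : HasInt f a :=
  ⟨integrableOn_Ioi_deriv_of_nonneg hc.continuousWithinAt hd hn ht,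
    (integral_Ioi_of_hasDerivAt_of_nonneg hc.continuousWithinAt hd hn ht).trans h⟩

end HalfLine

/-! ### The space `L²(r dr)` -/

section
variable {f g : ℝ → ℝ}

/-- The measure `r dr` on `(0, ∞)`. -/
noncomputable def radMeas : Measure ℝ :=
  (volume.restrict (Ioi (0:ℝ))).withDensity fun r => ENNReal.ofReal r

lemma ae_radMeas {p : ℝ → Prop} : (∀ᵐ r ∂radMeas, p r) ↔ ∀ᵐ r : ℝ, 0 < r → p r := by
  rw [radMeas, ae_withDensity_iff ENNReal.measurable_ofReal, ae_restrict_iff' measurableSet_Ioi]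
  refine eventually_congr (Eventually.of_forall fun r => ?_)
  simp only [mem_Ioi, ne_eq, ENNReal.ofReal_eq_zero, not_le]
  exact ⟨fun h hr => h hr hr, fun h hr _ => h hr⟩

lemma integral_radMeas (f : ℝ → ℝ) : ∫ r, f r ∂radMeas = ∫ r in Ioi (0:ℝ), f r * r := by
  rw [radMeas, integral_withDensity_eq_integral_toReal_smul ENNReal.measurable_ofReal
    (ae_of_all _ fun r => ENNReal.ofReal_lt_top)]
  refine setIntegral_congr_fun measurableSet_Ioi fun r (hr : 0 < r) => ?_
  simp [ENNReal.toReal_ofReal hr.le, mul_comm]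

lemma integrable_radMeas : Integrable f radMeas ↔ IntegrableOn (fun r => f r * r) (Ioi 0) := by
  rw [radMeas, integrable_withDensity_iff ENNReal.measurable_ofReal
    (ae_of_all _ fun r => ENNReal.ofReal_lt_top), IntegrableOn]
  refine integrable_congr ((ae_restrict_iff' measurableSet_Ioi).2 (ae_of_all _ fun r hr => ?_))
  simp [ENNReal.toReal_ofReal (le_of_lt hr)]

lemma aesm_radMeas : AEStronglyMeasurable f radMeas ↔
    AEStronglyMeasurable f (volume.restrict (Ioi (0:ℝ))) := by
  refine ⟨fun h => h.mono_ac ?_, fun h => h.mono_ac (withDensity_absolutelyContinuous _ _)⟩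
  refine Measure.AbsolutelyContinuous.mk fun s _ hs => ?_
  have : ∀ᵐ r ∂radMeas, r ∉ s := by rwa [ae_iff, show {a | ¬a ∉ s} = s by ext; simp]
  have h2 := (ae_restrict_iff' (μ := volume) (p := fun r => r ∉ s) measurableSet_Ioi).2
    (ae_radMeas.1 this)
  rw [ae_iff] at h2
  simpa using h2

lemma memLp_radMeas : MemLp f 2 radMeas ↔ MemL2 f := by
  refine ⟨fun h => ⟨aesm_radMeas.1 h.1, ?_⟩, fun h => ?_⟩
  · exact integrable_radMeas.1 ((memLp_two_iff_integrable_sq h.1).1 h)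
  · exact (memLp_two_iff_integrable_sq (aesm_radMeas.2 h.1)).2 (integrable_radMeas.2 h.2)

namespace MemL2

lemma add (hf : MemL2 f) (hg : MemL2 g) : MemL2 (fun r => f r + g r) :=
  memLp_radMeas.1 ((memLp_radMeas.2 hf).add (memLp_radMeas.2 hg))

lemma sub (hf : MemL2 f) (hg : MemL2 g) : MemL2 (fun r => f r - g r) :=
  memLp_radMeas.1 ((memLp_radMeas.2 hf).sub (memLp_radMeas.2 hg))

lemma const_mul (c : ℝ) (hf : MemL2 f) : MemL2 (fun r => c * f r) :=
  memLp_radMeas.1 ((memLp_radMeas.2 hf).const_mul c)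

lemma of_abs_le (hg : MemL2 g) (C : ℝ) (hm : AEMeasurable f (volume.restrict (Ioi (0:ℝ))))
    (h : ∀ r, 0 < r → |f r| ≤ C * |g r|) : MemL2 f :=
  memLp_radMeas.1 ((memLp_radMeas.2 hg).of_le_mul (c := C)
    (aesm_radMeas.2 hm.aestronglyMeasurable) (ae_radMeas.2 (ae_of_all _ h)))

lemma integrable_mul (hf : MemL2 f) (hg : MemL2 g) : IntegrableOn (fun r => f r * g r * r) (Ioi 0) :=
  integrable_radMeas.1 ((memLp_radMeas.2 hf).integrable_mul (memLp_radMeas.2 hg))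

lemma congr (hf : MemL2 f) (h : ∀ᵐ r : ℝ, 0 < r → g r = f r) : MemL2 g :=
  memLp_radMeas.1 ((memLp_radMeas.2 hf).ae_eq (ae_radMeas.2 (h.mono fun _ h hr => (h hr).symm)))

lemma aemeasurable (hf : MemL2 f) : AEMeasurable f (volume.restrict (Ioi (0:ℝ))) :=
  hf.aestronglyMeasurable.aemeasurable

end MemL2

end

/-! ### The rescaled harmonic map -/

/-- `sin Q_l`. -/
noncomputable def sQ (k : ℕ) (l r : ℝ) : ℝ := Real.sin (Q k (r / l))

/-- `cos Q_l`. -/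
noncomputable def cQ (k : ℕ) (l r : ℝ) : ℝ := Real.cos (Q k (r / l))

@[fun_prop]
lemma continuous_Q (k : ℕ) : Continuous (Q k) := by
  unfold Q; fun_prop

@[fun_prop]
lemma continuous_sQ (k : ℕ) (l : ℝ) : Continuous (sQ k l) :=
  by unfold sQ; fun_prop

@[fun_prop]
lemma continuous_cQ (k : ℕ) (l : ℝ) : Continuous (cQ k l) :=
  by unfold cQ; fun_prop

@[fun_prop]
lemma measurable_sQ (k : ℕ) (l : ℝ) : Measurable (sQ k l) := (continuous_sQ k l).measurable

@[fun_prop]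
lemma measurable_cQ (k : ℕ) (l : ℝ) : Measurable (cQ k l) := (continuous_cQ k l).measurable

lemma sin_two_arctan (x : ℝ) : Real.sin (2 * Real.arctan x) = 2 * x / (1 + x ^ 2) := by
  have h : 0 < 1 + x ^ 2 := by positivity
  rw [Real.sin_two_mul, Real.sin_arctan, Real.cos_arctan]
  field_simp
  rw [Real.sq_sqrt h.le]

lemma cos_two_arctan (x : ℝ) : Real.cos (2 * Real.arctan x) = (1 - x ^ 2) / (1 + x ^ 2) := by
  have h : 0 < 1 + x ^ 2 := by positivity
  rw [Real.cos_two_mul, Real.cos_sq_arctan]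
  field_simp
  ring

lemma sQ_eq (k : ℕ) (l r : ℝ) : sQ k l r = 2 * (r / l) ^ k / (1 + ((r / l) ^ k) ^ 2) :=
  sin_two_arctan _

lemma cQ_eq (k : ℕ) (l r : ℝ) : cQ k l r = (1 - ((r / l) ^ k) ^ 2) / (1 + ((r / l) ^ k) ^ 2) :=
  cos_two_arctan _

lemma sQ_sq_add_cQ_sq (k : ℕ) (l r : ℝ) : sQ k l r ^ 2 + cQ k l r ^ 2 = 1 :=
  Real.sin_sq_add_cos_sq _

lemma abs_cQ_le (k : ℕ) (l r : ℝ) : |cQ k l r| ≤ 1 := Real.abs_cos_le_one _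

lemma sQ_le_one (k : ℕ) (l r : ℝ) : sQ k l r ≤ 1 := Real.sin_le_one _

section
variable {k : ℕ} {l m r : ℝ}

lemma sQ_pos (hl : 0 < l) (hr : 0 < r) : 0 < sQ k l r := by
  rw [sQ_eq]; positivity

lemma abs_sQ_le (k : ℕ) (l r : ℝ) : |sQ k l r| ≤ 1 := Real.abs_sin_le_one _

lemma sQ_le_two_mul_pow (hl : 0 < l) (hr : 0 < r) : sQ k l r ≤ 2 * (r / l) ^ k := by
  have hx : 0 < (r / l) ^ k := by positivity
  rw [sQ_eq, div_le_iff₀ (by positivity)]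
  nlinarith [sq_nonneg ((r / l) ^ k), mul_pos hx (pow_pos hx 2)]

lemma sQ_le_two_mul_pow_inv (hl : 0 < l) (hr : 0 < r) : sQ k l r ≤ 2 * (l / r) ^ k := by
  have hx : 0 < (r / l) ^ k := by positivity
  have : (l / r) ^ k = 1 / (r / l) ^ k := by rw [← one_div_div r l, one_div_pow]
  rw [sQ_eq, this, div_le_iff₀ (by positivity)]
  field_simp
  nlinarith

lemma inv_sQ_eq (hl : 0 < l) (hr : 0 < r) : 1 / sQ k l r = ((r / l) ^ k + (l / r) ^ k) / 2 := by
  have hx : 0 < (r / l) ^ k := by positivity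
  have : (l / r) ^ k = 1 / (r / l) ^ k := by rw [← one_div_div r l, one_div_pow]
  rw [sQ_eq, this]
  field_simp
  ring

lemma hasDerivAt_Q (hl : 0 < l) (hr : 0 < r) :
    HasDerivAt (fun r => Q k (r / l)) (k * sQ k l r / r) r := by
  have h1 : HasDerivAt (fun r : ℝ => (r / l) ^ k) (k * (r / l) ^ (k - 1) * (1 / l)) r :=
    ((hasDerivAt_id r).div_const l).pow k
  refine ((h1.arctan).const_mul 2).congr_deriv ?_
  rw [sQ_eq]
  rcases Nat.eq_zero_or_pos k with rfl | hk
  · simp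
  · obtain ⟨j, rfl⟩ : ∃ j, k = j + 1 := ⟨k - 1, by omega⟩
    simp only [Nat.add_sub_cancel]
    have : (r / l) ^ (j + 1) = (r / l) ^ j * (r / l) := pow_succ _ _
    rw [this]
    field_simp

lemma hasDerivAt_sQ (hl : 0 < l) (hr : 0 < r) :
    HasDerivAt (sQ k l) (cQ k l r * (k * sQ k l r / r)) r := (hasDerivAt_Q hl hr).sin

lemma hasDerivAt_cQ (hl : 0 < l) (hr : 0 < r) :
    HasDerivAt (cQ k l) (-sQ k l r * (k * sQ k l r / r)) r := (hasDerivAt_Q hl hr).cos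

lemma LambdaQ_div (hl : 0 < l) (hr : 0 < r) : LambdaQ k (r / l) = k * sQ k l r := by
  have h := (hasDerivAt_Q (k := k) one_pos (div_pos hr hl)).deriv
  simp only [div_one] at h
  have hs : sQ k 1 (r / l) = sQ k l r := by simp [sQ]
  rw [LambdaQ, h, hs]
  field_simp

lemma tendsto_Q_atTop (hk : k ≠ 0) (hl : 0 < l) :
    Tendsto (fun r => Q k (r / l)) atTop (𝓝 Real.pi) := by
  have h : Tendsto (fun r : ℝ => (r / l) ^ k) atTop atTop :=
    (tendsto_pow_atTop hk).comp (tendsto_id.atTop_div_const hl)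
  have h2 := ((Real.tendsto_arctan_atTop.mono_right nhdsWithin_le_nhds).comp h).const_mul 2
  rw [show 2 * (Real.pi / 2) = Real.pi by ring] at h2
  exact h2

lemma Q_zero (hk : k ≠ 0) (l : ℝ) : Q k (0 / l) = 0 := by simp [Q, hk]

lemma hasInt_sQ_div (hk : k ≠ 0) (hl : 0 < l) : HasInt (fun r => sQ k l r / r) (Real.pi / k) := by
  have hk0 : (0:ℝ) < k := by positivity
  refine hasInt_of_hasDerivAt_of_nonneg (F := fun r => Q k (r / l) / k) (by fun_prop) (fun r hr => ?_)
    (fun r hr => div_nonneg (sQ_pos hl hr).le (le_of_lt hr)) ((tendsto_Q_atTop hk hl).div_const _)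
    (by rw [Q_zero hk]; simp)
  refine ((hasDerivAt_Q (k := k) hl hr).div_const (k:ℝ)).congr_deriv ?_
  field_simp

lemma tendsto_cQ_atTop (hk : k ≠ 0) (hl : 0 < l) : Tendsto (cQ k l) atTop (𝓝 (-1)) := by
  rw [← Real.cos_pi]
  exact (Real.continuous_cos.tendsto _).comp (tendsto_Q_atTop hk hl)

lemma cQ_zero (hk : k ≠ 0) (l : ℝ) : cQ k l 0 = 1 := by rw [cQ, Q_zero hk, Real.cos_zero]

lemma hasInt_sQ_sq_div (hk : k ≠ 0) (hl : 0 < l) : HasInt (fun r => sQ k l r ^ 2 / r) (2 / k) := by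
  have hk0 : (0:ℝ) < k := by positivity
  refine hasInt_of_hasDerivAt_of_nonneg (F := fun r => -cQ k l r / k) (by fun_prop) (fun r hr => ?_)
    (fun r hr => div_nonneg (sq_nonneg _) (le_of_lt hr))
    ((tendsto_cQ_atTop hk hl).neg.div_const _) (by rw [cQ_zero hk]; ring)
  refine ((hasDerivAt_cQ (k := k) hl hr).neg.div_const (k:ℝ)).congr_deriv ?_
  field_simp

lemma sQ_mul_pow (k : ℕ) (l r : ℝ) : sQ k l r * (r / l) ^ k = 1 - cQ k l r := by
  have : 0 < 1 + ((r / l) ^ k) ^ 2 := by positivity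
  rw [sQ_eq, cQ_eq]; field_simp; ring

lemma pow_div_eq (hl : 0 < l) (hm : 0 < m) (k : ℕ) (r : ℝ) :
    (r / m) ^ k = (l / m) ^ k * (r / l) ^ k := by
  rw [← mul_pow]; congr 1; field_simp

/-- The two rescaled profiles interact weakly: `sin Q_l sin Q_m ≤ 4 (l/m)^k`. -/
lemma sQ_mul_sQ_le (hl : 0 < l) (hm : 0 < m) (hr : 0 < r) :
    sQ k l r * sQ k m r ≤ 4 * (l / m) ^ k := by
  have h1 := sQ_le_two_mul_pow_inv (k := k) hl hr
  have h2 := sQ_le_two_mul_pow (k := k) hm hr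
  have h3 : (2 * (l / r) ^ k) * (2 * (r / m) ^ k) = 4 * (l / m) ^ k := by
    rw [show (l / m : ℝ) = (l / r) * (r / m) by field_simp, mul_pow]; ring
  rw [← h3]
  exact mul_le_mul h1 h2 (sQ_pos hm hr).le (by positivity)

/-- The geometric mean of the previous bound and the arithmetic-geometric inequality. -/
lemma sQ_mul_sQ_le_sqrt (hl : 0 < l) (hm : 0 < m) (hr : 0 < r) :
    sQ k l r * sQ k m r ≤ √((l / m) ^ k) * (sQ k l r + sQ k m r) := by
  have h1 := sQ_mul_sQ_le (k := k) hl hm hr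
  have hs := Real.sqrt_nonneg ((l / m) ^ k)
  have hs2 : √((l / m) ^ k) ^ 2 = (l / m) ^ k := Real.sq_sqrt (by positivity)
  have ha := sQ_pos (k := k) hl hr
  have hb := sQ_pos (k := k) hm hr
  have : (sQ k l r * sQ k m r) ^ 2 ≤ (√((l / m) ^ k) * (sQ k l r + sQ k m r)) ^ 2 := by
    rw [mul_pow, mul_pow, hs2]
    have e : 4 * (sQ k l r * sQ k m r) ≤ (sQ k l r + sQ k m r) ^ 2 := by
      nlinarith [sq_nonneg (sQ k l r - sQ k m r)]
    have hp : 0 ≤ (l / m) ^ k := by positivity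
    nlinarith [mul_nonneg hp (sub_nonneg.2 e), mul_pos ha hb]
  exact (pow_le_pow_iff_left₀ (by positivity) (by positivity) two_ne_zero).1 this

end

/-! ### The energy space `H` -/

/-- The density of `‖g‖_H²`. -/
noncomputable def hDens (k : ℕ) (g : ℝ → ℝ) (r : ℝ) : ℝ :=
  (deriv g r ^ 2 + (k : ℝ) ^ 2 * g r ^ 2 / r ^ 2) * r

section
variable {k : ℕ} {g : ℝ → ℝ} {r : ℝ}

lemma MemH.locAC (hg : MemH g) : LocAC g := hg.absolutelyContinuous

lemma MemH.aemeasurable (hg : MemH g) : AEMeasurable g (volume.restrict (Ioi (0:ℝ))) :=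
  hg.locAC.aesm.aemeasurable

lemma hDens_eq (hr : 0 < r) : hDens k g r = deriv g r ^ 2 * r + (k:ℝ) ^ 2 * (g r ^ 2 / r) := by
  unfold hDens; field_simp

lemma hDens_nonneg (hr : 0 < r) : 0 ≤ hDens k g r := by
  rw [hDens_eq hr]; positivity

lemma MemH.integrable_hDens (hg : MemH g) (k : ℕ) : IntegrableOn (hDens k g) (Ioi 0) := by
  refine ((hg.integrable_deriv).add (hg.integrable_hardy.const_mul ((k:ℝ) ^ 2))).congr_fun
    (fun r hr => ?_) measurableSet_Ioi
  exact (hDens_eq hr).symm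

lemma hSq_eq (k : ℕ) (g : ℝ → ℝ) : hSq k g = ∫ r in Ioi (0:ℝ), hDens k g r := rfl

lemma hSq_nonneg (k : ℕ) (g : ℝ → ℝ) : 0 ≤ hSq k g :=
  setIntegral_nonneg measurableSet_Ioi fun _ hr => hDens_nonneg hr

lemma sq_div_le_hDens (hk : 1 ≤ k) (hr : 0 < r) : g r ^ 2 / r ≤ hDens k g r := by
  rw [hDens_eq hr]
  have h1 : (1:ℝ) ≤ (k:ℝ) ^ 2 := one_le_pow₀ (by exact_mod_cast hk)
  have h2 : 0 ≤ g r ^ 2 / r := by positivity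
  nlinarith [mul_nonneg (sq_nonneg (deriv g r)) hr.le]

lemma sq_mul_le_hDens (hr : 0 < r) : (k:ℝ) ^ 2 * (g r ^ 2 / r) ≤ hDens k g r := by
  rw [hDens_eq hr]; linarith [mul_nonneg (sq_nonneg (deriv g r)) hr.le]

lemma deriv_sq_mul_le_hDens (hr : 0 < r) : deriv g r ^ 2 * r ≤ hDens k g r := by
  rw [hDens_eq hr]
  exact le_add_of_nonneg_right (by positivity)

lemma two_mul_abs_le_hDens (hk : 1 ≤ k) (hr : 0 < r) : 2 * (|g r| * |deriv g r|) ≤ hDens k g r := by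
  have h1 : (1:ℝ) ≤ (k:ℝ) ^ 2 := one_le_pow₀ (by exact_mod_cast hk)
  have h2 : 0 ≤ g r ^ 2 / r := by positivity
  have h3 : 2 * (|g r| * |deriv g r|) ≤ deriv g r ^ 2 * r + g r ^ 2 / r := by
    have h4 := two_mul_le_add_sq (|deriv g r| * r) |g r|
    rw [mul_pow, sq_abs, sq_abs] at h4
    rw [show deriv g r ^ 2 * r + g r ^ 2 / r = (deriv g r ^ 2 * r ^ 2 + g r ^ 2) / r by field_simp,
      le_div_iff₀ hr]
    linarith
  rw [hDens_eq hr]; nlinarith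

/-- Domination by the `H`-density gives integrability. -/
lemma MemH.integrableOn_of_le_add (hg : MemH g) {F w : ℝ → ℝ} {A B : ℝ} (k : ℕ)
    (hw : IntegrableOn w (Ioi 0)) (hF : AEMeasurable F (volume.restrict (Ioi (0:ℝ))))
    (h : ∀ r, 0 < r → |F r| ≤ A * hDens k g r + B * w r) : IntegrableOn F (Ioi 0) :=
  integrableOn_of_abs_le (((hg.integrable_hDens k).const_mul A).add (hw.const_mul B)) hF h

lemma MemH.integrableOn_of_le (hg : MemH g) {F : ℝ → ℝ} {A : ℝ} (k : ℕ)
    (hF : AEMeasurable F (volume.restrict (Ioi (0:ℝ))))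
    (h : ∀ r, 0 < r → |F r| ≤ A * hDens k g r) : IntegrableOn F (Ioi 0) :=
  integrableOn_of_abs_le ((hg.integrable_hDens k).const_mul A) hF h

lemma MemH.abs_integral_le (hg : MemH g) {F : ℝ → ℝ} {A : ℝ} (k : ℕ)
    (h : ∀ r, 0 < r → |F r| ≤ A * hDens k g r) : |∫ r in Ioi (0:ℝ), F r| ≤ A * hSq k g := by
  rw [hSq_eq, ← integral_const_mul]
  exact abs_integral_le_of_abs_le ((hg.integrable_hDens k).const_mul A) h

lemma MemH.abs_integral_le_add (hg : MemH g) {F w : ℝ → ℝ} {A B : ℝ} (k : ℕ)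
    (hw : IntegrableOn w (Ioi 0)) (h : ∀ r, 0 < r → |F r| ≤ A * hDens k g r + B * w r) :
    |∫ r in Ioi (0:ℝ), F r| ≤ A * hSq k g + B * ∫ r in Ioi (0:ℝ), w r := by
  have hi := hg.integrable_hDens k
  rw [hSq_eq, ← integral_const_mul, ← integral_const_mul,
    ← integral_add (hi.const_mul A) (hw.const_mul B)]
  exact abs_integral_le_of_abs_le ((hi.const_mul A).add (hw.const_mul B)) h

lemma MemH.ae_hasDerivAt (hg : MemH g) : ∀ᵐ r : ℝ, 0 < r → HasDerivAt g (deriv g r) r := by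
  filter_upwards [hg.locAC.ae_differentiableAt] with r hr h0 using (hr h0).hasDerivAt

lemma MemH.memL2_deriv (hg : MemH g) : MemL2 (deriv g) :=
  ⟨(measurable_deriv g).aestronglyMeasurable, hg.integrable_deriv⟩

lemma MemH.memL2_div (hg : MemH g) : MemL2 (fun r => g r / r) := by
  have hm := hg.aemeasurable
  refine ⟨AEMeasurable.aestronglyMeasurable (by fun_prop), ?_⟩
  exact hg.integrable_hardy.congr_fun (fun r (hr : 0 < r) => by field_simp) measurableSet_Ioi

lemma MemH.of_memL2 (h : LocAC g) (hd : MemL2 (deriv g)) (hi : MemL2 fun r => g r / r) : MemH g :=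
  ⟨h, hd.2, hi.2.congr_fun (fun r (hr : 0 < r) => by field_simp) measurableSet_Ioi⟩

/-- The total derivative of a product of an element of `H` with a function of the same kind. -/
lemma MemH.hasInt_deriv_mul {w w' : ℝ → ℝ} (hg : MemH g) (hw : ∀ r, 0 < r → HasDerivAt w (w' r) r)
    (hc : ContinuousOn w' (Ioi 0)) (h' : MemL2 w') (h : MemL2 fun r => w r / r) :
    HasInt (fun r => w' r * g r + w r * deriv g r) 0 := by
  have hi : IntegrableOn (fun r => w' r * g r + w r * deriv g r) (Ioi 0) :=
    ((h'.integrable_mul hg.memL2_div).add (h.integrable_mul hg.memL2_deriv)).congr_fun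
      (fun r (hr : 0 < r) => by simp only [Pi.add_apply]; field_simp) measurableSet_Ioi
  refine ⟨hi, integral_eq_zero_of_ae_hasDerivAt ((LocAC.of_hasDerivAt hw hc).mul hg.locAC) ?_ hi ?_⟩
  · filter_upwards [hg.ae_hasDerivAt] with r h1 hr using (hw r hr).mul (h1 hr)
  · exact (h.integrable_mul hg.memL2_div).congr_fun (fun r (hr : 0 < r) => by field_simp)
      measurableSet_Ioi

/-- The embedding of `H` into the bounded functions. -/
lemma MemH.sq_le_hSq (hg : MemH g) (hk : 1 ≤ k) (hr : 0 < r) : g r ^ 2 ≤ hSq k g := by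
  have hF : LocAC (fun r => g r ^ 2) := by simpa [sq] using hg.locAC.mul hg.locAC
  have hd : ∀ᵐ r ∂(volume.restrict (Ioi (0:ℝ))), deriv (fun r => g r ^ 2) r = 2 * g r * deriv g r := by
    rw [ae_restrict_iff' measurableSet_Ioi]
    filter_upwards [hg.ae_hasDerivAt] with x hx h0
    refine ((hx h0).fun_pow 2).deriv.trans ?_
    simp
  have hm := hg.aemeasurable
  have hi : IntegrableOn (deriv fun r => g r ^ 2) (Ioi 0) := by
    refine IntegrableOn.congr_fun_ae (f := fun r => 2 * g r * deriv g r) ?_ (hd.mono fun _ h => h.symm)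
    refine hg.integrableOn_of_le (A := 1) k ?_ fun r hr => ?_
    · have := measurable_deriv g
      fun_prop
    · have := two_mul_abs_le_hDens (g := g) hk hr
      rw [abs_mul, abs_mul, abs_two]; linarith
  obtain ⟨h0, -⟩ := tendsto_zero_of_integrable hF hi hg.integrable_hardy
  have hle : ∀ x, 0 < x → x ≤ r → g r ^ 2 - g x ^ 2 ≤ hSq k g := by
    intro x hx hxr
    rw [← hF.integral_deriv hx hr, intervalIntegral.integral_of_le hxr, hSq_eq]
    have hsub : Ioc x r ⊆ Ioi 0 := fun y hy => hx.trans hy.1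
    calc ∫ y in Ioc x r, deriv (fun r => g r ^ 2) y ≤ ∫ y in Ioc x r, hDens k g y := by
          refine integral_mono_ae (hi.mono_set hsub) ((hg.integrable_hDens k).mono_set hsub) ?_
          have := ae_restrict_of_ae_restrict_of_subset hsub hd
          filter_upwards [this, ae_restrict_mem measurableSet_Ioc] with y hy hym
          rw [hy]
          have := two_mul_abs_le_hDens (g := g) hk (hsub hym)
          rw [← abs_mul] at this
          nlinarith [le_abs_self (g y * deriv g y)]
      _ ≤ ∫ y in Ioi 0, hDens k g y := by
          refine setIntegral_mono_set (hg.integrable_hDens k) ?_ hsub.eventuallyLE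
          filter_upwards [ae_restrict_mem measurableSet_Ioi] with y hy using hDens_nonneg hy
  have hlim := h0.const_sub (g r ^ 2)
  rw [sub_zero] at hlim
  refine le_of_tendsto hlim ?_
  filter_upwards [Ioo_mem_nhdsGT hr] with x hx using hle x hx.1 hx.2.le

lemma MemH.abs_le_sqrt (hg : MemH g) (hk : 1 ≤ k) (hr : 0 < r) : |g r| ≤ √(hSq k g) :=
  Real.abs_le_sqrt (hg.sq_le_hSq hk hr)

lemma MemH.abs_le_half (hg : MemH g) (hk : 1 ≤ k) (hh : hSq k g ≤ 1 / 4) (hr : 0 < r) :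
    |g r| ≤ 1 / 2 :=
  (Real.abs_le_sqrt ((hg.sq_le_hSq hk hr).trans hh)).trans
    ((Real.sqrt_le_left (by norm_num)).2 (by norm_num))

lemma MemH.ae_deriv_sub {f : ℝ → ℝ} (hf : MemH f) (hg : MemH g) :
    ∀ᵐ r : ℝ, 0 < r → deriv (fun r => f r - g r) r = deriv f r - deriv g r := by
  filter_upwards [hf.ae_hasDerivAt, hg.ae_hasDerivAt] with r h1 h2 hr
    using ((h1 hr).sub (h2 hr)).deriv

lemma MemH.sub {f : ℝ → ℝ} (hf : MemH f) (hg : MemH g) : MemH (fun r => f r - g r) :=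
  .of_memL2 (hf.locAC.sub hg.locAC) ((hf.memL2_deriv.sub hg.memL2_deriv).congr (hf.ae_deriv_sub hg))
    ((hf.memL2_div.sub hg.memL2_div).congr (ae_of_all _ fun _ _ => sub_div _ _ _))

end

/-- `Q_l - Q_m`. -/
noncomputable def twoBubble (k : ℕ) (l m r : ℝ) : ℝ := Q k (r / l) - Q k (r / m)

section
variable {k : ℕ} {l m r : ℝ}

lemma hasDerivAt_twoBubble (hl : 0 < l) (hm : 0 < m) (hr : 0 < r) :
    HasDerivAt (twoBubble k l m) (k * (sQ k l r - sQ k m r) / r) r := by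
  refine ((hasDerivAt_Q (k := k) hl hr).sub (hasDerivAt_Q (k := k) hm hr)).congr_deriv ?_
  ring

lemma deriv_twoBubble (hl : 0 < l) (hm : 0 < m) (hr : 0 < r) :
    deriv (twoBubble k l m) r = k * (sQ k l r - sQ k m r) / r := (hasDerivAt_twoBubble hl hm hr).deriv

/-- With `s = (l / m) ^ k` and `α = (r / l) ^ k`, the difference is
`2 arctan ((1 - s) α / (1 + s α²))`. -/
lemma abs_twoBubble_le (hl : 0 < l) (hm : 0 < m) (hr : 0 < r) :
    |twoBubble k l m r| ≤ |1 - (l / m) ^ k| * (1 + 1 / (l / m) ^ k) * sQ k l r := by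
  have hα : 0 < (r / l) ^ k := by positivity
  have hs : 0 < (l / m) ^ k := by positivity
  rw [twoBubble, Q, Q, sQ_eq, pow_div_eq hl hm k r]
  generalize (r / l) ^ k = α at *
  generalize (l / m) ^ k = s at *
  have e := Real.arctan_add (x := α) (y := -(s * α)) (by nlinarith [mul_pos hα hα])
  rw [Real.arctan_neg, mul_neg, sub_neg_eq_add] at e
  have h0 : ∀ z : ℝ, 0 ≤ z → |Real.arctan z| ≤ z := fun z hz => by
    have h1 := Real.le_tan (Real.arctan_nonneg.2 hz) (Real.arctan_lt_pi_div_two _)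
    rwa [Real.tan_arctan, ← abs_of_nonneg (Real.arctan_nonneg.2 hz)] at h1
  have hle : ∀ z : ℝ, |Real.arctan z| ≤ |z| := fun z => by
    rcases abs_cases z with h | h <;> rw [h.1]
    · exact h0 z h.2
    · rw [← abs_neg, ← Real.arctan_neg]; exact h0 (-z) (by linarith)
  rw [← mul_sub, sub_eq_add_neg, e, abs_mul, abs_two]
  refine (mul_le_mul_of_nonneg_left (hle _) zero_le_two).trans ?_
  rw [show (α + -(s * α)) / (1 + α * (s * α)) = (1 - s) * (α / (1 + s * α ^ 2)) by ring, abs_mul,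
    abs_of_pos (by positivity : 0 < α / (1 + s * α ^ 2)), mul_left_comm, mul_assoc]
  refine mul_le_mul_of_nonneg_left ?_ (abs_nonneg _)
  rw [show (1 + 1 / s) * (2 * α / (1 + α ^ 2)) = 2 * ((1 + s) * α / (s * (1 + α ^ 2))) by
    field_simp; ring]
  gcongr 2 * ?_
  rw [div_le_div_iff₀ (by positivity) (by positivity)]
  nlinarith [mul_pos hα hs, pow_pos hα 3, mul_pos (pow_pos hα 3) hs]

lemma continuousOn_sQ_div (k : ℕ) (l : ℝ) : ContinuousOn (fun r => k * sQ k l r / r) (Ioi 0) :=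
  ContinuousOn.div (by fun_prop) continuousOn_id fun r (hr : 0 < r) => hr.ne'

lemma continuousOn_deriv_sQ (k : ℕ) (l : ℝ) :
    ContinuousOn (fun r => cQ k l r * (k * sQ k l r / r)) (Ioi 0) :=
  (continuous_cQ k l).continuousOn.mul (continuousOn_sQ_div k l)

lemma locAC_sQ (hl : 0 < l) : LocAC (sQ k l) :=
  .of_hasDerivAt (fun _ hr => hasDerivAt_sQ hl hr) (continuousOn_deriv_sQ k l)

lemma locAC_cQ (hl : 0 < l) : LocAC (cQ k l) :=
  .of_hasDerivAt (fun _ hr => hasDerivAt_cQ hl hr)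
    ((continuous_sQ k l).neg.continuousOn.mul (continuousOn_sQ_div k l))

lemma memL2_sQ_div (hk : k ≠ 0) (hl : 0 < l) : MemL2 fun r => sQ k l r / r :=
  ⟨(by fun_prop : Measurable fun r => sQ k l r / r).aestronglyMeasurable,
    (hasInt_sQ_sq_div hk hl).1.congr_fun (fun r (hr : 0 < r) => by field_simp)
      measurableSet_Ioi⟩

lemma memL2_sQ_mul_cQ_div (hk : k ≠ 0) (hl : 0 < l) :
    MemL2 fun r => cQ k l r * (k * sQ k l r / r) := by
  refine (memL2_sQ_div hk hl).of_abs_le k (by fun_prop) fun r hr => ?_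
  exact (abs_mul_le (abs_cQ_le k l r) (by rw [mul_div_assoc, abs_mul, Nat.abs_cast])).trans_eq
    (one_mul _)

lemma memH_twoBubble (hk : k ≠ 0) (hl : 0 < l) (hm : 0 < m) : MemH (twoBubble k l m) := by
  have hac : LocAC (twoBubble k l m) := .of_hasDerivAt
    (fun r hr => hasDerivAt_twoBubble hl hm hr) (ContinuousOn.div (by fun_prop)
      continuousOn_id fun r hr => ne_of_gt hr)
  refine .of_memL2 hac ((((memL2_sQ_div hk hl).sub (memL2_sQ_div hk hm)).const_mul k).congr
    (ae_of_all _ fun r hr => by rw [deriv_twoBubble hl hm hr]; ring))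
    ((memL2_sQ_div hk hl).of_abs_le (|1 - (l / m) ^ k| * (1 + 1 / (l / m) ^ k))
      (hac.aesm.aemeasurable.div aemeasurable_id) fun r hr => ?_)
  exact abs_div_le_mul_abs_div (by rw [abs_of_pos (sQ_pos hl hr)]; exact abs_twoBubble_le hl hm hr)

lemma remainder_eq (k : ℕ) (l m : ℝ) (φ : ℝ → ℝ) :
    remainder k l m φ = fun r => φ r - twoBubble k l m r := rfl

end

/-! ### Weighted quadratic forms -/

/-- A `C¹` weight on `(0,∞)` bounded by `M` that varies slowly: `|r γ'| ≤ ε`. -/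
structure IsWeight (γ γ' : ℝ → ℝ) (M ε : ℝ) : Prop where
  hasDerivAt : ∀ r, 0 < r → HasDerivAt γ (γ' r) r
  continuousOn : ContinuousOn γ' (Ioi 0)
  abs_le : ∀ r, 0 < r → |γ r| ≤ M
  abs_deriv_le : ∀ r, 0 < r → |r * γ' r| ≤ ε

/-- `∫ γ ((∂_r g)² + k² V g² / r²) r dr`. -/
noncomputable def qForm (k : ℕ) (V γ g : ℝ → ℝ) : ℝ :=
  ∫ r in Ioi (0:ℝ), γ r * (deriv g r ^ 2 + (k:ℝ) ^ 2 * V r * g r ^ 2 / r ^ 2) * r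

section
variable {k : ℕ} {l m r M ε : ℝ} {g γ γ' V : ℝ → ℝ}

lemma IsWeight.locAC (h : IsWeight γ γ' M ε) : LocAC γ := .of_hasDerivAt h.hasDerivAt h.continuousOn

lemma IsWeight.aemeasurable (h : IsWeight γ γ' M ε) :
    AEMeasurable γ (volume.restrict (Ioi (0:ℝ))) := h.locAC.aesm.aemeasurable

lemma IsWeight.aemeasurable' (h : IsWeight γ γ' M ε) :
    AEMeasurable γ' (volume.restrict (Ioi (0:ℝ))) :=
  (h.continuousOn.aestronglyMeasurable measurableSet_Ioi).aemeasurable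

lemma IsWeight.nonneg (h : IsWeight γ γ' M ε) : 0 ≤ M ∧ 0 ≤ ε :=
  ⟨(abs_nonneg _).trans (h.abs_le 1 one_pos), (abs_nonneg _).trans (h.abs_deriv_le 1 one_pos)⟩

lemma IsWeight.abs_deriv_mul_sq_le (h : IsWeight γ γ' M ε) (hk : 1 ≤ k) (hr : 0 < r) :
    |γ' r| * g r ^ 2 ≤ ε * hDens k g r := by
  have h1 := h.abs_deriv_le r hr
  rw [abs_mul, abs_of_pos hr] at h1
  have h2 := sq_div_le_hDens (g := g) hk hr
  rw [show |γ' r| * g r ^ 2 = (r * |γ' r|) * (g r ^ 2 / r) by field_simp]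
  exact mul_le_mul h1 h2 (by positivity) h.nonneg.2

lemma IsWeight.abs_deriv_mul_cQ_le (h : IsWeight γ γ' M ε) (hk : 1 ≤ k) (l : ℝ) (hr : 0 < r) :
    |γ' r * (k * cQ k l r * g r ^ 2)| ≤ k * ε * hDens k g r := by
  rw [show γ' r * (k * cQ k l r * g r ^ 2) = cQ k l r * (k * (γ' r * g r ^ 2)) by ring]
  refine (abs_mul_le_right _ (abs_cQ_le k l r)).trans ?_
  rw [one_mul, abs_mul, Nat.abs_cast, abs_mul (γ' r), abs_of_nonneg (sq_nonneg (g r)), mul_assoc]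
  gcongr _ * ?_
  exact h.abs_deriv_mul_sq_le hk hr

lemma qForm_integrand_abs_le (hγ : |γ r| ≤ M) (hV : |V r| ≤ 1) (hr : 0 < r) :
    |γ r * (deriv g r ^ 2 + (k:ℝ) ^ 2 * V r * g r ^ 2 / r ^ 2) * r| ≤ M * hDens k g r := by
  rw [mul_assoc]
  refine abs_mul_le hγ ?_
  have h : |(k:ℝ) ^ 2 * V r * g r ^ 2 / r ^ 2| ≤ (k:ℝ) ^ 2 * g r ^ 2 / r ^ 2 := by
    rw [show (k:ℝ) ^ 2 * V r * g r ^ 2 / r ^ 2 = V r * ((k:ℝ) ^ 2 * g r ^ 2 / r ^ 2) by ring]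
    exact (abs_mul_le_right _ hV).trans_eq (by rw [one_mul, abs_of_nonneg (by positivity)])
  exact abs_mul_le ((abs_add_le _ _).trans (add_le_add (abs_of_nonneg (sq_nonneg _)).le h))
    (abs_of_pos hr).le

lemma qForm_integrable (hg : MemH g) (hγm : AEMeasurable γ (volume.restrict (Ioi (0:ℝ))))
    (hγ : ∀ r, 0 < r → |γ r| ≤ M) (hVm : AEMeasurable V (volume.restrict (Ioi (0:ℝ))))
    (hV : ∀ r, 0 < r → |V r| ≤ 1) :
    IntegrableOn (fun r => γ r * (deriv g r ^ 2 + (k:ℝ) ^ 2 * V r * g r ^ 2 / r ^ 2) * r)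
      (Ioi 0) := by
  have hm := hg.aemeasurable
  have hd := measurable_deriv g
  exact hg.integrableOn_of_le k (by fun_prop) fun r hr =>
    qForm_integrand_abs_le (hγ r hr) (hV r hr) hr

/-- `∫ γ (∂_r g - k cos Q_l g / r)² r dr`: the factorization of the linearized operator about
`Q_l`, weighted. -/
noncomputable def bogForm (k : ℕ) (l : ℝ) (γ g : ℝ → ℝ) : ℝ :=
  ∫ r in Ioi (0:ℝ), γ r * (deriv g r - k * cQ k l r * g r / r) ^ 2 * r

lemma bog_integrand_le (hr : 0 < r) :
    (deriv g r - k * cQ k l r * g r / r) ^ 2 * r ≤ 2 * hDens k g r := by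
  have h1 : (deriv g r - k * cQ k l r * g r / r) ^ 2
      ≤ 2 * deriv g r ^ 2 + 2 * (k * cQ k l r * g r / r) ^ 2 := by
    nlinarith [sq_nonneg (deriv g r + k * cQ k l r * g r / r)]
  have h2 : (k * cQ k l r * g r / r) ^ 2 ≤ (k:ℝ) ^ 2 * g r ^ 2 / r ^ 2 := by
    rw [div_pow, mul_pow, mul_pow]
    gcongr
    have : cQ k l r ^ 2 ≤ 1 := by nlinarith [sQ_sq_add_cQ_sq k l r, sq_nonneg (sQ k l r)]
    nlinarith [sq_nonneg (k:ℝ)]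
  unfold hDens
  nlinarith

lemma bog_integrable (hg : MemH g)
    (hγm : AEMeasurable γ (volume.restrict (Ioi (0:ℝ)))) (hγ : ∀ r, 0 < r → |γ r| ≤ M) :
    IntegrableOn (fun r => γ r * (deriv g r - k * cQ k l r * g r / r) ^ 2 * r) (Ioi 0) := by
  have hm := hg.aemeasurable
  have hd := measurable_deriv g
  refine hg.integrableOn_of_le (A := M * 2) k (by fun_prop) fun r hr => ?_
  rw [mul_assoc (γ r), mul_assoc M]
  exact abs_mul_le (hγ r hr) ((abs_of_nonneg (by positivity)).trans_le (bog_integrand_le hr))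

/-- The weighted Bogomolny identity. -/
lemma qForm_eq_bogForm (hg : MemH g) (hk : 1 ≤ k) (hl : 0 < l) (hγ : IsWeight γ γ' M ε) :
    qForm k (fun r => cQ k l r ^ 2 - sQ k l r ^ 2) γ g
      = bogForm k l γ g - ∫ r in Ioi (0:ℝ), γ' r * (k * cQ k l r * g r ^ 2) := by
  have hm := hg.aemeasurable
  have hd := measurable_deriv g
  have hγm := hγ.aemeasurable
  have hγm' := hγ.aemeasurable'
  have hM := hγ.nonneg.1
  have hgg := hg.locAC.mul hg.locAC
  have hF : LocAC (fun r => k * ((γ r * cQ k l r) * (g r * g r))) :=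
    ((hγ.locAC.mul (locAC_cQ hl)).mul hgg).const_mul (k:ℝ)
  set F' : ℝ → ℝ := fun r => γ' r * (k * cQ k l r * g r ^ 2)
    + (γ r * (-(k:ℝ) ^ 2 * sQ k l r ^ 2 * g r ^ 2 / r) + γ r * (2 * k * cQ k l r * g r * deriv g r))
    with hF'
  have hder : ∀ᵐ r : ℝ, 0 < r → HasDerivAt (fun r => k * ((γ r * cQ k l r) * (g r * g r))) (F' r) r := by
    filter_upwards [hg.ae_hasDerivAt] with r hr h0
    refine ((((hγ.hasDerivAt r h0).mul (hasDerivAt_cQ (k := k) hl h0)).mul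
      ((hr h0).mul (hr h0))).const_mul (k:ℝ)).congr_deriv ?_
    simp only [hF', Pi.mul_apply]
    field_simp
    ring
  have i1 : IntegrableOn (fun r => γ' r * (k * cQ k l r * g r ^ 2)) (Ioi 0) :=
    hg.integrableOn_of_le k (by fun_prop) fun r hr => hγ.abs_deriv_mul_cQ_le hk l hr
  have iq := qForm_integrable (k := k) (V := fun r => cQ k l r ^ 2 - sQ k l r ^ 2) hg hγm hγ.abs_le
    (by fun_prop) (fun r _ => by
      have := sQ_sq_add_cQ_sq k l r
      rw [abs_le]; constructor <;> nlinarith [sq_nonneg (sQ k l r), sq_nonneg (cQ k l r)])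
  have ib := bog_integrable (k := k) (l := l) hg hγm hγ.abs_le
  have HF : HasInt F' _ := (((HasInt.of_integrable iq).sub (.of_integrable ib)).add
    (.of_integrable i1)).congr (ae_of_all _ fun r hr => by simp only [hF']; field_simp; ring)
  have h0 := integral_eq_zero_of_ae_hasDerivAt hF hder HF.1 (by
    refine hg.integrableOn_of_le (A := k * M) k (by fun_prop) fun r hr => ?_
    have h1 := hγ.abs_le r hr
    have h2 := sq_div_le_hDens (g := g) hk hr
    have hc := abs_cQ_le k l r
    rw [show k * (γ r * cQ k l r * (g r * g r)) / r = k * (γ r * (cQ k l r * (g r ^ 2 / r))) by ring]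
    exact (abs_mul_le (Nat.abs_cast k).le (abs_mul_le h1 (abs_mul_le hc
      ((abs_of_nonneg (by positivity)).trans_le h2)))).trans_eq (by ring))
  rw [HF.2] at h0
  unfold qForm bogForm
  linarith

end

/-! ### Localization between the two scales -/

/-- The Cauchy-Schwarz inequality for integrals. -/
lemma abs_integral_mul_le_sqrt {α : Type*} [MeasurableSpace α] {μ : Measure α} {f g : α → ℝ}
    (hf : Integrable (fun x => f x ^ 2) μ) (hg : Integrable (fun x => g x ^ 2) μ) :
    |∫ x, f x * g x ∂μ| ≤ √(∫ x, f x ^ 2 ∂μ) * √(∫ x, g x ^ 2 ∂μ) := by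
  by_cases hfg : Integrable (fun x => f x * g x) μ
  swap
  · rw [integral_undef hfg, abs_zero]; positivity
  have hA : 0 ≤ ∫ x, f x ^ 2 ∂μ := by positivity
  have hquad : ∀ t : ℝ, 0 ≤ (∫ x, f x ^ 2 ∂μ) * (t * t) + (2 * ∫ x, f x * g x ∂μ) * t
      + ∫ x, g x ^ 2 ∂μ := by
    intro t
    have h0 : 0 ≤ ∫ x, ((f x ^ 2 * (t * t) + (f x * g x) * (2 * t)) + g x ^ 2) ∂μ :=
      integral_nonneg fun x => by
        have : (f x ^ 2 * (t * t) + (f x * g x) * (2 * t)) + g x ^ 2 = (f x * t + g x) ^ 2 := by ring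
        simp only [this]; positivity
    have e := integral_add ((hf.mul_const (t * t)).add (hfg.mul_const (2 * t))) hg
    simp only [Pi.add_apply] at e
    rw [e, integral_add (hf.mul_const (t * t)) (hfg.mul_const (2 * t)), integral_mul_const,
      integral_mul_const] at h0
    linarith
  have hd := discrim_le_zero hquad
  rw [discrim] at hd
  rw [← Real.sqrt_mul hA]
  exact Real.abs_le_sqrt (by nlinarith)

/-- The inner cutoff `1 / (1 + (r/s)^θ)`; for small `θ` it varies slowly. -/
noncomputable def cutIn (θ s r : ℝ) : ℝ := 1 / (1 + (r / s) ^ θ)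

/-- The derivative of `cutIn`. -/
noncomputable def cutInDeriv (θ s r : ℝ) : ℝ := -(θ * (r / s) ^ θ / r) / (1 + (r / s) ^ θ) ^ 2

section
variable {k : ℕ} {l m r s θ M ε : ℝ} {g γ γ' V : ℝ → ℝ}

lemma cutIn_pos (hs : 0 < s) (hr : 0 < r) : 0 < cutIn θ s r := by unfold cutIn; positivity

lemma cutIn_le_one (hs : 0 < s) (hr : 0 < r) : cutIn θ s r ≤ 1 := by
  unfold cutIn
  rw [div_le_one (by positivity)]
  linarith [Real.rpow_nonneg (div_pos hr hs).le θ]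

lemma isWeight_cutIn (hs : 0 < s) (hθ : 0 ≤ θ) :
    IsWeight (cutIn θ s) (cutInDeriv θ s) 1 θ := by
  refine ⟨fun r hr => ?_, ?_, fun r hr => ?_, fun r hr => ?_⟩
  · have hx : 0 < r / s := div_pos hr hs
    have h1 : HasDerivAt (fun r : ℝ => (r / s) ^ θ) (1 / s * θ * (r / s) ^ (θ - 1)) r :=
      ((hasDerivAt_id r).div_const s).rpow_const (Or.inl hx.ne')
    have h2 : HasDerivAt (fun r : ℝ => 1 + (r / s) ^ θ) (1 / s * θ * (r / s) ^ (θ - 1)) r :=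
      h1.const_add 1
    have hp : 0 < 1 + (r / s) ^ θ := by positivity
    have h3 := h2.inv hp.ne'
    have : (cutIn θ s) = fun r => (1 + (r / s) ^ θ)⁻¹ := by
      funext r; rw [cutIn, one_div]
    rw [this]
    refine h3.congr_deriv ?_
    rw [cutInDeriv, Real.rpow_sub_one hx.ne']
    field_simp
  · unfold cutInDeriv
    have hc : ContinuousOn (fun r : ℝ => (r / s) ^ θ) (Ioi 0) := by fun_prop
    refine ContinuousOn.div ((continuousOn_const.mul hc).div continuousOn_id
      fun r hr => ne_of_gt hr).neg ((continuousOn_const.add hc).pow 2) fun r hr => ?_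
    have : 0 < (r / s) ^ θ := Real.rpow_pos_of_pos (div_pos hr hs) _
    positivity
  · rw [abs_of_pos (cutIn_pos hs hr)]; exact cutIn_le_one hs hr
  · have hx : 0 < (r / s) ^ θ := by positivity
    have : r * cutInDeriv θ s r = -(θ * ((r / s) ^ θ / (1 + (r / s) ^ θ) ^ 2)) := by
      unfold cutInDeriv; field_simp
    rw [this, abs_neg, abs_of_nonneg (by positivity)]
    have : (r / s) ^ θ / (1 + (r / s) ^ θ) ^ 2 ≤ 1 := by
      rw [div_le_one (by positivity)]; nlinarith
    nlinarith

lemma IsWeight.one_sub (h : IsWeight γ γ' M ε) :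
    IsWeight (fun r => 1 - γ r) (fun r => -γ' r) (1 + M) ε := by
  refine ⟨fun r hr => by simpa using (h.hasDerivAt r hr).const_sub 1, h.continuousOn.neg,
    fun r hr => ?_, fun r hr => ?_⟩
  · exact (abs_sub _ _).trans (by rw [abs_one]; linarith [h.abs_le r hr])
  · rw [mul_neg, abs_neg]; exact h.abs_deriv_le r hr

lemma IsWeight.mul {δ δ' : ℝ → ℝ} {M' ε' : ℝ} (h : IsWeight γ γ' M ε) (h' : IsWeight δ δ' M' ε') :
    IsWeight (fun r => γ r * δ r) (fun r => γ' r * δ r + γ r * δ' r) (M * M') (ε * M' + M * ε') := by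
  refine ⟨fun r hr => (h.hasDerivAt r hr).mul (h'.hasDerivAt r hr),
    (h.continuousOn.mul h'.locAC.continuousOn).add (h.locAC.continuousOn.mul h'.continuousOn),
    fun r hr => abs_mul_le (h.abs_le r hr) (h'.abs_le r hr), fun r hr => ?_⟩
  rw [show r * (γ' r * δ r + γ r * δ' r) = (r * γ' r) * δ r + γ r * (r * δ' r) by ring]
  exact (abs_add_le _ _).trans (add_le_add (abs_mul_le (h.abs_deriv_le r hr) (h'.abs_le r hr))
    (abs_mul_le (h.abs_le r hr) (h'.abs_deriv_le r hr)))

/-- `cos 2 (Q_l - Q_m)`. -/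
noncomputable def cos2P (k : ℕ) (l m r : ℝ) : ℝ := Real.cos (2 * twoBubble k l m r)

lemma cos2P_eq (k : ℕ) (l m r : ℝ) : cos2P k l m r
    = (cQ k l r ^ 2 - sQ k l r ^ 2) * (cQ k m r ^ 2 - sQ k m r ^ 2)
      + 4 * (sQ k l r * cQ k l r) * (sQ k m r * cQ k m r) := by
  unfold cos2P twoBubble sQ cQ
  rw [mul_sub, Real.cos_sub, Real.cos_two_mul, Real.cos_two_mul, Real.sin_two_mul,
    Real.sin_two_mul]
  have h1 := Real.sin_sq_add_cos_sq (Q k (r / l))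
  have h2 := Real.sin_sq_add_cos_sq (Q k (r / m))
  rw [show Real.sin (Q k (r / l)) ^ 2 = 1 - Real.cos (Q k (r / l)) ^ 2 by linarith,
    show Real.sin (Q k (r / m)) ^ 2 = 1 - Real.cos (Q k (r / m)) ^ 2 by linarith]
  ring

lemma cos2P_comm (k : ℕ) (l m r : ℝ) : cos2P k l m r = cos2P k m l r := by
  rw [cos2P_eq, cos2P_eq]; ring

lemma abs_cos2P_le (k : ℕ) (l m r : ℝ) : |cos2P k l m r| ≤ 1 := Real.abs_cos_le_one _

@[fun_prop]
lemma measurable_twoBubble (k : ℕ) (l m : ℝ) : Measurable (twoBubble k l m) := by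
  unfold twoBubble; fun_prop

@[fun_prop]
lemma measurable_cos2P (k : ℕ) (l m : ℝ) : Measurable (cos2P k l m) := by
  unfold cos2P; fun_prop

/-- The one-bubble potential `cos 2 Q_l`. -/
noncomputable def cos2Q (k : ℕ) (l r : ℝ) : ℝ := cQ k l r ^ 2 - sQ k l r ^ 2

@[fun_prop]
lemma measurable_cos2Q (k : ℕ) (l : ℝ) : Measurable (cos2Q k l) := by
  unfold cos2Q; fun_prop

lemma abs_cos2Q_le (k : ℕ) (l r : ℝ) : |cos2Q k l r| ≤ 1 := by
  have := sQ_sq_add_cQ_sq k l r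
  rw [cos2Q, abs_le]; constructor <;> nlinarith [sq_nonneg (sQ k l r), sq_nonneg (cQ k l r)]

lemma abs_cos2P_sub_le (hm : 0 < m) (hr : 0 < r) :
    |cos2P k l m r - cos2Q k l r| ≤ 4 * sQ k m r := by
  have e : cos2P k l m r - cos2Q k l r
      = -2 * (cos2Q k l r * sQ k m r) * sQ k m r + 4 * (sQ k l r * cQ k l r) * cQ k m r * sQ k m r := by
    rw [cos2P_eq, cos2Q]
    have := sQ_sq_add_cQ_sq k m r
    rw [show cQ k m r ^ 2 = 1 - sQ k m r ^ 2 by linarith]; ring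
  have hs := sQ_pos (k := k) hm hr
  have h1 : |cos2Q k l r * sQ k m r| ≤ 1 := by
    rw [abs_mul]; exact mul_le_one₀ (abs_cos2Q_le k l r) (abs_nonneg _) (abs_sQ_le k m r)
  have h2 : |sQ k l r * cQ k l r| ≤ 1 / 2 := by
    have := sQ_sq_add_cQ_sq k l r
    rw [abs_le]
    constructor <;> nlinarith [sq_nonneg (sQ k l r + cQ k l r), sq_nonneg (sQ k l r - cQ k l r)]
  have h3 : |(sQ k l r * cQ k l r) * cQ k m r| ≤ 1 / 2 := by
    rw [abs_mul]
    have := abs_cQ_le k m r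
    nlinarith [abs_nonneg (sQ k l r * cQ k l r), abs_nonneg (cQ k m r)]
  rw [e, abs_le]
  rw [abs_le] at h1 h3
  constructor <;> nlinarith

lemma sQ_le_rpow (hk : 1 ≤ k) (hm : 0 < m) (hr : 0 < r) (hθ0 : 0 ≤ θ) (hθ : θ ≤ 1) :
    sQ k m r ≤ 2 * (r / m) ^ θ ∧ sQ k m r ≤ 2 * (m / r) ^ θ := by
  have key : ∀ x : ℝ, 0 < x → sQ k m r ≤ 2 * x ^ k → sQ k m r ≤ 2 * x ^ θ := by
    intro x hx h
    rcases le_total x 1 with h1 | h1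
    · refine h.trans ?_
      rw [← Real.rpow_natCast]
      have : (1:ℝ) ≤ k := by exact_mod_cast hk
      exact mul_le_mul_of_nonneg_left
        (Real.rpow_le_rpow_of_exponent_ge hx h1 (by linarith)) (by norm_num)
    · linarith [sQ_le_one k m r, Real.one_le_rpow h1 hθ0]
  exact ⟨key _ (by positivity) (sQ_le_two_mul_pow hm hr),
    key _ (by positivity) (sQ_le_two_mul_pow_inv hm hr)⟩

lemma sqrt_mul_div (hl : 0 < l) (hm : 0 < m) :
    √(l * m) / m = √(l / m) ∧ l / √(l * m) = √(l / m) := by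
  rw [Real.sqrt_mul hl.le, Real.sqrt_div hl.le]
  have h1 := Real.mul_self_sqrt hl.le
  have h2 := Real.mul_self_sqrt hm.le
  have h3 := Real.sqrt_pos.2 hl
  have h4 := Real.sqrt_pos.2 hm
  constructor
  · rw [div_eq_div_iff hm.ne' h4.ne', mul_assoc, h2]
  · rw [div_eq_div_iff (by positivity) h4.ne']
    nlinarith

lemma cutIn_mul_sQ_le (hk : 1 ≤ k) (hl : 0 < l) (hm : 0 < m) (hr : 0 < r) (hθ0 : 0 ≤ θ)
    (hθ : θ ≤ 1) : cutIn θ √(l * m) r * sQ k m r ≤ 2 * √(l / m) ^ θ := by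
  have hs : 0 < √(l * m) := by positivity
  have h1 : cutIn θ √(l * m) r ≤ (√(l * m) / r) ^ θ := by
    unfold cutIn
    rw [← inv_div r, Real.inv_rpow (by positivity), one_div]
    exact inv_anti₀ (by positivity) (by linarith)
  calc cutIn θ √(l * m) r * sQ k m r ≤ (√(l * m) / r) ^ θ * (2 * (r / m) ^ θ) :=
        mul_le_mul h1 (sQ_le_rpow hk hm hr hθ0 hθ).1 (sQ_pos hm hr).le (by positivity)
    _ = 2 * √(l / m) ^ θ := by
        rw [← (sqrt_mul_div hl hm).1, mul_left_comm, ← Real.mul_rpow (by positivity) (by positivity)]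
        congr 2; field_simp

lemma cutOut_mul_sQ_le (hk : 1 ≤ k) (hl : 0 < l) (hm : 0 < m) (hr : 0 < r) (hθ0 : 0 ≤ θ)
    (hθ : θ ≤ 1) : (1 - cutIn θ √(l * m) r) * sQ k l r ≤ 2 * √(l / m) ^ θ := by
  have hs : 0 < √(l * m) := by positivity
  have h1 : 1 - cutIn θ √(l * m) r ≤ (r / √(l * m)) ^ θ := by
    unfold cutIn
    have hx : 0 < (r / √(l * m)) ^ θ := by positivity
    rw [sub_le_iff_le_add, ← sub_le_iff_le_add', le_div_iff₀ (by positivity)]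
    nlinarith
  calc (1 - cutIn θ √(l * m) r) * sQ k l r ≤ (r / √(l * m)) ^ θ * (2 * (l / r) ^ θ) :=
        mul_le_mul h1 (sQ_le_rpow hk hl hr hθ0 hθ).2 (sQ_pos hl hr).le (by positivity)
    _ = 2 * √(l / m) ^ θ := by
        rw [← (sqrt_mul_div hl hm).2, mul_left_comm, ← Real.mul_rpow (by positivity) (by positivity)]
        congr 2; field_simp

lemma MemH.abs_integral_deriv_weight_le (hg : MemH g) (hk : 1 ≤ k) (hγ : IsWeight γ γ' M ε) :
    |∫ r in Ioi (0:ℝ), γ' r * (k * cQ k l r * g r ^ 2)| ≤ k * ε * hSq k g :=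
  hg.abs_integral_le k fun _ hr => hγ.abs_deriv_mul_cQ_le hk l hr

/-- Changing the potential where the weight times the change is small. -/
lemma abs_qForm_sub_le {V' : ℝ → ℝ} {τ : ℝ} (hg : MemH g) (hγ : IsWeight γ γ' M ε)
    (hVm : Measurable V) (hV : ∀ r, 0 < r → |V r| ≤ 1)
    (hVm' : Measurable V') (hV' : ∀ r, 0 < r → |V' r| ≤ 1)
    (h : ∀ r, 0 < r → |γ r * (V r - V' r)| ≤ τ) :
    |qForm k V γ g - qForm k V' γ g| ≤ τ * hSq k g := by
  unfold qForm
  rw [← integral_sub (qForm_integrable hg hγ.aemeasurable hγ.abs_le hVm.aemeasurable hV)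
    (qForm_integrable hg hγ.aemeasurable hγ.abs_le hVm'.aemeasurable hV')]
  refine hg.abs_integral_le k fun r hr => ?_
  have e : γ r * (deriv g r ^ 2 + (k:ℝ) ^ 2 * V r * g r ^ 2 / r ^ 2) * r
      - γ r * (deriv g r ^ 2 + (k:ℝ) ^ 2 * V' r * g r ^ 2 / r ^ 2) * r
      = (γ r * (V r - V' r)) * ((k:ℝ) ^ 2 * (g r ^ 2 / r)) := by field_simp; ring
  rw [e]
  exact abs_mul_le (h r hr) (by rw [abs_of_nonneg (by positivity)]; exact sq_mul_le_hDens hr)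

lemma qForm_one_bubble (hg : MemH g) (hk : 1 ≤ k) (hl : 0 < l) (hγ : IsWeight γ γ' M ε) :
    |qForm k (cos2Q k l) γ g - bogForm k l γ g| ≤ k * ε * hSq k g := by
  have h := qForm_eq_bogForm hg hk hl hγ
  have h2 := hg.abs_integral_deriv_weight_le (l := l) hk hγ
  change |qForm k (fun r => cQ k l r ^ 2 - sQ k l r ^ 2) γ g - _| ≤ _
  rwa [h, sub_sub_cancel_left, abs_neg]

/-- The two-bubble quadratic form splits into the two one-bubble ones, up to a small error. -/
lemma qForm_ge_bogForm_add (hg : MemH g) (hk : 1 ≤ k) (hl : 0 < l) (hm : 0 < m)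
    (hθ0 : 0 ≤ θ) (hθ : θ ≤ 1) (hγ : IsWeight γ γ' M ε) :
    bogForm k l (fun r => γ r * cutIn θ √(l * m) r) g
      + bogForm k m (fun r => γ r * (1 - cutIn θ √(l * m) r)) g
      - (k * (3 * ε + 2 * M * θ) + 16 * M * √(l / m) ^ θ) * hSq k g ≤ qForm k (cos2P k l m) γ g := by
  have hs : 0 < √(l * m) := by positivity
  have hM := hγ.nonneg.1
  have hc1 := isWeight_cutIn (θ := θ) hs hθ0
  have hw1 := hγ.mul hc1
  have hw2 := hγ.mul hc1.one_sub
  have iq := fun {γ γ' M ε} (h : IsWeight γ γ' M ε) => qForm_integrable (k := k) hg h.aemeasurable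
    h.abs_le (measurable_cos2P k l m).aemeasurable (fun r _ => abs_cos2P_le k l m r)
  have hsplit : qForm k (cos2P k l m) γ g
      = qForm k (cos2P k l m) (fun r => γ r * cutIn θ √(l * m) r) g
        + qForm k (cos2P k l m) (fun r => γ r * (1 - cutIn θ √(l * m) r)) g := by
    unfold qForm
    rw [← integral_add (iq hw1) (iq hw2)]
    congr 1; funext r; ring
  have hcut : ∀ r, 0 < r → 0 ≤ cutIn θ √(l * m) r ∧ 0 ≤ 1 - cutIn θ √(l * m) r := fun r hr =>
    ⟨(cutIn_pos hs hr).le, sub_nonneg.2 (cutIn_le_one hs hr)⟩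
  have a : ∀ {w w' : ℝ → ℝ} {W ε'} (n : ℝ), IsWeight (fun r => γ r * w r) w' W ε' →
      (∀ r, 0 < r → |w r * (cos2P k l m r - cos2Q k n r)| ≤ 8 * √(l / m) ^ θ) →
      |qForm k (cos2P k l m) (fun r => γ r * w r) g - qForm k (cos2Q k n) (fun r => γ r * w r) g|
        ≤ M * (8 * √(l / m) ^ θ) * hSq k g := fun n hw h =>
    abs_qForm_sub_le hg hw (measurable_cos2P k l m) (fun r _ => abs_cos2P_le k l m r)
      (measurable_cos2Q k n) (fun r _ => abs_cos2Q_le k n r) fun r hr => by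
        rw [mul_assoc]; exact abs_mul_le (hγ.abs_le r hr) (h r hr)
  have a1 := a l hw1 fun r hr => by
    have := cutIn_mul_sQ_le hk hl hm hr hθ0 hθ
    refine (abs_mul_le (abs_of_nonneg (hcut r hr).1).le (abs_cos2P_sub_le hm hr)).trans ?_
    linarith
  have a2 := a m hw2 fun r hr => by
    have := cutOut_mul_sQ_le hk hl hm hr hθ0 hθ
    rw [cos2P_comm]
    refine (abs_mul_le (abs_of_nonneg (hcut r hr).2).le (abs_cos2P_sub_le hl hr)).trans ?_
    linarith
  have b1 := qForm_one_bubble hg hk hl hw1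
  have b2 := qForm_one_bubble hg hk hm hw2
  rw [abs_le] at a1 a2 b1 b2
  rw [hsplit]
  linarith [a1.1, a2.1, b1.1, b2.1]

lemma bogForm_nonneg (hγ : ∀ r, 0 < r → 0 ≤ γ r) : 0 ≤ bogForm k l γ g :=
  setIntegral_nonneg measurableSet_Ioi fun r hr => by
    have hr0 : (0:ℝ) < r := hr
    have := hγ r hr
    positivity

/-- Slowly varying nonnegative weights do not destroy the nonnegativity of the two-bubble form. -/
lemma qForm_two_bubble_ge (hg : MemH g) (hk : 1 ≤ k) (hl : 0 < l) (hm : 0 < m)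
    (hθ0 : 0 ≤ θ) (hθ : θ ≤ 1) (hγ : IsWeight γ γ' M ε) (hpos : ∀ r, 0 < r → 0 ≤ γ r) :
    -((k * (3 * ε + 2 * M * θ) + 16 * M * √(l / m) ^ θ) * hSq k g) ≤ qForm k (cos2P k l m) γ g := by
  have hs : 0 < √(l * m) := by positivity
  have h := qForm_ge_bogForm_add hg hk hl hm hθ0 hθ hγ
  have h1 : 0 ≤ bogForm k l (fun r => γ r * cutIn θ √(l * m) r) g := bogForm_nonneg fun r hr =>
    mul_nonneg (hpos r hr) (cutIn_pos hs hr).le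
  have h2 : 0 ≤ bogForm k m (fun r => γ r * (1 - cutIn θ √(l * m) r)) g := bogForm_nonneg fun r hr =>
    mul_nonneg (hpos r hr) (sub_nonneg.2 (cutIn_le_one hs hr))
  linarith

/-! ### Coercivity -/

lemma intervalIntegral_inv_sQ_sq_le (hk : 1 ≤ k) (hl : 0 < l) {a b : ℝ} (ha : 0 < a) (hab : a ≤ b) :
    IntegrableOn (fun r => 1 / (r * sQ k l r ^ 2)) (Ioc a b) ∧
    ∫ r in Ioc a b, 1 / (r * sQ k l r ^ 2) ≤ 1 / sQ k l a ^ 2 + 1 / sQ k l b ^ 2 := by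
  have hk0 : (1:ℝ) ≤ k := by exact_mod_cast hk
  have hb : 0 < b := ha.trans_le hab
  have hpos : ∀ r ∈ Icc a b, 0 < r := fun r hr => ha.trans_le hr.1
  have hcont : ContinuousOn (fun r => 1 / (r * sQ k l r ^ 2)) (Icc a b) :=
    continuousOn_const.div (continuousOn_id.mul ((continuous_sQ k l).pow 2).continuousOn)
      fun r hr => (mul_pos (hpos r hr) (pow_pos (sQ_pos hl (hpos r hr)) 2)).ne'
  have hint : IntegrableOn (fun r => 1 / (r * sQ k l r ^ 2)) (Icc a b) := hcont.integrableOn_Icc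
  refine ⟨hint.mono_set Ioc_subset_Icc_self, ?_⟩
  set X : ℝ → ℝ := fun r => (((r / l) ^ k) ^ 2 - ((l / r) ^ k) ^ 2) / (4 * k) with hX
  have hXd : ∀ r, 0 < r → HasDerivAt X ((((r / l) ^ k) ^ 2 + ((l / r) ^ k) ^ 2) / (2 * r)) r := by
    intro r hr
    have h1 : HasDerivAt (fun r : ℝ => ((r / l) ^ k) ^ 2)
        (2 * ((r / l) ^ k) * (k * (r / l) ^ (k - 1) * (1 / l))) r := by
      refine ((((hasDerivAt_id r).div_const l).pow k).pow 2).congr_deriv ?_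
      simp
    have h2 : HasDerivAt (fun r : ℝ => ((l / r) ^ k) ^ 2)
        (2 * ((l / r) ^ k) * (k * (l / r) ^ (k - 1) * (-l / r ^ 2))) r := by
      have h3 : HasDerivAt (fun r : ℝ => l / r) (-l / r ^ 2) r := by
        refine ((hasDerivAt_const r l).div (hasDerivAt_id r) hr.ne').congr_deriv ?_
        simp
      refine ((h3.pow k).pow 2).congr_deriv ?_
      simp
    refine ((h1.sub h2).div_const (4 * (k:ℝ))).congr_deriv ?_
    obtain ⟨j, rfl⟩ : ∃ j, k = j + 1 := ⟨k - 1, by omega⟩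
    simp only [Nat.add_sub_cancel, pow_succ]
    field_simp
    ring
  have hle : ∀ r, 0 < r → 1 / (r * sQ k l r ^ 2) ≤ (((r / l) ^ k) ^ 2 + ((l / r) ^ k) ^ 2) / (2 * r) := by
    intro r hr
    have e : 1 / (r * sQ k l r ^ 2) = (1 / sQ k l r) ^ 2 / r := by
      have := (sQ_pos (k := k) hl hr).ne'
      field_simp
    rw [e, inv_sQ_eq hl hr, div_le_div_iff₀ hr (by positivity)]
    nlinarith [sq_nonneg ((r / l) ^ k - (l / r) ^ k)]
  have hmono : ∫ r in Ioc a b, 1 / (r * sQ k l r ^ 2) ≤ X b - X a := by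
    have hXc : ContinuousOn (fun r => (((r / l) ^ k) ^ 2 + ((l / r) ^ k) ^ 2) / (2 * r)) (Icc a b) := by
      refine ContinuousOn.div (ContinuousOn.add (by fun_prop) ?_) (by fun_prop)
        fun r hr => by have := hpos r hr; positivity
      exact ((continuousOn_const.div continuousOn_id fun r hr => (hpos r hr).ne').pow k).pow 2
    rw [← intervalIntegral.integral_eq_sub_of_hasDerivAt (f := X)
      (fun r hr => hXd r (by rw [uIcc_of_le hab] at hr; exact hpos r hr))
      (by rw [intervalIntegrable_iff_integrableOn_Icc_of_le hab]; exact hXc.integrableOn_Icc),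
      intervalIntegral.integral_of_le hab]
    exact setIntegral_mono_on (hint.mono_set Ioc_subset_Icc_self)
      (hXc.integrableOn_Icc.mono_set Ioc_subset_Icc_self) measurableSet_Ioc
      fun r hr => hle r (ha.trans hr.1)
  refine hmono.trans ?_
  have e : ∀ r, 0 < r → 1 / sQ k l r ^ 2 = (((r / l) ^ k + (l / r) ^ k) / 2) ^ 2 := fun r hr => by
    rw [← inv_sQ_eq hl hr, one_div_pow]
  rw [e a ha, e b hb]
  simp only [hX]
  have p1 : 0 < (a / l) ^ k := by positivity
  have p2 : 0 < (l / a) ^ k := by positivity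
  have p3 : 0 < (b / l) ^ k := by positivity
  have p4 : 0 < (l / b) ^ k := by positivity
  rw [← sub_div, div_le_iff₀ (by positivity)]
  nlinarith [mul_pos p1 p2, mul_pos p3 p4, sq_nonneg ((a / l) ^ k), sq_nonneg ((l / b) ^ k),
    mul_nonneg (sub_nonneg.2 hk0) (sq_nonneg ((a / l) ^ k + (l / a) ^ k)),
    mul_nonneg (sub_nonneg.2 hk0) (sq_nonneg ((b / l) ^ k + (l / b) ^ k))]

/-- Variation of constants for `∂_r - k cos Q_l / r`, whose kernel is spanned by `sin Q_l`. -/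
lemma abs_wronskian_le (hg : MemH g) (hk : 1 ≤ k) (hl : 0 < l) (hγ : IsWeight γ γ' M ε)
    (hpos : ∀ r, 0 < r → 0 ≤ γ r) {a b : ℝ} (ha : 0 < a) (hab : a ≤ b)
    (hhalf : ∀ r ∈ Icc a b, 1 / 2 ≤ γ r) :
    |g b * sQ k l a - g a * sQ k l b| ≤ √(2 * bogForm k l γ g) * (sQ k l a + sQ k l b) := by
  have hb : 0 < b := ha.trans_le hab
  have hsub : Ioc a b ⊆ Ioi 0 := fun r hr => ha.trans hr.1
  have hsa := sQ_pos (k := k) hl ha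
  have hsb := sQ_pos (k := k) hl hb
  set h : ℝ → ℝ := fun r => deriv g r - k * cQ k l r * g r / r with hh
  have hinvd : ∀ r, 0 < r → HasDerivAt (fun r => 1 / sQ k l r)
      (-(cQ k l r * (k * sQ k l r / r)) / sQ k l r ^ 2) r := by
    intro r hr
    refine ((hasDerivAt_const r (1:ℝ)).div (hasDerivAt_sQ hl hr) (sQ_pos hl hr).ne').congr_deriv ?_
    simp
  have hinv : LocAC (fun r => 1 / sQ k l r) := by
    refine LocAC.of_hasDerivAt hinvd ?_
    exact (continuousOn_deriv_sQ k l).neg.div ((continuous_sQ k l).pow 2).continuousOn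
      fun r hr => (pow_pos (sQ_pos hl hr) 2).ne'
  have hy := hg.locAC.mul hinv
  have hyd : ∀ᵐ r : ℝ, 0 < r → deriv (fun r => g r * (1 / sQ k l r)) r = h r * (1 / sQ k l r) := by
    filter_upwards [hg.ae_hasDerivAt] with r hr h0
    have hs := (sQ_pos (k := k) hl h0).ne'
    refine ((hr h0).mul (hinvd r h0)).deriv.trans ?_
    simp only [hh]; field_simp; ring
  have e1 : g b * (1 / sQ k l b) - g a * (1 / sQ k l a) = ∫ r in Ioc a b, h r * (1 / sQ k l r) := by
    rw [← hy.integral_deriv ha hb, intervalIntegral.integral_of_le hab]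
    refine setIntegral_congr_ae measurableSet_Ioc ?_
    filter_upwards [hyd] with r hr hr' using hr (hsub hr')
  have hbog := bog_integrable (k := k) (l := l) hg hγ.aemeasurable hγ.abs_le
  have e2 : ∫ r in Ioc a b, h r * (1 / sQ k l r)
      = ∫ r in Ioc a b, (h r * √r) * (1 / (√r * sQ k l r)) := by
    refine setIntegral_congr_fun measurableSet_Ioc fun r hr => ?_
    have := Real.sqrt_pos.2 (hsub hr)
    have := (sQ_pos (k := k) hl (hsub hr)).ne'
    field_simp
  have e3 : ∀ r ∈ Ioc a b, (1 / (√r * sQ k l r)) ^ 2 = 1 / (r * sQ k l r ^ 2) := fun r hr => by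
    rw [one_div_pow, mul_pow, Real.sq_sqrt (le_of_lt (hsub hr))]
  have e4 : ∀ r ∈ Ioc a b, (h r * √r) ^ 2 = h r ^ 2 * r := fun r hr => by
    rw [mul_pow, Real.sq_sqrt (le_of_lt (hsub hr))]
  obtain ⟨i5, h5⟩ := intervalIntegral_inv_sQ_sq_le hk hl ha hab
  have hle : ∀ r ∈ Ioc a b, h r ^ 2 * r ≤ 2 * (γ r * h r ^ 2 * r) := fun r hr => by
    have := hhalf r (Ioc_subset_Icc_self hr)
    have h0 : 0 ≤ h r ^ 2 * r := mul_nonneg (sq_nonneg _) (le_of_lt (hsub hr))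
    nlinarith
  have hm := hg.aemeasurable
  have hd := measurable_deriv g
  have i6 : IntegrableOn (fun r => h r ^ 2 * r) (Ioc a b) := by
    refine ((hbog.mono_set hsub).const_mul 2).mono' ?_ ?_
    · have : AEMeasurable (fun r => h r ^ 2 * r) (volume.restrict (Ioi 0)) := by fun_prop
      exact (this.mono_measure (Measure.restrict_mono hsub le_rfl)).aestronglyMeasurable
    · filter_upwards [ae_restrict_mem measurableSet_Ioc] with r hr
      rw [Real.norm_eq_abs, abs_of_nonneg (mul_nonneg (sq_nonneg _) (le_of_lt (hsub hr)))]
      exact hle r hr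
  have h6 : ∫ r in Ioc a b, h r ^ 2 * r ≤ 2 * bogForm k l γ g := by
    calc ∫ r in Ioc a b, h r ^ 2 * r ≤ ∫ r in Ioc a b, 2 * (γ r * h r ^ 2 * r) :=
          setIntegral_mono_on i6 ((hbog.mono_set hsub).const_mul 2) measurableSet_Ioc hle
      _ ≤ ∫ r in Ioi 0, 2 * (γ r * h r ^ 2 * r) := by
          refine setIntegral_mono_set (hbog.const_mul 2) (ae_Ioi fun r hr => ?_) hsub.eventuallyLE
          have := hpos r hr
          simp only [Pi.zero_apply]
          positivity
      _ = 2 * bogForm k l γ g := by rw [integral_const_mul]; rfl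
  have hcs := abs_integral_mul_le_sqrt (μ := volume.restrict (Ioc a b))
    (f := fun r => h r * √r) (g := fun r => 1 / (√r * sQ k l r))
    (i6.congr_fun (fun r hr => (e4 r hr).symm) measurableSet_Ioc)
    (i5.congr_fun (fun r hr => (e3 r hr).symm) measurableSet_Ioc)
  rw [setIntegral_congr_fun measurableSet_Ioc e3, setIntegral_congr_fun measurableSet_Ioc e4,
    ← e2, ← e1] at hcs
  have h7 : |g b * (1 / sQ k l b) - g a * (1 / sQ k l a)|
      ≤ √(2 * bogForm k l γ g) * (1 / sQ k l a + 1 / sQ k l b) := by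
    refine hcs.trans (mul_le_mul (Real.sqrt_le_sqrt h6) ?_ (Real.sqrt_nonneg _) (Real.sqrt_nonneg _))
    refine Real.sqrt_le_iff.2 ⟨by positivity, h5.trans ?_⟩
    have : 0 < 1 / sQ k l a * (1 / sQ k l b) := by positivity
    rw [← one_div_pow, ← one_div_pow]
    nlinarith
  have e8 : g b * sQ k l a - g a * sQ k l b
      = (g b * (1 / sQ k l b) - g a * (1 / sQ k l a)) * (sQ k l a * sQ k l b) := by field_simp
  have e9 : sQ k l a + sQ k l b = (1 / sQ k l a + 1 / sQ k l b) * (sQ k l a * sQ k l b) := by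
    field_simp; ring
  rw [e8, e9, abs_mul, abs_of_pos (mul_pos hsa hsb), ← mul_assoc (√_)]
  exact mul_le_mul_of_nonneg_right h7 (mul_pos hsa hsb).le

end

/-- A function bounded by `A` and supported in `[0, B]`. -/
structure BddSupp (Z : ℝ → ℝ) (A B : ℝ) : Prop where
  continuous : Continuous Z
  abs_le : ∀ r, |Z r| ≤ A
  eq_zero : ∀ r, B ≤ r → Z r = 0
  pos : 0 < B

lemma exists_bddSupp {Z : ℝ → ℝ} (hc : Continuous Z) (hs : HasCompactSupport Z) :
    ∃ A B, BddSupp Z A B := by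
  obtain ⟨A, hA⟩ := hs.exists_bound_of_continuous hc
  obtain ⟨B, hB⟩ := hs.isCompact.bddAbove
  refine ⟨A, max (B + 1) 1, hc, hA, fun r hr => ?_, lt_max_of_lt_right one_pos⟩
  refine image_eq_zero_of_notMem_tsupport fun h => ?_
  have h1 := hB h
  have h2 := (le_max_left (B + 1) 1).trans hr
  linarith

section
variable {k : ℕ} {l m r s θ M ε : ℝ} {g γ γ' V Z : ℝ → ℝ} {A B : ℝ}

lemma BddSupp.nonneg (h : BddSupp Z A B) : 0 ≤ A := (abs_nonneg _).trans (h.abs_le 0)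

lemma BddSupp.integrable_mul (h : BddSupp Z A B) (hl : 0 < l) {f : ℝ → ℝ} {D : ℝ}
    (hf : AEMeasurable f (volume.restrict (Ioi (0:ℝ)))) (hD : ∀ r, 0 < r → |f r| ≤ D) :
    IntegrableOn (fun r => Z (r / l) * f r * r) (Ioi 0) := by
  have hD0 : 0 ≤ D := (abs_nonneg _).trans (hD 1 one_pos)
  have hZ : Measurable Z := h.continuous.measurable
  have hm : AEMeasurable (fun r => Z (r / l) * f r * r) (volume.restrict (Ioi 0)) := by fun_prop
  have hi : IntegrableOn (fun r => Z (r / l) * f r * r) (Ioc 0 (B * l)) := by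
    refine (integrableOn_const (C := A * D * (B * l)) measure_Ioc_lt_top.ne).mono'
      (hm.mono_set Ioc_subset_Ioi_self).aestronglyMeasurable ?_
    filter_upwards [ae_restrict_mem measurableSet_Ioc] with r hr
    rw [norm_mul, norm_mul]
    have := h.nonneg
    refine mul_le_mul (mul_le_mul (h.abs_le _) (hD r hr.1) (norm_nonneg _) this) ?_
      (norm_nonneg _) (by positivity)
    rw [Real.norm_eq_abs, abs_of_pos hr.1]; exact hr.2
  refine hi.of_forall_sdiff_eq_zero measurableSet_Ioi fun r hr => ?_
  have : B * l ≤ r := by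
    by_contra hh; exact hr.2 ⟨hr.1, (not_le.1 hh).le⟩
  rw [h.eq_zero _ (by rwa [le_div_iff₀ hl])]; ring

lemma pair_rescaleL2 (l : ℝ) (f : ℝ → ℝ) :
    pair (rescaleL2 l Z) f = 1 / l * ∫ r in Ioi (0:ℝ), Z (r / l) * f r * r := by
  unfold pair rescaleL2
  rw [← integral_const_mul]
  congr 1; funext r; ring

lemma integral_rescale_sQ (hl : 0 < l) :
    k * ∫ r in Ioi (0:ℝ), Z (r / l) * sQ k l r * r = l ^ 2 * pair Z (LambdaQ k) := by
  have h := integral_comp_mul_left_Ioi (fun r => Z (r / l) * sQ k l r * r) 0 hl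
  rw [mul_zero, smul_eq_mul] at h
  have e : ∫ r in Ioi (0:ℝ), Z (r / l) * sQ k l r * r
      = l * ∫ x in Ioi (0:ℝ), Z (l * x / l) * sQ k l (l * x) * (l * x) := by
    rw [h]; field_simp
  rw [e, pair, ← integral_const_mul, ← integral_const_mul, ← integral_const_mul]
  refine integral_congr_Ioi fun r hr => ?_
  have h1 : LambdaQ k r = k * sQ k 1 r := by simpa using LambdaQ_div (k := k) one_pos hr
  have h2 : sQ k l (l * r) = sQ k 1 r := by
    unfold sQ; rw [mul_div_cancel_left₀ _ hl.ne', div_one]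
  simp only [h1, h2, mul_div_cancel_left₀ _ hl.ne']
  ring

/-- The orthogonality condition turns variation of constants into a bound for `g` itself on the
region `I` where the weight is large. -/
lemma abs_le_of_orthogonal (hg : MemH g) (hk : 1 ≤ k) (hl : 0 < l) (hγ : IsWeight γ γ' M ε)
    (hpos : ∀ r, 0 < r → 0 ≤ γ r) (hZ : BddSupp Z A B) (hN : 0 < pair Z (LambdaQ k))
    (horth : pair (rescaleL2 l Z) g = 0) {I : Set ℝ} (hI : I.OrdConnected) (hI0 : I ⊆ Ioi 0)
    (hhalf : ∀ r ∈ I, 1 / 2 ≤ γ r) {d : ℝ} (hd0 : 0 ≤ d)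
    (hd : ∀ x, 0 < x → x ≤ B * l → x ∉ I → x ≤ d) (hr : r ∈ I) :
    |g r| ≤ 2 * k * A / pair Z (LambdaQ k) *
      (B ^ 2 * √(2 * bogForm k l γ g) + (d / l) ^ 2 * √(hSq k g)) := by
  have hA := hZ.nonneg
  set N := pair Z (LambdaQ k)
  set H := √(2 * bogForm k l γ g)
  set G := √(hSq k g)
  have hr0 : 0 < r := hI0 hr
  have hH : 0 ≤ H := Real.sqrt_nonneg _
  have hG : 0 ≤ G := Real.sqrt_nonneg _
  have hsup : ∀ x, 0 < x → |g x| ≤ G := fun x hx => hg.abs_le_sqrt hk hx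
  have i1 := hZ.integrable_mul hl hg.aemeasurable hsup
  have i2 := hZ.integrable_mul (f := sQ k l) hl (by fun_prop) (fun x _ => abs_sQ_le k l x)
  have h0 : ∫ x in Ioi (0:ℝ), Z (x / l) * g x * x = 0 := by
    rw [pair_rescaleL2 l] at horth
    exact (mul_eq_zero.1 horth).resolve_left (by positivity)
  have hW : ∀ x ∈ I, |g r * sQ k l x - g x * sQ k l r| ≤ 2 * H := by
    intro x hx
    have hx0 : 0 < x := hI0 hx
    have hs : sQ k l x + sQ k l r ≤ 2 := by linarith [sQ_le_one k l x, sQ_le_one k l r]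
    rcases le_total x r with h | h
    · have := abs_wronskian_le hg hk hl hγ hpos hx0 h fun y hy => hhalf y (hI.out hx hr hy)
      exact this.trans (by rw [mul_comm]; gcongr)
    · have := abs_wronskian_le hg hk hl hγ hpos hr0 h fun y hy => hhalf y (hI.out hr hx hy)
      rw [abs_sub_comm] at this
      exact this.trans (by rw [mul_comm, add_comm]; gcongr)
  have hW' : ∀ x, 0 < x → |g r * sQ k l x - g x * sQ k l r| ≤ 2 * G := by
    intro x hx
    refine (abs_sub _ _).trans ?_
    linarith [abs_mul_le (hsup r hr0) (abs_sQ_le k l x), abs_mul_le (hsup x hx) (abs_sQ_le k l r)]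
  have e1 : g r * ∫ x in Ioi (0:ℝ), Z (x / l) * sQ k l x * x
      = ∫ x in Ioi (0:ℝ), Z (x / l) * (g r * sQ k l x - g x * sQ k l r) * x := by
    have : ∀ x, Z (x / l) * (g r * sQ k l x - g x * sQ k l r) * x
        = g r * (Z (x / l) * sQ k l x * x) - sQ k l r * (Z (x / l) * g x * x) := fun x => by ring
    simp_rw [this]
    rw [integral_sub (i2.const_mul _) (i1.const_mul _), integral_const_mul, integral_const_mul, h0]
    ring
  have hBl : 0 < B * l := mul_pos hZ.pos hl
  -- the dominating function
  set D : ℝ → ℝ := fun x => (Ioc 0 (B * l)).indicator (fun x => 2 * A * H * x) x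
    + (Ioc 0 d).indicator (fun x => 2 * A * G * x) x with hD
  have ind : ∀ (c b : ℝ), 0 ≤ b →
      Integrable ((Ioc 0 b).indicator (fun x : ℝ => c * x)) ∧
      ∫ x in Ioi (0:ℝ), (Ioc 0 b).indicator (fun x : ℝ => c * x) x = c * (b ^ 2 / 2) := by
    intro c b hb
    constructor
    · rw [integrable_indicator_iff measurableSet_Ioc]
      exact (continuous_const.mul continuous_id).integrableOn_Ioc
    · rw [setIntegral_indicator measurableSet_Ioc, inter_eq_right.2 fun x hx => hx.1,
        ← intervalIntegral.integral_of_le hb, intervalIntegral.integral_const_mul, integral_id]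
      ring
  have hle : ∀ x ∈ Ioi (0:ℝ), ‖Z (x / l) * (g r * sQ k l x - g x * sQ k l r) * x‖ ≤ D x := by
    intro x hx
    have hx0 : (0:ℝ) < x := hx
    rw [norm_mul, norm_mul, Real.norm_eq_abs, Real.norm_eq_abs, Real.norm_eq_abs, abs_of_pos hx0]
    have n1 : 0 ≤ (Ioc 0 (B * l)).indicator (fun x => 2 * A * H * x) x :=
      indicator_nonneg (fun y hy => by have := hy.1; positivity) x
    have n2 : 0 ≤ (Ioc 0 d).indicator (fun x => 2 * A * G * x) x :=
      indicator_nonneg (fun y hy => by have := hy.1; positivity) x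
    by_cases hxB : x ≤ B * l
    · have hz := hZ.abs_le (x / l)
      by_cases hxI : x ∈ I
      · have : (Ioc 0 (B * l)).indicator (fun x => 2 * A * H * x) x = 2 * A * H * x :=
          indicator_of_mem (show x ∈ Ioc 0 (B * l) from ⟨hx0, hxB⟩) _
        simp only [hD, this]
        have h1 := mul_le_mul hz (hW x hxI) (abs_nonneg _) hA
        nlinarith
      · have : (Ioc 0 d).indicator (fun x => 2 * A * G * x) x = 2 * A * G * x :=
          indicator_of_mem (show x ∈ Ioc 0 d from ⟨hx0, hd x hx0 hxB hxI⟩) _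
        simp only [hD, this]
        have h1 := mul_le_mul hz (hW' x hx0) (abs_nonneg _) hA
        nlinarith
    · rw [hZ.eq_zero _ (by rw [le_div_iff₀ hl]; exact (not_le.1 hxB).le)]
      simp only [hD, abs_zero, zero_mul]
      exact add_nonneg n1 n2
  have hbound := norm_integral_le_of_norm_le (((ind (2 * A * H) _ hBl.le).1.integrableOn
      (s := Ioi 0)).add ((ind (2 * A * G) _ hd0).1.integrableOn (s := Ioi 0)))
    ((ae_restrict_mem measurableSet_Ioi).mono hle)
  simp only [Pi.add_apply] at hbound
  rw [integral_add (ind (2 * A * H) _ hBl.le).1.integrableOn (ind (2 * A * G) _ hd0).1.integrableOn,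
    (ind _ _ hBl.le).2, (ind _ _ hd0).2, ← e1, Real.norm_eq_abs, abs_mul] at hbound
  have hI2 := integral_rescale_sQ (k := k) (Z := Z) hl
  set S := ∫ x in Ioi (0:ℝ), Z (x / l) * sQ k l x * x
  have hk0 : (0:ℝ) < k := by exact_mod_cast hk
  have hS : S = l ^ 2 * N / k := by field_simp; linarith
  rw [hS, abs_of_pos (show 0 < l ^ 2 * N / k by positivity)] at hbound
  have h3 : |g r| * (l ^ 2 * N) ≤ k * (A * (H * (B * l) ^ 2 + G * d ^ 2)) := by
    have e : |g r| * (l ^ 2 * N / k) = |g r| * (l ^ 2 * N) / k := by ring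
    rw [e, div_le_iff₀ hk0] at hbound
    nlinarith
  have e4 : 2 * k * A / N * (B ^ 2 * H + (d / l) ^ 2 * G)
      = 2 * (k * (A * (H * (B * l) ^ 2 + G * d ^ 2))) / (l ^ 2 * N) := by
    field_simp
  rw [e4, le_div_iff₀ (by positivity)]
  have : 0 ≤ k * (A * (H * (B * l) ^ 2 + G * d ^ 2)) := by positivity
  linarith

/-- The part of the `H`-norm seen by the weight is controlled by the one-bubble form. -/
lemma weighted_hDens_le (hg : MemH g) (hk : 1 ≤ k) (hl : 0 < l) (hγ : IsWeight γ γ' M ε)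
    (hpos : ∀ r, 0 < r → 0 ≤ γ r) (hone : ∀ r, 0 < r → γ r ≤ 1) {I : Set ℝ} {X e : ℝ}
    (hX : ∀ r ∈ I, |g r| ≤ X) (he : ∀ r, 0 < r → r ∉ I → sQ k l r ≤ e) :
    ∫ r in Ioi (0:ℝ), γ r * hDens k g r
      ≤ bogForm k l γ g + 4 * k * X ^ 2 + (k * ε + 2 * e ^ 2) * hSq k g := by
  have hk0 : (0:ℝ) < k := by exact_mod_cast hk
  have hm := hg.aemeasurable
  have hγm := hγ.aemeasurable
  have h1 := qForm_one_bubble hg hk hl hγ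
  rw [abs_le] at h1
  have iq := qForm_integrable (k := k) hg hγm hγ.abs_le (measurable_cos2Q k l).aemeasurable
    (fun r _ => abs_cos2Q_le k l r)
  have i3 : IntegrableOn (fun r => 2 * γ r * sQ k l r ^ 2 * ((k:ℝ) ^ 2 * (g r ^ 2 / r))) (Ioi 0) := by
    refine hg.integrableOn_of_le (A := 2) k (by fun_prop) fun r hr => ?_
    have hp := hpos r hr
    have hs : sQ k l r ^ 2 ≤ 1 := by nlinarith [sQ_sq_add_cQ_sq k l r, sq_nonneg (cQ k l r)]
    rw [abs_of_nonneg (by positivity)]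
    refine mul_le_mul ?_ (sq_mul_le_hDens hr) (by positivity) (by norm_num)
    nlinarith [mul_le_one₀ (hone r hr) (sq_nonneg _) hs]
  have e1 : ∫ r in Ioi (0:ℝ), γ r * hDens k g r = qForm k (cos2Q k l) γ g
      + ∫ r in Ioi (0:ℝ), 2 * γ r * sQ k l r ^ 2 * ((k:ℝ) ^ 2 * (g r ^ 2 / r)) := by
    rw [qForm, ← integral_add iq i3]
    refine integral_congr_Ioi fun r hr => ?_
    have := sQ_sq_add_cQ_sq k l r
    simp only [hDens, cos2Q]
    rw [show cQ k l r ^ 2 = 1 - sQ k l r ^ 2 by linarith]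
    field_simp
    ring
  have h3 := hg.abs_integral_le_add (A := 2 * e ^ 2) (B := 2 * (k:ℝ) ^ 2 * X ^ 2) k
    (hasInt_sQ_sq_div (k := k) (by omega) hl).1
    (F := fun r => 2 * γ r * sQ k l r ^ 2 * ((k:ℝ) ^ 2 * (g r ^ 2 / r))) (fun r hr => by
      have h2 := sq_mul_le_hDens (k := k) (g := g) hr
      have hp := hpos r hr
      have h1' := hone r hr
      have hs0 := sQ_pos (k := k) hl hr
      have hD := hDens_nonneg (k := k) (g := g) hr
      rw [abs_of_nonneg (by positivity)]
      by_cases hrI : r ∈ I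
      · have hg2 : g r ^ 2 ≤ X ^ 2 := by
          rw [← sq_abs]; exact pow_le_pow_left₀ (abs_nonneg _) (hX r hrI) 2
        have : 2 * γ r * sQ k l r ^ 2 * ((k:ℝ) ^ 2 * (g r ^ 2 / r))
            ≤ 2 * 1 * sQ k l r ^ 2 * ((k:ℝ) ^ 2 * (X ^ 2 / r)) := by gcongr
        have e' : 2 * 1 * sQ k l r ^ 2 * ((k:ℝ) ^ 2 * (X ^ 2 / r))
            = 2 * (k:ℝ) ^ 2 * X ^ 2 * (sQ k l r ^ 2 / r) := by ring
        have : 0 ≤ 2 * e ^ 2 * hDens k g r := by positivity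
        linarith
      · have hs := he r hr hrI
        have : 2 * γ r * sQ k l r ^ 2 * ((k:ℝ) ^ 2 * (g r ^ 2 / r)) ≤ 2 * 1 * e ^ 2 * hDens k g r := by
          gcongr
        have : 0 ≤ 2 * (k:ℝ) ^ 2 * X ^ 2 * (sQ k l r ^ 2 / r) := by positivity
        linarith)
  rw [(hasInt_sQ_sq_div (k := k) (by omega) hl).2] at h3
  have e2 : 2 * (k:ℝ) ^ 2 * X ^ 2 * (2 / k) = 4 * k * X ^ 2 := by field_simp; ring
  rw [e2] at h3
  rw [e1]
  linarith [h1.2, (abs_le.1 h3).2]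

lemma coercive_arith {n C t b1 b2 D p e2 X : ℝ} (hn : 0 ≤ n) (hC : 1 ≤ C) (ht : 0 ≤ t)
    (hD : b1 + b2 - (k * (3 * 0 + 2 * 1 * t) + 16 * 1 * p) * n ≤ D)
    (hmain : n ≤ C * (b1 + b2) + (2 * (k * t) + 16 * e2 + X) * n) (h1 : C * (k * t) ≤ 1 / 16)
    (h2 : C * p ≤ 1 / 256) (h3 : e2 ≤ 1 / 256) (h4 : X ≤ 1 / 8) : n ≤ 4 * C * D := by
  have hkt : 0 ≤ k * t := by positivity
  have h5 : k * t ≤ 1 / 16 := by nlinarith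
  have h6 : C * (b1 + b2) ≤ C * (D + (2 * (k * t) + 16 * p) * n) :=
    mul_le_mul_of_nonneg_left (by linarith) (by linarith)
  have h7 : C * (D + (2 * (k * t) + 16 * p) * n)
      = C * D + (2 * (C * (k * t)) + 16 * (C * p)) * n := by ring
  have h8 : (2 * (C * (k * t)) + 16 * (C * p)) * n ≤ (3 / 16) * n :=
    mul_le_mul_of_nonneg_right (by linarith) hn
  have h9 : (2 * (k * t) + 16 * e2 + X) * n ≤ (5 / 16) * n :=
    mul_le_mul_of_nonneg_right (by linarith) hn
  linarith

set_option maxHeartbeats 1000000 in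
/-- Under the orthogonality conditions the linearized energy about a two-bubble with
well-separated scales is coercive: each half of the partition `cutIn`, `1 - cutIn` sees one bubble,
and there `g` is controlled by the factorized form and its orthogonality condition. -/
lemma exists_coercive (hk : 1 ≤ k) (hZc : Continuous Z) (hZs : HasCompactSupport Z)
    (hN : 0 < pair Z (LambdaQ k)) : ∃ c e₀ : ℝ, 0 < c ∧ 0 < e₀ ∧ ∀ l m : ℝ, 0 < l → 0 < m →
      √(l / m) ≤ e₀ → ∀ g, MemH g → pair (rescaleL2 l Z) g = 0 → pair (rescaleL2 m Z) g = 0 →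
      c * hSq k g ≤ qForm k (cos2P k l m) (fun _ => 1) g := by
  obtain ⟨A, B, hZ⟩ := exists_bddSupp hZc hZs
  have hA := hZ.nonneg
  have hB := hZ.pos
  have hk0 : (1:ℝ) ≤ k := by exact_mod_cast hk
  set c1 := 2 * k * A / pair Z (LambdaQ k) with hc1
  have hc10 : 0 ≤ c1 := by positivity
  -- `C` compares the localized `H`-norms with the factorized forms
  set C := 1 + 16 * k * c1 ^ 2 * B ^ 4 with hC
  have hC1 : 1 ≤ C := by rw [hC]; linarith [show 0 ≤ 16 * k * c1 ^ 2 * B ^ 4 by positivity]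
  set θ := 1 / (16 * k * C) with hθ
  have hθ0 : 0 < θ := by positivity
  have hθ1 : θ ≤ 1 := by
    rw [hθ, div_le_one (by positivity)]; nlinarith
  set ν := 1 / (256 * C * (1 + k * c1 ^ 2)) with hν
  have hν0 : 0 < ν := by positivity
  have hν1 : ν ≤ 1 := by
    rw [hν, div_le_one (by positivity)]
    nlinarith [mul_nonneg (show (0:ℝ) ≤ k by linarith) (sq_nonneg c1)]
  refine ⟨1 / (4 * C), min (ν ^ (1 / θ)) (min ν (1 / B)), by positivity, by positivity,
    fun l m hl hm hlm g hg ho1 ho2 => ?_⟩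
  set e := √(l / m) with he
  have he0 : 0 < e := Real.sqrt_pos.2 (by positivity)
  have he1 : e ≤ ν := hlm.trans ((min_le_right _ _).trans (min_le_left _ _))
  have heB : e ≤ 1 / B := hlm.trans ((min_le_right _ _).trans (min_le_right _ _))
  have heθ : e ^ θ ≤ ν := by
    calc e ^ θ ≤ (ν ^ (1 / θ)) ^ θ :=
          Real.rpow_le_rpow he0.le (hlm.trans (min_le_left _ _)) hθ0.le
      _ = ν := by rw [← Real.rpow_mul hν0.le, one_div_mul_cancel hθ0.ne', Real.rpow_one]
  obtain ⟨hsm, hls⟩ := sqrt_mul_div hl hm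
  set s := √(l * m) with hs
  have hs0 : 0 < s := Real.sqrt_pos.2 (by positivity)
  have hw := isWeight_cutIn (θ := θ) hs0 hθ0.le
  have hsplit := qForm_ge_bogForm_add hg hk hl hm hθ0.le hθ1 (γ := fun _ => 1) (γ' := fun _ => 0)
    (M := 1) (ε := 0) ⟨fun r _ => hasDerivAt_const r 1, continuousOn_const, by simp, by simp⟩
  simp only [one_mul] at hsplit
  rw [← he, ← hs] at hsplit
  set γ1 := fun r => cutIn θ s r with hγ1
  set γ2 := fun r => 1 - cutIn θ s r with hγ2
  have p1 : ∀ r, 0 < r → 0 ≤ γ1 r := fun r hr => (cutIn_pos hs0 hr).le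
  have p2 : ∀ r, 0 < r → 0 ≤ γ2 r := fun r hr => sub_nonneg.2 (cutIn_le_one hs0 hr)
  have q1 : ∀ r, 0 < r → γ1 r ≤ 1 := fun r hr => cutIn_le_one hs0 hr
  have q2 : ∀ r, 0 < r → γ2 r ≤ 1 := fun r hr => by
    simp only [hγ2]; linarith [cutIn_pos (θ := θ) hs0 hr]
  have half1 : ∀ r ∈ Ioc 0 s, 1 / 2 ≤ γ1 r := fun r hr => by
    have : (r / s) ^ θ ≤ 1 := Real.rpow_le_one (div_nonneg hr.1.le hs0.le)
      ((div_le_one hs0).2 hr.2) hθ0.le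
    have h0 : 0 ≤ (r / s) ^ θ := Real.rpow_nonneg (div_nonneg hr.1.le hs0.le) _
    simp only [hγ1, cutIn]
    rw [div_le_div_iff₀ (by norm_num) (by linarith)]; linarith
  have half2 : ∀ r ∈ Ici s, 1 / 2 ≤ γ2 r := fun r hr => by
    have : 1 ≤ (r / s) ^ θ := Real.one_le_rpow ((one_le_div hs0).2 hr) hθ0.le
    have : cutIn θ s r ≤ 1 / 2 := by
      simp only [cutIn]
      rw [div_le_div_iff₀ (by linarith) (by norm_num)]; linarith
    simp only [hγ2]; linarith
  set b1 := bogForm k l γ1 g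
  set b2 := bogForm k m γ2 g
  have hb1 : 0 ≤ b1 := bogForm_nonneg p1
  have hb2 : 0 ≤ b2 := bogForm_nonneg p2
  set n := hSq k g
  have hn : 0 ≤ n := hSq_nonneg k g
  have X1 : ∀ r ∈ Ioc 0 s, |g r| ≤ c1 * (B ^ 2 * √(2 * b1) + (0 / l) ^ 2 * √n) := fun r hr =>
    abs_le_of_orthogonal hg hk hl hw p1 hZ hN ho1 ordConnected_Ioc (fun x hx => hx.1) half1 le_rfl
      (fun x hx hxB hxI => by
        exfalso; refine hxI ⟨hx, hxB.trans ?_⟩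
        have : B * (l / s) ≤ 1 := by
          rw [hls]; calc B * e ≤ B * (1 / B) := by gcongr
            _ = 1 := by field_simp
        rw [← mul_div_assoc, div_le_one hs0] at this
        exact this) hr
  have X2 : ∀ r ∈ Ici s, |g r| ≤ c1 * (B ^ 2 * √(2 * b2) + (s / m) ^ 2 * √n) := fun r hr =>
    abs_le_of_orthogonal hg hk hm hw.one_sub p2 hZ hN ho2 ordConnected_Ici
      (fun x hx => hs0.trans_le hx) half2 hs0.le (fun x _ _ hxI => (not_le.1 hxI).le) hr
  have out : ∀ x : ℝ, 0 < x → x ≤ e → x ^ k ≤ e := fun x hx hxe => by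
    have : x ≤ 1 := hxe.trans (he1.trans hν1)
    exact (pow_le_of_le_one hx.le this (by omega)).trans hxe
  have w1 := weighted_hDens_le hg hk hl hw p1 q1 X1 (e := 2 * e) (fun r hr hrI => by
    have hsr : s < r := by by_contra hh; exact hrI ⟨hr, not_lt.1 hh⟩
    refine (sQ_le_two_mul_pow_inv hl hr).trans ?_
    have := out (l / r) (by positivity) (by rw [he, ← hls]; gcongr)
    linarith)
  have w2 := weighted_hDens_le hg hk hm hw.one_sub p2 q2 X2 (e := 2 * e) (fun r hr hrI => by
    have hsr : r < s := not_le.1 hrI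
    refine (sQ_le_two_mul_pow hm hr).trans ?_
    have := out (r / m) (by positivity) (by rw [he, ← hsm]; gcongr)
    linarith)
  have hsum : n = (∫ r in Ioi (0:ℝ), γ1 r * hDens k g r) + ∫ r in Ioi (0:ℝ), γ2 r * hDens k g r := by
    have hD := hg.integrable_hDens k
    have hi : ∀ {γ γ' M ε}, IsWeight γ γ' M ε →
        IntegrableOn (fun r => γ r * hDens k g r) (Ioi 0) := fun {γ γ' M ε} h =>
      hg.integrableOn_of_le (A := M) k (h.aemeasurable.mul hD.aemeasurable) fun r hr =>
        abs_mul_le (h.abs_le r hr) (abs_of_nonneg (hDens_nonneg hr)).le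
    rw [← integral_add (hi hw) (hi hw.one_sub)]
    refine integral_congr_ae (ae_of_all _ fun r => ?_)
    change hDens k g r = cutIn θ s r * hDens k g r + (1 - cutIn θ s r) * hDens k g r
    ring
  have sq1 : (c1 * (B ^ 2 * √(2 * b1) + (0 / l) ^ 2 * √n)) ^ 2 = 2 * c1 ^ 2 * B ^ 4 * b1 := by
    rw [zero_div]
    have := Real.sq_sqrt (show 0 ≤ 2 * b1 by positivity)
    calc _ = c1 ^ 2 * B ^ 4 * √(2 * b1) ^ 2 := by ring
      _ = _ := by rw [this]; ring
  have sq2 : (c1 * (B ^ 2 * √(2 * b2) + (s / m) ^ 2 * √n)) ^ 2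
      ≤ 4 * c1 ^ 2 * B ^ 4 * b2 + 2 * c1 ^ 2 * e ^ 4 * n := by
    have h1 := Real.sq_sqrt (show 0 ≤ 2 * b2 by positivity)
    have h2 := Real.sq_sqrt hn
    rw [hsm, mul_pow]
    have : (B ^ 2 * √(2 * b2) + e ^ 2 * √n) ^ 2
        ≤ 2 * (B ^ 2 * √(2 * b2)) ^ 2 + 2 * (e ^ 2 * √n) ^ 2 := by
      nlinarith [sq_nonneg (B ^ 2 * √(2 * b2) - e ^ 2 * √n)]
    rw [mul_pow, mul_pow, h1, h2] at this
    nlinarith [mul_le_mul_of_nonneg_left this (sq_nonneg c1)]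
  rw [sq1] at w1
  have hmain : n ≤ C * (b1 + b2) + (2 * (k * θ) + 16 * e ^ 2 + 8 * k * c1 ^ 2 * e ^ 4) * n := by
    have h4k : 4 * k * (c1 * (B ^ 2 * √(2 * b2) + (s / m) ^ 2 * √n)) ^ 2
        ≤ 4 * k * (4 * c1 ^ 2 * B ^ 4 * b2 + 2 * c1 ^ 2 * e ^ 4 * n) :=
      mul_le_mul_of_nonneg_left sq2 (by positivity)
    have hx : 0 ≤ k * c1 ^ 2 * B ^ 4 * b1 := by positivity
    have e' : C * (b1 + b2) = b1 + b2 + 16 * k * c1 ^ 2 * B ^ 4 * b1 + 16 * k * c1 ^ 2 * B ^ 4 * b2 := by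
      rw [hC]; ring
    have w1' : ∫ r in Ioi (0:ℝ), γ1 r * hDens k g r
      ≤ b1 + 4 * k * (2 * c1 ^ 2 * B ^ 4 * b1) + (k * θ + 2 * (2 * e) ^ 2) * n := w1
    have w2' : ∫ r in Ioi (0:ℝ), γ2 r * hDens k g r
      ≤ b2 + 4 * k * (c1 * (B ^ 2 * √(2 * b2) + (s / m) ^ 2 * √n)) ^ 2
        + (k * θ + 2 * (2 * e) ^ 2) * n := w2
    rw [e']
    linarith only [w1', w2', h4k, hx, hsum]
  have kθ : C * (k * θ) = 1 / 16 := by rw [hθ]; field_simp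
  have hkc : 0 ≤ k * c1 ^ 2 := by positivity
  have Cν : C * ν ≤ 1 / 256 := by
    rw [hν, mul_one_div, div_le_div_iff₀ (by positivity) (by norm_num)]
    nlinarith
  have h5 : k * c1 ^ 2 * ν ≤ 1 / 256 := by
    rw [hν, mul_one_div, div_le_div_iff₀ (by positivity) (by norm_num)]
    nlinarith
  have hfin := coercive_arith hn hC1 (by positivity) hsplit hmain kθ.le
    ((mul_le_mul_of_nonneg_left heθ (by positivity)).trans Cν)
    (show e ^ 2 ≤ 1 / 256 by nlinarith) (show 8 * k * c1 ^ 2 * e ^ 4 ≤ 1 / 8 by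
      have h4 : e ^ 4 ≤ ν := (pow_le_of_le_one he0.le (he1.trans hν1) (by norm_num)).trans he1
      have h6 : k * c1 ^ 2 * e ^ 4 ≤ k * c1 ^ 2 * ν := by gcongr
      linarith)
  rw [div_mul_eq_mul_div, one_mul, div_le_iff₀ (by positivity)]
  linarith

end

/-! ### The energy of a perturbed two-bubble -/

section EnergyExpansion
variable {k : ℕ} {l m r : ℝ} {f g : ℝ → ℝ} {a b : ℝ}

/-- The interaction term `k² (sin 2P - sin 2a + sin 2b) / 2` of the two bubbles `a = Q_l`,
`b = Q_m`, `P = a - b`. -/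
noncomputable def inter (k : ℕ) (l m r : ℝ) : ℝ :=
  2 * (k:ℝ) ^ 2 * (sQ k l r * sQ k m r) * (sQ k l r * cQ k m r - cQ k l r * sQ k m r)

lemma sin_twoBubble (k : ℕ) (l m r : ℝ) :
    Real.sin (twoBubble k l m r) = sQ k l r * cQ k m r - cQ k l r * sQ k m r := Real.sin_sub _ _

lemma cos_twoBubble (k : ℕ) (l m r : ℝ) :
    Real.cos (twoBubble k l m r) = cQ k l r * cQ k m r + sQ k l r * sQ k m r := Real.cos_sub _ _

lemma inter_eq (k : ℕ) (l m r : ℝ) :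
    (k:ℝ) ^ 2 * Real.sin (2 * twoBubble k l m r) / 2
      = k ^ 2 * (sQ k l r * cQ k l r) - k ^ 2 * (sQ k m r * cQ k m r) + inter k l m r := by
  rw [Real.sin_two_mul, sin_twoBubble, cos_twoBubble, inter]
  have h1 := sQ_sq_add_cQ_sq k l r
  have h2 := sQ_sq_add_cQ_sq k m r
  linear_combination (k:ℝ) ^ 2 * (sQ k l r * cQ k l r) * h2 - (k:ℝ) ^ 2 * (sQ k m r * cQ k m r) * h1

@[fun_prop]
lemma measurable_inter (k : ℕ) (l m : ℝ) : Measurable (inter k l m) := by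
  unfold inter; fun_prop

lemma abs_inter_le_mul (hl : 0 < l) (hm : 0 < m) (hr : 0 < r) :
    |inter k l m r| ≤ 2 * (k:ℝ) ^ 2 * (sQ k l r * sQ k m r) * (sQ k l r + sQ k m r) := by
  have ha := sQ_pos (k := k) hl hr
  have hb := sQ_pos (k := k) hm hr
  rw [inter, abs_mul, abs_of_nonneg (by positivity : 0 ≤ 2 * (k:ℝ) ^ 2 * (sQ k l r * sQ k m r))]
  refine mul_le_mul_of_nonneg_left ?_ (by positivity)
  have h1 := abs_le.1 (abs_cQ_le k l r)
  have h2 := abs_le.1 (abs_cQ_le k m r)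
  rw [abs_le]; constructor <;> nlinarith

lemma abs_inter_le (hl : 0 < l) (hm : 0 < m) (hr : 0 < r) :
    |inter k l m r| ≤ 8 * (k:ℝ) ^ 2 * (l / m) ^ k * (sQ k l r + sQ k m r) := by
  refine (abs_inter_le_mul hl hm hr).trans ?_
  have h1 := sQ_mul_sQ_le (k := k) hl hm hr
  have ha := sQ_pos (k := k) hl hr
  have hb := sQ_pos (k := k) hm hr
  have h3 := mul_le_mul_of_nonneg_left h1 (by positivity : 0 ≤ 2 * (k:ℝ) ^ 2 * (sQ k l r + sQ k m r))
  linarith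

/-- `sin a sin b (1 + cos (a - b))`, the density of the interaction energy. -/
noncomputable def interEnergy (k : ℕ) (l m r : ℝ) : ℝ :=
  sQ k l r * sQ k m r * (1 + (cQ k l r * cQ k m r + sQ k l r * sQ k m r))

/-- In terms of `α = (r / l) ^ k` and `β = (r / m) ^ k` the quotient of the two sides without the
factor `(l / m) ^ k` is `αβ / (α + β)²`. -/
lemma interEnergy_le (hl : 0 < l) (hm : 0 < m) (hr : 0 < r) :
    interEnergy k l m r ≤ 2 * (l / m) ^ k * (sQ k l r + sQ k m r) ^ 2 := by
  have hα : 0 < (r / l) ^ k := by positivity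
  have hs : 0 < (l / m) ^ k := by positivity
  rw [interEnergy, sQ_eq, sQ_eq, cQ_eq, cQ_eq, pow_div_eq hl hm k r]
  generalize (r / l) ^ k = α at *
  generalize (l / m) ^ k = s at *
  have e1 : 2 * α / (1 + α ^ 2) * (2 * (s * α) / (1 + (s * α) ^ 2)) *
      (1 + ((1 - α ^ 2) / (1 + α ^ 2) * ((1 - (s * α) ^ 2) / (1 + (s * α) ^ 2)) +
      2 * α / (1 + α ^ 2) * (2 * (s * α) / (1 + (s * α) ^ 2))))
      = 8 * s * α ^ 2 * (1 + s * α ^ 2) ^ 2 / ((1 + α ^ 2) * (1 + (s * α) ^ 2)) ^ 2 := by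
    field_simp; ring
  have e2 : 2 * s * (2 * α / (1 + α ^ 2) + 2 * (s * α) / (1 + (s * α) ^ 2)) ^ 2
      = 8 * s * α ^ 2 * (1 + s * α ^ 2) ^ 2 * (1 + s) ^ 2
        / ((1 + α ^ 2) * (1 + (s * α) ^ 2)) ^ 2 := by
    field_simp; ring
  rw [e1, e2]
  refine div_le_div_of_nonneg_right ?_ (by positivity)
  exact le_mul_of_one_le_right (by positivity) (by nlinarith)

@[fun_prop]
lemma measurable_interEnergy (k : ℕ) (l m : ℝ) : Measurable (interEnergy k l m) := by
  unfold interEnergy; fun_prop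

lemma interEnergy_nonneg (hl : 0 < l) (hm : 0 < m) (hr : 0 < r) : 0 ≤ interEnergy k l m r := by
  have ha := sQ_pos (k := k) hl hr
  have hb := sQ_pos (k := k) hm hr
  have := Real.neg_one_le_cos (twoBubble k l m r)
  rw [cos_twoBubble] at this
  exact mul_nonneg (by positivity) (by linarith)

lemma hasInt_sQ_add (hk : k ≠ 0) (hl : 0 < l) (hm : 0 < m) :
    HasInt (fun r => (sQ k l r + sQ k m r) / r) (2 * Real.pi / k) := by
  have := (HasInt.congr ((hasInt_sQ_div hk hl).add
    (hasInt_sQ_div hk hm)) (ae_of_all _ fun r _ => add_div _ _ _))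
  convert this using 1; ring

lemma integral_interEnergy_le (hk : k ≠ 0) (hl : 0 < l) (hm : 0 < m) :
    IntegrableOn (fun r => interEnergy k l m r / r) (Ioi 0) ∧
    2 * (k:ℝ) ^ 2 * ∫ r in Ioi (0:ℝ), interEnergy k l m r / r
      ≤ 16 * k * (l / m) ^ k + 16 * Real.pi * k * ((l / m) ^ k * √((l / m) ^ k)) := by
  have hs : 0 ≤ (l / m) ^ k := by positivity
  have H : HasInt (fun r => 2 * (l / m) ^ k * (sQ k l r ^ 2 / r + sQ k m r ^ 2 / r
      + 2 * √((l / m) ^ k) * ((sQ k l r + sQ k m r) / r)))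
      (2 * (l / m) ^ k * (2 / k + 2 / k + 2 * √((l / m) ^ k) * (2 * Real.pi / k))) :=
    (((hasInt_sQ_sq_div hk hl).add
      (hasInt_sQ_sq_div hk hm)).add
      ((hasInt_sQ_add hk hl hm).const_mul _)).const_mul _
  have hle : ∀ r : ℝ, 0 < r → interEnergy k l m r / r ≤ 2 * (l / m) ^ k * (sQ k l r ^ 2 / r
      + sQ k m r ^ 2 / r + 2 * √((l / m) ^ k) * ((sQ k l r + sQ k m r) / r)) := by
    intro r hr
    have h1 := interEnergy_le (k := k) hl hm hr
    have h2 := sQ_mul_sQ_le_sqrt (k := k) hl hm hr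
    have h3 : (sQ k l r + sQ k m r) ^ 2 ≤ sQ k l r ^ 2 + sQ k m r ^ 2
      + 2 * √((l / m) ^ k) * (sQ k l r + sQ k m r) := by nlinarith
    have h4 := h1.trans (mul_le_mul_of_nonneg_left h3 (by positivity))
    refine (div_le_div_of_nonneg_right h4 hr.le).trans (le_of_eq ?_)
    ring
  have hi : IntegrableOn (fun r => interEnergy k l m r / r) (Ioi 0) :=
    integrableOn_of_abs_le H.1 (by fun_prop) fun r hr => by
      rw [abs_of_nonneg (div_nonneg (interEnergy_nonneg hl hm hr) hr.le)]; exact hle r hr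
  refine ⟨hi, ?_⟩
  have h := setIntegral_mono_on hi H.1 measurableSet_Ioi fun r hr => hle r hr
  rw [H.2] at h
  have hk' : (0:ℝ) < k := by positivity
  have := mul_le_mul_of_nonneg_left h (by positivity : 0 ≤ 2 * (k:ℝ) ^ 2)
  refine this.trans (le_of_eq ?_)
  field_simp
  ring

lemma abs_sin_sub_le {x : ℝ} (hx : |x| ≤ 1) : |Real.sin x - x| ≤ |x| ^ 3 / 4 := by
  have h := Real.sin_bound hx
  have h0 := abs_nonneg x
  have h1 : |x| ^ 5 ≤ |x| ^ 3 := pow_le_pow_of_le_one h0 hx (by norm_num)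
  rw [show Real.sin x - x = (Real.sin x - (x - x ^ 3 / 6)) - x ^ 3 / 6 by ring]
  refine (abs_sub _ _).trans ?_
  rw [abs_div, abs_pow, abs_of_pos (by norm_num : (0:ℝ) < 6)]
  linarith [pow_nonneg h0 3]

lemma abs_cos_sub_le {x : ℝ} (hx : |x| ≤ 1) : |Real.cos x - (1 - x ^ 2 / 2)| ≤ |x| ^ 3 / 16 := by
  have h := Real.cos_bound hx
  have h0 := abs_nonneg x
  have h1 : |x| ^ 4 ≤ |x| ^ 3 := pow_le_pow_of_le_one h0 hx (by norm_num)
  linarith [pow_nonneg h0 3]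

lemma sin_add_sq_sub (P x : ℝ) : Real.sin (P + x) ^ 2 - Real.sin P ^ 2
    = (Real.sin (2 * P) * Real.sin (2 * x) + Real.cos (2 * P) * (1 - Real.cos (2 * x))) / 2 := by
  rw [Real.sin_sq_eq_half_sub, Real.sin_sq_eq_half_sub, mul_add, Real.cos_add]; ring

/-- Taylor expansion of `sin²` to second order. -/
lemma abs_sin_sq_taylor (P : ℝ) {x : ℝ} (hx : |x| ≤ 1 / 2) :
    |Real.sin (P + x) ^ 2 - Real.sin P ^ 2 - Real.sin (2 * P) * x - Real.cos (2 * P) * x ^ 2|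
      ≤ 2 * |x| ^ 3 := by
  have h2 : |2 * x| ≤ 1 := by rw [abs_mul, abs_two]; linarith
  have hs := abs_sin_sub_le h2
  have hc := abs_cos_sub_le h2
  rw [abs_mul, abs_two] at hs hc
  rw [sin_add_sq_sub, show (Real.sin (2 * P) * Real.sin (2 * x)
      + Real.cos (2 * P) * (1 - Real.cos (2 * x))) / 2 - Real.sin (2 * P) * x - Real.cos (2 * P) * x ^ 2
      = 1 / 2 * (Real.sin (2 * P) * (Real.sin (2 * x) - 2 * x))
        - 1 / 2 * (Real.cos (2 * P) * (Real.cos (2 * x) - (1 - (2 * x) ^ 2 / 2))) by ring]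
  refine (abs_sub _ _).trans ?_
  have a1 := abs_mul_le (Real.abs_sin_le_one (2 * P)) hs
  have a2 := abs_mul_le (Real.abs_cos_le_one (2 * P)) hc
  rw [abs_mul (1 / 2), abs_mul (1 / 2), abs_of_pos (by norm_num : (0:ℝ) < 1 / 2)]
  nlinarith [pow_nonneg (abs_nonneg x) 3]

lemma energy_Q (hk : k ≠ 0) : energy k (Q k) (fun _ => 0) = Real.pi * (4 * k) := by
  have h := (hasInt_sQ_sq_div hk one_pos).const_mul (2 * (k:ℝ) ^ 2)
  have h' : HasInt (fun r => ((0:ℝ) ^ 2 + deriv (Q k) r ^ 2 + (k:ℝ) ^ 2 * Real.sin (Q k r) ^ 2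
      / r ^ 2) * r) _ := h.congr (ae_of_all _ fun r hr => by
    have hd := (hasDerivAt_Q (k := k) one_pos hr).deriv
    have e : sQ k 1 r = Real.sin (Q k r) := by simp [sQ]
    simp only [div_one] at hd
    rw [hd, e]
    field_simp; ring)
  have hk' : (k:ℝ) ≠ 0 := by exact_mod_cast hk
  rw [energy, h'.2]
  field_simp; ring

/-- Expansion of the energy around a pair of bubbles: the linear term is the interaction `inter`, and
the constant term falls short of `2 𝓔(Q)` by the interaction energy. -/
theorem energy_expansion {φ v : ℝ → ℝ} (hk : 1 ≤ k) (hl : 0 < l) (hm : 0 < m) (h0 : MemH0 φ v)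
    (hE : energy k φ v = 2 * energy k (Q k) (fun _ => 0))
    (hs : hSq k (remainder k l m φ) ≤ 1 / 4) :
    |l2Sq v + qForm k (cos2P k l m) (fun _ => 1) (remainder k l m φ)
      + 2 * (∫ r in Ioi (0:ℝ), inter k l m r * remainder k l m φ r / r)
      - 2 * (k:ℝ) ^ 2 * ∫ r in Ioi (0:ℝ), interEnergy k l m r / r|
      ≤ 2 * √(hSq k (remainder k l m φ)) * hSq k (remainder k l m φ) ∧
    |∫ r in Ioi (0:ℝ), inter k l m r * remainder k l m φ r / r|
      ≤ 16 * Real.pi * k * (l / m) ^ k * √(hSq k (remainder k l m φ)) := by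
  have hk0 : k ≠ 0 := by omega
  have hk' : (0:ℝ) < k := by positivity
  have hg : MemH (remainder k l m φ) := h0.memH.sub (memH_twoBubble hk0 hl hm)
  have hφ : ∀ r, φ r = twoBubble k l m r + remainder k l m φ r := fun r => by
    rw [remainder_eq]; ring
  set g := remainder k l m φ with hgdef
  have hgm := hg.aemeasurable
  have hgs : ∀ r, 0 < r → |g r| ≤ √(hSq k g) := fun r hr => hg.abs_le_sqrt hk hr
  have hIle : ∀ r, 0 < r → |inter k l m r * g r / r|
      ≤ (8 * (k:ℝ) ^ 2 * (l / m) ^ k * √(hSq k g)) * ((sQ k l r + sQ k m r) / r) :=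
    fun r hr => (abs_div_le hr (abs_mul_le (abs_inter_le hl hm hr) (hgs r hr))).trans_eq (by ring)
  have hW := hasInt_sQ_add (k := k) hk0 hl hm
  have hI : HasInt (fun r => inter k l m r * g r / r) _ := HasInt.of_integrable <|
    hg.integrableOn_of_le_add (A := 0) k hW.1
      (by fun_prop)
      (fun r hr => by simpa using hIle r hr)
  have hIb : |∫ r in Ioi (0:ℝ), inter k l m r * g r / r|
      ≤ 16 * Real.pi * k * (l / m) ^ k * √(hSq k g) := by
    refine (hg.abs_integral_le_add (A := 0) k hW.1 (fun r hr => by simpa using hIle r hr)).trans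
      (le_of_eq ?_)
    rw [hW.2]; field_simp; ring
  refine ⟨?_, hIb⟩
  have hv : HasInt (fun r => v r ^ 2 * r) (l2Sq v) := HasInt.of_integrable h0.memL2.integrable
  have hD : HasInt (fun r => (fun _ => (1:ℝ)) r * (deriv g r ^ 2
      + (k:ℝ) ^ 2 * cos2P k l m r * g r ^ 2 / r ^ 2) * r) (qForm k (cos2P k l m) (fun _ => 1) g) :=
    HasInt.of_integrable <| qForm_integrable (M := 1) hg aemeasurable_const (by simp)
      (measurable_cos2P k l m).aemeasurable (fun r _ => abs_cos2P_le k l m r)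
  have hT := HasInt.of_integrable (integral_interEnergy_le (k := k) hk0 hl hm).1
  have hS := ((hasInt_sQ_sq_div hk0 hl).add
    (hasInt_sQ_sq_div hk0 hm)).const_mul (2 * (k:ℝ) ^ 2)
  -- the cubic Taylor remainder of `sin²`
  let ρ : ℝ → ℝ := fun r => (k:ℝ) ^ 2 * (Real.sin (twoBubble k l m r + g r) ^ 2
    - Real.sin (twoBubble k l m r) ^ 2
    - Real.sin (2 * twoBubble k l m r) * g r - Real.cos (2 * twoBubble k l m r) * g r ^ 2) / r
  have hρle : ∀ r, 0 < r → |ρ r| ≤ (2 * √(hSq k g)) * hDens k g r := by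
    intro r hr
    have h1 := abs_sin_sq_taylor (twoBubble k l m r) (hg.abs_le_half hk hs hr)
    have h3 : 2 * |g r| ^ 3 ≤ 2 * √(hSq k g) * g r ^ 2 := by
      rw [← sq_abs (g r)]
      nlinarith [mul_le_mul_of_nonneg_right (hgs r hr) (sq_nonneg |g r|)]
    simp only [ρ]
    refine (abs_div_le hr (abs_mul_le (abs_of_nonneg (sq_nonneg (k:ℝ))).le (h1.trans h3))).trans ?_
    rw [show (k:ℝ) ^ 2 * (2 * √(hSq k g) * g r ^ 2) / r
      = 2 * √(hSq k g) * ((k:ℝ) ^ 2 * (g r ^ 2 / r)) by ring]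
    exact mul_le_mul_of_nonneg_left (sq_mul_le_hDens hr) (by positivity)
  have hPm : Measurable (twoBubble k l m) := measurable_twoBubble k l m
  have hρ : HasInt ρ _ := HasInt.of_integrable <| hg.integrableOn_of_le k (by fun_prop) hρle
  have hρb := hg.abs_integral_le k hρle
  -- the cross term, an exact derivative up to the interaction term
  let G' : ℝ → ℝ := fun r => (k * (cQ k l r * (k * sQ k l r / r) - cQ k m r * (k * sQ k m r / r)))
    * g r + k * (sQ k l r - sQ k m r) * deriv g r
  have hG : HasInt G' 0 := by
    refine hg.hasInt_deriv_mul (w := fun r => k * (sQ k l r - sQ k m r))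
      (fun r hr => ((hasDerivAt_sQ hl hr).sub (hasDerivAt_sQ hm hr)).const_mul (k:ℝ))
      (((continuousOn_deriv_sQ k l).sub (continuousOn_deriv_sQ k m)).const_mul _)
      (((memL2_sQ_mul_cQ_div hk0 hl).sub (memL2_sQ_mul_cQ_div hk0 hm)).const_mul _) ?_
    simpa only [mul_div_assoc, sub_div] using
      ((memL2_sQ_div hk0 hl).sub (memL2_sQ_div hk0 hm)).const_mul (k:ℝ)
  have H := (((((hv.add hD).add (hI.const_mul 2)).add hρ).add (hG.const_mul 2)).add hS).sub
    (hT.const_mul (2 * (k:ℝ) ^ 2))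
  have H' : HasInt (fun r => (v r ^ 2 + deriv φ r ^ 2 + (k:ℝ) ^ 2 * Real.sin (φ r) ^ 2 / r ^ 2) * r)
      _ := H.congr (by
    filter_upwards [hg.ae_hasDerivAt] with r h hr
    have hd : deriv φ r = k * (sQ k l r - sQ k m r) / r + deriv g r := by
      have : φ = fun r => twoBubble k l m r + g r := funext hφ
      rw [this]
      exact ((hasDerivAt_twoBubble hl hm hr).add (h hr)).deriv
    have hi := inter_eq k l m r
    have hsin := sin_twoBubble k l m r
    have ha := sQ_sq_add_cQ_sq k l r
    have hb := sQ_sq_add_cQ_sq k m r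
    rw [hd, hφ r]
    simp only [ρ, G', cos2P, interEnergy]
    have hin : inter k l m r = (k:ℝ) ^ 2 * Real.sin (2 * twoBubble k l m r) / 2
      - k ^ 2 * (sQ k l r * cQ k l r) + k ^ 2 * (sQ k m r * cQ k m r) := by linarith
    rw [hin, hsin]
    field_simp
    ring_nf
    linear_combination ((k:ℝ) ^ 2 * sQ k m r ^ 2) * ha + ((k:ℝ) ^ 2 * sQ k l r ^ 2) * hb)
  rw [energy_Q hk0, energy, H'.2] at hE
  have hE' := mul_left_cancel₀ (by positivity)
    (hE.trans (by ring : 2 * (Real.pi * (4 * k)) = 2 * Real.pi * (1 / 2) * (8 * k)))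
  have hk8 : 2 * (k:ℝ) ^ 2 * (2 / k + 2 / k) = 8 * k := by field_simp; ring
  refine le_trans (le_of_eq ?_) hρb
  rw [← abs_neg]
  congr 1
  linarith

lemma energy_arith {κ h V D X T s c p : ℝ} (hc : 0 < c) (hκ : 0 < κ) (hp : 0 < p) (hh : 0 ≤ h)
    (hs : 0 ≤ s) (hV : 0 ≤ V) (hs1 : s ≤ 1)
    (h1 : |V + D + 2 * X - T| ≤ 2 * √h * h) (h2 : |X| ≤ 16 * p * κ * s * √h)
    (h3 : T ≤ 16 * κ * s + 16 * p * κ * (s * √s)) (h4 : c * h ≤ D) (h5 : √h ≤ c / 4)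
    (h6 : √h ≤ 1) :
    h ≤ 100 * κ * (1 + p) / c * s ∧
      V + D ≤ (16 * κ + 16 * p * κ * √s + (32 * p * κ + 200 * κ * (1 + p) / c) * √h) * s := by
  have a1 := (abs_le.1 h1).2
  have a2 := (abs_le.1 h2).1
  have hq := Real.sqrt_nonneg h
  have hqs := Real.sqrt_nonneg s
  have hs1' : √s ≤ 1 := Real.sqrt_le_one.2 hs1
  have b1 : V + D ≤ 16 * κ * s + 16 * p * κ * (s * √s) + 32 * p * κ * s * √h + 2 * √h * h := by
    linarith
  have b2 : 16 * p * κ * (s * √s) ≤ 16 * p * κ * s := by gcongr; nlinarith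
  have b3 : 32 * p * κ * s * √h ≤ 32 * p * κ * s := mul_le_of_le_one_right (by positivity) h6
  have b4 : 2 * √h * h ≤ c / 2 * h := by nlinarith
  have b5 : c / 2 * h ≤ 50 * κ * (1 + p) * s := by nlinarith
  have b6 : h ≤ 100 * κ * (1 + p) / c * s := by
    rw [div_mul_eq_mul_div, le_div_iff₀ hc]; linarith
  refine ⟨b6, b1.trans ?_⟩
  have b7 : 2 * √h * h ≤ 2 * √h * (100 * κ * (1 + p) / c * s) := by gcongr
  have e : (16 * κ + 16 * p * κ * √s + (32 * p * κ + 200 * κ * (1 + p) / c) * √h) * s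
    = 16 * κ * s + 16 * p * κ * (s * √s) + 32 * p * κ * s * √h
      + 2 * √h * (100 * κ * (1 + p) / c * s) := by ring
  rw [e]; linarith

lemma sqrt_div_le_rpow (hk : 1 ≤ k) (hl : 0 < l) (hm : 0 < m) :
    √(l / m) ≤ ((l / m) ^ k) ^ (1 / (2 * k : ℝ)) := by
  have h : 0 ≤ l / m := by positivity
  have hk' : (0:ℝ) < k := by positivity
  rw [← Real.rpow_natCast, ← Real.rpow_mul h, Real.sqrt_eq_rpow]
  refine le_of_eq ?_
  congr 1; field_simp

/-- At the energy of two bubbles, the energy expansion and the coercivity of the quadratic form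
control the remainder by the scale separation; the size of `ψ_t` is controlled with the sharp
constant. -/
theorem exists_energy_control {Z : ℝ → ℝ} (hk : 1 ≤ k) (hZc : Continuous Z)
    (hZs : HasCompactSupport Z) (hN : 0 < pair Z (LambdaQ k)) :
    ∃ C : ℝ, 0 < C ∧ ∀ ν : ℝ, 0 < ν → ∃ η : ℝ, 0 < η ∧ ∀ (l m : ℝ) (φ v : ℝ → ℝ), 0 < l → 0 < m →
      MemH0 φ v → energy k φ v = 2 * energy k (Q k) (fun _ => 0) →
      pair (rescaleL2 l Z) (remainder k l m φ) = 0 →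
      pair (rescaleL2 m Z) (remainder k l m φ) = 0 →
      hSq k (remainder k l m φ) ≤ η → (l / m) ^ k ≤ η →
      hSq k (remainder k l m φ) ≤ C * (l / m) ^ k ∧
      0 ≤ qForm k (cos2P k l m) (fun _ => 1) (remainder k l m φ) ∧
      l2Sq v + qForm k (cos2P k l m) (fun _ => 1) (remainder k l m φ)
        ≤ (16 * k + ν) * (l / m) ^ k := by
  obtain ⟨c, e₀, hc, he₀, hco⟩ := exists_coercive hk hZc hZs hN
  have hk0 : k ≠ 0 := by omega
  have hk' : (0:ℝ) < k := by positivity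
  have hp := Real.pi_pos
  refine ⟨100 * k * (1 + Real.pi) / c, by positivity, fun ν hν => ?_⟩
  have ht : Tendsto (fun x : ℝ => x ^ (1 / (2 * k : ℝ))) (𝓝[>] 0) (𝓝 0) := by
    have := (Real.continuousAt_rpow_const 0 (1 / (2 * k : ℝ)) (Or.inr (by positivity))).tendsto
    rw [Real.zero_rpow (by positivity)] at this
    exact this.mono_left nhdsWithin_le_nhds
  have ht2 : Tendsto (fun x : ℝ => 16 * Real.pi * k * √x
      + (32 * Real.pi * k + 200 * k * (1 + Real.pi) / c) * √x) (𝓝[>] 0) (𝓝 0) := by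
    have h : Continuous (fun x : ℝ => 16 * Real.pi * k * √x
      + (32 * Real.pi * k + 200 * k * (1 + Real.pi) / c) * √x) := by fun_prop
    simpa using (h.tendsto 0).mono_left nhdsWithin_le_nhds
  have ht3 : Tendsto (fun x : ℝ => √x) (𝓝[>] 0) (𝓝 0) := by
    simpa using (Real.continuous_sqrt.tendsto 0).mono_left nhdsWithin_le_nhds
  have hlt : ∀ x : ℝ, 0 < x → ∀ᶠ y in 𝓝[>] (0:ℝ), y < x := fun x hx =>
    nhdsWithin_le_nhds (eventually_lt_nhds hx)
  obtain ⟨η, hη1, hη2, hη3, hη4, hη5, hη6⟩ := ((ht.eventually_lt_const he₀).and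
    ((ht2.eventually_lt_const hν).and ((ht3.eventually_lt_const (by positivity : 0 < c / 4)).and
    ((ht3.eventually_lt_const one_pos).and ((hlt (1 / 4) (by norm_num)).and
      self_mem_nhdsWithin))))).exists
  have hη6 : 0 < η := hη6
  refine ⟨η, hη6, fun l m φ v hl hm h0 hE ho1 ho2 hg hs => ?_⟩
  have hs0 : 0 ≤ (l / m) ^ k := by positivity
  have hσ : √(l / m) ≤ e₀ := (sqrt_div_le_rpow hk hl hm).trans
    ((Real.rpow_le_rpow hs0 hs (by positivity)).trans hη1.le)
  have hgH : MemH (remainder k l m φ) := h0.memH.sub (memH_twoBubble hk0 hl hm)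
  have h4 := hco l m hl hm hσ _ hgH ho1 ho2
  obtain ⟨h1, h2⟩ := energy_expansion hk hl hm h0 hE (by linarith)
  have h3 := (integral_interEnergy_le (k := k) hk0 hl hm).2
  have hh := hSq_nonneg k (remainder k l m φ)
  have hsq : √(hSq k (remainder k l m φ)) ≤ √η := by gcongr
  have hsq2 : √((l / m) ^ k) ≤ √η := by gcongr
  have hV : 0 ≤ l2Sq v := setIntegral_nonneg measurableSet_Ioi fun r (hr : 0 < r) => by positivity
  obtain ⟨r1, r2⟩ := energy_arith hc hk' hp hh hs0 hV (by linarith) h1 h2 h3 h4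
    (by linarith) (by linarith)
  refine ⟨r1, le_trans (by positivity) h4, r2.trans (mul_le_mul_of_nonneg_right ?_ hs0)⟩
  linarith [mul_le_mul_of_nonneg_left hsq2 (by positivity : 0 ≤ 16 * Real.pi * k),
    mul_le_mul_of_nonneg_left hsq
      (by positivity : 0 ≤ 32 * Real.pi * k + 200 * k * (1 + Real.pi) / c)]

lemma integrableOn_LambdaQ_sq (hk : 2 ≤ k) (hl : 0 < l) :
    IntegrableOn (fun r => sQ k l r ^ 2 * r) (Ioi 0) := by
  have hm : Measurable (sQ k l) := measurable_sQ k l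
  have h1 : IntegrableOn (fun r => sQ k l r ^ 2 * r) (Ioc 0 l) := by
    refine Integrable.mono' (g := fun _ => l) (by simp) (by fun_prop)
      ((ae_restrict_iff' measurableSet_Ioc).2 (ae_of_all _ fun r hr => ?_))
    have hr0 : 0 < r := hr.1
    rw [Real.norm_of_nonneg (by positivity)]
    have h1 : sQ k l r ^ 2 ≤ 1 := by
      rw [sq_le_one_iff_abs_le_one]; exact abs_sQ_le k l r
    nlinarith [hr.2]
  have h2 : IntegrableOn (fun r => sQ k l r ^ 2 * r) (Ioi l) := by
    have hi : IntegrableOn (fun r : ℝ => 4 * l ^ 4 * r ^ (-3:ℝ)) (Ioi l) :=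
      (integrableOn_Ioi_rpow_of_lt (by norm_num) hl).const_mul _
    refine Integrable.mono' hi (by fun_prop)
      ((ae_restrict_iff' measurableSet_Ioi).2 (ae_of_all _ fun r hr => ?_))
    have hlr : l < r := hr
    have hr0 : 0 < r := hl.trans hr
    rw [Real.norm_of_nonneg (by positivity)]
    have a1 := sQ_le_two_mul_pow_inv (k := k) hl hr0
    have a2 : (l / r) ^ k ≤ (l / r) ^ 2 :=
      pow_le_pow_of_le_one (by positivity) ((div_le_one hr0).2 hlr.le) hk
    have a3 : sQ k l r ^ 2 ≤ (2 * (l / r) ^ 2) ^ 2 :=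
      pow_le_pow_left₀ (sQ_pos hl hr0).le (by linarith) 2
    rw [show r ^ (-3:ℝ) = 1 / r ^ 3 by norm_num]
    refine (mul_le_mul_of_nonneg_right a3 hr0.le).trans (le_of_eq ?_)
    field_simp; ring
  rw [← Ioc_union_Ioi_eq_Ioi hl.le]
  exact h1.union h2

lemma kappa_eq (k : ℕ) : kappa k = (k:ℝ) ^ 2 * ∫ r in Ioi (0:ℝ), sQ k 1 r ^ 2 * r := by
  rw [kappa, l2Sq, ← integral_const_mul]
  refine integral_congr_Ioi fun r hr => ?_
  have := LambdaQ_div (k := k) one_pos hr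
  rw [div_one] at this
  rw [this]; ring

/-- `κ ≥ k`, since `sin² Q` has mass at least `1 / k` on `(1, ∞)` for `dr / r`. -/
lemma le_kappa (hk : 2 ≤ k) : (k:ℝ) ≤ kappa k := by
  have hk0 : k ≠ 0 := by omega
  have hk' : (0:ℝ) < k := by positivity
  have hd : ∀ r ∈ Ioi (1:ℝ), HasDerivAt (fun r => -cQ k 1 r / k) (sQ k 1 r ^ 2 / r) r := by
    intro r hr
    have hr0 : (0:ℝ) < r := one_pos.trans hr
    exact ((hasDerivAt_cQ (k := k) one_pos hr0).neg.div_const (k:ℝ)).congr_deriv (by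
      field_simp)
  have hI := integral_Ioi_of_hasDerivAt_of_tendsto (a := 1) (m := 1 / k)
    (f := fun r => -cQ k 1 r / k) (f' := fun r => sQ k 1 r ^ 2 / r)
    (((continuous_cQ k 1).neg.div_const _).continuousWithinAt) hd
    ((hasInt_sQ_sq_div hk0 one_pos).1.mono_set (Ioi_subset_Ioi zero_le_one))
    (by have := ((tendsto_cQ_atTop (k := k) hk0 one_pos).neg.div_const (k:ℝ)); rwa [neg_neg] at this)
  have hc1 : cQ k 1 1 = 0 := by rw [cQ_eq]; norm_num
  have hle : ∫ r in Ioi (1:ℝ), sQ k 1 r ^ 2 / r ≤ ∫ r in Ioi (0:ℝ), sQ k 1 r ^ 2 * r := by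
    have hi := integrableOn_LambdaQ_sq hk one_pos
    refine (setIntegral_mono_on ((hasInt_sQ_sq_div hk0 one_pos).1.mono_set
      (Ioi_subset_Ioi zero_le_one)) (hi.mono_set (Ioi_subset_Ioi zero_le_one))
      measurableSet_Ioi fun r (hr : 1 < r) => ?_).trans
      (setIntegral_mono_set hi ((ae_restrict_iff' measurableSet_Ioi).2 (ae_of_all _ fun r
        (hr : 0 < r) => by positivity)) (Ioi_subset_Ioi zero_le_one).eventuallyLE)
    have : sQ k 1 r ^ 2 / r ≤ sQ k 1 r ^ 2 := div_le_self (sq_nonneg _) hr.le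
    nlinarith [sq_nonneg (sQ k 1 r)]
  rw [hI, hc1] at hle
  rw [kappa_eq]
  have : (k:ℝ) ^ 2 * (1 / k) = k := by field_simp
  have h2 := mul_le_mul_of_nonneg_left hle (sq_nonneg (k:ℝ))
  simp only [neg_zero, zero_div, sub_zero] at h2
  linarith

end EnergyExpansion

/-! ### Weights of the virial functional -/

section VirialWeight
variable {c R K : ℝ} {q : ℝ → ℝ} {y : ℝ}

/-- The weight `(q'' + q' / y) / 2`. -/
noncomputable def virB (q : ℝ → ℝ) (y : ℝ) : ℝ := (deriv (deriv q) y + deriv q y / y) / 2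

/-- The weight `q' / y`. -/
noncomputable def virM (q : ℝ → ℝ) (y : ℝ) : ℝ := deriv q y / y

/-- The derivative of `virB q`, in terms of the derivatives of `q`. -/
noncomputable def virBDeriv (q : ℝ → ℝ) (y : ℝ) : ℝ :=
  (iteratedDeriv 3 q y + (deriv (deriv q) y / y - deriv q y / y ^ 2)) / 2

lemma hasDerivAt_comp_div {f : ℝ → ℝ} {f' r l : ℝ} (h : HasDerivAt f f' (r / l)) :
    HasDerivAt (fun r => f (r / l)) (f' * (1 / l)) r :=
  HasDerivAt.comp r h ((hasDerivAt_id r).div_const l)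

namespace IsVirialWeight

lemma hasDerivAt (h : IsVirialWeight c R K q) (hy : 0 < y) :
    HasDerivAt q (deriv q y) y ∧ HasDerivAt (deriv q) (deriv (deriv q) y) y ∧
      HasDerivAt (deriv (deriv q)) (iteratedDeriv 3 q y) y := by
  have h3 : ContDiffOn ℝ (2 + 1) q (Ioi 0) := h.contDiffOn
  rw [contDiffOn_succ_iff_deriv_of_isOpen isOpen_Ioi] at h3
  have h2 : ContDiffOn ℝ (1 + 1) (deriv q) (Ioi 0) := h3.2.2
  rw [contDiffOn_succ_iff_deriv_of_isOpen isOpen_Ioi] at h2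
  have hn : Ioi (0:ℝ) ∈ 𝓝 y := Ioi_mem_nhds hy
  refine ⟨(h3.1.differentiableAt hn).hasDerivAt, (h2.1.differentiableAt hn).hasDerivAt, ?_⟩
  rw [show iteratedDeriv 3 q = deriv (deriv (deriv q)) by simp [iteratedDeriv_succ]]
  exact ((h2.2.2.differentiableOn one_ne_zero).differentiableAt hn).hasDerivAt

lemma continuousOn_third (h : IsVirialWeight c R K q) : ContinuousOn (iteratedDeriv 3 q) (Ioi 0) := by
  obtain ⟨L, hL⟩ := h.lipschitz
  exact hL.continuousOn

lemma continuousOn_deriv (h : IsVirialWeight c R K q) : ContinuousOn (deriv q) (Ioi 0) :=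
  fun _ hy => (h.hasDerivAt hy).2.1.continuousAt.continuousWithinAt

lemma continuousOn_deriv2 (h : IsVirialWeight c R K q) : ContinuousOn (deriv (deriv q)) (Ioi 0) :=
  fun _ hy => (h.hasDerivAt hy).2.2.continuousAt.continuousWithinAt

lemma hasDerivAt_virM (h : IsVirialWeight c R K q) (hy : 0 < y) :
    HasDerivAt (virM q) (deriv (deriv q) y / y - deriv q y / y ^ 2) y :=
  ((h.hasDerivAt hy).2.1.div (hasDerivAt_id y) hy.ne').congr_deriv (by
    simp only [id]; field_simp)

lemma hasDerivAt_virB (h : IsVirialWeight c R K q) (hy : 0 < y) :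
    HasDerivAt (virB q) (virBDeriv q y) y :=
  ((h.hasDerivAt hy).2.2.add (h.hasDerivAt_virM hy)).div_const 2

lemma mul_deriv_virM (hy : 0 < y) :
    y * (deriv (deriv q) y / y - deriv q y / y ^ 2) = 2 * (virB q y - virM q y) := by
  rw [virB, virM]; field_simp; ring

lemma abs_virB_sub_virM_le (h : IsVirialWeight c R K q) (hy : 0 < y) :
    |2 * (virB q y - virM q y)| ≤ c := by
  have := h.multiplier_le y hy
  rwa [show (fun s => deriv q s / s) = virM q from rfl, (h.hasDerivAt_virM hy).deriv,
    mul_deriv_virM hy] at this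

lemma abs_virM_le (h : IsVirialWeight c R K q) (hy : 0 < y) : |virM q y| ≤ K := by
  rw [virM, abs_div, abs_of_pos hy, div_le_iff₀ hy]; exact h.abs_deriv_le y hy

lemma abs_virB_le (h : IsVirialWeight c R K q) (hy : 0 < y) : |virB q y| ≤ K := by
  have h1 := abs_le.1 (h.abs_virM_le hy)
  have h2 := abs_le.1 (h.abs_deriv2_le y hy)
  rw [virM] at h1
  rw [virB, abs_le]; constructor <;> linarith

lemma neg_le_virB (h : IsVirialWeight c R K q) (hy : 0 < y) : -c ≤ virB q y := by
  have h1 := h.deriv2_ge y hy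
  have h2 := h.deriv_div_ge y hy
  rw [one_div_mul_eq_div] at h2
  rw [virB]; linarith

lemma virM_eq_one (h : IsVirialWeight c R K q) (hy : 0 < y) (hR : y < R) : virM q y = 1 := by
  have : q =ᶠ[𝓝 y] fun r => 1 / 2 * r ^ 2 := by
    filter_upwards [Ioo_mem_nhds hy hR] with r hr using h.eq_half_sq r hr.1 hr.2.le
  have hd := this.deriv_eq
  rw [virM, hd, (((hasDerivAt_pow 2 y).const_mul (1 / 2 : ℝ))).deriv]
  field_simp; norm_num

lemma exists_deriv_eq_zero (h : IsVirialWeight c R K q) :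
    ∃ R', R < R' ∧ ∀ y, R' < y → deriv q y = 0 := by
  obtain ⟨R', h1, m, hm⟩ := h.eq_const
  refine ⟨R', h1, fun y hy => ?_⟩
  have : q =ᶠ[𝓝 y] fun _ => m := by
    filter_upwards [Ioi_mem_nhds hy] with r hr using hm r (le_of_lt hr)
  rw [this.deriv_eq, deriv_const]

lemma locAC_virBDeriv (h : IsVirialWeight c R K q) : LocAC (virBDeriv q) := by
  obtain ⟨L, hL⟩ := h.lipschitz
  have h1 : LocAC (iteratedDeriv 3 q) := fun a b ha hab =>
    (hL.mono (by
      rw [uIcc_of_le hab]; exact fun x hx => lt_of_lt_of_le ha hx.1)).absolutelyContinuousOnInterval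
  have h2 : LocAC (fun y => deriv (deriv q) y / y - deriv q y / y ^ 2) := by
    refine LocAC.of_hasDerivAt (F' := fun y => (iteratedDeriv 3 q y * y - deriv (deriv q) y * 1) / y ^ 2
      - (deriv (deriv q) y * y ^ 2 - deriv q y * (2 * y)) / (y ^ 2) ^ 2) (fun y hy => ?_) ?_
    · refine (((h.hasDerivAt hy).2.2.div (hasDerivAt_id y) hy.ne').sub
        ((h.hasDerivAt hy).2.1.div (hasDerivAt_pow 2 y) (by positivity))).congr_deriv ?_
      simp
    · have h1 := h.continuousOn_third
      have h2 := h.continuousOn_deriv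
      have h3 := h.continuousOn_deriv2
      refine ContinuousOn.sub (ContinuousOn.div (by fun_prop) (by fun_prop)
        fun x (hx : 0 < x) => by positivity) (ContinuousOn.div (by fun_prop) (by fun_prop)
        fun x (hx : 0 < x) => by positivity)
  convert (h1.add h2).const_mul (1 / 2) using 2
  rw [virBDeriv]; ring

/-- The bound on the bilaplacian says that `y (q'' + q' / y)' - c log y` is nonincreasing. -/
lemma virBDeriv_sub_le (h : IsVirialWeight c R K q) {a b : ℝ} (ha : 0 < a) (hab : a ≤ b) :
    b * virBDeriv q b - a * virBDeriv q a ≤ c / 2 * Real.log (b / a) := by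
  have hid : LocAC (fun y : ℝ => y) := LocAC.of_hasDerivAt (fun y _ => hasDerivAt_id y)
    continuousOn_const
  have hz : LocAC (fun y => y * virBDeriv q y) := hid.mul h.locAC_virBDeriv
  have hb : 0 < b := ha.trans_le hab
  have hle : ∀ᵐ y : ℝ, 0 < y → deriv (fun y => y * virBDeriv q y) y ≤ c / 2 * y⁻¹ := by
    filter_upwards [h.locAC_virBDeriv.ae_differentiableAt, h.bilaplacian_le] with y h1 h2 hy
    have e1 : deriv (radialLaplacian q) =ᶠ[𝓝 y] fun s => 2 * virBDeriv q s := by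
      filter_upwards [Ioi_mem_nhds hy] with s hs
      refine HasDerivAt.deriv ?_
      refine ((h.hasDerivAt_virB hs).const_mul (2:ℝ)).congr_of_eventuallyEq (Eventually.of_forall fun x => ?_)
      simp only [radialLaplacian, virB]; ring
    have e2 : radialLaplacian (radialLaplacian q) y
        = 2 * deriv (virBDeriv q) y + 2 * virBDeriv q y / y := by
      conv_lhs => rw [radialLaplacian]
      rw [e1.deriv_eq, e1.self_of_nhds, deriv_const_mul _ (h1 hy)]
    have h3 := h2 hy
    rw [e2] at h3
    rw [show deriv (fun y => y * virBDeriv q y) y = _ from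
      ((hasDerivAt_id' y).mul (h1 hy).hasDerivAt).deriv]
    exact (le_of_eq (by field_simp; ring)).trans
      ((mul_le_mul_of_nonneg_right h3 (by positivity : 0 ≤ y / 2)).trans_eq (by field_simp))
  have hi := hz.intervalIntegrable_deriv ha hb
  have h0 : (0:ℝ) ∉ uIcc a b := by rw [uIcc_of_le hab]; exact fun h => absurd h.1 (not_le.2 ha)
  have h1 := intervalIntegral.integral_mono_ae_restrict hab hi
    ((intervalIntegral.intervalIntegrable_inv (f := fun y => y) (fun x hx => fun e => h0 (e ▸ hx)) continuousOn_id).const_mul (c / 2))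
    ((ae_restrict_iff' measurableSet_Icc).2 (by
      filter_upwards [hle] with y hy hm using hy (ha.trans_le hm.1)))
  rw [hz.integral_deriv ha hb, intervalIntegral.integral_const_mul, integral_inv_of_pos ha hb] at h1
  exact h1

/-- A one-sided bound on the second logarithmic derivative of `B` and a bound on `B` control the
logarithmic derivative: otherwise `B` would vary by more than its bound over a logarithmic length
`1 / √c`. -/
lemma abs_mul_virBDeriv_le (h : IsVirialWeight c R K q) (hc : 0 < c) (hy : 0 < y) :
    |y * virBDeriv q y| ≤ (K + c + 1) * √c := by
  set L := 1 / √c with hL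
  have hs : 0 < √c := Real.sqrt_pos.2 hc
  have hL0 : 0 < L := by positivity
  have hsL : √c * L = 1 := mul_one_div_cancel hs.ne'
  let N : ℝ → ℝ := fun x => virB q (Real.exp x)
  have hN : ∀ x, HasDerivAt N (Real.exp x * virBDeriv q (Real.exp x)) x := fun x =>
    ((h.hasDerivAt_virB (Real.exp_pos x)).comp x (Real.hasDerivAt_exp x)).congr_deriv (by ring)
  have hmono : ∀ x x', x ≤ x' → Real.exp x' * virBDeriv q (Real.exp x')
      - Real.exp x * virBDeriv q (Real.exp x) ≤ c / 2 * (x' - x) := fun x x' hx => by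
    have := h.virBDeriv_sub_le (Real.exp_pos x) (Real.exp_le_exp.2 hx)
    rwa [← Real.exp_sub, Real.log_exp] at this
  have hcont : Continuous N := continuous_iff_continuousAt.2 fun x => (hN x).continuousAt
  set x := Real.log y with hx
  have hyx : y = Real.exp x := (Real.exp_log hy).symm
  have hb : ∀ x, -c ≤ N x ∧ N x ≤ K := fun x =>
    ⟨h.neg_le_virB (Real.exp_pos x), (abs_le.1 (h.abs_virB_le (Real.exp_pos x))).2⟩
  obtain ⟨ξ, hξ, e1⟩ := exists_hasDerivAt_eq_slope N _ (by linarith : x < x + L)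
    hcont.continuousOn fun x _ => hN x
  obtain ⟨ξ', hξ', e2⟩ := exists_hasDerivAt_eq_slope N _ (by linarith : x - L < x)
    hcont.continuousOn fun x _ => hN x
  have m1 := hmono x ξ hξ.1.le
  have m2 := hmono ξ' x hξ'.2.le
  have c1 : c / 2 * (ξ - x) ≤ c / 2 * L := by gcongr; linarith [hξ.2]
  have c2 : c / 2 * (x - ξ') ≤ c / 2 * L := by gcongr; linarith [hξ'.1]
  have s1 : (N (x + L) - N x) / (x + L - x) ≥ -(K + c) * √c := by
    rw [ge_iff_le, le_div_iff₀ (by linarith), show x + L - x = L by ring, mul_assoc, hsL]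
    linarith [(hb (x + L)).1, (hb x).2]
  have s2 : (N x - N (x - L)) / (x - (x - L)) ≤ (K + c) * √c := by
    rw [div_le_iff₀ (by linarith), show x - (x - L) = L by ring, mul_assoc, hsL]
    linarith [(hb (x - L)).1, (hb x).2]
  have hcL : c / 2 * L ≤ √c := by
    rw [hL, mul_one_div, div_right_comm, Real.div_sqrt]; linarith
  rw [hyx, abs_le]
  constructor <;> nlinarith

/-- The weights on the scale `l`. -/
lemma isWeight_virB (h : IsVirialWeight c R K q) (hc : 0 < c) {l : ℝ} (hl : 0 < l) :
    IsWeight (fun r => virB q (r / l)) (fun r => virBDeriv q (r / l) * (1 / l)) K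
      ((K + c + 1) * √c) where
  hasDerivAt r hr := (hasDerivAt_comp_div (h.hasDerivAt_virB (div_pos hr hl)))
  continuousOn := by
    refine ContinuousOn.mul ?_ continuousOn_const
    exact h.locAC_virBDeriv.continuousOn.comp (by fun_prop) fun r (hr : 0 < r) => div_pos hr hl
  abs_le r hr := h.abs_virB_le (div_pos hr hl)
  abs_deriv_le r hr := by
    have := h.abs_mul_virBDeriv_le hc (div_pos hr hl)
    rwa [show r * (virBDeriv q (r / l) * (1 / l)) = r / l * virBDeriv q (r / l) by ring]

lemma isWeight_virM (h : IsVirialWeight c R K q) {l : ℝ} (hl : 0 < l) :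
    IsWeight (fun r => virM q (r / l))
      (fun r => (2 * (virB q (r / l) - virM q (r / l))) / r) K c where
  hasDerivAt r hr := (hasDerivAt_comp_div (h.hasDerivAt_virM (div_pos hr hl))).congr_deriv (by
      rw [← mul_deriv_virM (div_pos hr hl)]; field_simp)
  continuousOn := by
    have h1 : ContinuousOn (fun r => virB q (r / l)) (Ioi 0) := continuousOn_of_forall_continuousAt
      fun r hr => (hasDerivAt_comp_div (h.hasDerivAt_virB (div_pos hr hl))).continuousAt
    have h2 : ContinuousOn (fun r => virM q (r / l)) (Ioi 0) := continuousOn_of_forall_continuousAt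
      fun r hr => (hasDerivAt_comp_div (h.hasDerivAt_virM (div_pos hr hl))).continuousAt
    exact (continuousOn_const.mul (h1.sub h2)).div continuousOn_id fun r hr => ne_of_gt hr
  abs_le r hr := h.abs_virM_le (div_pos hr hl)
  abs_deriv_le r hr := by
    rw [mul_div_cancel₀ _ hr.ne']; exact h.abs_virB_sub_virM_le (div_pos hr hl)

end IsVirialWeight
end VirialWeight

section StaticVirial
variable {k : ℕ} {l m r s : ℝ} {g : ℝ → ℝ}

/-- `k² sin (2 (P + x)) / 2 - k² sin (2 a) / 2 + k² sin (2 b) / 2`, the forcing term seen by the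
remainder `x`. -/
noncomputable def force (k : ℕ) (l m x r : ℝ) : ℝ :=
  (k:ℝ) ^ 2 * Real.sin (2 * (twoBubble k l m r + x)) / 2 - (k:ℝ) ^ 2 * (sQ k l r * cQ k l r)
    + (k:ℝ) ^ 2 * (sQ k m r * cQ k m r)

/-- The part of `force` of second order in the remainder `x`. -/
noncomputable def forceN (k : ℕ) (l m x r : ℝ) : ℝ :=
  (k:ℝ) ^ 2 / 2 * (Real.sin (2 * (twoBubble k l m r + x)) - Real.sin (2 * twoBubble k l m r)
    - 2 * x * cos2P k l m r)

/-- The part of the potential `k² sin² / 2` of second order in the remainder `x`. -/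
noncomputable def potN (k : ℕ) (l m x r : ℝ) : ℝ :=
  (k:ℝ) ^ 2 / 2 * (Real.sin (twoBubble k l m r + x) ^ 2 - Real.sin (twoBubble k l m r) ^ 2
    - Real.sin (2 * twoBubble k l m r) * x)

lemma force_eq (k : ℕ) (l m x r : ℝ) : force k l m x r
    = inter k l m r + (k:ℝ) ^ 2 * cos2P k l m r * x + forceN k l m x r := by
  have := inter_eq k l m r
  rw [force, forceN]; linear_combination this

lemma abs_taylor_sin_cos {A B x : ℝ} (hA : |A| ≤ 1) (hB : |B| ≤ 1) (hx : |x| ≤ 1 / 2) :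
    |A * (Real.cos (2 * x) - 1)| ≤ 2 * x ^ 2 ∧ |B * (Real.sin (2 * x) - 2 * x)| ≤ x ^ 2 := by
  have h2 : |2 * x| ≤ 1 := by rw [abs_mul, abs_two]; linarith
  have hs := abs_sin_sub_le h2
  rw [abs_mul, abs_two] at hs
  have h0 := abs_nonneg x
  constructor
  · refine (abs_mul_le hA (B := 2 * x ^ 2) ?_).trans_eq (one_mul _)
    have := Real.one_sub_sq_div_two_le_cos (x := 2 * x)
    rw [abs_le]; constructor <;> linarith [Real.cos_le_one (2 * x), sq_nonneg x]
  · refine (abs_mul_le hB (B := x ^ 2) ?_).trans_eq (one_mul _)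
    rw [← sq_abs x]; nlinarith [mul_le_mul_of_nonneg_left hx (sq_nonneg |x|)]

lemma abs_forceN_le (k : ℕ) (l m r : ℝ) {x : ℝ} (hx : |x| ≤ 1 / 2) :
    |forceN k l m x r| ≤ 2 * ((k:ℝ) ^ 2 * x ^ 2) := by
  obtain ⟨h1, h2⟩ := abs_taylor_sin_cos (Real.abs_sin_le_one (2 * twoBubble k l m r))
    (Real.abs_cos_le_one (2 * twoBubble k l m r)) hx
  rw [show forceN k l m x r = (k:ℝ) ^ 2 / 2 * (Real.sin (2 * twoBubble k l m r) *
      (Real.cos (2 * x) - 1) + Real.cos (2 * twoBubble k l m r) * (Real.sin (2 * x) - 2 * x)) by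
    rw [forceN, mul_add, Real.sin_add, cos2P]; ring]
  refine (abs_mul_le (abs_of_nonneg (by positivity : 0 ≤ (k:ℝ) ^ 2 / 2)).le
    ((abs_add_le _ _).trans (add_le_add h1 h2))).trans ?_
  nlinarith [mul_nonneg (sq_nonneg (k:ℝ)) (sq_nonneg x)]

lemma abs_potN_le (k : ℕ) (l m r : ℝ) {x : ℝ} (hx : |x| ≤ 1 / 2) :
    |potN k l m x r| ≤ 2 * ((k:ℝ) ^ 2 * x ^ 2) := by
  obtain ⟨h1, h2⟩ := abs_taylor_sin_cos (Real.abs_cos_le_one (2 * twoBubble k l m r))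
    (Real.abs_sin_le_one (2 * twoBubble k l m r)) hx
  rw [show potN k l m x r = (k:ℝ) ^ 2 / 2 * ((Real.sin (2 * twoBubble k l m r) *
      (Real.sin (2 * x) - 2 * x) - Real.cos (2 * twoBubble k l m r) * (Real.cos (2 * x) - 1)) / 2) by
    rw [potN, sin_add_sq_sub]; ring]
  refine (abs_mul_le (abs_of_nonneg (by positivity : 0 ≤ (k:ℝ) ^ 2 / 2)).le
    (abs_div_le two_pos ((abs_sub _ _).trans (add_le_add h2 h1)))).trans ?_
  nlinarith [mul_nonneg (sq_nonneg (k:ℝ)) (sq_nonneg x)]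

lemma measurable_forceN_comp {μ : Measure ℝ} (k : ℕ) (l m : ℝ) (hg : AEMeasurable g μ) :
    AEMeasurable (fun r => forceN k l m (g r) r) μ ∧ AEMeasurable (fun r => force k l m (g r) r) μ ∧
    AEMeasurable (fun r => potN k l m (g r) r) μ := by
  have h1 := measurable_twoBubble k l m
  have h2 := measurable_cos2P k l m
  unfold forceN force potN
  refine ⟨by fun_prop, by fun_prop, by fun_prop⟩

/-- The leading term of the derivative of `b`. The integrand is `4 k² sin³ a (r / m) ^ k` up to
smaller terms, and `4 ∫ (2u / (1 + u²))³ du = 8`. -/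
lemma abs_integral_sQ_inter_sub_le (hk : k ≠ 0) (hl : 0 < l) (hm : 0 < m) (hs1 : (l / m) ^ k ≤ 1) :
    IntegrableOn (fun r => sQ k l r * inter k l m r / r) (Ioi 0) ∧
    |k * (∫ r in Ioi (0:ℝ), sQ k l r * inter k l m r / r) - 8 * (k:ℝ) ^ 2 * (l / m) ^ k|
      ≤ 64 * Real.pi * (k:ℝ) ^ 2 * ((l / m) ^ k * √((l / m) ^ k)) := by
  have hk' : (0:ℝ) < k := by positivity
  have hs0 : 0 < (l / m) ^ k := by positivity
  have hW := hasInt_sQ_add (k := k) hk hl hm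
  set σ := √((l / m) ^ k) with hσ
  have hσ0 : 0 < σ := by positivity
  have hσσ : σ * σ = (l / m) ^ k := Real.mul_self_sqrt hs0.le
  have hσ1 : σ ≤ 1 := Real.sqrt_le_one.2 hs1
  -- the main part is an exact derivative
  have hMI : HasInt (fun r => sQ k l r ^ 3 * (r / l) ^ k / r) (2 / k) := by
    refine hasInt_of_hasDerivAt_of_nonneg (F := fun r => (1 - cQ k l r) ^ 2 / (2 * k)) (by fun_prop)
      (fun r (hr : 0 < r) => ?_) (fun r (hr : 0 < r) => ?_)
      ((((tendsto_cQ_atTop (k := k) hk hl).const_sub 1).pow 2).div_const _)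
      (by rw [cQ_zero hk]; field_simp; norm_num)
    · refine ((((hasDerivAt_cQ (k := k) hl hr).const_sub 1).fun_pow 2).div_const _).congr_deriv ?_
      rw [← sQ_mul_pow]; field_simp; ring
    · have := sQ_pos (k := k) hl hr; positivity
  have hMain : HasInt (fun r => 4 * (k:ℝ) ^ 2 * (l / m) ^ k * (sQ k l r ^ 3 * (r / l) ^ k / r))
      (4 * (k:ℝ) ^ 2 * (l / m) ^ k * (2 / k)) := hMI.const_mul _
  let d : ℝ → ℝ := fun r => sQ k l r * inter k l m r / r
      - 4 * (k:ℝ) ^ 2 * (l / m) ^ k * (sQ k l r ^ 3 * (r / l) ^ k / r)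
  have hle : ∀ r, 0 < r → |d r| ≤ 32 * (k:ℝ) ^ 2 * ((l / m) ^ k * σ) * ((sQ k l r + sQ k m r) / r) := by
    intro r hr
    have ha := sQ_pos (k := k) hl hr
    have hb := sQ_pos (k := k) hm hr
    have hab := sQ_mul_sQ_le (k := k) hl hm hr
    have hab2 := sQ_mul_sQ_le_sqrt (k := k) hl hm hr
    rw [← hσ] at hab2
    have hβ : 0 < (r / m) ^ k := by positivity
    have hα : 0 < (r / l) ^ k := by positivity
    have hpe := pow_div_eq hl hm k r
    -- `sin a ≤ 2 / α`
    have haα : sQ k l r * (r / l) ^ k ≤ 2 := by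
      rw [sQ_mul_pow]; linarith [(abs_le.1 (abs_cQ_le k l r)).1]
    have haβ : sQ k l r * (r / m) ^ k ≤ 2 * (l / m) ^ k := by
      rw [hpe]; nlinarith
    have hbc : 2 * (r / m) ^ k - sQ k m r * cQ k m r
        = sQ k m r * ((r / m) ^ k * ((r / m) ^ k * (3 + ((r / m) ^ k) ^ 2) / (1 + ((r / m) ^ k) ^ 2))) := by
      rw [sQ_eq, cQ_eq]; generalize (r / m) ^ k = β at *; field_simp; ring
    have hfrac : (r / m) ^ k * (3 + ((r / m) ^ k) ^ 2) / (1 + ((r / m) ^ k) ^ 2) ≤ 3 * (r / m) ^ k := by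
      rw [div_le_iff₀ (by positivity)]
      generalize (r / m) ^ k = β at *; nlinarith [pow_pos hβ 3]
    have hfrac0 : 0 ≤ (r / m) ^ k * (3 + ((r / m) ^ k) ^ 2) / (1 + ((r / m) ^ k) ^ 2) := by positivity
    have e : d r = (-(2 * (k:ℝ) ^ 2 * sQ k l r ^ 3 * (2 * (r / m) ^ k - sQ k m r * cQ k m r))
        - 2 * (k:ℝ) ^ 2 * cQ k l r * (sQ k l r * sQ k m r) ^ 2) / r := by
      simp only [d, inter, hpe]; field_simp; ring
    rw [e, abs_div, abs_of_pos hr, ← mul_div_assoc]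
    refine div_le_div_of_nonneg_right ?_ hr.le
    refine (abs_sub _ _).trans ?_
    rw [abs_neg, abs_mul _ (_ ^ 2), abs_mul _ (cQ k l r), hbc]
    generalize hX : (r / m) ^ k * (3 + ((r / m) ^ k) ^ 2) / (1 + ((r / m) ^ k) ^ 2) = X at *
    generalize (r / m) ^ k = β at *
    have hc := abs_cQ_le k l r
    have ha1 := sQ_le_one k l r
    generalize sQ k l r = a at *
    generalize sQ k m r = b at *
    generalize cQ k l r = d at *
    rw [abs_of_nonneg (by positivity), abs_of_nonneg (by positivity : 0 ≤ (a * b) ^ 2),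
      abs_of_nonneg (by positivity : 0 ≤ 2 * (k:ℝ) ^ 2)]
    generalize (l / m) ^ k = S at *
    have t1 : a ^ 3 * (b * (β * X)) ≤ 12 * (S * σ) * b := by
      have x1 : (a * β) * (a * β) ≤ (2 * S) * (2 * S) := by gcongr
      have x2 : a ^ 3 * (b * (β * X)) ≤ a ^ 3 * (b * (β * (3 * β))) := by
        gcongr
      have x3 : a ^ 3 * (b * (β * (3 * β))) = 3 * (a * b) * ((a * β) * (a * β)) := by ring
      have x4 : 3 * (a * b) * ((a * β) * (a * β)) ≤ 3 * (1 * b) * ((2 * S) * (2 * S)) := by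
        gcongr
      have x5 : S * S ≤ S * σ := by gcongr; nlinarith
      nlinarith
    have t2 : (a * b) ^ 2 ≤ 4 * (S * σ) * (a + b) := by
      linarith [mul_le_mul hab hab2 (by positivity) (by positivity)]
    have t3 : 2 * (k:ℝ) ^ 2 * |d| * (a * b) ^ 2 ≤ 2 * (k:ℝ) ^ 2 * 1 * (4 * (S * σ) * (a + b)) := by
      gcongr
    have t4 : 2 * (k:ℝ) ^ 2 * a ^ 3 * (b * (β * X)) ≤ 2 * (k:ℝ) ^ 2 * (12 * (S * σ) * b) := by
      rw [mul_assoc]; gcongr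
    have t5 : 0 ≤ (k:ℝ) ^ 2 * ((S * σ) * a) := by positivity
    nlinarith
  have hdi := integrableOn_of_abs_le (hW.1.const_mul _) (by fun_prop) hle
  have hfull : HasInt (fun r => sQ k l r * inter k l m r / r) _ :=
    ((HasInt.of_integrable hdi).add hMain).congr (ae_of_all _ fun r _ => by ring)
  refine ⟨hfull.1, ?_⟩
  have hb := abs_integral_le_of_abs_le (hW.1.const_mul _) hle
  rw [integral_const_mul, hW.2] at hb
  have e : k * ((∫ r in Ioi (0:ℝ), d r) + 4 * (k:ℝ) ^ 2 * (l / m) ^ k * (2 / k))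
      - 8 * (k:ℝ) ^ 2 * (l / m) ^ k = k * ∫ r in Ioi (0:ℝ), d r := by
    have hY : k * (4 * (k:ℝ) ^ 2 * (l / m) ^ k * (2 / k)) = 8 * (k:ℝ) ^ 2 * (l / m) ^ k := by
      field_simp; ring
    linear_combination hY
  rw [hfull.2, e]
  refine (abs_mul_le (Nat.abs_cast k).le hb).trans_eq ?_
  field_simp; ring

end StaticVirial
/-! ### The virial integral as a quadratic form -/

section StaticVirialEstimate
variable {k : ℕ} {l m r s c ε K ρ ν : ℝ} {g M M' B B' : ℝ → ℝ}

set_option maxHeartbeats 1000000 in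
/-- Pointwise bound of the error terms in the virial identity. -/
lemma virial_error_le {κ a b x p d r V I N W M B B' M' K c ε ρ ν σ h : ℝ} (hκ : 1 ≤ κ) (hr : 0 < r)
    (hd1 : κ ^ 2 * x ^ 2 ≤ d * r) (hd2 : p ^ 2 * r ≤ d) (hd3 : 2 * (|x| * |p|) ≤ d)
    (ha : 0 < a) (ha1 : a ≤ 1) (hb : 0 < b) (hb1 : b ≤ 1) (hV : |V| ≤ 4 * b)
    (hab : a * b ≤ 4 * σ ^ 2) (hab' : a * b ≤ σ * (a + b)) (hσ : 0 ≤ σ) (hσ1 : σ ≤ 1)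
    (hN : |N| ≤ 2 * (κ ^ 2 * x ^ 2)) (hW : |W| ≤ 2 * (κ ^ 2 * x ^ 2))
    (hI : |I| ≤ 8 * κ ^ 2 * σ ^ 2 * (a + b)) (hM : |M| ≤ K) (hB : |B| ≤ K)
    (hB' : |r * B'| ≤ ε) (hM' : |r * M'| ≤ c) (hBM : |2 * (B - M)| ≤ c)
    (hρ1 : |(1 - M) * a| ≤ ρ) (hρ2 : |M * b| ≤ ρ) (hx : |x| ≤ h) (hν : 0 < ν) :
    |κ ^ 3 * a * V * x / r + (κ * ((1 - M) * a) * N / r + κ * (M * b) * N / r)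
      + (B - M) * p ^ 2 * r + r * B' * x * p + (I * (M * p) + I * (B * x / r)) + B * x * N / r
      - M' * W|
      ≤ (3 * ν + 4 * κ * ρ + 3 * c + ε + 2 * K * h) * d
        + (16 * κ ^ 4 + 64 * κ ^ 4 * K ^ 2) / ν * σ ^ 3 * ((a + b) / r) := by
  have hd0 : 0 ≤ d := by nlinarith
  have hK0 : 0 ≤ K := (abs_nonneg _).trans hM
  have hκ0 : 0 < κ := by linarith
  have hdiv : ∀ {y}, |y| ≤ 2 * (κ ^ 2 * x ^ 2) → |y / r| ≤ 2 * d := fun {y} hy => by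
    rw [abs_div, abs_of_pos hr, div_le_iff₀ hr]; linarith
  have hww : (a + b) ^ 2 ≤ 2 * (a + b) := by nlinarith
  have hσ43 : σ ^ 4 ≤ σ ^ 3 := pow_le_pow_of_le_one hσ hσ1 (by norm_num)
  have hwr : 0 < (a + b) / r := by positivity
  -- weighted arithmetic-geometric mean
  have amgm : ∀ u v : ℝ, u * v ≤ ν * u ^ 2 + v ^ 2 / (4 * ν) := fun u v => by
    have : ν * u ^ 2 + v ^ 2 / (4 * ν) - u * v = (2 * ν * u - v) ^ 2 / (4 * ν) := by
      field_simp; ring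
    linarith [div_nonneg (sq_nonneg (2 * ν * u - v)) (by positivity : 0 ≤ 4 * ν)]
  have e1 : |κ ^ 3 * a * V * x / r| ≤ ν * d + 16 * κ ^ 4 / ν * σ ^ 3 * ((a + b) / r) := by
    rw [abs_div, abs_of_pos hr, div_le_iff₀ hr]
    have h1 := abs_mul_le (abs_mul_le (abs_of_pos (by positivity : 0 < κ ^ 3 * a)).le hV)
      (le_refl |x|)
    have h2 := amgm (κ * |x|) (4 * κ ^ 2 * (a * b))
    have h3 : (a * b) ^ 2 ≤ 4 * σ ^ 3 * (a + b) := by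
      have := mul_le_mul hab hab' (by positivity) (by positivity)
      linarith
    have h4 : (4 * κ ^ 2 * (a * b)) ^ 2 / (4 * ν) ≤ 16 * κ ^ 4 / ν * σ ^ 3 * (a + b) := by
      calc (4 * κ ^ 2 * (a * b)) ^ 2 / (4 * ν) = 4 * κ ^ 4 / ν * (a * b) ^ 2 := by
            field_simp
        _ ≤ 4 * κ ^ 4 / ν * (4 * σ ^ 3 * (a + b)) := mul_le_mul_of_nonneg_left h3 (by positivity)
        _ = _ := by ring
    have h5 : (κ * |x|) ^ 2 ≤ d * r := by rw [mul_pow, sq_abs]; exact hd1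
    have h6 := mul_le_mul_of_nonneg_left h5 hν.le
    have e : (ν * d + 16 * κ ^ 4 / ν * σ ^ 3 * ((a + b) / r)) * r
      = ν * (d * r) + 16 * κ ^ 4 / ν * σ ^ 3 * (a + b) := by field_simp
    rw [e]; linarith
  have e2 : ∀ y, |y| ≤ ρ → |κ * y * N / r| ≤ 2 * κ * ρ * d := fun y hy => by
    rw [mul_div_assoc]
    exact (abs_mul_le (abs_mul_le (abs_of_pos hκ0).le hy) (hdiv hN)).trans_eq (by ring)
  have e3 : |(B - M) * p ^ 2 * r| ≤ c * d := by
    rw [abs_mul, abs_two] at hBM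
    rw [mul_assoc]
    exact abs_mul_le (by linarith [abs_nonneg (B - M)]) (by rwa [abs_of_nonneg (by positivity)])
  have e4 : |r * B' * x * p| ≤ ε * d := by
    rw [mul_assoc]
    exact abs_mul_le hB' (by rw [abs_mul]; linarith [mul_nonneg (abs_nonneg x) (abs_nonneg p)])
  have hIK : ∀ y, |y| ≤ K → ∀ u, u ^ 2 ≤ d * r → |I * (y * (u / r))|
      ≤ ν * d + 32 * κ ^ 4 * K ^ 2 / ν * σ ^ 3 * ((a + b) / r) := fun y hy u hu => by
    have h1 := abs_mul_le hI (abs_mul_le hy (abs_div_le hr (le_refl |u|)))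
    rw [show 8 * κ ^ 2 * σ ^ 2 * (a + b) * (K * (|u| / r))
      = (|u| * (8 * κ ^ 2 * K * σ ^ 2 * (a + b))) / r by ring] at h1
    refine h1.trans ?_
    rw [div_le_iff₀ hr]
    have h2 := amgm |u| (8 * κ ^ 2 * K * σ ^ 2 * (a + b))
    rw [sq_abs] at h2
    have h3 : (8 * κ ^ 2 * K * σ ^ 2 * (a + b)) ^ 2 / (4 * ν)
        ≤ 32 * κ ^ 4 * K ^ 2 / ν * σ ^ 3 * (a + b) := by
      calc (8 * κ ^ 2 * K * σ ^ 2 * (a + b)) ^ 2 / (4 * ν)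
          = 16 * κ ^ 4 * K ^ 2 / ν * (σ ^ 4 * (a + b) ^ 2) := by field_simp; ring
        _ ≤ 16 * κ ^ 4 * K ^ 2 / ν * (σ ^ 3 * (2 * (a + b))) :=
            mul_le_mul_of_nonneg_left (mul_le_mul hσ43 hww (by positivity) (by positivity))
              (by positivity)
        _ = _ := by ring
    have h6 := mul_le_mul_of_nonneg_left hu hν.le
    have e : (ν * d + 32 * κ ^ 4 * K ^ 2 / ν * σ ^ 3 * ((a + b) / r)) * r
      = ν * (d * r) + 32 * κ ^ 4 * K ^ 2 / ν * σ ^ 3 * (a + b) := by field_simp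
    rw [e]; linarith
  have e5 := hIK M hM (p * r) (by nlinarith)
  have e5' := hIK B hB x ((le_mul_of_one_le_left (sq_nonneg x) (one_le_pow₀ hκ)).trans hd1)
  rw [mul_div_cancel_right₀ _ hr.ne'] at e5
  rw [← mul_div_assoc] at e5'
  have e6 : |B * x * N / r| ≤ 2 * K * h * d := by
    rw [mul_div_assoc]
    exact (abs_mul_le (abs_mul_le hB hx) (hdiv hN)).trans_eq (by ring)
  have e7 : |M' * W| ≤ 2 * c * d := by
    rw [show M' * W = r * M' * (W / r) by field_simp]
    exact (abs_mul_le hM' (hdiv hW)).trans_eq (by ring)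
  have e2a := e2 _ hρ1
  have e2b := e2 _ hρ2
  have esum : (16 * κ ^ 4 + 64 * κ ^ 4 * K ^ 2) / ν * σ ^ 3 * ((a + b) / r)
    = 16 * κ ^ 4 / ν * σ ^ 3 * ((a + b) / r)
      + 2 * (32 * κ ^ 4 * K ^ 2 / ν * σ ^ 3 * ((a + b) / r)) := by ring
  rw [esum]
  rw [abs_le] at *
  constructor <;> linarith [e1.1, e1.2]

/-- The derivative of the virial functional `⟨ΛQ_l | ψ_t⟩ + ⟨ψ_t | 𝓐₀ g⟩`, up to sign and the factor
`l`, as an integral. -/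
noncomputable def virDens (k : ℕ) (l m : ℝ) (M B B' g : ℝ → ℝ) (r : ℝ) : ℝ :=
  (k:ℝ) ^ 2 * (sQ k l r * cQ k l r) * deriv g r + k * sQ k l r * force k l m (g r) r / r
    + (2 * B r - M r) * deriv g r ^ 2 * r + r * B' r * g r * deriv g r
    + force k l m (g r) r * (M r * deriv g r + B r * g r / r)

/-- The integral of the virial density at the scale `l` of the inner bubble. -/
noncomputable def virInt (k : ℕ) (q : ℝ → ℝ) (l m : ℝ) (g : ℝ → ℝ) : ℝ :=
  ∫ r in Ioi (0:ℝ), virDens k l m (fun r => virM q (r / l)) (fun r => virB q (r / l))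
    (fun r => virBDeriv q (r / l) * (1 / l)) g r

lemma hasInt_deriv_sQ_mul_cQ_mul (hk : k ≠ 0) (hl : 0 < l) (hg : MemH g) :
    HasInt (fun r => (cQ k l r * (k * sQ k l r / r) * cQ k l r
    + sQ k l r * (-sQ k l r * (k * sQ k l r / r))) * g r + sQ k l r * cQ k l r * deriv g r) 0 := by
  refine hg.hasInt_deriv_mul (w := fun r => sQ k l r * cQ k l r)
    (fun r hr => (hasDerivAt_sQ hl hr).mul (hasDerivAt_cQ hl hr))
    (((continuousOn_deriv_sQ k l).mul (continuous_cQ k l).continuousOn).add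
      ((continuous_sQ k l).continuousOn.mul
        ((continuous_sQ k l).neg.continuousOn.mul (continuousOn_sQ_div k l))))
    ((memL2_sQ_div hk hl).of_abs_le k (by fun_prop) fun r hr => ?_)
    ((memL2_sQ_div hk hl).of_abs_le 1 (by fun_prop) fun r hr => ?_)
  · rw [show cQ k l r * (k * sQ k l r / r) * cQ k l r + sQ k l r * (-sQ k l r * (k * sQ k l r / r))
      = k * cos2Q k l r * (sQ k l r / r) by rw [cos2Q]; ring]
    refine abs_mul_le_right _ ((abs_mul_le (Nat.abs_cast k).le (abs_cos2Q_le k l r)).trans_eq ?_)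
    ring
  · rw [mul_div_right_comm, mul_comm]
    exact abs_mul_le_right _ (abs_cQ_le k l r)

lemma hasInt_deriv_mul_potN (hk : 1 ≤ k) (hl : 0 < l) (hm : 0 < m) (hg : MemH g)
    (hM : IsWeight M M' K c) (hh : hSq k g ≤ 1 / 4) :
    HasInt (fun r => M' r * potN k l m (g r) r + M r * (k * (sQ k l r - sQ k m r) / r
    * forceN k l m (g r) r + deriv g r * ((k:ℝ) ^ 2 * cos2P k l m r * g r + forceN k l m (g r) r))) 0 := by
  have hgm := hg.aemeasurable
  obtain ⟨hNm, -, hWm⟩ := measurable_forceN_comp k l m hgm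
  have hMm := hM.aemeasurable; have hMm' := hM.aemeasurable'
  have hdiv : ∀ r, 0 < r → ∀ {y}, |y| ≤ 2 * ((k:ℝ) ^ 2 * g r ^ 2) → |y / r| ≤ 2 * hDens k g r :=
    fun r hr {y} hy => (abs_div_le hr hy).trans (by
      rw [mul_div_assoc, mul_div_assoc]; linarith [sq_mul_le_hDens (k := k) (g := g) hr])
  have hG : IntegrableOn (fun r => M' r * potN k l m (g r) r + M r * (k * (sQ k l r - sQ k m r) / r
      * forceN k l m (g r) r + deriv g r * ((k:ℝ) ^ 2 * cos2P k l m r * g r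
        + forceN k l m (g r) r))) (Ioi 0) := by
    refine hg.integrableOn_of_le (A := 2 * c + K * (4 * k + (k:ℝ) ^ 2)) k (by fun_prop)
      fun r hr => ?_
    have hx := hg.abs_le_half hk hh hr
    have hN := abs_forceN_le k l m r hx
    have t1 : |M' r * potN k l m (g r) r| ≤ c * (2 * hDens k g r) := by
      rw [show M' r * potN k l m (g r) r = r * M' r * (potN k l m (g r) r / r) by field_simp]
      exact abs_mul_le (hM.abs_deriv_le r hr) (hdiv r hr (abs_potN_le k l m r hx))
    have t2 : |k * (sQ k l r - sQ k m r) / r * forceN k l m (g r) r|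
        ≤ k * 2 * (2 * hDens k g r) := by
      rw [div_mul_eq_mul_div, mul_div_assoc]
      refine abs_mul_le (abs_mul_le (Nat.abs_cast k).le ?_) (hdiv r hr hN)
      have hp := sQ_pos (k := k) hl hr; have hp' := sQ_pos (k := k) hm hr
      rw [abs_le]; constructor <;> linarith [sQ_le_one k l r, sQ_le_one k m r]
    have t3 : |deriv g r * ((k:ℝ) ^ 2 * cos2P k l m r * g r + forceN k l m (g r) r)|
        ≤ (k:ℝ) ^ 2 * hDens k g r := by
      have u1 := abs_mul_le (abs_mul_le (abs_of_nonneg (sq_nonneg (k:ℝ))).le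
        (abs_cos2P_le k l m r)) (le_refl |g r|)
      have u2 : |forceN k l m (g r) r| ≤ (k:ℝ) ^ 2 * |g r| := by
        refine hN.trans ?_
        rw [← sq_abs (g r)]
        have := mul_le_mul_of_nonneg_left hx (abs_nonneg (g r))
        nlinarith [mul_le_mul_of_nonneg_left this (sq_nonneg (k:ℝ))]
      refine (abs_mul_le le_rfl ((abs_add_le _ _).trans (add_le_add u1 u2))).trans ?_
      linarith [mul_le_mul_of_nonneg_left (two_mul_abs_le_hDens (k := k) (g := g) hk hr)
        (sq_nonneg (k:ℝ))]
    have t4 := abs_mul_le (hM.abs_le r hr) ((abs_add_le _ _).trans (add_le_add t2 t3))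
    exact (abs_add_le _ _).trans ((add_le_add t1 t4).trans (le_of_eq (by ring)))
  have hpd : ∀ᵐ r : ℝ, 0 < r → HasDerivAt (fun r => potN k l m (g r) r)
      (k * (sQ k l r - sQ k m r) / r * forceN k l m (g r) r
        + deriv g r * ((k:ℝ) ^ 2 * cos2P k l m r * g r + forceN k l m (g r) r)) r := by
    filter_upwards [hg.ae_hasDerivAt] with r h hr
    have hP := hasDerivAt_twoBubble (k := k) hl hm hr
    have h1 := ((hP.add (h hr)).sin.pow 2).sub (hP.sin.pow 2)
    have h2 := (hP.const_mul 2).sin.mul (h hr)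
    refine ((h1.sub h2).const_mul ((k:ℝ) ^ 2 / 2)).congr_deriv ?_
    simp only [forceN, cos2P, Nat.cast_ofNat, show (2:ℕ) - 1 = 1 from rfl, pow_one,
      Pi.add_apply, Real.sin_two_mul]
    ring
  have hPac : LocAC (twoBubble k l m) := (memH_twoBubble (by omega) hl hm).locAC
  have hsl : ∀ {F : ℝ → ℝ}, LocAC F → LocAC (fun r => Real.sin (F r)) := fun hF =>
    LocAC.lipschitz_comp (Real.lipschitzWith_sin) hF
  have hpotac : LocAC (fun r => potN k l m (g r) r) := by
    have h1 := hsl (hPac.add hg.locAC)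
    have h2 := hsl hPac
    have h3 := hsl (hPac.const_mul 2)
    convert (((h1.mul h1).sub (h2.mul h2)).sub (h3.mul hg.locAC)).const_mul ((k:ℝ) ^ 2 / 2)
      using 2
    rw [potN]; ring
  refine ⟨hG, integral_eq_zero_of_ae_hasDerivAt (hM.locAC.mul hpotac) ?_ hG ?_⟩
  · filter_upwards [hpd] with r h hr
    exact (hM.hasDerivAt r hr).mul (h hr)
  · refine hg.integrableOn_of_le (A := K * 2) k (by fun_prop) fun r hr => ?_
    rw [mul_div_assoc, mul_assoc]
    exact abs_mul_le (hM.abs_le r hr) (hdiv r hr (abs_potN_le k l m r (hg.abs_le_half hk hh hr)))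

set_option maxHeartbeats 1000000 in
/-- Integrating by parts all terms that are linear in `g`, and the quadratic ones that contain
`M ∂_r g`, leaves the interaction term, a quadratic form and small errors. -/
theorem abs_virial_sub_le (hk : 1 ≤ k) (hl : 0 < l) (hm : 0 < m) (hg : MemH g)
    (hM : IsWeight M M' K c) (hB : IsWeight B B' K ε) (hBM : ∀ r, 0 < r → |2 * (B r - M r)| ≤ c)
    (hρ1 : ∀ r, 0 < r → |(1 - M r) * sQ k l r| ≤ ρ) (hρ2 : ∀ r, 0 < r → |M r * sQ k m r| ≤ ρ)
    (hh : hSq k g ≤ 1 / 4) (hs : (l / m) ^ k ≤ 1) (hν : 0 < ν) :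
    |(∫ r in Ioi (0:ℝ), virDens k l m M B B' g r) - 8 * (k:ℝ) ^ 2 * (l / m) ^ k
      - qForm k (cos2P k l m) B g|
      ≤ (3 * ν + 4 * k * ρ + 3 * c + ε + 2 * K * √(hSq k g)) * hSq k g
        + ((16 * k ^ 4 + 64 * k ^ 4 * K ^ 2) / ν * (2 * Real.pi / k) + 64 * Real.pi * (k:ℝ) ^ 2)
          * ((l / m) ^ k * √((l / m) ^ k)) := by
  have hk0 : k ≠ 0 := by omega
  have hk1 : (1:ℝ) ≤ k := by exact_mod_cast hk
  have hk' : (0:ℝ) < k := by linarith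
  have hgm := hg.aemeasurable
  have hs0 : 0 < (l / m) ^ k := by positivity
  set σ := √((l / m) ^ k) with hσ
  have hσ0 : 0 ≤ σ := Real.sqrt_nonneg _
  have hσσ : σ ^ 2 = (l / m) ^ k := Real.sq_sqrt hs0.le
  have hσ1 : σ ≤ 1 := by nlinarith
  have hW := hasInt_sQ_add (k := k) hk0 hl hm
  obtain ⟨hIi, hIle⟩ := abs_integral_sQ_inter_sub_le hk0 hl hm hs
  obtain ⟨hNm, hTm, hWm⟩ := measurable_forceN_comp k l m hgm
  have hMm := hM.aemeasurable; have hMm' := hM.aemeasurable'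
  have hBm := hB.aemeasurable; have hBm' := hB.aemeasurable'
  have hmV := measurable_cos2P k l m
  have hmV' := measurable_cos2Q k l
  let Err : ℝ → ℝ := fun r => (k:ℝ) ^ 3 * sQ k l r * (cos2P k l m r - cos2Q k l r) * g r / r
    + (k * ((1 - M r) * sQ k l r) * forceN k l m (g r) r / r
      + k * (M r * sQ k m r) * forceN k l m (g r) r / r)
    + (B r - M r) * deriv g r ^ 2 * r + r * B' r * g r * deriv g r
    + (inter k l m r * (M r * deriv g r) + inter k l m r * (B r * g r / r))
    + B r * g r * forceN k l m (g r) r / r - M' r * potN k l m (g r) r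
  have hErr : ∀ r, 0 < r → |Err r| ≤ (3 * ν + 4 * k * ρ + 3 * c + ε + 2 * K * √(hSq k g))
      * hDens k g r + (16 * k ^ 4 + 64 * k ^ 4 * K ^ 2) / ν * σ ^ 3 * ((sQ k l r + sQ k m r) / r) := by
    intro r hr
    have hx := hg.abs_le_half hk hh hr
    refine virial_error_le hk1 hr ?_ (deriv_sq_mul_le_hDens hr) (two_mul_abs_le_hDens hk hr)
      (sQ_pos hl hr) (sQ_le_one _ _ _) (sQ_pos hm hr) (sQ_le_one _ _ _) (abs_cos2P_sub_le hm hr)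
      (by rw [hσσ]; exact sQ_mul_sQ_le hl hm hr) (sQ_mul_sQ_le_sqrt hl hm hr) hσ0 hσ1
      (abs_forceN_le k l m r hx) (abs_potN_le k l m r hx)
      (by rw [hσσ]; exact abs_inter_le hl hm hr) (hM.abs_le r hr) (hB.abs_le r hr)
      (hB.abs_deriv_le r hr) (hM.abs_deriv_le r hr) (hBM r hr) (hρ1 r hr) (hρ2 r hr)
      (hg.abs_le_sqrt hk hr) hν
    have e : (k:ℝ) ^ 2 * (g r ^ 2 / r) * r = (k:ℝ) ^ 2 * g r ^ 2 := by field_simp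
    rw [hDens_eq hr, add_mul, e]
    nlinarith [mul_nonneg (mul_nonneg (sq_nonneg (deriv g r)) hr.le) hr.le]
  have hErri : IntegrableOn Err (Ioi 0) :=
    hg.integrableOn_of_le_add k hW.1 (by fun_prop) hErr
  have hErrb := hg.abs_integral_le_add k hW.1 hErr
  have hD : HasInt _ (qForm k (cos2P k l m) B g) := HasInt.of_integrable <| qForm_integrable hg
    hBm hB.abs_le hmV.aemeasurable (fun r _ => abs_cos2P_le k l m r)
  have hG₁ := hasInt_deriv_sQ_mul_cQ_mul hk0 hl hg
  have hG₂ := hasInt_deriv_mul_potN hk hl hm hg hM hh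
  have H := (((((show HasInt _ _ from HasInt.of_integrable hIi).const_mul (k:ℝ)).add hD).add
    (HasInt.of_integrable hErri)).add (hG₁.const_mul ((k:ℝ) ^ 2))).add hG₂
  have H' : HasInt (virDens k l m M B B' g) _ := H.congr (ae_of_all _ fun r hr => by
    simp only [virDens, Err, cos2Q, force_eq]
    field_simp
    ring)
  rw [H'.2]
  have e3 : σ ^ 3 = (l / m) ^ k * σ := by rw [← hσσ]; ring
  rw [hW.2, e3] at hErrb
  rw [abs_le] at *
  constructor <;> linarith [hErrb.1, hErrb.2, hIle.1, hIle.2]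

end StaticVirialEstimate
/-! ### Bounds for the virial integral -/

section VirialEstimate
variable {k : ℕ} {l m r c K R ε θ M : ℝ} {g q γ γ' V : ℝ → ℝ}

lemma IsWeight.affine (h : IsWeight γ γ' M ε) (a b : ℝ) (ha : |a| = 1) (hb : 0 ≤ b) :
    IsWeight (fun r => a * γ r + b) (fun r => a * γ' r) (M + b) ε where
  hasDerivAt r hr := ((h.hasDerivAt r hr).const_mul a).add_const b
  continuousOn := continuousOn_const.mul h.continuousOn
  abs_le r hr := by
    simpa [abs_mul, ha, abs_of_nonneg hb] using (abs_add_le (a * γ r) b).trans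
      (add_le_add_left (abs_mul_le ha.le (h.abs_le r hr)) _)
  abs_deriv_le r hr := by
    rw [mul_left_comm, abs_mul, ha, one_mul]; exact h.abs_deriv_le r hr

lemma qForm_affine (hg : MemH g) (hγ : IsWeight γ γ' M ε) (a b : ℝ)
    (hVm : AEMeasurable V (volume.restrict (Ioi (0:ℝ)))) (hV : ∀ r, 0 < r → |V r| ≤ 1) :
    qForm k V (fun r => a * γ r + b) g = a * qForm k V γ g + b * qForm k V (fun _ => 1) g := by
  have h1 : HasInt _ (qForm k V γ g) := HasInt.of_integrable
    (qForm_integrable (k := k) hg hγ.aemeasurable hγ.abs_le hVm hV)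
  have h2 : HasInt _ (qForm k V (fun _ => 1) g) := HasInt.of_integrable
    (qForm_integrable (k := k) (M := 1) hg aemeasurable_const (by simp) hVm hV)
  exact (((h1.const_mul a).add (h2.const_mul b)).congr
    (g := fun r => (a * γ r + b) * (deriv g r ^ 2 + (k:ℝ) ^ 2 * V r * g r ^ 2 / r ^ 2) * r)
    (ae_of_all _ fun r _ => by ring)).2

/-- A slowly varying weight between `-c` and `K` can only lose a multiple of `c` in the quadratic
form, and gain at most `K` times the form itself. -/
lemma qForm_weight_bounds (hg : MemH g) (hk : 1 ≤ k) (hl : 0 < l) (hm : 0 < m) (hθ0 : 0 ≤ θ)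
    (hθ : θ ≤ 1) (hγ : IsWeight γ γ' K ε) (hc : 0 ≤ c) (hlow : ∀ r, 0 < r → -c ≤ γ r) :
    -c * qForm k (cos2P k l m) (fun _ => 1) g
        - (k * (3 * ε + 2 * (K + c) * θ) + 16 * (K + c) * √(l / m) ^ θ) * hSq k g
      ≤ qForm k (cos2P k l m) γ g ∧
    qForm k (cos2P k l m) γ g ≤ K * qForm k (cos2P k l m) (fun _ => 1) g
        + (k * (3 * ε + 2 * (K + K) * θ) + 16 * (K + K) * √(l / m) ^ θ) * hSq k g := by
  have hV := fun r (_ : 0 < r) => abs_cos2P_le k l m r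
  have hVm := (measurable_cos2P k l m).aemeasurable (μ := volume.restrict (Ioi (0:ℝ)))
  have hK := hγ.nonneg.1
  have h1 := qForm_two_bubble_ge hg hk hl hm hθ0 hθ (hγ.affine 1 c abs_one hc)
    fun r hr => by linarith [hlow r hr]
  have h2 := qForm_two_bubble_ge hg hk hl hm hθ0 hθ (hγ.affine (-1) K (by simp) hK)
    fun r hr => by linarith [(abs_le.1 (hγ.abs_le r hr)).2]
  rw [qForm_affine hg hγ _ _ hVm hV] at h1 h2
  constructor <;> linarith

lemma virial_arith {κ C S h D DB X E A T T' τ c K : ℝ} (hS : 0 ≤ S) (hκ : 0 ≤ κ)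
    (hτ : 0 < τ) (hc : 0 ≤ c) (hcτ : c ≤ τ) (hK : 0 < K) (hh : 0 ≤ h)
    (hhS : h ≤ C * S)
    (hD : D ≤ (16 * κ + 1) * S) (hX : |X - 8 * κ ^ 2 * S - DB| ≤ A * h + E * (S * √S))
    (h1 : -c * D - T * h ≤ DB) (h2 : DB ≤ K * D + T' * h)
    (hA : A ≤ τ * (8 + 4 * κ + 3 * K)) (hE : E * √S ≤ τ)
    (hT : T ≤ τ * (κ * (7 * K + 8) + 32 * (K + 1)))
    (hT' : T' ≤ τ * (κ * (7 * K + 8) + 32 * (K + 1))) :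
    (8 * κ ^ 2 - τ * (C * (8 + 4 * κ + 3 * K) + 1 + (16 * κ + 1)
        + C * (κ * (7 * K + 8) + 32 * (K + 1)))) * S ≤ X ∧
      X ≤ (8 * κ ^ 2 + K * (16 * κ + 1) + τ * (C * (8 + 4 * κ + 3 * K) + 1 + (16 * κ + 1)
        + C * (κ * (7 * K + 8) + 32 * (K + 1)))) * S := by
  have a1 : A * h ≤ τ * (8 + 4 * κ + 3 * K) * (C * S) := by gcongr
  have a2 : T * h ≤ τ * (κ * (7 * K + 8) + 32 * (K + 1)) * (C * S) := by gcongr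
  have a3 : T' * h ≤ τ * (κ * (7 * K + 8) + 32 * (K + 1)) * (C * S) := by gcongr
  have a4 : E * (S * √S) ≤ τ * S := by nlinarith
  have a5 : c * D ≤ τ * ((16 * κ + 1) * S) := (mul_le_mul_of_nonneg_left hD hc).trans (by gcongr)
  have a6 : K * D ≤ K * ((16 * κ + 1) * S) := by gcongr
  have a7 : 0 ≤ τ * ((16 * κ + 1) * S) := by positivity
  obtain ⟨x1, x2⟩ := abs_le.1 hX
  constructor <;> linarith

/-- The static form of the estimate on `b'`. The small parameter `τ` is also the exponent of the
cutoff that separates the bubbles, and `c₁ = τ²` since the weight varies at the rate `√c`. -/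
theorem exists_virial_estimate {Z : ℝ → ℝ} (hk : 1 ≤ k) (hK : 0 < K) (hZc : Continuous Z)
    (hZs : HasCompactSupport Z) (hN : 0 < pair Z (LambdaQ k)) {δ : ℝ} (hδ : 0 < δ) :
    ∃ c₁ R₁ : ℝ, 0 < c₁ ∧ 0 < R₁ ∧ ∀ c R : ℝ, 0 < c → c ≤ c₁ → R₁ ≤ R →
      ∀ q : ℝ → ℝ, IsVirialWeight c R K q →
      ∃ η : ℝ, 0 < η ∧ ∀ (l m : ℝ) (φ v : ℝ → ℝ), 0 < l → 0 < m →
      MemH0 φ v → energy k φ v = 2 * energy k (Q k) (fun _ => 0) →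
      pair (rescaleL2 l Z) (remainder k l m φ) = 0 →
      pair (rescaleL2 m Z) (remainder k l m φ) = 0 →
      hSq k (remainder k l m φ) ≤ η → (l / m) ^ k ≤ η →
      (8 * (k:ℝ) ^ 2 - δ) * (l / m) ^ k ≤ virInt k q l m (remainder k l m φ) ∧
      virInt k q l m (remainder k l m φ) ≤ (8 * (k:ℝ) ^ 2 + K * (16 * k + 1) + δ) * (l / m) ^ k := by
  obtain ⟨C, hC, hen⟩ := exists_energy_control hk hZc hZs hN
  obtain ⟨η₁, hη₁, hen⟩ := hen 1 one_pos
  have hk0 : k ≠ 0 := by omega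
  have hk1 : (1:ℝ) ≤ k := by exact_mod_cast hk
  have hk' : (0:ℝ) < k := by linarith
  set G : ℝ := C * (8 + 4 * k + 3 * K) + 1 + (16 * k + 1)
        + C * (k * (7 * K + 8) + 32 * (K + 1)) with hG
  have hG0 : 0 < G := by positivity
  obtain ⟨τ, hτ, hτ1, hτG⟩ : ∃ τ : ℝ, 0 < τ ∧ τ ≤ 1 ∧ τ * G ≤ δ :=
    ⟨min 1 (δ / G), by positivity, min_le_left _ _, (le_div_iff₀ hG0).1 (min_le_right _ _)⟩
  refine ⟨τ ^ 2, max 1 (2 * (1 + K) / τ), by positivity, lt_max_of_lt_left one_pos,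
    fun c R hc hcc hR q hq => ?_⟩
  have hR1 : 1 ≤ R := (le_max_left _ _).trans hR
  have hRτ : 2 * (1 + K) / R ≤ τ := by
    have := (le_max_right _ _).trans hR
    rw [div_le_iff₀ hτ] at this
    rw [div_le_iff₀ (by linarith)]; linarith
  have hsc : √c ≤ τ := by rw [Real.sqrt_le_left hτ.le]; exact hcc
  have hcτ : c ≤ τ := by nlinarith
  have hc1 : c ≤ 1 := hcτ.trans hτ1
  obtain ⟨R', hRR, hR'⟩ := hq.exists_deriv_eq_zero
  have hR'0 : 0 < R' := by linarith
  set E : ℝ := (16 * k ^ 4 + 64 * k ^ 4 * K ^ 2) / τ * (2 * Real.pi / k) + 64 * Real.pi * (k:ℝ) ^ 2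
    with hE
  have hpi := Real.pi_pos
  have hE0 : 0 ≤ E := by positivity
  have hcont : ∀ f : ℝ → ℝ, ContinuousAt f 0 → f 0 = 0 → ∀ᶠ x in 𝓝[>] (0:ℝ), f x < τ := by
    intro f hf h0
    exact nhdsWithin_le_nhds (hf.eventually_lt_const (by rwa [h0]))
  have f1 := hcont (fun x => E * √x) (by fun_prop) (by simp)
  have f2 := hcont (fun x => 2 * K * R' ^ k * x) (by fun_prop) (by simp)
  have f3 := hcont (fun x => (x ^ (1 / (2 * k : ℝ))) ^ τ)
    (ContinuousAt.rpow_const (Real.continuousAt_rpow_const _ _ (Or.inr (by positivity)))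
      (Or.inr hτ.le))
    (by rw [Real.zero_rpow (by positivity), Real.zero_rpow hτ.ne'])
  have f4 := hcont (fun x => √x) (by fun_prop) (by simp)
  have f5 : ∀ᶠ x in 𝓝[>] (0:ℝ), x < η₁ := nhdsWithin_le_nhds (eventually_lt_nhds hη₁)
  have f6 : ∀ᶠ x in 𝓝[>] (0:ℝ), x < 1 / 4 :=
    nhdsWithin_le_nhds (eventually_lt_nhds (by norm_num))
  obtain ⟨η, ⟨hη1, hη2, hη3, hη4⟩, ⟨hη5, hη6⟩, hη0⟩ := ((f1.and (f2.and (f3.and f4))).and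
    ((f5.and f6).and self_mem_nhdsWithin)).exists
  have hη0 : 0 < η := hη0
  refine ⟨η, hη0, fun l m φ v hl hm h0 hEn ho1 ho2 hgη hSη => ?_⟩
  obtain ⟨hhS, hD0, hVD⟩ := hen l m φ v hl hm h0 hEn ho1 ho2 (hgη.trans hη5.le) (hSη.trans hη5.le)
  have hg : MemH (remainder k l m φ) := h0.memH.sub (memH_twoBubble hk0 hl hm)
  have hV : 0 ≤ l2Sq v := setIntegral_nonneg measurableSet_Ioi fun r (hr : 0 < r) => by positivity
  have hS0 : 0 ≤ (l / m) ^ k := by positivity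
  have hB := hq.isWeight_virB hc hl
  have hM := hq.isWeight_virM hl
  have hKc : K + c + 1 ≤ K + 2 := by linarith
  have hετ : (K + c + 1) * √c ≤ (K + 2) * τ := by gcongr
  have hσθ : √(l / m) ^ τ ≤ τ := by
    refine le_trans ?_ hη3.le
    gcongr; exact (sqrt_div_le_rpow hk hl hm).trans (by gcongr)
  have hσθ0 : 0 ≤ √(l / m) ^ τ := by positivity
  obtain ⟨hDl, hDu⟩ := qForm_weight_bounds hg hk hl hm hτ.le hτ1 hB hc.le
    fun r hr => hq.neg_le_virB (div_pos hr hl)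
  have hmain := abs_virial_sub_le (ρ := τ) (ν := τ) hk hl hm hg hM hB
    (fun r hr => hq.abs_virB_sub_virM_le (div_pos hr hl))
    (fun r hr => ?_) (fun r hr => ?_) (hgη.trans hη6.le) (hSη.trans (by linarith)) hτ
  · have hsh : √(hSq k (remainder k l m φ)) ≤ τ := (Real.sqrt_le_sqrt hgη).trans hη4.le
    have key := virial_arith (E := E) (T := k * (3 * ((K + c + 1) * √c) + 2 * (K + c) * τ)
        + 16 * (K + c) * √(l / m) ^ τ)
      (T' := k * (3 * ((K + c + 1) * √c) + 2 * (K + K) * τ) + 16 * (K + K) * √(l / m) ^ τ)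
      hS0 hk'.le hτ hc.le hcτ hK (hSq_nonneg _ _) hhS (by linarith) hmain hDl hDu ?_ ?_ ?_ ?_
    · rw [← hG] at key
      refine ⟨le_trans (mul_le_mul_of_nonneg_right ?_ hS0) key.1,
        key.2.trans (mul_le_mul_of_nonneg_right ?_ hS0)⟩ <;> linarith
    · linarith [mul_le_mul_of_nonneg_left hsh hK.le]
    · exact le_trans (by gcongr) hη1.le
    · have x1 : k * (3 * ((K + c + 1) * √c) + 2 * (K + c) * τ)
          ≤ k * (3 * ((K + 2) * τ) + 2 * (K + 1) * τ) := by gcongr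
      have x2 : 16 * (K + c) * √(l / m) ^ τ ≤ 16 * (K + 1) * τ := by gcongr
      have x3 : 0 ≤ τ * (2 * k * K + 16 * (K + 1)) := by positivity
      linarith
    · have x1 : k * (3 * ((K + c + 1) * √c) + 2 * (K + K) * τ)
          ≤ k * (3 * ((K + 2) * τ) + 2 * (K + K) * τ) := by gcongr
      have x2 : 16 * (K + K) * √(l / m) ^ τ ≤ 16 * (K + K) * τ := by gcongr
      have x3 : 0 ≤ τ * (2 * k + 32) := by positivity
      linarith
  · rcases lt_or_ge (r / l) R with h | h
    · rw [hq.virM_eq_one (div_pos hr hl) h]; simpa using hτ.le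
    · have h1 := hq.abs_virM_le (div_pos hr hl)
      have h2 := sQ_le_two_mul_pow_inv (k := k) hl hr
      have h3 : (l / r) ^ k ≤ 1 / R := by
        have e : l / r ≤ 1 / R := by
          rw [← one_div_div]; gcongr
        have e1 : l / r ≤ 1 := e.trans ((div_le_one (by linarith)).2 hR1)
        exact (pow_le_of_le_one (by positivity) e1 hk0).trans e
      refine (abs_mul_le (A := 1 + K) ((abs_sub _ _).trans (by rw [abs_one]; linarith))
        ((abs_of_pos (sQ_pos hl hr)).trans_le (h2.trans (mul_le_mul_of_nonneg_left h3 zero_le_two)))).trans (le_trans ?_ hRτ)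
      exact le_of_eq (by ring)
  · rcases le_or_gt (r / l) R' with h | h
    · have h1 := hq.abs_virM_le (div_pos hr hl)
      have h2 := sQ_le_two_mul_pow (k := k) hm hr
      rw [pow_div_eq hl hm k r] at h2
      have h3 : (r / l) ^ k ≤ R' ^ k := by gcongr
      refine (abs_mul_le h1 ((abs_of_pos (sQ_pos hm hr)).trans_le (h2.trans
        (mul_le_mul_of_nonneg_left (mul_le_mul hSη h3 (by positivity) hη0.le) zero_le_two)))).trans
        (le_trans (le_of_eq ?_) hη2.le)
      ring
    · rw [virM, hR' _ h]; simpa using hτ.le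

end VirialEstimate

/-! ### The Hilbert space `L²(r dr)` -/

section HilbertSpace
variable {f g : ℝ → ℝ} {x y : ℝ → ℝ}

/-- The Hilbert space `L²((0, ∞), r dr)`. -/
abbrev RadL2 : Type := Lp ℝ 2 radMeas

open Classical in
/-- The class in `L²(r dr)` of a function (`0` if the function is not square integrable). -/
noncomputable def toX (f : ℝ → ℝ) : RadL2 := if h : MemLp f 2 radMeas then h.toLp f else 0

lemma coe_toX (h : MemL2 f) : ∀ᵐ r : ℝ, 0 < r → toX f r = f r := by
  have h' := memLp_radMeas.2 h
  rw [← ae_radMeas, toX, dif_pos h']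
  exact h'.coeFn_toLp

lemma memL2_coe (u : RadL2) : MemL2 u := memLp_radMeas.1 (Lp.memLp u)

lemma toX_congr (h : ∀ᵐ r : ℝ, 0 < r → f r = g r) (hg : MemL2 g) : toX f = toX g := by
  have h' : f =ᵐ[radMeas] g := ae_radMeas.2 h
  have hg' := memLp_radMeas.2 hg
  have hf' := hg'.ae_eq h'.symm
  rw [toX, toX, dif_pos hf', dif_pos hg', MemLp.toLp_eq_toLp_iff]
  exact h'

lemma toX_coe (u : RadL2) : toX u = u := by
  rw [toX, dif_pos (Lp.memLp u), Lp.toLp_coeFn]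

lemma eq_toX {u : RadL2} (h : ∀ᵐ r : ℝ, 0 < r → u r = f r) (hf : MemL2 f) : u = toX f := by
  rw [← toX_coe u]; exact toX_congr h hf

lemma toX_add (hf : MemL2 f) (hg : MemL2 g) : toX (fun r => f r + g r) = toX f + toX g := by
  have hf' := memLp_radMeas.2 hf; have hg' := memLp_radMeas.2 hg
  have h := hf'.add hg'
  rw [toX, toX, toX, dif_pos hf', dif_pos hg', ← MemLp.toLp_add]
  exact dif_pos h

lemma toX_sub (hf : MemL2 f) (hg : MemL2 g) : toX (fun r => f r - g r) = toX f - toX g := by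
  have hf' := memLp_radMeas.2 hf; have hg' := memLp_radMeas.2 hg
  have h := hf'.sub hg'
  rw [toX, toX, toX, dif_pos hf', dif_pos hg', ← MemLp.toLp_sub]
  exact dif_pos h

lemma toX_const_mul (c : ℝ) (hf : MemL2 f) : toX (fun r => c * f r) = c • toX f := by
  have hf' := memLp_radMeas.2 hf
  have h := hf'.const_mul c
  rw [toX, toX, dif_pos hf', ← MemLp.toLp_const_smul]
  exact dif_pos h

lemma inner_eq_pair (u v : RadL2) : inner ℝ u v = pair u v := by
  rw [L2.inner_def, integral_radMeas, pair]
  refine integral_congr_Ioi fun r _ => ?_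
  simp [mul_comm]

lemma pair_congr {f' g' : ℝ → ℝ} (hf : ∀ᵐ r : ℝ, 0 < r → f r = f' r)
    (hg : ∀ᵐ r : ℝ, 0 < r → g r = g' r) : pair f g = pair f' g' := by
  refine setIntegral_congr_ae measurableSet_Ioi ?_
  filter_upwards [hf, hg] with r h1 h2 hr
  rw [h1 hr, h2 hr]

lemma inner_toX (hf : MemL2 f) (hg : MemL2 g) : inner ℝ (toX f) (toX g) = pair f g := by
  rw [inner_eq_pair]; exact pair_congr (coe_toX hf) (coe_toX hg)

lemma inner_toX_right (u : RadL2) (hg : MemL2 g) : inner ℝ u (toX g) = pair u g := by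
  rw [inner_eq_pair]; exact pair_congr (ae_of_all _ fun _ _ => rfl) (coe_toX hg)

lemma MemL2.hasInt (hf : MemL2 f) (hg : MemL2 g) : HasInt (fun r => f r * g r * r) (pair f g) :=
  .of_integrable (hf.integrable_mul hg)

lemma integral_eq_inner_toX {F : ℝ → ℝ} (u : RadL2) (hg : MemL2 g)
    (h : ∀ r, 0 < r → F r = u r * g r * r) : ∫ r in Ioi (0:ℝ), F r = inner ℝ u (toX g) :=
  (integral_congr_Ioi h).trans (inner_toX_right u hg).symm

lemma norm_toX_sq (hf : MemL2 f) : ‖toX f‖ ^ 2 = l2Sq f := by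
  rw [← real_inner_self_eq_norm_sq, inner_toX hf hf, pair, l2Sq]
  refine integral_congr_Ioi fun r _ => ?_
  ring

lemma norm_toX (hf : MemL2 f) : ‖toX f‖ = √(l2Sq f) := by
  rw [← norm_toX_sq hf, Real.sqrt_sq (norm_nonneg _)]

lemma l2Sq_nonneg (f : ℝ → ℝ) : 0 ≤ l2Sq f :=
  setIntegral_nonneg measurableSet_Ioi fun r (hr : 0 < r) => by positivity

lemma l2Sq_le_of_abs_le (hf : MemL2 f) (hg : MemL2 g) {C : ℝ} (hC : 0 ≤ C)
    (h : ∀ r, 0 < r → |f r| ≤ C * |g r|) : l2Sq f ≤ C ^ 2 * l2Sq g := by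
  rw [l2Sq, l2Sq, ← integral_const_mul]
  refine setIntegral_mono_on hf.2 (hg.2.const_mul _) measurableSet_Ioi fun r (hr : 0 < r) => ?_
  rw [← mul_assoc, ← mul_pow]
  refine mul_le_mul_of_nonneg_right ?_ hr.le
  rw [sq_le_sq, abs_mul, abs_of_nonneg hC]; exact h r hr

lemma norm_toX_le (hg : MemL2 g) {C : ℝ} (hC : 0 ≤ C)
    (hm : AEMeasurable f (volume.restrict (Ioi (0:ℝ)))) (h : ∀ r, 0 < r → |f r| ≤ C * |g r|) :
    ‖toX f‖ ≤ C * ‖toX g‖ := by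
  have hf := hg.of_abs_le C hm h
  refine le_of_sq_le_sq ?_ (by positivity)
  rw [mul_pow, norm_toX_sq hf, norm_toX_sq hg]
  exact l2Sq_le_of_abs_le hf hg hC h

lemma MemL2.bdd_mul {a : ℝ → ℝ} {C : ℝ} (hf : MemL2 f)
    (ha : AEMeasurable a (volume.restrict (Ioi (0:ℝ)))) (hC : ∀ r, 0 < r → |a r| ≤ C) :
    MemL2 fun r => a r * f r :=
  hf.of_abs_le C (ha.mul hf.aemeasurable) fun r hr => abs_mul_le_right _ (hC r hr)

/-- Multiplication by a bounded measurable function, as an operator on `L²(r dr)`. -/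
noncomputable def mulOp (a : ℝ → ℝ) (C : ℝ) (ha : AEMeasurable a (volume.restrict (Ioi (0:ℝ))))
    (hC : ∀ r, 0 < r → |a r| ≤ C) : RadL2 →L[ℝ] RadL2 :=
  have hm : ∀ u : RadL2, MemL2 (fun r => a r * u r) := fun u => (memL2_coe u).bdd_mul ha hC
  LinearMap.mkContinuous
    { toFun := fun u => toX fun r => a r * u r
      map_add' := fun u v => by
        rw [← toX_add (hm u) (hm v)]
        refine toX_congr ?_ ((hm u).add (hm v))
        filter_upwards [ae_radMeas.1 (Lp.coeFn_add u v)] with r h hr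
        rw [h hr, Pi.add_apply]; ring
      map_smul' := fun c u => by
        rw [RingHom.id_apply, ← toX_const_mul c (hm u)]
        refine toX_congr ?_ ((hm u).const_mul c)
        filter_upwards [ae_radMeas.1 (Lp.coeFn_smul c u)] with r h hr
        rw [h hr, Pi.smul_apply, smul_eq_mul]; ring } C
    fun u => by
      have := norm_toX_le (memL2_coe u) ((abs_nonneg _).trans (hC 1 one_pos)) (hm u).aemeasurable
        fun r hr => abs_mul_le_right _ (hC r hr)
      rwa [toX_coe] at this

lemma mulOp_toX {a : ℝ → ℝ} {C : ℝ} (ha : AEMeasurable a (volume.restrict (Ioi (0:ℝ))))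
    (hC : ∀ r, 0 < r → |a r| ≤ C) (hf : MemL2 f) :
    mulOp a C ha hC (toX f) = toX fun r => a r * f r := by
  refine toX_congr ?_ (hf.bdd_mul ha hC)
  filter_upwards [coe_toX hf] with r h hr
  rw [h hr]

lemma coe_mulOp {a : ℝ → ℝ} {C : ℝ} (ha : AEMeasurable a (volume.restrict (Ioi (0:ℝ))))
    (hC : ∀ r, 0 < r → |a r| ≤ C) (u : RadL2) :
    ∀ᵐ r : ℝ, 0 < r → mulOp a C ha hC u r = a r * u r := by
  have h := mulOp_toX ha hC (memL2_coe u)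
  rw [toX_coe] at h
  rw [h]
  exact coe_toX ((memL2_coe u).bdd_mul ha hC)

end HilbertSpace

/-! ### Averaging in time -/

section Steklov
variable {X Y : Type*} [NormedAddCommGroup X] [InnerProductSpace ℝ X] [CompleteSpace X]
  [NormedAddCommGroup Y] [NormedSpace ℝ Y]

/-- The average of `u` over `[x, x + e]`, with the value `u x` for `e = 0`. -/
noncomputable def average (u : ℝ → Y) (e x : ℝ) : Y := ∫ θ in (0:ℝ)..1, u (x + e * θ)

lemma continuous_average {u : ℝ → Y} (hu : Continuous u) :
    Continuous fun p : ℝ × ℝ => average u p.1 p.2 :=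
  intervalIntegral.continuous_parametric_intervalIntegral_of_continuous' (by fun_prop) 0 1

lemma integral_eq_smul_average (u : ℝ → Y) {e : ℝ} (he : e ≠ 0) (x : ℝ) :
    ∫ τ in x..x + e, u τ = e • average u e x := by
  rw [average, intervalIntegral.integral_comp_add_mul (f := u) he]
  simp [smul_smul, he]

variable [CompleteSpace Y]

/-- If the increments of `v` and `a` over every subinterval satisfy a quadratic identity, then
`⟪v, a⟫` is the integral of the quadratic expression: apply the identity to
`⟪∫ v, ∫ a⟫` over short intervals. No differentiability of `v` and `a` is needed. -/
theorem inner_sub_eq_integral_of_increments {v a : ℝ → X} {w : ℝ → Y} {B : Y → ℝ} {t₁ t₂ : ℝ}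
    (ht : t₁ < t₂) (hv : Continuous v) (ha : Continuous a)
    (hw : Continuous w) (hB : Continuous B) (hB2 : ∀ (c : ℝ) y, B (c • y) = c ^ 2 * B y)
    (h : ∀ s s', t₁ ≤ s → s < s' → s' ≤ t₂ →
      inner ℝ (v s' - v s) (∫ τ in s..s', a τ) + inner ℝ (∫ τ in s..s', v τ) (a s' - a s)
        = B (∫ τ in s..s', w τ)) :
    inner ℝ (v t₂) (a t₂) - inner ℝ (v t₁) (a t₁) = ∫ τ in t₁..t₂, B (w τ) := by
  have hav := continuous_average hv
  have haa := continuous_average ha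
  have haw := continuous_average hw
  let L : ℝ → ℝ := fun e => inner ℝ (average v e (t₂ - e)) (average a e (t₂ - e))
    - inner ℝ (average v e t₁) (average a e t₁)
  let Rr : ℝ → ℝ := fun e => ∫ x in t₁..t₂ - e, B (average w e x)
  have hL : Continuous L := by fun_prop
  have hR : Continuous Rr := by fun_prop
  have hLR : ∀ e, 0 < e → e < t₂ - t₁ → L e = Rr e := by
    intro e he het
    have hd : ∀ {u : ℝ → X}, Continuous u → ∀ x, HasDerivAt (fun x => ∫ τ in x..x + e, u τ)
        (u (x + e) - u x) x := fun {u} hu x => by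
      have e1 : (fun x => ∫ τ in x..x + e, u τ) = fun x => (∫ τ in (0:ℝ)..x + e, u τ)
          - ∫ τ in (0:ℝ)..x, u τ := by
        funext x
        rw [intervalIntegral.integral_interval_sub_left (hu.intervalIntegrable _ _)
          (hu.intervalIntegrable _ _)]
      rw [e1]
      have h1 := hu.integral_hasStrictDerivAt 0 x
      have h2 := (hu.integral_hasStrictDerivAt 0 (x + e)).hasDerivAt.comp_add_const x e
      exact h2.sub h1.hasDerivAt
    have hder : ∀ x ∈ uIcc t₁ (t₂ - e), HasDerivAt (fun x => (1 / e ^ 2) *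
        inner ℝ (∫ τ in x..x + e, v τ) (∫ τ in x..x + e, a τ)) (B (average w e x)) x := by
      intro x hx
      rw [uIcc_of_le (by linarith)] at hx
      refine (((hd hv x).inner ℝ (hd ha x)).const_mul (1 / e ^ 2)).congr_deriv ?_
      have := h x (x + e) hx.1 (by linarith) (by linarith [hx.2])
      rw [add_comm, this, integral_eq_smul_average w he.ne', hB2]
      field_simp
    have hcont : Continuous fun x => B (average w e x) := by fun_prop
    have := intervalIntegral.integral_eq_sub_of_hasDerivAt hder (hcont.intervalIntegrable _ _)
    simp only [Rr]
    rw [this]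
    simp only [integral_eq_smul_average _ he.ne', inner_smul_left, inner_smul_right, L]
    simp only [conj_trivial]
    field_simp
  have hcl : L 0 = Rr 0 := by
    have h1 : Tendsto L (𝓝[>] 0) (𝓝 (L 0)) := hL.continuousAt.mono_left nhdsWithin_le_nhds
    have h2 : Tendsto Rr (𝓝[>] 0) (𝓝 (Rr 0)) := hR.continuousAt.mono_left nhdsWithin_le_nhds
    refine tendsto_nhds_unique h1 (h2.congr' ?_)
    filter_upwards [Ioo_mem_nhdsGT (by linarith : 0 < t₂ - t₁)] with e he
    exact (hLR e he.1 he.2).symm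
  simpa [L, Rr, average, intervalIntegral.integral_const] using hcl

/-- The fundamental theorem of calculus within an arbitrary interval. -/
lemma hasDerivWithinAt_of_sub_eq_integral {G F : ℝ → Y} {J : Set ℝ} {t0 : ℝ} (hJ : J.OrdConnected)
    (ht0 : t0 ∈ J) (hF : ContinuousWithinAt F J t0) (hFi : ContinuousOn F J)
    (h : ∀ t ∈ J, G t - G t0 = ∫ τ in t0..t, F τ) : HasDerivWithinAt G (F t0) J t0 := by
  rw [hasDerivWithinAt_iff_isLittleO, Asymptotics.isLittleO_iff]
  intro ε hε
  have h1 : ∀ᶠ t in 𝓝[J] t0, ‖F t - F t0‖ < ε := by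
    have := Metric.tendsto_nhds.1 hF ε hε
    simpa [dist_eq_norm] using this
  obtain ⟨ρ, hρ, hρ'⟩ := Metric.mem_nhdsWithin_iff.1 h1
  filter_upwards [self_mem_nhdsWithin, mem_nhdsWithin_of_mem_nhds (Metric.ball_mem_nhds t0 hρ)]
    with t ht htρ
  have hsub : uIcc t0 t ⊆ J := hJ.uIcc_subset ht0 ht
  have hi : IntervalIntegrable F volume t0 t := (hFi.mono hsub).intervalIntegrable
  have e1 : G t - G t0 - (t - t0) • F t0 = ∫ τ in t0..t, (F τ - F t0) := by
    rw [intervalIntegral.integral_sub hi intervalIntegrable_const, h t ht,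
      intervalIntegral.integral_const]
  rw [e1, Real.norm_eq_abs]
  refine intervalIntegral.norm_integral_le_of_norm_le_const fun τ hτ => ?_
  have hτ' := uIoc_subset_uIcc hτ
  have : τ ∈ Metric.ball t0 ρ := by
    rw [Metric.mem_ball, Real.dist_eq] at htρ ⊢
    refine lt_of_le_of_lt ?_ htρ
    have := abs_sub_left_of_mem_uIcc hτ'
    simpa [abs_sub_comm] using this
  exact (hρ' ⟨this, hsub hτ'⟩).le

end Steklov

/-! ### Solutions as curves in `L²(r dr)` -/

section Curves
variable {k : ℕ} {J : Set ℝ} {ψ ψt : ℝ → ℝ → ℝ} {l m : ℝ} {f g φ : ℝ → ℝ}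

lemma l2Sq_congr (h : ∀ᵐ r : ℝ, 0 < r → f r = g r) : l2Sq f = l2Sq g := by
  refine setIntegral_congr_ae measurableSet_Ioi ?_
  filter_upwards [h] with r h hr
  rw [h hr]

lemma MemH.l2Sq_deriv_le (hg : MemH g) (k : ℕ) : l2Sq (deriv g) ≤ hSq k g :=
  setIntegral_mono_on hg.integrable_deriv (hg.integrable_hDens k) measurableSet_Ioi
    fun _ hr => deriv_sq_mul_le_hDens hr

lemma MemH.l2Sq_div_le (hg : MemH g) (hk : 1 ≤ k) : l2Sq (fun r => g r / r) ≤ hSq k g := by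
  refine setIntegral_mono_on hg.memL2_div.integrable (hg.integrable_hDens k) measurableSet_Ioi
    fun r (hr : 0 < r) => ?_
  rw [show (g r / r) ^ 2 * r = g r ^ 2 / r by field_simp]; exact sq_div_le_hDens hk hr

lemma MemL2.locallyIntegrableOn (h : MemL2 f) :
    LocallyIntegrableOn (fun r => f r * r) (Ioi 0) := by
  rw [locallyIntegrableOn_iff isOpen_Ioi.isLocallyClosed]
  intro s hs hc
  have h1 : IntegrableOn (fun r => f r ^ 2 * r) s := h.integrable.mono_set hs
  have h2 : IntegrableOn (fun r : ℝ => r) s := continuousOn_id.integrableOn_compact hc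
  have hm := h.aemeasurable.mono_measure (Measure.restrict_mono hs le_rfl)
  refine (h1.add h2).mono' (AEMeasurable.aestronglyMeasurable (by fun_prop)) ?_
  filter_upwards [ae_restrict_mem hc.measurableSet] with r hr
  have hr0 : (0:ℝ) < r := hs hr
  simp only [Pi.add_apply, Real.norm_eq_abs]
  rw [abs_mul, abs_of_pos hr0]
  nlinarith [sq_nonneg (|f r| - 1), sq_abs (f r), mul_nonneg (sq_nonneg (|f r| - 1)) hr0.le]

lemma MemL2.locallyIntegrableOn' (h : MemL2 f) : LocallyIntegrableOn f (Ioi 0) := by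
  have h2 := h.locallyIntegrableOn.continuousOn_mul (g := fun r => 1 / r)
    (continuousOn_const.div continuousOn_id fun r (hr : 0 < r) => hr.ne') isOpen_Ioi.isLocallyClosed
  rw [locallyIntegrableOn_iff isOpen_Ioi.isLocallyClosed] at h2 ⊢
  refine fun s hs hc => (h2 s hs hc).congr_fun (fun r hr => ?_) hc.measurableSet
  have : (0:ℝ) < r := hs hr
  field_simp

lemma LocAC.locallyIntegrableOn (h : LocAC f) : LocallyIntegrableOn f (Ioi 0) :=
  h.continuousOn.locallyIntegrableOn measurableSet_Ioi

lemma IsTest.memL2 (h : IsTest φ) : MemL2 φ := by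
  have hc := h.contDiff.continuous
  refine ⟨hc.aestronglyMeasurable, (Continuous.integrable_of_hasCompactSupport
    (by fun_prop) ?_).integrableOn⟩
  rw [show (fun r => φ r ^ 2 * r) = fun r => φ r * (φ r * r) by funext r; ring]
  exact h.hasCompactSupport.mul_right

lemma IsTest.memL2_div (h : IsTest φ) : MemL2 (fun r => φ r / r) := by
  obtain ⟨a, b, ha, hab, -, h0⟩ := h.exists_Icc
  have hc := h.contDiff.continuous.measurable
  refine h.memL2.of_abs_le (1 / a) (by fun_prop) fun r hr => ?_
  by_cases hm : r ∈ Ioo a b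
  · rw [abs_div, abs_of_pos hr, div_eq_mul_one_div, mul_comm]
    gcongr; exact hm.1.le
  · rw [h0 r hm]; simp

lemma intervalIntegral_inner_left {v : ℝ → RadL2} {s s' : ℝ} (hv : IntervalIntegrable v volume s s')
    (x : RadL2) : inner ℝ (∫ τ in s..s', v τ) x = ∫ τ in s..s', inner ℝ (v τ) x := by
  simpa only [innerSL_apply_apply, real_inner_comm x] using
    ((innerSL ℝ x).intervalIntegral_comp_comm hv).symm

lemma sub_eq_integral_of_hasDerivWithinAt {F F' : ℝ → ℝ} (hJ : J.OrdConnected)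
    (hd : ∀ t ∈ J, HasDerivWithinAt F (F' t) J t) (hc : ContinuousOn F' J) {s s' : ℝ} (hs : s ∈ J)
    (hs' : s' ∈ J) (h : s ≤ s') : F s' - F s = ∫ τ in s..s', F' τ := by
  have hsub : Icc s s' ⊆ J := hJ.out hs hs'
  refine (intervalIntegral.integral_eq_sub_of_hasDerivAt_of_le h
    (fun t ht => ((hd t (hsub ht)).continuousWithinAt).mono hsub) (fun t ht => ?_) ?_).symm
  · exact (hd t (hsub (Ioo_subset_Icc_self ht))).hasDerivAt
      (mem_of_superset (Icc_mem_nhds ht.1 ht.2) hsub)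
  · exact ContinuousOn.intervalIntegrable (by rw [uIcc_of_le h]; exact hc.mono hsub)

/-- `ψ_t` as a curve in `L²(r dr)`. -/
noncomputable def vC (ψt : ℝ → ℝ → ℝ) (t : ℝ) : RadL2 := toX (ψt t)

/-- The radial derivative of `ψ - (Q_l - Q_m)` as a curve in `L²(r dr)`, for fixed `l` and `m`. -/
noncomputable def pC (k : ℕ) (l m : ℝ) (ψ : ℝ → ℝ → ℝ) (t : ℝ) : RadL2 :=
  toX (deriv (remainder k l m (ψ t)))

/-- `(ψ - (Q_l - Q_m)) / r` as a curve in `L²(r dr)`, for fixed `l` and `m`. -/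
noncomputable def zC (k : ℕ) (l m : ℝ) (ψ : ℝ → ℝ → ℝ) (t : ℝ) : RadL2 :=
  toX fun r => remainder k l m (ψ t) r / r

/-- `r` times the nonlinearity, as a curve in `L²(r dr)`. -/
noncomputable def fC (k : ℕ) (l m : ℝ) (ψ : ℝ → ℝ → ℝ) (t : ℝ) : RadL2 :=
  toX fun r => force k l m (remainder k l m (ψ t) r) r / r

lemma abs_force_sub_le (k : ℕ) (l m x y r : ℝ) :
    |force k l m x r - force k l m y r| ≤ (k:ℝ) ^ 2 * |x - y| := by
  have h := Real.abs_sin_sub_sin_le (2 * (twoBubble k l m r + x)) (2 * (twoBubble k l m r + y))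
  rw [show 2 * (twoBubble k l m r + x) - 2 * (twoBubble k l m r + y) = 2 * (x - y) by ring, abs_mul, abs_two] at h
  rw [show force k l m x r - force k l m y r = (k:ℝ) ^ 2 / 2 * (Real.sin (2 * (twoBubble k l m r + x))
    - Real.sin (2 * (twoBubble k l m r + y))) by rw [force, force]; ring, abs_mul,
    abs_of_nonneg (by positivity : 0 ≤ (k:ℝ) ^ 2 / 2)]
  linarith [mul_le_mul_of_nonneg_left h (by positivity : 0 ≤ (k:ℝ) ^ 2 / 2)]

lemma force_zero (k : ℕ) (l m r : ℝ) : force k l m 0 r = inter k l m r := by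
  have := inter_eq k l m r
  rw [force, add_zero]; linarith

lemma remainder_sub_remainder (k : ℕ) (l m : ℝ) (f g : ℝ → ℝ) (r : ℝ) :
    remainder k l m f r - remainder k l m g r = f r - g r := by
  rw [remainder_eq, remainder_eq]; ring

lemma memL2_force (hk : k ≠ 0) (hl : 0 < l) (hm : 0 < m) (hg : MemH g) :
    MemL2 (fun r => force k l m (g r) r / r) := by
  have hgm := hg.aemeasurable
  obtain ⟨-, hTm, -⟩ := measurable_forceN_comp k l m hgm
  have hI : MemL2 (fun r => inter k l m r / r) := by
    refine (memL2_sQ_div hk hl).of_abs_le (4 * (k:ℝ) ^ 2) (by fun_prop) fun r hr => ?_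
    have ha := sQ_pos (k := k) hl hr; have hb := sQ_pos (k := k) hm hr
    refine abs_div_le_mul_abs_div ((abs_inter_le_mul hl hm hr).trans ?_)
    rw [abs_of_pos ha]
    have h1 : sQ k m r * (sQ k l r + sQ k m r) ≤ 2 := by
      nlinarith [sQ_le_one k l r, sQ_le_one k m r]
    nlinarith [mul_le_mul_of_nonneg_left h1 (by positivity : 0 ≤ 2 * (k:ℝ) ^ 2 * sQ k l r)]
  have hd : MemL2 (fun r => (force k l m (g r) r - inter k l m r) / r) := by
    refine hg.memL2_div.of_abs_le ((k:ℝ) ^ 2) (by fun_prop) fun r hr => ?_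
    have h := abs_force_sub_le k l m (g r) 0 r
    rw [force_zero, sub_zero] at h
    exact abs_div_le_mul_abs_div h
  exact (hd.add hI).congr (ae_of_all _ fun r _ => by ring)

namespace IsWaveMap

lemma memH_remainder (h : IsWaveMap k J ψ ψt) (hk : k ≠ 0) (hl : 0 < l) (hm : 0 < m) {t : ℝ}
    (ht : t ∈ J) : MemH (remainder k l m (ψ t)) :=
  (h.memH0 t ht).memH.sub (memH_twoBubble hk hl hm)

/-- Continuity in `L²(r dr)` of quantities that are controlled by the solution. -/
lemma continuousOn_toX (h : IsWaveMap k J ψ ψt) {F : ℝ → ℝ → ℝ} (hF : ∀ t ∈ J, MemL2 (F t)) (C : ℝ)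
    (hle : ∀ t ∈ J, ∀ t0 ∈ J, l2Sq (fun r => F t r - F t0 r)
      ≤ C * (hSq k (fun r => ψ t r - ψ t0 r) + l2Sq (fun r => ψt t r - ψt t0 r))) :
    ContinuousOn (fun t => toX (F t)) J := by
  intro t0 ht0
  rw [ContinuousWithinAt, tendsto_iff_norm_sub_tendsto_zero]
  have h1 : Tendsto (fun t => √(C * (hSq k (fun r => ψ t r - ψ t0 r)
      + l2Sq (fun r => ψt t r - ψt t0 r)))) (𝓝[J] t0) (𝓝 0) := by
    simpa using ((h.continuous t0 ht0).const_mul C).sqrt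
  refine squeeze_zero' (Eventually.of_forall fun t => norm_nonneg _) ?_ h1
  filter_upwards [self_mem_nhdsWithin] with t ht
  rw [← toX_sub (hF t ht) (hF t0 ht0), norm_toX ((hF t ht).sub (hF t0 ht0))]
  exact Real.sqrt_le_sqrt (hle t ht t0 ht0)

lemma memH_sub (h : IsWaveMap k J ψ ψt) {t t0 : ℝ} (ht : t ∈ J) (ht0 : t0 ∈ J) :
    MemH (fun r => ψ t r - ψ t0 r) := (h.memH0 t ht).memH.sub (h.memH0 t0 ht0).memH

lemma continuousOn_vC (h : IsWaveMap k J ψ ψt) : ContinuousOn (vC ψt) J :=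
  h.continuousOn_toX (fun t ht => (h.memH0 t ht).memL2) 1 fun t _ t0 _ => by
    linarith [hSq_nonneg k (fun r => ψ t r - ψ t0 r)]

lemma continuousOn_pC (h : IsWaveMap k J ψ ψt) (hk : k ≠ 0) (hl : 0 < l) (hm : 0 < m) :
    ContinuousOn (pC k l m ψ) J :=
  h.continuousOn_toX (fun t ht => (h.memH_remainder hk hl hm ht).memL2_deriv) 1
    fun t ht t0 ht0 => by
    have e := l2Sq_congr (((h.memH_remainder hk hl hm ht).ae_deriv_sub
      (h.memH_remainder hk hl hm ht0)).mono fun r h hr => (h hr).symm)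
    simp only [remainder_sub_remainder] at e
    rw [e]
    linarith [(h.memH_sub ht ht0).l2Sq_deriv_le k, l2Sq_nonneg (fun r => ψt t r - ψt t0 r)]

lemma continuousOn_zC (h : IsWaveMap k J ψ ψt) (hk : k ≠ 0) (hl : 0 < l) (hm : 0 < m) :
    ContinuousOn (zC k l m ψ) J :=
  h.continuousOn_toX (fun t ht => (h.memH_remainder hk hl hm ht).memL2_div) 1
    fun t ht t0 ht0 => by
    simp only [← sub_div, remainder_sub_remainder]
    linarith [(h.memH_sub ht ht0).l2Sq_div_le (Nat.one_le_iff_ne_zero.2 hk),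
      l2Sq_nonneg (fun r => ψt t r - ψt t0 r)]

lemma continuousOn_fC (h : IsWaveMap k J ψ ψt) (hk : k ≠ 0) (hl : 0 < l) (hm : 0 < m) :
    ContinuousOn (fC k l m ψ) J :=
  h.continuousOn_toX (fun t ht => memL2_force hk hl hm (h.memH_remainder hk hl hm ht)) (((k:ℝ) ^ 2) ^ 2)
    fun t ht t0 ht0 => by
    have hs := (h.memH_sub ht ht0)
    have h1 := l2Sq_le_of_abs_le ((memL2_force hk hl hm (h.memH_remainder hk hl hm ht)).sub
      (memL2_force hk hl hm (h.memH_remainder hk hl hm ht0))) hs.memL2_div (sq_nonneg (k:ℝ))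
      fun r hr => by
        have h2 := abs_force_sub_le k l m (remainder k l m (ψ t) r) (remainder k l m (ψ t0) r) r
        rw [remainder_sub_remainder] at h2
        rw [← sub_div]
        exact abs_div_le_mul_abs_div h2
    refine h1.trans (mul_le_mul_of_nonneg_left ?_ (by positivity))
    linarith [hs.l2Sq_div_le (Nat.one_le_iff_ne_zero.2 hk), l2Sq_nonneg (fun r => ψt t r - ψt t0 r)]

lemma intervalIntegrable_curve {E : Type*} [NormedAddCommGroup E] {c : ℝ → E} (hJ : J.OrdConnected)
    (hc : ContinuousOn c J) {s s' : ℝ} (hs : s ∈ J) (hs' : s' ∈ J) : IntervalIntegrable c volume s s' :=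
  (hc.mono (hJ.uIcc_subset hs hs')).intervalIntegrable

/-- The first equation of the system, integrated in time. -/
lemma integral_vC (h : IsWaveMap k J ψ ψt) (hJ : J.OrdConnected) {s s' : ℝ} (hs : s ∈ J)
    (hs' : s' ∈ J) (hss : s ≤ s') :
    ∀ᵐ r : ℝ, 0 < r → (∫ τ in s..s', vC ψt τ : RadL2) r = ψ s' r - ψ s r := by
  have hcont := h.continuousOn_vC
  have hW := h.memH_sub hs' hs
  set u : RadL2 := ∫ τ in s..s', vC ψt τ with hu
  have hid : LocAC (fun r : ℝ => r) := LocAC.of_hasDerivAt (fun r _ => hasDerivAt_id r)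
    continuousOn_const
  have hWl : LocallyIntegrableOn (fun r => (ψ s' r - ψ s r) * r) (Ioi 0) :=
    (hW.locAC.mul hid).locallyIntegrableOn
  have hul := (memL2_coe u).locallyIntegrableOn
  have key : ∀ φ, IsTest φ → ∫ r in Ioi (0:ℝ), (u r * r - (ψ s' r - ψ s r) * r) * φ r = 0 := by
    intro φ hφ
    have hd := fun t ht => h.velocity φ hφ.contDiff hφ.hasCompactSupport hφ.tsupport_subset t ht
    have e1 : ∀ t ∈ J, pair (ψt t) φ = inner ℝ (vC ψt t) (toX φ) := fun t ht =>
      (inner_toX (h.memH0 t ht).memL2 hφ.memL2).symm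
    have hc : ContinuousOn (fun t => pair (ψt t) φ) J :=
      (hcont.inner continuousOn_const).congr e1
    have hF := sub_eq_integral_of_hasDerivWithinAt hJ hd hc hs hs' hss
    have e2 : ∫ τ in s..s', pair (ψt τ) φ = inner ℝ u (toX φ) := by
      rw [hu, intervalIntegral_inner_left (intervalIntegrable_curve hJ hcont hs hs')]
      exact intervalIntegral.integral_congr fun τ hτ => e1 τ (hJ.uIcc_subset hs hs' hτ)
    rw [e2, inner_toX_right _ hφ.memL2] at hF
    have hi : ∀ t ∈ J, IntegrableOn (fun r => ψ t r * φ r * r) (Ioi 0) := fun t ht =>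
      (hφ.integrable_mul ((h.memH0 t ht).memH.locAC.mul hid).locallyIntegrableOn).congr
        (ae_of_all _ fun r => by ring)
    have e3 : pair (ψ s') φ - pair (ψ s) φ = ∫ r in Ioi (0:ℝ), (ψ s' r - ψ s r) * r * φ r := by
      rw [pair, pair, ← integral_sub (hi s' hs') (hi s hs)]
      exact integral_congr_ae (ae_of_all _ fun r => by ring)
    have e4 : pair u φ = ∫ r in Ioi (0:ℝ), u r * r * φ r :=
      integral_congr_ae (ae_of_all _ fun r => by ring)
    rw [e3, e4] at hF
    simp only [sub_mul _ _ (φ _)]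
    rw [integral_sub (hφ.integrable_mul hul) (hφ.integrable_mul hWl), hF, sub_self]
  filter_upwards [ae_eq_zero_of_test (hul.sub hWl) key] with r h1 hr
  have h2 := h1 hr
  rw [Pi.sub_apply, ← sub_mul] at h2
  exact sub_eq_zero.1 ((mul_eq_zero.1 h2).resolve_right hr.ne')

lemma memL2_sub (h : IsWaveMap k J ψ ψt) (hJ : J.OrdConnected) {s s' : ℝ} (hs : s ∈ J)
    (hs' : s' ∈ J) : MemL2 (fun r => ψ s' r - ψ s r) := by
  have key : ∀ {s s'}, s ∈ J → s' ∈ J → s ≤ s' → MemL2 (fun r => ψ s' r - ψ s r) :=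
    fun hs hs' hss => (memL2_coe _).congr
      ((h.integral_vC hJ hs hs' hss).mono fun _ h hr => (h hr).symm)
  rcases le_total s s' with hss | hss
  · exact key hs hs' hss
  · exact ((key hs' hs hss).const_mul (-1)).congr (ae_of_all _ fun r _ => by ring)

lemma toX_sub_eq_integral (h : IsWaveMap k J ψ ψt) (hJ : J.OrdConnected) {s s' : ℝ} (hs : s ∈ J)
    (hs' : s' ∈ J) : toX (fun r => ψ s' r - ψ s r) = ∫ τ in s..s', vC ψt τ := by
  rcases le_total s s' with hss | hss
  · exact (eq_toX (h.integral_vC hJ hs hs' hss) (h.memL2_sub hJ hs hs')).symm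
  · rw [intervalIntegral.integral_symm, eq_toX (h.integral_vC hJ hs' hs hss) (h.memL2_sub hJ hs' hs),
      ← neg_one_smul ℝ, ← toX_const_mul _ (h.memL2_sub hJ hs' hs)]
    congr 1; funext r; ring

/-- `ψ(t) - ψ(t0)` is differentiable in time as a curve in `L²(r dr)`. -/
lemma hasDerivWithinAt_toX_sub (h : IsWaveMap k J ψ ψt) (hJ : J.OrdConnected) {t0 : ℝ}
    (ht0 : t0 ∈ J) : HasDerivWithinAt (fun t => toX (fun r => ψ t r - ψ t0 r)) (vC ψt t0) J t0 := by
  refine hasDerivWithinAt_of_sub_eq_integral hJ ht0 (h.continuousOn_vC t0 ht0) h.continuousOn_vC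
    fun t ht => ?_
  rw [h.toX_sub_eq_integral hJ ht0 ht, h.toX_sub_eq_integral hJ ht0 ht0]
  simp

/-- The time integral of `ψ - (Q_l - Q_m)` as a locally absolutely continuous function. -/
lemma exists_integral_zC (h : IsWaveMap k J ψ ψt) (hJ : J.OrdConnected) (hk : k ≠ 0) (hl : 0 < l)
    (hm : 0 < m) {s s' : ℝ} (hs : s ∈ J) (hs' : s' ∈ J) :
    ∃ U, LocAC U ∧ (∀ᵐ r : ℝ, 0 < r → U r = (∫ τ in s..s', zC k l m ψ τ : RadL2) r * r) ∧
      ∀ᵐ r : ℝ, 0 < r → HasDerivAt U ((∫ τ in s..s', pC k l m ψ τ : RadL2) r) r := by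
  have hzc := intervalIntegrable_curve hJ (h.continuousOn_zC hk hl hm) hs hs'
  have hpc := intervalIntegrable_curve hJ (h.continuousOn_pC hk hl hm) hs hs'
  set z : RadL2 := ∫ τ in s..s', zC k l m ψ τ
  set p : RadL2 := ∫ τ in s..s', pC k l m ψ τ
  refine exists_locAC_of_weak_deriv (memL2_coe z).locallyIntegrableOn
    (memL2_coe p).locallyIntegrableOn' fun φ hφ => ?_
  rw [integral_eq_inner_toX z hφ.deriv.memL2 fun r _ => by ring,
    integral_eq_inner_toX p hφ.memL2_div fun r _ => by field_simp, intervalIntegral_inner_left hzc, intervalIntegral_inner_left hpc,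
    ← intervalIntegral.integral_neg]
  refine intervalIntegral.integral_congr fun τ hτ => ?_
  have hg := h.memH_remainder hk hl hm (hJ.uIcc_subset hs hs' hτ)
  simp only [zC, pC]
  rw [inner_toX hg.memL2_div hφ.deriv.memL2, inner_toX hg.memL2_deriv hφ.memL2_div]
  exact (integral_congr_Ioi fun r hr => by field_simp).trans
    ((hg.locAC.integral_mul_deriv_test hφ).trans
      (congrArg _ (integral_congr_Ioi fun r hr => by field_simp)))

/-- The wave equation integrated in time: `r` times the time integral of `∂_r ψ - ∂_r (Q_l - Q_m)`
is locally absolutely continuous. -/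
lemma exists_integral_pC (h : IsWaveMap k J ψ ψt) (hJ : J.OrdConnected) (hk : k ≠ 0) (hl : 0 < l)
    (hm : 0 < m) {s s' : ℝ} (hs : s ∈ J) (hs' : s' ∈ J) (hss : s ≤ s') :
    ∃ y, LocAC y ∧ (∀ᵐ r : ℝ, 0 < r → y r = (∫ τ in s..s', pC k l m ψ τ : RadL2) r * r) ∧
      ∀ᵐ r : ℝ, 0 < r → HasDerivAt y ((vC ψt s' - vC ψt s : RadL2) r * r
        + (∫ τ in s..s', fC k l m ψ τ : RadL2) r) r := by
  have hpc := intervalIntegrable_curve hJ (h.continuousOn_pC hk hl hm) hs hs'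
  have hfc := intervalIntegrable_curve hJ (h.continuousOn_fC hk hl hm) hs hs'
  set p : RadL2 := ∫ τ in s..s', pC k l m ψ τ
  set F : RadL2 := ∫ τ in s..s', fC k l m ψ τ
  set dv : RadL2 := vC ψt s' - vC ψt s with hdv
  have hFl := (memL2_coe F).locallyIntegrableOn'
  have hvl := (memL2_coe dv).locallyIntegrableOn
  refine exists_locAC_of_weak_deriv (memL2_coe p).locallyIntegrableOn (hvl.add hFl) fun φ hφ => ?_
  have e2 : ∫ r in Ioi (0:ℝ), (dv r * r + F r) * φ r
      = inner ℝ dv (toX φ) + inner ℝ F (toX fun r => φ r / r) := by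
    rw [← integral_eq_inner_toX dv hφ.memL2 (F := fun r => dv r * r * φ r) fun r _ => by ring,
      ← integral_eq_inner_toX F hφ.memL2_div (F := fun r => F r * φ r) fun r _ => by field_simp,
      ← integral_add (hφ.integrable_mul hvl) (hφ.integrable_mul hFl)]
    simp only [← add_mul]
  -- the equation tested with `φ`, rewritten for the remainder
  have hd : ∀ t ∈ J, HasDerivWithinAt (fun t => pair (ψt t) φ)
      (-(inner ℝ (pC k l m ψ t) (toX (deriv φ))
        + inner ℝ (fC k l m ψ t) (toX fun r => φ r / r))) J t := by
    intro t ht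
    refine (h.equation φ hφ.contDiff hφ.hasCompactSupport hφ.tsupport_subset t ht).congr_deriv ?_
    have hg := h.memH_remainder hk hl hm ht
    have hψ := (h.memH0 t ht).memH
    simp only [pC, fC]
    rw [inner_toX hg.memL2_deriv hφ.deriv.memL2, inner_toX (memL2_force hk hl hm hg) hφ.memL2_div]
    have hst := (((locAC_sQ (k := k) hl).sub (locAC_sQ (k := k) hm)).const_mul (k:ℝ)).integral_mul_deriv_test hφ
    have hP := (memH_twoBubble (k := k) hk hl hm)
    have hsc : ∀ l, LocallyIntegrableOn (fun r => (k:ℝ) ^ 2 * (sQ k l r * cQ k l r) / r) (Ioi 0) :=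
      fun l => (ContinuousOn.div (by fun_prop) continuousOn_id
        fun r (hr : 0 < r) => hr.ne').locallyIntegrableOn measurableSet_Ioi
    have i1 := hφ.integrable_mul (hsc l)
    have i2 := hφ.integrable_mul (hsc m)
    have H1 : HasInt (fun r => deriv (ψ t) r * deriv φ r * r) _ :=
      ((hP.memL2_deriv.hasInt hφ.deriv.memL2).add (hg.memL2_deriv.hasInt hφ.deriv.memL2)).congr (by
        filter_upwards [hP.ae_hasDerivAt, hg.ae_hasDerivAt] with r h1 h2 hr
        have : ψ t = fun r => twoBubble k l m r + remainder k l m (ψ t) r := by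
          funext x; rw [remainder_eq]; ring
        have hd : deriv (ψ t) r = deriv (twoBubble k l m) r + deriv (remainder k l m (ψ t)) r := by
          conv_lhs => rw [this]
          exact ((h1 hr).add (h2 hr)).deriv
        rw [hd]; ring)
    have H2 : HasInt (fun r => (k : ℝ) ^ 2 * Real.sin (2 * ψ t r) / (2 * r ^ 2) * φ r * r) _ :=
      ((((memL2_force hk hl hm hg).hasInt hφ.memL2_div).add (.of_integrable i1)).sub
        (.of_integrable i2)).congr (ae_of_all _ fun r hr => by
        have : ψ t r = twoBubble k l m r + remainder k l m (ψ t) r := by rw [remainder_eq]; ring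
        rw [this, force]; field_simp; ring)
    rw [H1.2, H2.2]
    have e4 : pair (deriv (twoBubble k l m)) (deriv φ)
        = ∫ r in Ioi (0:ℝ), k * (sQ k l r - sQ k m r) * deriv φ r :=
      integral_congr_Ioi fun r hr => by simp only [deriv_twoBubble hl hm hr]; field_simp
    have e5 : ∫ r in Ioi (0:ℝ), deriv (fun r => k * (sQ k l r - sQ k m r)) r * φ r
        = (∫ r in Ioi (0:ℝ), (k:ℝ) ^ 2 * (sQ k l r * cQ k l r) / r * φ r)
          - ∫ r in Ioi (0:ℝ), (k:ℝ) ^ 2 * (sQ k m r * cQ k m r) / r * φ r := by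
      rw [← integral_sub i1 i2]
      refine integral_congr_Ioi fun r hr => ?_
      have hd := ((hasDerivAt_sQ (k := k) hl hr).sub (hasDerivAt_sQ (k := k) hm hr)).const_mul (k:ℝ)
      have hd' : deriv (fun r => k * (sQ k l r - sQ k m r)) r = _ := hd.deriv
      simp only [hd']; field_simp
    rw [e4, hst, e5]
    ring
  have hcE : ContinuousOn (fun t => -(inner ℝ (pC k l m ψ t) (toX (deriv φ))
        + inner ℝ (fC k l m ψ t) (toX fun r => φ r / r))) J :=
    (((h.continuousOn_pC hk hl hm).inner continuousOn_const).add
      ((h.continuousOn_fC hk hl hm).inner continuousOn_const)).neg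
  have hF := sub_eq_integral_of_hasDerivWithinAt hJ hd hcE hs hs' hss
  have hin : ∀ {f : ℝ → RadL2}, ContinuousOn f J → ∀ x : RadL2,
      IntervalIntegrable (fun τ => inner ℝ (f τ) x) volume s s' := fun hf x =>
    intervalIntegrable_curve hJ (hf.inner continuousOn_const) hs hs'
  rw [intervalIntegral.integral_neg, intervalIntegral.integral_add
    (hin (h.continuousOn_pC hk hl hm) _) (hin (h.continuousOn_fC hk hl hm) _),
    ← intervalIntegral_inner_left hpc, ← intervalIntegral_inner_left hfc] at hF
  have e6 : pair (ψt s') φ - pair (ψt s) φ = inner ℝ dv (toX φ) := by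
    rw [hdv, inner_sub_left]
    simp only [vC]
    rw [inner_toX (h.memH0 s' hs').memL2 hφ.memL2, inner_toX (h.memH0 s hs).memL2 hφ.memL2]
  rw [integral_eq_inner_toX p hφ.deriv.memL2 fun r _ => by ring, e2, ← e6, hF]
  ring

end IsWaveMap
end Curves

/-! ### The virial identity along a solution -/

section VirialIdentity
variable {k : ℕ} {J : Set ℝ} {ψ ψt : ℝ → ℝ → ℝ} {l m K c ε ρ t0 : ℝ} {f g θ θ' : ℝ → ℝ}
  {M M' B B' : ℝ → ℝ}

lemma hasDerivWithinAt_of_sub_eq_integral_of_le {Y : Type*} [NormedAddCommGroup Y] [NormedSpace ℝ Y]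
    [CompleteSpace Y] {G F : ℝ → Y} (hJ : J.OrdConnected) (ht0 : t0 ∈ J) (hF : ContinuousOn F J)
    (h : ∀ s ∈ J, ∀ s' ∈ J, s ≤ s' → G s' - G s = ∫ τ in s..s', F τ) :
    HasDerivWithinAt G (F t0) J t0 := by
  refine hasDerivWithinAt_of_sub_eq_integral hJ ht0 (hF t0 ht0) hF fun t ht => ?_
  rcases le_total t0 t with h1 | h1
  · exact h _ ht0 _ ht h1
  · rw [intervalIntegral.integral_symm, ← h _ ht _ ht0 h1, neg_sub]

namespace IsWaveMap

/-- The time derivative of `⟨ψ_t | θ⟩` for a fixed profile `θ`. -/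
lemma hasDerivWithinAt_inner_vC (h : IsWaveMap k J ψ ψt) (hJ : J.OrdConnected) (hk : k ≠ 0)
    (hl : 0 < l) (hm : 0 < m) (ht0 : t0 ∈ J) (hθ : MemL2 θ) (hθr : MemL2 fun r => θ r / r)
    (hθ' : MemL2 θ') (hθa : LocAC θ) (hd : ∀ r, 0 < r → HasDerivAt θ (θ' r) r) :
    HasDerivWithinAt (fun t => inner ℝ (vC ψt t) (toX θ))
      (-inner ℝ (pC k l m ψ t0) (toX θ') - inner ℝ (fC k l m ψ t0) (toX fun r => θ r / r)) J t0 := by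
  have hp := h.continuousOn_pC hk hl hm
  have hf := h.continuousOn_fC hk hl hm
  have hc : ContinuousOn (fun t => -inner ℝ (pC k l m ψ t) (toX θ')
      - inner ℝ (fC k l m ψ t) (toX fun r => θ r / r)) J := by fun_prop
  refine hasDerivWithinAt_of_sub_eq_integral_of_le hJ ht0 hc fun s hs s' hs' hss => ?_
  have hpi := intervalIntegrable_curve hJ hp hs hs'
  have hfi := intervalIntegrable_curve hJ hf hs hs'
  have hin : ∀ {f : ℝ → RadL2}, ContinuousOn f J → ∀ x : RadL2,
      IntervalIntegrable (fun τ => inner ℝ (f τ) x) volume s s' := fun hf x =>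
    intervalIntegrable_curve hJ (hf.inner continuousOn_const) hs hs'
  obtain ⟨y, hy, hye, hyd⟩ := h.exists_integral_pC hJ hk hl hm hs hs' hss
  have hn : IntervalIntegrable (fun τ => -inner ℝ (pC k l m ψ τ) (toX θ')) volume s s' :=
    (hin hp _).neg
  rw [intervalIntegral.integral_sub hn (hin hf _), intervalIntegral.integral_neg,
    ← intervalIntegral_inner_left hpi, ← intervalIntegral_inner_left hfi, ← inner_sub_left,
    inner_toX_right _ hθ, inner_toX_right _ hθr, inner_toX_right _ hθ']
  set p : RadL2 := ∫ τ in s..s', pC k l m ψ τ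
  set F : RadL2 := ∫ τ in s..s', fC k l m ψ τ
  set dv : RadL2 := vC ψt s' - vC ψt s
  have H := (((memL2_coe dv).hasInt hθ).add ((memL2_coe F).hasInt hθr)).add ((memL2_coe p).hasInt hθ')
  have hi : IntegrableOn (fun r => y r * θ r / r) (Ioi 0) :=
    (((memL2_coe p).hasInt hθr).congr (hye.mono fun r h1 hr => by rw [h1 hr]; field_simp)).1
  have key := integral_eq_zero_of_ae_hasDerivAt (hy.mul hθa) (by
    filter_upwards [hye, hyd] with r h1 h2 hr
    refine ((h2 hr).mul (hd r hr)).congr_deriv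
      (g' := dv r * θ r * r + F r * (θ r / r) * r + p r * θ' r * r) ?_
    rw [h1 hr]; field_simp) H.1 hi
  linarith [H.2.symm.trans key]

end IsWaveMap

/-- The quadratic expression in `(∂_r g, g / r, r · nonlinearity)` that appears in the virial
identity with weights `M` and `B`. -/
noncomputable def virialForm (M B B' p z F : ℝ → ℝ) : ℝ :=
  -pair (fun r => (2 * B r - M r) * p r) p - pair (fun r => r * B' r * z r) p
    - pair F (fun r => M r * p r + B r * z r)

lemma IsWeight.memL2_mul (hM : IsWeight M M' K c) (hf : MemL2 f) : MemL2 fun r => M r * f r :=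
  hf.bdd_mul hM.aemeasurable hM.abs_le

lemma IsWeight.memL2_deriv_mul (hM : IsWeight M M' K c) (hf : MemL2 f) :
    MemL2 fun r => r * M' r * f r :=
  hf.bdd_mul (measurable_id.aemeasurable.mul hM.aemeasurable') hM.abs_deriv_le

lemma IsWeight.abs_mul_le (hM : IsWeight M M' K c) (h0 : ∀ r, ρ < r → M r = 0) {r : ℝ}
    (hr : 0 < r) : |r * M r| ≤ |ρ| * K := by
  by_cases hr' : ρ < r
  · rw [h0 r hr', mul_zero, abs_zero]; exact mul_nonneg (abs_nonneg _) hM.nonneg.1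
  · exact WaveMapTwoBubble.abs_mul_le ((abs_of_pos hr).trans_le
      ((not_lt.1 hr').trans (le_abs_self _))) (hM.abs_le r hr)

lemma IsWeight.memL2_id_mul (hM : IsWeight M M' K c) (h0 : ∀ r, ρ < r → M r = 0) (hf : MemL2 f) :
    MemL2 fun r => r * M r * f r :=
  hf.bdd_mul (measurable_id.aemeasurable.mul hM.aemeasurable) fun _ => hM.abs_mul_le h0

/-- The virial identity for a time increment `δv` of `ψ_t` and the time integrals `p`, `z`, `F` of
`∂_r g`, `g / r` and of `r` times the nonlinearity. -/
lemma inner_virial_increment (hM : IsWeight M M' K c) (hB : IsWeight B B' K ε)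
    (hMB : ∀ r, 0 < r → r * M' r = 2 * (B r - M r)) (hM0 : ∀ r, ρ < r → M r = 0)
    (hB0 : ∀ r, ρ < r → B r = 0) {dv p z F : RadL2} {y U : ℝ → ℝ} (hy : LocAC y) (hU : LocAC U)
    (hye : ∀ᵐ r : ℝ, 0 < r → y r = p r * r) (hUe : ∀ᵐ r : ℝ, 0 < r → U r = z r * r)
    (hyd : ∀ᵐ r : ℝ, 0 < r → HasDerivAt y (dv r * r + F r) r)
    (hUd : ∀ᵐ r : ℝ, 0 < r → HasDerivAt U (p r) r) :
    pair dv (fun r => r * M r * p r + r * B r * z r) = virialForm M B B' p z F := by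
  have hp := memL2_coe p; have hz := memL2_coe z; have hF := memL2_coe F
  have h2 : MemL2 fun r => (2 * B r - M r) * p r :=
    (((hB.memL2_mul hp).const_mul 2).sub (hM.memL2_mul hp)).congr (ae_of_all _ fun r _ => by ring)
  have H := ((((memL2_coe dv).hasInt ((hM.memL2_id_mul hM0 hp).add (hB.memL2_id_mul hB0 hz))).add
    (h2.hasInt hp)).add ((hB.memL2_deriv_mul hz).hasInt hp)).add
    (hF.hasInt ((hM.memL2_mul hp).add (hB.memL2_mul hz)))
  have hi := (((((hM.memL2_mul hp).hasInt hp).const_mul (1 / 2)).add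
    ((hB.memL2_mul hz).hasInt hp)).congr
    (g := fun r => (1 / 2 * (M r * (y r * y r)) + B r * (y r * U r)) / r) (by
      filter_upwards [hye, hUe] with r h1 h2 hr
      rw [h1 hr, h2 hr]; field_simp)).1
  have key := integral_eq_zero_of_ae_hasDerivAt
    (((hM.locAC.mul (hy.mul hy)).const_mul (1 / 2)).add (hB.locAC.mul (hy.mul hU))) (by
    filter_upwards [hye, hUe, hyd, hUd] with r h1 h2 h3 h4 hr
    refine ((((hM.hasDerivAt r hr).mul ((h3 hr).mul (h3 hr))).const_mul (1 / 2)).add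
      ((hB.hasDerivAt r hr).mul ((h3 hr).mul (h4 hr)))).congr_deriv
      (g' := dv r * (r * M r * p r + r * B r * z r) * r + (2 * B r - M r) * p r * p r * r
        + r * B' r * z r * p r * r + F r * (M r * p r + B r * z r) * r) ?_
    simp only [Pi.mul_apply, h1 hr, h2 hr]
    linear_combination (1 / 2) * (p r * p r * r) * hMB r hr) H.1 hi
  rw [virialForm]
  linarith [H.2.symm.trans key]

/-- `⟨W | r M W' + B W⟩ = 0` when `B = (2 r M + r² M') / (2 r)`. -/
lemma pair_virial_eq_zero (hM : IsWeight M M' K c) (hB : IsWeight B B' K ε)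
    (hMB : ∀ r, 0 < r → r * M' r = 2 * (B r - M r)) (hM0 : ∀ r, ρ < r → M r = 0)
    (hW : MemH f) (hW2 : MemL2 f) : pair f (fun r => r * M r * deriv f r + B r * f r) = 0 := by
  have H := hW2.hasInt ((hM.memL2_id_mul hM0 hW.memL2_deriv).add (hB.memL2_mul hW2))
  have hid : LocAC (fun r : ℝ => r) := LocAC.of_hasDerivAt (fun r _ => hasDerivAt_id r)
    continuousOn_const
  have hi := ((((hM.memL2_mul hW2).hasInt hW2).const_mul (1 / 2)).congr
    (g := fun r => 1 / 2 * (M r * ((r * r) * (f r * f r))) / r) (ae_of_all _ fun r hr => by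
      field_simp)).1
  have key := integral_eq_zero_of_ae_hasDerivAt
    ((hM.locAC.mul ((hid.mul hid).mul (hW.locAC.mul hW.locAC))).const_mul (1 / 2)) (by
    filter_upwards [hW.ae_hasDerivAt] with r h1 hr
    refine (((hM.hasDerivAt r hr).mul (((hasDerivAt_id r).mul (hasDerivAt_id r)).mul
      ((h1 hr).mul (h1 hr)))).const_mul (1 / 2)).congr_deriv
      (g' := f r * (r * M r * deriv f r + B r * f r) * r) ?_
    simp only [id, Pi.mul_apply]
    linear_combination (1 / 2) * (f r * f r * r) * hMB r hr) H.1 hi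
  exact H.2.symm.trans key

lemma memL2_sQ (hk : 2 ≤ k) (hl : 0 < l) : MemL2 (sQ k l) :=
  ⟨(measurable_sQ k l).aestronglyMeasurable, integrableOn_LambdaQ_sq hk hl⟩

namespace IsWaveMap

/-- The virial identity: the time derivative of `⟨ψ_t | r M ∂_r g + B g⟩` for
`g = ψ - (Q_l - Q_m)` with fixed scales. The product is only formally differentiable, so the
identity is integrated over short time intervals. -/
theorem hasDerivWithinAt_virial (h : IsWaveMap k J ψ ψt) (hJ : J.OrdConnected) (hk : k ≠ 0)
    (hl : 0 < l) (hm : 0 < m) (ht0 : t0 ∈ J) (hM : IsWeight M M' K c) (hB : IsWeight B B' K ε)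
    (hMB : ∀ r, 0 < r → r * M' r = 2 * (B r - M r)) (hM0 : ∀ r, ρ < r → M r = 0)
    (hB0 : ∀ r, ρ < r → B r = 0) :
    HasDerivWithinAt (fun t => pair (ψt t) (fun r => r * M r * deriv (remainder k l m (ψ t)) r
      + B r * remainder k l m (ψ t) r))
      (virialForm M B B' (deriv (remainder k l m (ψ t0))) (fun r => remainder k l m (ψ t0) r / r)
        (fun r => force k l m (remainder k l m (ψ t0) r) r / r)) J t0 := by
  have hmm := hM.aemeasurable; have hbm := hB.aemeasurable; have hbm' := hB.aemeasurable'
  have hrM : ∀ r, 0 < r → |r * M r| ≤ |ρ| * K := fun r hr => hM.abs_mul_le hM0 hr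
  have hrB : ∀ r, 0 < r → |r * B r| ≤ |ρ| * K := fun r hr => hB.abs_mul_le hB0 hr
  have h2B : ∀ r, 0 < r → |2 * B r - M r| ≤ 2 * K + K := fun r hr => by
    exact (abs_sub _ _).trans (add_le_add (abs_mul_le abs_two.le (hB.abs_le r hr)) (hM.abs_le r hr))
  let rM := mulOp (fun r => r * M r) _ (by fun_prop) hrM
  let rB := mulOp (fun r => r * B r) _ (by fun_prop) hrB
  let T1 := mulOp (fun r => 2 * B r - M r) _ (by fun_prop) h2B
  let T2 := mulOp (fun r => r * B' r) _ (by fun_prop) hB.abs_deriv_le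
  let T3 := mulOp M _ hmm hM.abs_le
  let T4 := mulOp B _ hbm hB.abs_le
  let V : RadL2 × RadL2 × RadL2 → ℝ := fun y => -inner ℝ (T1 y.1) y.1 - inner ℝ (T2 y.2.1) y.1
    - inner ℝ y.2.2 (T3 y.1 + T4 y.2.1)
  have hV : Continuous V := by fun_prop
  have hV2 : ∀ (c : ℝ) y, V (c • y) = c ^ 2 * V y := fun c y => by
    simp only [V, Prod.smul_fst, Prod.smul_snd, map_smul, inner_smul_left, inner_smul_right,
      conj_trivial, ← smul_add]
    ring
  have hVf : ∀ p z F : RadL2, V (p, z, F) = virialForm M B B' p z F := fun p z F => by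
    simp only [V, virialForm, inner_eq_pair]
    congr 1
    · congr 1
      · exact congrArg _ (pair_congr (coe_mulOp _ _ _) (ae_of_all _ fun _ _ => rfl))
      · exact pair_congr (coe_mulOp _ _ _) (ae_of_all _ fun _ _ => rfl)
    · refine pair_congr (ae_of_all _ fun _ _ => rfl) ?_
      filter_upwards [coe_mulOp hmm hM.abs_le p, coe_mulOp hbm hB.abs_le z,
        ae_radMeas.1 (Lp.coeFn_add (T3 p) (T4 z))] with r h1 h2 h3 hr
      rw [h3 hr, Pi.add_apply, h1 hr, h2 hr]
  have hp := h.continuousOn_pC hk hl hm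
  have hz := h.continuousOn_zC hk hl hm
  have hf := h.continuousOn_fC hk hl hm
  have hv := h.continuousOn_vC
  let a : ℝ → RadL2 := fun t => rM (pC k l m ψ t) + rB (zC k l m ψ t)
  have ha : ContinuousOn a J := by fun_prop
  let w : ℝ → RadL2 × RadL2 × RadL2 := fun t => (pC k l m ψ t, zC k l m ψ t, fC k l m ψ t)
  have hw : ContinuousOn w J := by fun_prop
  have hMp := fun {f : ℝ → ℝ} (hf : MemL2 f) => hM.memL2_id_mul hM0 hf
  have hBp := fun {f : ℝ → ℝ} (hf : MemL2 f) => hB.memL2_id_mul hB0 hf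
  have ha_eq : ∀ {g : ℝ → ℝ}, MemH g → rM (toX (deriv g)) + rB (toX fun r => g r / r)
      = toX fun r => r * M r * deriv g r + B r * g r := fun {g} hg => by
    have e1 := mulOp_toX (by fun_prop) hrM hg.memL2_deriv
    have e2 := mulOp_toX (by fun_prop) hrB hg.memL2_div
    rw [show rM (toX (deriv g)) = _ from e1, show rB (toX fun r => g r / r) = _ from e2,
      ← toX_add (hMp hg.memL2_deriv) (hBp hg.memL2_div)]
    refine (toX_congr (ae_of_all _ fun r hr => ?_)
      ((hMp hg.memL2_deriv).add (hBp hg.memL2_div))).symm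
    field_simp
  have hmem : ∀ {g : ℝ → ℝ}, MemH g → MemL2 fun r => r * M r * deriv g r + B r * g r :=
    fun {g} hg => ((hMp hg.memL2_deriv).add (hBp hg.memL2_div)).congr
      (ae_of_all _ fun r hr => by field_simp)
  have hinc : ∀ s ∈ J, ∀ s' ∈ J, s ≤ s' →
      inner ℝ (vC ψt s' - vC ψt s) (∫ τ in s..s', a τ)
        + inner ℝ (∫ τ in s..s', vC ψt τ) (a s' - a s) = V (∫ τ in s..s', w τ) := by
    intro s hs s' hs' hss
    have hpi := intervalIntegrable_curve hJ hp hs hs'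
    have hzi := intervalIntegrable_curve hJ hz hs hs'
    have hwi := intervalIntegrable_curve hJ hw hs hs'
    have hw' : ∫ τ in s..s', w τ = (∫ τ in s..s', pC k l m ψ τ, ∫ τ in s..s', zC k l m ψ τ,
        ∫ τ in s..s', fC k l m ψ τ) := by
      have e1 := (ContinuousLinearMap.fst ℝ RadL2 (RadL2 × RadL2)).intervalIntegral_comp_comm hwi
      have e2 := ((ContinuousLinearMap.fst ℝ RadL2 RadL2).comp
        (ContinuousLinearMap.snd ℝ RadL2 (RadL2 × RadL2))).intervalIntegral_comp_comm hwi
      have e3 := ((ContinuousLinearMap.snd ℝ RadL2 RadL2).comp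
        (ContinuousLinearMap.snd ℝ RadL2 (RadL2 × RadL2))).intervalIntegral_comp_comm hwi
      exact Prod.ext e1.symm (Prod.ext e2.symm e3.symm)
    obtain ⟨y, hy, hye, hyd⟩ := h.exists_integral_pC hJ hk hl hm hs hs' hss
    obtain ⟨U, hU, hUe, hUd⟩ := h.exists_integral_zC hJ hk hl hm hs hs'
    have key := inner_virial_increment hM hB hMB hM0 hB0 hy hU hye hUe hyd hUd
    have e1 : ∫ τ in s..s', a τ = rM (∫ τ in s..s', pC k l m ψ τ)
        + rB (∫ τ in s..s', zC k l m ψ τ) := by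
      rw [← rM.intervalIntegral_comp_comm hpi, ← rB.intervalIntegral_comp_comm hzi]
      exact intervalIntegral.integral_add
        (intervalIntegrable_curve hJ (rM.continuous.comp_continuousOn hp) hs hs')
        (intervalIntegrable_curve hJ (rB.continuous.comp_continuousOn hz) hs hs')
    rw [hw', hVf, ← key, e1, inner_eq_pair]
    have hW := h.memH_sub hs' hs
    have e2 : inner ℝ (∫ τ in s..s', vC ψt τ) (a s' - a s) = 0 := by
      rw [← h.toX_sub_eq_integral hJ hs hs']
      have e3 : a s' - a s = toX fun r => r * M r * deriv (fun r => ψ s' r - ψ s r) r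
          + B r * (ψ s' r - ψ s r) := by
        rw [← ha_eq hW]
        simp only [a, pC, zC]
        have hg := h.memH_remainder hk hl hm hs
        have hg' := h.memH_remainder hk hl hm hs'
        rw [add_sub_add_comm, ← map_sub, ← map_sub, ← toX_sub hg'.memL2_deriv hg.memL2_deriv,
          ← toX_sub hg'.memL2_div hg.memL2_div]
        have e := hg'.ae_deriv_sub hg
        simp only [remainder_sub_remainder] at e
        simp only [← sub_div, remainder_sub_remainder]
        rw [toX_congr (e.mono fun r h1 hr => (h1 hr).symm) hW.memL2_deriv]
      rw [e3, inner_toX (h.memL2_sub hJ hs hs') (hmem hW)]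
      exact pair_virial_eq_zero hM hB hMB hM0 hW (h.memL2_sub hJ hs hs')
    rw [e2, add_zero]
    refine pair_congr (ae_of_all _ fun _ _ => rfl) ?_
    filter_upwards [coe_mulOp (by fun_prop) hrM (∫ τ in s..s', pC k l m ψ τ),
      coe_mulOp (by fun_prop) hrB (∫ τ in s..s', zC k l m ψ τ),
      ae_radMeas.1 (Lp.coeFn_add (rM (∫ τ in s..s', pC k l m ψ τ))
        (rB (∫ τ in s..s', zC k l m ψ τ)))] with r h1 h2 h3 hr
    rw [h3 hr, Pi.add_apply, h1 hr, h2 hr]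
  have hD : HasDerivWithinAt (fun t => inner ℝ (vC ψt t) (a t)) (V (w t0)) J t0 := by
    refine hasDerivWithinAt_of_sub_eq_integral_of_le (F := fun t => V (w t)) hJ ht0
      (hV.comp_continuousOn hw) fun s hs s' hs' hss => ?_
    rcases hss.eq_or_lt with rfl | hlt
    · simp
    -- the curves are extended by constants outside `[s, s']`
    let cl : ℝ → ℝ := fun τ => max s (min τ s')
    have hcl : Continuous cl := by fun_prop
    have hclJ : ∀ τ, cl τ ∈ J := fun τ => hJ.out hs hs'
      ⟨le_max_left _ _, max_le hss (min_le_right _ _)⟩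
    have hcl_eq : ∀ τ, s ≤ τ → τ ≤ s' → cl τ = τ := fun τ h1 h2 => by
      simp only [cl, min_eq_left h2, max_eq_right h1]
    have hint : ∀ {E : Type} [NormedAddCommGroup E] [NormedSpace ℝ E] (u : ℝ → E) (x x' : ℝ),
        s ≤ x → x ≤ x' → x' ≤ s' → ∫ τ in x..x', u (cl τ) = ∫ τ in x..x', u τ := by
      intro E _ _ u x x' h1 h2 h3
      refine intervalIntegral.integral_congr fun τ hτ => ?_
      rw [uIcc_of_le h2] at hτ
      rw [hcl_eq τ (h1.trans hτ.1) (hτ.2.trans h3)]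
    have := inner_sub_eq_integral_of_increments (v := fun τ => vC ψt (cl τ)) (a := fun τ => a (cl τ))
      (w := fun τ => w (cl τ)) (B := V) hlt (hv.comp_continuous hcl hclJ)
      (ha.comp_continuous hcl hclJ) (hw.comp_continuous hcl hclJ) hV hV2 fun x x' h1 h2 h3 => by
        rw [hint a x x' h1 h2.le h3, hint w x x' h1 h2.le h3, hint (vC ψt) x x' h1 h2.le h3,
          hcl_eq x h1 (h2.le.trans h3), hcl_eq x' (h1.trans h2.le) h3]
        exact hinc x (hJ.out hs hs' ⟨h1, h2.le.trans h3⟩) x' (hJ.out hs hs' ⟨h1.trans h2.le, h3⟩) h2.le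
    rw [hcl_eq s le_rfl hss, hcl_eq s' hss le_rfl] at this
    rw [this]
    exact hint (fun τ => V (w τ)) s s' le_rfl hss le_rfl
  have hD' : V (w t0) = virialForm M B B' (deriv (remainder k l m (ψ t0)))
      (fun r => remainder k l m (ψ t0) r / r)
        (fun r => force k l m (remainder k l m (ψ t0) r) r / r) := by
    have hg := h.memH_remainder hk hl hm ht0
    have i1 := coe_toX hg.memL2_deriv
    have i2 := coe_toX hg.memL2_div
    have i3 := coe_toX (memL2_force hk hl hm hg)
    simp only [w, hVf, virialForm, pC, zC, fC]
    congr 1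
    · congr 1
      · exact congrArg _ (pair_congr (i1.mono fun r h1 hr => by rw [h1 hr]) i1)
      · exact pair_congr (i2.mono fun r h1 hr => by rw [h1 hr]) i1
    · refine pair_congr i3 ?_
      filter_upwards [i1, i2] with r h1 h2 hr
      rw [h1 hr, h2 hr]
  rw [hD'] at hD
  refine hD.congr_of_mem (fun t ht => ?_) ht0
  have hg := h.memH_remainder hk hl hm ht
  simp only [a, vC, pC, zC]
  rw [ha_eq hg, inner_toX (h.memH0 t ht).memL2 (hmem hg)]

/-- The time derivative of `b` with the scales frozen at `l` and `m`. -/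
theorem hasDerivWithinAt_frozen {R : ℝ} {q : ℝ → ℝ} (h : IsWaveMap k J ψ ψt) (hJ : J.OrdConnected)
    (hk : 2 ≤ k) (hl : 0 < l) (hm : 0 < m) (ht0 : t0 ∈ J) (hc : 0 < c) (hq : IsVirialWeight c R K q) :
    HasDerivWithinAt (fun t => -pair (rescaleL2 l (LambdaQ k)) (ψt t)
      - pair (ψt t) (A0 q l (remainder k l m (ψ t))))
      (1 / l * virInt k q l m (remainder k l m (ψ t0))) J t0 := by
  unfold virInt
  have hk0 : k ≠ 0 := by omega
  obtain ⟨R', hR', hR0⟩ := hq.exists_deriv_eq_zero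
  have hM := hq.isWeight_virM hl
  have hB := hq.isWeight_virB hc hl
  set M : ℝ → ℝ := fun r => virM q (r / l) with hMdef
  set B : ℝ → ℝ := fun r => virB q (r / l) with hBdef
  set B' : ℝ → ℝ := fun r => virBDeriv q (r / l) * (1 / l)
  have hM0 : ∀ r, R' * l < r → M r = 0 := fun r hr => by
    simp only [hMdef, virM]; rw [hR0 _ ((lt_div_iff₀ hl).2 hr), zero_div]
  have hB0 : ∀ r, R' * l < r → B r = 0 := fun r hr => by
    have hr' := (lt_div_iff₀ hl).2 hr
    have e : deriv (deriv q) (r / l) = 0 := by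
      have : deriv q =ᶠ[𝓝 (r / l)] fun _ => 0 := by
        filter_upwards [Ioi_mem_nhds hr'] with y hy using hR0 y hy
      rw [this.deriv_eq, deriv_const]
    simp only [hBdef, virB]; rw [e, hR0 _ hr']; simp
  have h1 := h.hasDerivWithinAt_virial hJ hk0 hl hm ht0 hM hB
    (fun r hr => by simp only [hMdef, hBdef]; field_simp) hM0 hB0
  have h2 := h.hasDerivWithinAt_inner_vC hJ hk0 hl hm ht0 (memL2_sQ hk hl) (memL2_sQ_div hk0 hl)
    (memL2_sQ_mul_cQ_div hk0 hl) (locAC_sQ hl) (fun r hr => hasDerivAt_sQ hl hr)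
  have hg := h.memH_remainder hk0 hl hm ht0
  have hF := memL2_force hk0 hl hm hg
  simp only [pC, fC] at h2
  rw [inner_toX hg.memL2_deriv (memL2_sQ_mul_cQ_div hk0 hl), inner_toX hF (memL2_sQ_div hk0 hl)] at h2
  have h3 := (h2.const_mul (-(k / l))).sub (h1.const_mul (1 / l))
  have e : ∀ t ∈ J, -pair (rescaleL2 l (LambdaQ k)) (ψt t)
      - pair (ψt t) (A0 q l (remainder k l m (ψ t))) = -(k / l) * inner ℝ (vC ψt t) (toX (sQ k l))
      - 1 / l * pair (ψt t) (fun r => r * M r * deriv (remainder k l m (ψ t)) r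
      + B r * remainder k l m (ψ t) r) := fun t ht => by
    simp only [vC]
    rw [inner_toX (h.memH0 t ht).memL2 (memL2_sQ hk hl)]
    have e1 : pair (rescaleL2 l (LambdaQ k)) (ψt t) = k / l * pair (ψt t) (sQ k l) := by
      rw [pair, pair, ← integral_const_mul]
      refine integral_congr_Ioi fun r hr => ?_
      simp only [rescaleL2, LambdaQ_div hl hr]; field_simp
    have e2 : pair (ψt t) (A0 q l (remainder k l m (ψ t)))
        = 1 / l * pair (ψt t) (fun r => r * M r * deriv (remainder k l m (ψ t)) r
      + B r * remainder k l m (ψ t) r) := by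
      rw [pair, pair, ← integral_const_mul]
      refine integral_congr_Ioi fun r hr => ?_
      simp only [A0, hMdef, hBdef, virM, virB]; field_simp; ring
    rw [e1, e2]; ring
  refine (h3.congr_of_mem e ht0).congr_deriv ?_
  -- the two derivatives add up to the integral of the virial density
  have h2B : MemL2 fun r => (2 * B r - M r) * deriv (remainder k l m (ψ t0)) r :=
    (((hB.memL2_mul hg.memL2_deriv).const_mul 2).sub (hM.memL2_mul hg.memL2_deriv)).congr
      (ae_of_all _ fun r _ => by ring)
  have I := (((((hg.memL2_deriv.hasInt (memL2_sQ_mul_cQ_div hk0 hl)).const_mul k).add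
    ((hF.hasInt (memL2_sQ_div hk0 hl)).const_mul k)).add (h2B.hasInt hg.memL2_deriv)).add
    (((hB.memL2_deriv_mul hg.memL2_div).hasInt hg.memL2_deriv).add
    (hF.hasInt ((hM.memL2_mul hg.memL2_deriv).add (hB.memL2_mul hg.memL2_div)))))
  have I' := I.congr (g := virDens k l m M B B' (remainder k l m (ψ t0))) (ae_of_all _ fun r hr => by
    simp only [virDens]; field_simp; ring)
  rw [I'.2, virialForm]
  ring

end IsWaveMap

end VirialIdentity

/-! ### Differentiating rescaled profiles in `L²(r dr)` -/

section RescaledProfiles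
variable {J : Set ℝ} {t0 : ℝ}

/-- Dominated convergence in `L²(r dr)`. -/
lemma tendsto_toX {ι : Type*} {F : Filter ι} [F.IsCountablyGenerated] {h : ι → ℝ → ℝ}
    {h₀ G : ℝ → ℝ} (hG : MemL2 G) (hm : ∀ᶠ i in F, AEMeasurable (h i) (volume.restrict (Ioi (0:ℝ))))
    (hm₀ : MemL2 h₀) (hle : ∀ᶠ i in F, ∀ r, 0 < r → |h i r| ≤ |G r|)
    (hlim : ∀ r, 0 < r → Tendsto (fun i => h i r) F (𝓝 (h₀ r))) :
    Tendsto (fun i => toX (h i)) F (𝓝 (toX h₀)) := by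
  rw [tendsto_iff_norm_sub_tendsto_zero]
  have hi : ∀ᶠ i in F, MemL2 (h i) := by
    filter_upwards [hm, hle] with i h1 h2
    exact hG.of_abs_le 1 h1 fun r hr => by rw [one_mul]; exact h2 r hr
  refine Tendsto.congr' (f₁ := fun i => √(l2Sq fun r => h i r - h₀ r)) (hi.mono fun i h1 => by
    beta_reduce; rw [← toX_sub h1 hm₀, norm_toX (h1.sub hm₀)]) ?_
  rw [← Real.sqrt_zero, show (0:ℝ) = ∫ r in Ioi (0:ℝ), (fun _ => (0:ℝ)) r by simp]
  refine (Real.continuous_sqrt.tendsto _).comp ?_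
  refine tendsto_integral_filter_of_dominated_convergence
    (fun r => 2 * (G r ^ 2 * r) + 2 * (h₀ r ^ 2 * r)) ?_ ?_ ?_ ?_
  · filter_upwards [hm] with i h1
    have := hm₀.aemeasurable
    exact AEMeasurable.aestronglyMeasurable (by fun_prop)
  · filter_upwards [hle] with i h1
    refine ae_Ioi fun r hr => ?_
    rw [Real.norm_of_nonneg (by positivity), ← mul_assoc, ← mul_assoc, ← add_mul]
    refine mul_le_mul_of_nonneg_right ?_ hr.le
    have h2 := sq_le_sq.2 (h1 r hr)
    nlinarith [sq_nonneg (h i r + h₀ r)]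
  · exact (hG.2.const_mul 2).add (hm₀.2.const_mul 2)
  · refine ae_Ioi fun r hr => ?_
    simpa using (((hlim r hr).sub_const (h₀ r)).pow 2).mul_const r

lemma abs_sub_le_of_hasDerivWithinAt {f f' : ℝ → ℝ} {C : ℝ} {s : Set ℝ} (hs : Convex ℝ s)
    (hd : ∀ t ∈ s, HasDerivWithinAt f (f' t) s t) (hC : ∀ t ∈ s, |f' t| ≤ C) {t t' : ℝ}
    (ht : t ∈ s) (ht' : t' ∈ s) : |f t' - f t| ≤ C * |t' - t| :=
  hs.norm_image_sub_le_of_norm_hasDerivWithin_le hd hC ht ht'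

lemma exists_convex_of_eventually {p : ℝ → Prop} (hJ : J.OrdConnected) (h : ∀ᶠ t in 𝓝[J] t0, p t)
    (ht0 : t0 ∈ J) : ∃ s ∈ 𝓝[J] t0, t0 ∈ s ∧ s ⊆ J ∧ Convex ℝ s ∧ ∀ t ∈ s, p t := by
  obtain ⟨ρ, hρ, hρ'⟩ := Metric.mem_nhdsWithin_iff.1 h
  exact ⟨Metric.ball t0 ρ ∩ J, inter_mem (mem_nhdsWithin_of_mem_nhds (Metric.ball_mem_nhds t0 hρ))
    self_mem_nhdsWithin, ⟨Metric.mem_ball_self hρ, ht0⟩, inter_subset_right,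
    (convex_ball t0 ρ).inter hJ.convex, hρ'⟩

/-- Differentiation under a dominated pointwise time derivative. -/
lemma hasDerivWithinAt_toX {h h' : ℝ → ℝ → ℝ} {G : ℝ → ℝ} (hJ : J.OrdConnected) (ht0 : t0 ∈ J)
    (hG : MemL2 G) (hm : ∀ t ∈ J, AEMeasurable (h t) (volume.restrict (Ioi (0:ℝ))))
    (h0 : MemL2 (h t0)) (h0' : MemL2 (h' t0))
    (hd : ∀ t ∈ J, ∀ r, 0 < r → HasDerivWithinAt (fun t => h t r) (h' t r) J t)
    (hle : ∀ᶠ t in 𝓝[J] t0, ∀ r, 0 < r → |h' t r| ≤ |G r|) :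
    HasDerivWithinAt (fun t => toX (h t)) (toX (h' t0)) J t0 := by
  obtain ⟨s, hs, hts, hsJ, hsc, hsp⟩ := exists_convex_of_eventually hJ hle ht0
  have hmv : ∀ t ∈ s, ∀ r, 0 < r → |h t r - h t0 r| ≤ |G r| * |t - t0| := fun t ht r hr =>
    abs_sub_le_of_hasDerivWithinAt hsc (fun τ hτ => (hd τ (hsJ hτ) r hr).mono hsJ)
      (fun τ hτ => hsp τ hτ r hr) hts ht
  have hmem : ∀ t ∈ s, MemL2 (h t) := fun t ht => by
    simpa using (hG.of_abs_le |t - t0| ((hm t (hsJ ht)).sub (hm t0 ht0)) fun r hr => by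
      rw [mul_comm]; exact hmv t ht r hr).add h0
  rw [hasDerivWithinAt_iff_tendsto_slope]
  have hle' : 𝓝[J \ {t0}] t0 ≤ 𝓝[J] t0 := nhdsWithin_mono _ sdiff_subset
  have hs' : ∀ᶠ t in 𝓝[J \ {t0}] t0, t ∈ s := hle' hs
  refine Tendsto.congr' (f₁ := fun t => toX fun r => (t - t0)⁻¹ * (h t r - h t0 r))
    (hs'.mono fun t ht => by
      beta_reduce; rw [toX_const_mul _ ((hmem t ht).sub h0), toX_sub (hmem t ht) h0, slope_def_module]) (tendsto_toX hG ?_ h0' ?_ fun r hr => ?_)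
  · filter_upwards [hs'] with t ht
    exact ((hm t (hsJ ht)).sub (hm t0 ht0)).const_mul _
  · filter_upwards [hs', self_mem_nhdsWithin] with t ht htn r hr
    rw [abs_mul, abs_inv, inv_mul_le_iff₀ (abs_sub_pos.2 htn.2), mul_comm]
    exact hmv t ht r hr
  · exact (hasDerivWithinAt_iff_tendsto_slope.1 (hd t0 ht0 r hr)).congr fun t => by
      rw [slope_def_module, smul_eq_mul]

/-- A difference of multipliers, differentiable in time and applied to a curve that is merely
continuous. -/
lemma hasDerivWithinAt_toX_mul {w w' P : ℝ → ℝ → ℝ} {C : ℝ} (hJ : J.OrdConnected) (ht0 : t0 ∈ J)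
    (hm : ∀ t ∈ J, AEMeasurable (w t) (volume.restrict (Ioi (0:ℝ))))
    (hm' : AEMeasurable (w' t0) (volume.restrict (Ioi (0:ℝ))))
    (hP : ∀ t ∈ J, MemL2 (P t)) (hPc : ContinuousOn (fun t => toX (P t)) J)
    (hd : ∀ t ∈ J, ∀ r, 0 < r → HasDerivWithinAt (fun t => w t r) (w' t r) J t)
    (hle : ∀ᶠ t in 𝓝[J] t0, ∀ r, 0 < r → |w' t r| ≤ C) :
    HasDerivWithinAt (fun t => toX fun r => (w t r - w t0 r) * P t r)
      (toX fun r => w' t0 r * P t0 r) J t0 := by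
  obtain ⟨s, hs, hts, hsJ, hsc, hsp⟩ := exists_convex_of_eventually hJ hle ht0
  have hC : 0 ≤ C := (abs_nonneg _).trans (hsp t0 hts 1 one_pos)
  have hmv : ∀ t ∈ s, ∀ r, 0 < r → |w t r - w t0 r| ≤ C * |t - t0| := fun t ht r hr =>
    abs_sub_le_of_hasDerivWithinAt hsc (fun τ hτ => (hd τ (hsJ hτ) r hr).mono hsJ)
      (fun τ hτ => hsp τ hτ r hr) hts ht
  have hP0 := hP t0 ht0
  have h1 : HasDerivWithinAt (fun t => toX fun r => (w t r - w t0 r) * P t0 r)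
      (toX fun r => w' t0 r * P t0 r) J t0 := by
    refine hasDerivWithinAt_toX (h := fun t r => (w t r - w t0 r) * P t0 r)
      (h' := fun t r => w' t r * P t0 r) hJ ht0 (hP0.const_mul C)
      (fun t ht => ((hm t ht).sub (hm t0 ht0)).mul hP0.aemeasurable) (by simpa using hP0.const_mul 0)
      (hP0.bdd_mul hm' (hsp t0 hts)) (fun t ht r hr => ((hd t ht r hr).sub_const _).mul_const _) ?_
    filter_upwards [hs] with t ht r hr
    rw [abs_mul C, abs_of_nonneg hC]
    exact abs_mul_le_right _ (hsp t ht r hr)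
  have h2 : HasDerivWithinAt (fun t => toX fun r => (w t r - w t0 r) * (P t r - P t0 r))
      0 J t0 := by
    rw [hasDerivWithinAt_iff_isLittleO]
    have hz : toX (fun r => (w t0 r - w t0 r) * (P t0 r - P t0 r)) = 0 := by
      simpa using toX_const_mul 0 hP0
    simp only [hz, smul_zero, sub_zero]
    have hlim : Tendsto (fun t => C * ‖toX (P t) - toX (P t0)‖) (𝓝[J] t0) (𝓝 0) := by
      simpa using (tendsto_iff_norm_sub_tendsto_zero.1 (hPc t0 ht0)).const_mul C
    refine Asymptotics.isLittleO_iff.2 fun ε hε => ?_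
    filter_upwards [hs, hlim.eventually (gt_mem_nhds hε), self_mem_nhdsWithin] with t ht h3 htJ
    have h4 := norm_toX_le ((hP t htJ).sub hP0) (C := C * |t - t0|) (by positivity)
      (f := fun r => (w t r - w t0 r) * (P t r - P t0 r))
      (((hm t htJ).sub (hm t0 ht0)).mul ((hP t htJ).aemeasurable.sub hP0.aemeasurable))
      fun r hr => abs_mul_le_right _ (hmv t ht r hr)
    rw [toX_sub (hP t htJ) hP0, mul_right_comm] at h4
    exact h4.trans (by rw [Real.norm_eq_abs]; gcongr)
  have h3 := h1.add h2
  rw [add_zero] at h3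
  have e : ∀ t ∈ s, toX (fun r => (w t r - w t0 r) * P t r)
      = toX (fun r => (w t r - w t0 r) * P t0 r)
        + toX (fun r => (w t r - w t0 r) * (P t r - P t0 r)) := fun t ht => by
    have hb : ∀ {f : ℝ → ℝ}, MemL2 f → MemL2 fun r => (w t r - w t0 r) * f r := fun hf =>
      hf.bdd_mul ((hm t (hsJ ht)).sub (hm t0 ht0)) (hmv t ht)
    rw [← toX_add (hb hP0) (hb ((hP t (hsJ ht)).sub hP0))]
    congr 1; funext r; ring
  exact h3.congr_of_eventuallyEq (mem_of_superset hs e) (e t0 hts)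

/-- The product rule for `⟪f, u⟫` at a zero of `u` needs only continuity of `f`. -/
lemma hasDerivWithinAt_inner_of_eq_zero {X : Type*} [NormedAddCommGroup X] [InnerProductSpace ℝ X]
    {f u : ℝ → X} {u' : X} (hf : ContinuousWithinAt f J t0) (hu : HasDerivWithinAt u u' J t0)
    (h0 : u t0 = 0) : HasDerivWithinAt (fun t => inner ℝ (f t) (u t)) (inner ℝ (f t0) u') J t0 := by
  rw [hasDerivWithinAt_iff_tendsto_slope] at hu ⊢
  have h1 : Tendsto f (𝓝[J \ {t0}] t0) (𝓝 (f t0)) := hf.mono_left (nhdsWithin_mono _ sdiff_subset)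
  refine (h1.inner hu).congr fun t => ?_
  simp only [slope_def_module, h0, inner_zero_right, sub_zero, inner_smul_right, smul_eq_mul]

/-- A `C¹` length scale. -/
structure IsScale (J : Set ℝ) (a a' : ℝ → ℝ) : Prop where
  pos : ∀ t ∈ J, 0 < a t
  hasDerivWithinAt : ∀ t ∈ J, HasDerivWithinAt a (a' t) J t
  continuousOn_deriv : ContinuousOn a' J

variable {a a' b b' w w' u u' : ℝ → ℝ} {l m r C C' D ε : ℝ}

lemma IsScale.continuousOn (h : IsScale J a a') : ContinuousOn a J :=
  fun t ht => (h.hasDerivWithinAt t ht).continuousWithinAt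

lemma IsScale.exists_bound (h : IsScale J a a') (ht0 : t0 ∈ J) : ∃ L : ℝ, 0 < L ∧
    ∀ᶠ t in 𝓝[J] t0, t ∈ J ∧ a t ≤ L ∧ 1 / a t ≤ L ∧ |a' t / a t| ≤ L := by
  have hp := h.pos t0 ht0
  have h1 := (h.continuousOn t0 ht0).eventually (gt_mem_nhds (lt_add_one (a t0)))
  have h2 := (ContinuousWithinAt.div continuousWithinAt_const (h.continuousOn t0 ht0)
    hp.ne' (f := fun _ => (1:ℝ))).eventually (gt_mem_nhds (lt_add_one (1 / a t0)))
  have h3 := ((h.continuousOn_deriv t0 ht0).div (h.continuousOn t0 ht0) hp.ne').abs.eventually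
    (gt_mem_nhds (lt_add_one |a' t0 / a t0|))
  have e1 : 0 ≤ 1 / a t0 := by positivity
  refine ⟨a t0 + 1 + (1 / a t0 + 1) + (|a' t0 / a t0| + 1), by positivity, ?_⟩
  filter_upwards [self_mem_nhdsWithin, h1, h2, h3] with t ht g1 g2 g3
  have := abs_nonneg (a' t0 / a t0)
  simp only [Pi.div_apply] at g2 g3
  exact ⟨ht, by linarith, by linarith, by linarith⟩

/-- The chain rule for a rescaled profile. -/
lemma IsScale.hasDerivWithinAt_comp (h : IsScale J a a')
    (hw : ∀ y, 0 < y → HasDerivAt w (w' y) y) {t : ℝ} (ht : t ∈ J) (hr : 0 < r) :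
    HasDerivWithinAt (fun t => w (r / a t)) (-(a' t / a t) * (r / a t * w' (r / a t))) J t := by
  have hp := h.pos t ht
  refine ((hw (r / a t) (div_pos hr hp)).comp_hasDerivWithinAt t
    ((hasDerivWithinAt_const t J r).div (h.hasDerivWithinAt t ht) hp.ne')).congr_deriv ?_
  field_simp; ring

/-- The comparison function `1 / (1 + (r / l)²)`, which belongs to `L²(r dr)`. -/
noncomputable def decay (l r : ℝ) : ℝ := 1 / (1 + (r / l) ^ 2)

lemma decay_pos (l r : ℝ) : 0 < decay l r := by unfold decay; positivity

lemma decay_le_one (l r : ℝ) : decay l r ≤ 1 := by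
  unfold decay; rw [div_le_one (by positivity)]; nlinarith [sq_nonneg (r / l)]

lemma decay_mono (hl : 0 < l) (hm : l ≤ m) (hr : 0 < r) : decay l r ≤ decay m r := by
  unfold decay
  have : r / m ≤ r / l := by gcongr
  have h0 : 0 ≤ r / m := by bound
  gcongr

lemma measurable_decay (l : ℝ) : Measurable (decay l) := by unfold decay; fun_prop

lemma memL2_decay (hl : 0 < l) : MemL2 (decay l) := by
  refine ⟨(measurable_decay l).aestronglyMeasurable, ?_⟩
  refine ((integrable_inv_one_add_sq.comp_div hl.ne').const_mul l).integrableOn.mono' (Measurable.aestronglyMeasurable (by have := measurable_decay l; fun_prop)) ?_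
  refine ae_Ioi fun r hr => ?_
  rw [Real.norm_of_nonneg (by positivity), decay]
  rw [show (1 / (1 + (r / l) ^ 2)) ^ 2 * r
    = l * (1 + (r / l) ^ 2)⁻¹ * ((r / l) / (1 + (r / l) ^ 2)) by field_simp]
  refine mul_le_of_le_one_right (by positivity) ?_
  rw [div_le_one (by positivity)]
  nlinarith [sq_nonneg (r / l - 1)]

/-- A function on the half-line that decays like `y⁻²` together with its logarithmic derivative. -/
structure IsProfile (w w' : ℝ → ℝ) (C : ℝ) : Prop where
  hasDerivAt : ∀ y, 0 < y → HasDerivAt w (w' y) y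
  continuousOn : ContinuousOn w' (Ioi 0)
  abs_le : ∀ y, 0 < y → |w y| ≤ C * decay 1 y
  abs_deriv_le : ∀ y, 0 < y → |y * w' y| ≤ C * decay 1 y

lemma decay_div (l r : ℝ) : decay 1 (r / l) = decay l r := by simp [decay]

lemma IsProfile.nonneg (h : IsProfile w w' C) : 0 ≤ C :=
  nonneg_of_mul_nonneg_left ((abs_nonneg _).trans (h.abs_le 1 one_pos)) (decay_pos 1 1)

lemma IsProfile.isWeight (h : IsProfile w w' C) : IsWeight w w' C C where
  hasDerivAt := h.hasDerivAt
  continuousOn := h.continuousOn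
  abs_le y hy := (h.abs_le y hy).trans (mul_le_of_le_one_right h.nonneg (decay_le_one 1 y))
  abs_deriv_le y hy := (h.abs_deriv_le y hy).trans (mul_le_of_le_one_right h.nonneg (decay_le_one 1 y))

lemma continuousOn_comp_div {f : ℝ → ℝ} (hf : ContinuousOn f (Ioi 0)) (hl : 0 < l) :
    ContinuousOn (fun r => f (r / l)) (Ioi 0) :=
  hf.comp (continuousOn_id.div_const l) fun _ hx => div_pos hx hl

lemma aemeasurable_comp_div {f : ℝ → ℝ} (hf : ContinuousOn f (Ioi 0)) (hl : 0 < l) :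
    AEMeasurable (fun r => f (r / l)) (volume.restrict (Ioi (0:ℝ))) :=
  ((continuousOn_comp_div hf hl).aestronglyMeasurable measurableSet_Ioi).aemeasurable

lemma IsScale.tendsto_comp (h : IsScale J a a') {f : ℝ → ℝ} (hf : ContinuousOn f (Ioi 0))
    (ht0 : t0 ∈ J) (hr : 0 < r) : Tendsto (fun t => f (r / a t)) (𝓝[J] t0) (𝓝 (f (r / a t0))) := by
  have hp := h.pos t0 ht0
  refine ((hf.continuousAt (Ioi_mem_nhds (div_pos hr hp))).tendsto).comp ?_
  exact (ContinuousWithinAt.div continuousWithinAt_const (h.continuousOn t0 ht0) hp.ne')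

lemma memL2_comp_mul_comp {f g : ℝ → ℝ} (hf : ContinuousOn f (Ioi 0)) (hg : ContinuousOn g (Ioi 0))
    (hfC : ∀ y, 0 < y → |f y| ≤ C * decay 1 y) (hgD : ∀ y, 0 < y → |g y| ≤ D) (hl : 0 < l)
    (hm : 0 < m) : MemL2 fun r => f (r / l) * g (r / m) := by
  refine (memL2_decay hl).of_abs_le (C * D) ((aemeasurable_comp_div hf hl).mul
    (aemeasurable_comp_div hg hm)) fun r hr => ?_
  have h1 := hfC _ (div_pos hr hl)
  rw [decay_div] at h1
  rw [abs_mul, abs_of_pos (decay_pos l r)]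
  rw [mul_right_comm]
  exact mul_le_mul h1 (hgD _ (div_pos hr hm)) (abs_nonneg _) ((abs_nonneg _).trans h1)

/-- Continuity in time of a product of two rescaled functions. -/
lemma continuousOn_toX_comp_mul_comp (ha : IsScale J a a') (hb : IsScale J b b') {f g : ℝ → ℝ}
    (hf : ContinuousOn f (Ioi 0)) (hg : ContinuousOn g (Ioi 0))
    (hfC : ∀ y, 0 < y → |f y| ≤ C * decay 1 y) (hgD : ∀ y, 0 < y → |g y| ≤ D) :
    ContinuousOn (fun t => toX fun r => f (r / a t) * g (r / b t)) J := by
  intro t0 ht0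
  have hD : 0 ≤ D := (abs_nonneg _).trans (hgD 1 one_pos)
  have hC : 0 ≤ C := nonneg_of_mul_nonneg_left ((abs_nonneg _).trans (hfC 1 one_pos)) (decay_pos 1 1)
  obtain ⟨L, hL, hLe⟩ := ha.exists_bound ht0
  refine tendsto_toX ((memL2_decay hL).const_mul (C * D)) ?_
    (memL2_comp_mul_comp hf hg hfC hgD (ha.pos t0 ht0) (hb.pos t0 ht0)) ?_
    fun r hr => (ha.tendsto_comp hf ht0 hr).mul (hb.tendsto_comp hg ht0 hr)
  · filter_upwards [hLe] with t ht
    exact (aemeasurable_comp_div hf (ha.pos t ht.1)).mul (aemeasurable_comp_div hg (hb.pos t ht.1))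
  · filter_upwards [hLe] with t ht r hr
    have h1 := hfC _ (div_pos hr (ha.pos t ht.1))
    rw [decay_div] at h1
    have h2 := mul_le_mul_of_nonneg_left (decay_mono (ha.pos t ht.1) ht.2.1 hr) hC
    rw [abs_of_nonneg (mul_nonneg (mul_nonneg hC hD) (decay_pos L r).le), mul_right_comm]
    exact abs_mul_le (h1.trans h2) (hgD _ (div_pos hr (hb.pos t ht.1)))

lemma IsProfile.memL2_comp_mul (hw : IsProfile w w' C) (hu : IsWeight u u' D ε) (hl : 0 < l)
    (hm : 0 < m) : MemL2 fun r => w (r / l) * u (r / m) :=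
  memL2_comp_mul_comp hw.isWeight.locAC.continuousOn hu.locAC.continuousOn hw.abs_le hu.abs_le hl hm

lemma IsProfile.continuousOn_toX_comp_mul (hw : IsProfile w w' C) (hu : IsWeight u u' D ε)
    (ha : IsScale J a a') (hb : IsScale J b b') :
    ContinuousOn (fun t => toX fun r => w (r / a t) * u (r / b t)) J :=
  continuousOn_toX_comp_mul_comp ha hb hw.isWeight.locAC.continuousOn hu.locAC.continuousOn hw.abs_le
    hu.abs_le

lemma continuousOn_id_mul {f : ℝ → ℝ} (hf : ContinuousOn f (Ioi 0)) :
    ContinuousOn (fun y => y * f y) (Ioi 0) := continuousOn_id.mul hf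

lemma IsWeight.continuousOn' (h : IsWeight w w' C ε) : ContinuousOn w (Ioi 0) :=
  h.locAC.continuousOn

/-- The time derivative of a product of two rescaled profiles. -/
lemma hasDerivWithinAt_toX_comp_mul_comp (hJ : J.OrdConnected) (ha : IsScale J a a')
    (hb : IsScale J b b') (hw : IsProfile w w' C) (hu : IsWeight u u' D D) (ht0 : t0 ∈ J) :
    HasDerivWithinAt (fun t => toX fun r => w (r / a t) * u (r / b t))
      (toX fun r => -(a' t0 / a t0) * (r / a t0 * w' (r / a t0)) * u (r / b t0)
        + w (r / a t0) * (-(b' t0 / b t0) * (r / b t0 * u' (r / b t0)))) J t0 := by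
  have hC := hw.nonneg
  have hD := hu.nonneg.1
  obtain ⟨L, hL, hLe⟩ := ha.exists_bound ht0
  obtain ⟨L', hL', hLe'⟩ := hb.exists_bound ht0
  refine hasDerivWithinAt_toX (h := fun t r => w (r / a t) * u (r / b t))
    (h' := fun t r => -(a' t / a t) * (r / a t * w' (r / a t)) * u (r / b t)
        + w (r / a t) * (-(b' t / b t) * (r / b t * u' (r / b t)))) hJ ht0
    ((memL2_decay hL).const_mul (L * C * D + C * (L' * D)))
    (fun t ht => (aemeasurable_comp_div hw.isWeight.continuousOn' (ha.pos t ht)).mul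
      (aemeasurable_comp_div hu.continuousOn' (hb.pos t ht)))
    (hw.memL2_comp_mul hu (ha.pos t0 ht0) (hb.pos t0 ht0)) ?_
    (fun t ht r hr => (ha.hasDerivWithinAt_comp hw.hasDerivAt ht hr).mul
      (hb.hasDerivWithinAt_comp hu.hasDerivAt ht hr)) ?_
  · have h1 := (memL2_comp_mul_comp (continuousOn_id_mul hw.continuousOn) hu.continuousOn'
      hw.abs_deriv_le hu.abs_le (ha.pos t0 ht0) (hb.pos t0 ht0)).const_mul (-(a' t0 / a t0))
    have h2 := (memL2_comp_mul_comp hw.isWeight.continuousOn' (continuousOn_id_mul hu.continuousOn)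
      hw.abs_le hu.abs_deriv_le (ha.pos t0 ht0) (hb.pos t0 ht0)).const_mul (-(b' t0 / b t0))
    exact (h1.add h2).congr (ae_of_all _ fun r _ => by ring)
  · filter_upwards [hLe, hLe'] with t ht ht' r hr
    have hra := div_pos hr (ha.pos t ht.1)
    have hrb := div_pos hr (hb.pos t ht.1)
    have h1 := hw.abs_le _ hra
    have h1' := hw.abs_deriv_le _ hra
    rw [decay_div] at h1 h1'
    have hdm := mul_le_mul_of_nonneg_left (decay_mono (ha.pos t ht.1) ht.2.1 hr) hC
    have hd0 := decay_pos L r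
    refine (abs_add_le _ _).trans ((add_le_add (abs_mul_le (abs_mul_le
      ((abs_neg _).trans_le ht.2.2.2) (h1'.trans hdm)) (hu.abs_le _ hrb)) (abs_mul_le (h1.trans hdm)
      (abs_mul_le ((abs_neg _).trans_le ht'.2.2.2) (hu.abs_deriv_le _ hrb)))).trans ?_)
    rw [abs_of_nonneg (by positivity)]
    exact le_of_eq (by ring)

/-- A smooth function that vanishes for large arguments is a profile. -/
lemma exists_isProfile {f : ℝ → ℝ} {A : ℝ} (hf : ContDiff ℝ 1 f) (h0 : ∀ y, A ≤ y → f y = 0) :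
    ∃ C, IsProfile f (deriv f) C := by
  have hc : Continuous f := hf.continuous
  have hc' : Continuous (deriv f) := by fun_prop
  obtain ⟨C, hC⟩ := (isCompact_Icc (a := (0:ℝ)) (b := A)).exists_bound_of_continuousOn hc.continuousOn
  obtain ⟨C', hC'⟩ := (isCompact_Icc (a := (0:ℝ)) (b := A)).exists_bound_of_continuousOn
    (continuous_id.mul hc').continuousOn
  have key : ∀ {g : ℝ → ℝ} {D : ℝ}, (∀ y ∈ Icc 0 A, |g y| ≤ D) → (∀ y, A < y → g y = 0) →
      ∀ y, 0 < y → |g y| ≤ |D| * (1 + A ^ 2) * decay 1 y := by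
    intro g D h1 h2 y hy
    rcases le_or_gt y A with h | h
    · rw [decay, div_one, mul_one_div, le_div_iff₀ (by positivity)]
      have := h1 y ⟨hy.le, h⟩
      exact mul_le_mul (this.trans (le_abs_self _)) (by nlinarith) (by positivity) (abs_nonneg _)
    · rw [h2 y h, abs_zero]
      have := decay_pos 1 y
      positivity
  have h0' : ∀ y, A < y → y * deriv f y = 0 := fun y hy => by
    have : f =ᶠ[𝓝 y] fun _ => 0 := by
      filter_upwards [Ioi_mem_nhds hy] with x hx using h0 x (le_of_lt hx)
    rw [this.deriv_eq, deriv_const, mul_zero]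
  have hmono : ∀ {D : ℝ}, |D| ≤ |C| + |C'| → ∀ y, |D| * (1 + A ^ 2) * decay 1 y
      ≤ (|C| + |C'|) * (1 + A ^ 2) * decay 1 y := fun h y => by
    have := decay_pos 1 y
    gcongr
  refine ⟨(|C| + |C'|) * (1 + A ^ 2), fun y _ => ?_, hc'.continuousOn, fun y hy => ?_, fun y hy => ?_⟩
  · exact (hf.differentiable one_ne_zero y).hasDerivAt
  · exact (key hC (fun y hy => h0 y hy.le) y hy).trans (hmono (by norm_num) y)
  · exact (key hC' h0' y hy).trans (hmono (by norm_num) y)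

end RescaledProfiles

/-! ### The remainder with time-dependent scales -/

section MovingScales
variable {k : ℕ} {J : Set ℝ} {t0 l m r y C : ℝ} {a a' b b' w F : ℝ → ℝ} {ψ ψt : ℝ → ℝ → ℝ}

lemma sQ_one_div (k : ℕ) (l r : ℝ) : sQ k 1 (r / l) = sQ k l r := by simp [sQ]

lemma cQ_one_div (k : ℕ) (l r : ℝ) : cQ k 1 (r / l) = cQ k l r := by simp [cQ]

lemma sQ_le_two_mul_div (hk : 1 ≤ k) (hl : 0 < l) (hr : 0 < r) : sQ k l r ≤ 2 * (r / l) := by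
  rcases le_total (r / l) 1 with h | h
  · linarith [sQ_le_two_mul_pow (k := k) hl hr, pow_one (r / l),
      pow_le_pow_of_le_one (by positivity : 0 ≤ r / l) h hk]
  · linarith [sQ_le_one k l r]

lemma sQ_le_two_mul_inv_pow {j : ℕ} (hk : j ≤ k) (hl : 0 < l) (hr : 0 < r) :
    sQ k l r ≤ 2 * (l / r) ^ j := by
  rcases le_total (l / r) 1 with h | h
  · linarith [sQ_le_two_mul_pow_inv (k := k) hl hr,
      pow_le_pow_of_le_one (by positivity : 0 ≤ l / r) h hk]
  · linarith [sQ_le_one k l r, one_le_pow₀ (n := j) h]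

lemma sQ_le_decay (hk : 2 ≤ k) (hy : 0 < y) : sQ k 1 y ≤ 4 * decay 1 y := by
  have h1 := sQ_le_two_mul_inv_pow hk one_pos hy
  rw [div_pow, one_pow, mul_one_div, le_div_iff₀ (by positivity)] at h1
  rw [decay, mul_one_div, le_div_iff₀ (by positivity), div_one]
  linarith [sQ_le_one k 1 y]

lemma sQ_le_mul_decay (hk : 2 ≤ k) (hy : 0 < y) : sQ k 1 y ≤ 4 * (y * decay 1 y) := by
  have h1 := sQ_le_two_mul_inv_pow (j := 1) (by omega : 1 ≤ k) one_pos hy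
  rw [pow_one, mul_one_div, le_div_iff₀ hy] at h1
  have h2 := sQ_le_two_mul_div (by omega : 1 ≤ k) one_pos hy
  rw [div_one] at h2
  rw [decay, mul_one_div, mul_div_assoc', le_div_iff₀ (by positivity), div_one]
  nlinarith

lemma abs_cQ_mul_sQ_le (hy : 0 < y) : |cQ k 1 y * (k * sQ k 1 y)| ≤ k * sQ k 1 y := by
  have h0 : 0 ≤ k * sQ k 1 y := mul_nonneg (Nat.cast_nonneg k) (sQ_pos one_pos hy).le
  simpa [abs_of_nonneg h0] using abs_mul_le_right (k * sQ k 1 y) (abs_cQ_le k 1 y)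

lemma isProfile_sQ (hk : 2 ≤ k) :
    IsProfile (sQ k 1) (fun y => cQ k 1 y * (k * sQ k 1 y / y)) (4 * k) where
  hasDerivAt y hy := hasDerivAt_sQ one_pos hy
  continuousOn := continuousOn_deriv_sQ k 1
  abs_le y hy := by
    rw [abs_of_pos (sQ_pos one_pos hy)]
    have h1 : (1:ℝ) ≤ k := by exact_mod_cast (by omega : 1 ≤ k)
    nlinarith [decay_pos 1 y, sQ_le_decay hk hy]
  abs_deriv_le y hy := by
    rw [show y * (cQ k 1 y * (k * sQ k 1 y / y)) = cQ k 1 y * (k * sQ k 1 y) by field_simp]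
    refine (abs_cQ_mul_sQ_le hy).trans ?_
    nlinarith [sQ_le_decay hk hy, Nat.cast_nonneg (α := ℝ) k]

/-- Differentiability in time of a rescaled function, divided by `r ^ j`. The function need not
be square integrable itself. -/
lemma hasDerivWithinAt_toX_sub_div (j : ℕ) (hJ : J.OrdConnected) (ha : IsScale J a a')
    (hw : ∀ y, 0 < y → HasDerivAt w (F y / y) y) (hF : ContinuousOn F (Ioi 0))
    (hC : ∀ y, 0 < y → |F y| ≤ C * (y ^ j * decay 1 y)) (ht0 : t0 ∈ J) :
    HasDerivWithinAt (fun t => toX fun r => (w (r / a t) - w (r / a t0)) / r ^ j)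
      (-(a' t0 / a t0) • toX fun r => F (r / a t0) / r ^ j) J t0 := by
  have hC0 : 0 ≤ C := nonneg_of_mul_nonneg_left ((abs_nonneg _).trans (hC 1 one_pos))
    (by have := decay_pos 1 1; positivity)
  have hwc : ContinuousOn w (Ioi 0) := fun y hy => (hw y hy).continuousAt.continuousWithinAt
  obtain ⟨L, hL, hLe⟩ := ha.exists_bound ht0
  have hle : ∀ᶠ t in 𝓝[J] t0, t ∈ J ∧ ∀ r, 0 < r → |F (r / a t) / r ^ j| ≤ C * L ^ j * decay L r ∧
      |-(a' t / a t) * (F (r / a t) / r ^ j)| ≤ |L * (C * L ^ j) * decay L r| := by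
    filter_upwards [hLe] with t ht
    refine ⟨ht.1, fun r hr => ?_⟩
    have hp := ha.pos t ht.1
    have h1 := hC _ (div_pos hr hp)
    rw [decay_div] at h1
    have hd0 := decay_pos L r
    have hd1 := decay_pos (a t) r
    have hd := decay_mono hp ht.2.1 hr
    have hq : r / a t ≤ r * L := by rw [div_eq_mul_one_div]; exact mul_le_mul_of_nonneg_left ht.2.2.1 hr.le
    have h2 : |F (r / a t) / r ^ j| ≤ C * L ^ j * decay L r := by
      refine (abs_div_le (by positivity) h1).trans ((div_le_iff₀ (by positivity)).2 ?_)
      calc _ ≤ C * ((r * L) ^ j * decay L r) := by gcongr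
        _ = _ := by rw [mul_pow]; ring
    rw [mul_assoc L]
    exact ⟨h2, (abs_mul_le ((abs_neg _).trans_le ht.2.2.2) h2).trans (le_abs_self _)⟩
  have hG := (memL2_decay hL).const_mul
  have hmem : MemL2 fun r => F (r / a t0) / r ^ j := (memL2_decay hL).of_abs_le (C * L ^ j)
    ((aemeasurable_comp_div hF (ha.pos t0 ht0)).div (by fun_prop)) fun r hr => by
      rw [abs_of_pos (decay_pos L r)]; exact ((hle.self_of_nhdsWithin ht0).2 r hr).1
  rw [← toX_const_mul _ hmem]
  refine hasDerivWithinAt_toX (h := fun t r => (w (r / a t) - w (r / a t0)) / r ^ j)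
    (h' := fun t r => -(a' t / a t) * (F (r / a t) / r ^ j)) hJ ht0 (hG _)
    (fun t ht => ((aemeasurable_comp_div hwc (ha.pos t ht)).sub
      (aemeasurable_comp_div hwc (ha.pos t0 ht0))).div (by fun_prop)) (by simpa using hG 0)
    (hmem.const_mul _) (fun t ht r hr => ?_) (hle.mono fun t ht r hr => (ht.2 r hr).2)
  refine (((ha.hasDerivWithinAt_comp hw ht hr).sub_const _).div_const _).congr_deriv ?_
  rw [mul_div_cancel₀ _ (div_pos hr (ha.pos t ht)).ne', mul_div_assoc]

lemma hasDerivWithinAt_toX_Q_div_pow {j : ℕ} (hJ : J.OrdConnected) (ha : IsScale J a a')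
    (hj : ∀ y, 0 < y → sQ k 1 y ≤ 4 * (y ^ j * decay 1 y)) (ht0 : t0 ∈ J) :
    HasDerivWithinAt (fun t => toX fun r => (Q k (r / a t) - Q k (r / a t0)) / r ^ j)
      (-(a' t0 / a t0) • toX fun r => k * sQ k (a t0) r / r ^ j) J t0 := by
  have h1 := hasDerivWithinAt_toX_sub_div (w := Q k) (F := fun y => k * sQ k 1 y) (C := 4 * k) j hJ
    ha (fun y hy => by simpa only [div_one] using hasDerivAt_Q (k := k) one_pos hy) (by fun_prop)
    (fun y hy => by
      rw [abs_of_nonneg (mul_nonneg (Nat.cast_nonneg k) (sQ_pos one_pos hy).le)]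
      nlinarith [hj y hy, Nat.cast_nonneg (α := ℝ) k]) ht0
  simpa only [sQ_one_div] using h1

lemma hasDerivWithinAt_toX_Q (hk : 2 ≤ k) (hJ : J.OrdConnected) (ha : IsScale J a a')
    (ht0 : t0 ∈ J) :
    HasDerivWithinAt (fun t => toX fun r => Q k (r / a t) - Q k (r / a t0))
      (-(k * a' t0 / a t0) • toX (sQ k (a t0))) J t0 := by
  have h1 := hasDerivWithinAt_toX_Q_div_pow (j := 0) hJ ha (by simpa using fun y => sQ_le_decay hk)
    ht0
  simp only [pow_zero, div_one] at h1
  refine h1.congr_deriv ?_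
  rw [toX_const_mul _ (memL2_sQ hk (ha.pos t0 ht0)), smul_smul]; congr 1; ring

/-- `Q_{a(t)} / r` is differentiable in time. -/
lemma hasDerivWithinAt_toX_Q_div (hk : 2 ≤ k) (hJ : J.OrdConnected) (ha : IsScale J a a')
    (ht0 : t0 ∈ J) :
    HasDerivWithinAt (fun t => toX fun r => (Q k (r / a t) - Q k (r / a t0)) / r)
      (-(k * a' t0 / a t0) • toX fun r => sQ k (a t0) r / r) J t0 := by
  have h1 := hasDerivWithinAt_toX_Q_div_pow (j := 1) hJ ha
    (by simpa using fun y => sQ_le_mul_decay hk) ht0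
  simp only [pow_one, mul_div_assoc] at h1
  refine h1.congr_deriv ?_
  rw [toX_const_mul _ (memL2_sQ_div (by omega) (ha.pos t0 ht0)), smul_smul]; congr 1; ring

/-- `∂_r Q_{a(t)}` is differentiable in time. -/
lemma hasDerivWithinAt_toX_sQ_div (hk : 2 ≤ k) (hJ : J.OrdConnected) (ha : IsScale J a a')
    (ht0 : t0 ∈ J) :
    HasDerivWithinAt (fun t => toX fun r => (sQ k (a t) r - sQ k (a t0) r) / r)
      (-(a' t0 / a t0) • toX fun r => cQ k (a t0) r * (k * sQ k (a t0) r / r)) J t0 := by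
  have h1 := hasDerivWithinAt_toX_sub_div (F := fun y => cQ k 1 y * (k * sQ k 1 y)) (C := 4 * k) 1 hJ
    ha (fun y hy => by simpa only [mul_div_assoc] using hasDerivAt_sQ (k := k) one_pos hy)
    (by fun_prop) (fun y hy => (abs_cQ_mul_sQ_le hy).trans (by
      nlinarith [sQ_le_mul_decay hk hy, Nat.cast_nonneg (α := ℝ) k])) ht0
  simpa only [pow_one, sQ_one_div, cQ_one_div, mul_div_assoc] using h1

namespace IsWaveMap

lemma toX_remainder_div_sub (h : IsWaveMap k J ψ ψt) (hk : k ≠ 0) {l' m' t : ℝ} (hl : 0 < l)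
    (hm : 0 < m) (hl' : 0 < l') (hm' : 0 < m') (ht : t ∈ J) :
    toX (fun r => remainder k l' m' (ψ t) r / r) = zC k l m ψ t
      - toX (fun r => (Q k (r / l') - Q k (r / l)) / r)
      + toX (fun r => (Q k (r / m') - Q k (r / m)) / r) := by
  have hQ : ∀ {l l' : ℝ}, 0 < l → 0 < l' → MemL2 fun r => (Q k (r / l') - Q k (r / l)) / r :=
    fun hl hl' => (memH_twoBubble hk hl' hl).memL2_div
  have hg := (h.memH_remainder hk hl hm ht).memL2_div
  rw [zC, ← toX_sub hg (hQ hl hl'), ← toX_add (hg.sub (hQ hl hl')) (hQ hm hm')]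
  congr 1; funext r; simp only [remainder_eq, twoBubble]; ring

lemma toX_deriv_remainder_sub (h : IsWaveMap k J ψ ψt) (hk : k ≠ 0) {l' m' t : ℝ} (hl : 0 < l)
    (hm : 0 < m) (hl' : 0 < l') (hm' : 0 < m') (ht : t ∈ J) :
    toX (deriv (remainder k l' m' (ψ t))) = pC k l m ψ t
      - (k:ℝ) • toX (fun r => (sQ k l' r - sQ k l r) / r)
      + (k:ℝ) • toX (fun r => (sQ k m' r - sQ k m r) / r) := by
  have hQ : ∀ {l l' : ℝ}, 0 < l → 0 < l' → MemL2 fun r => (sQ k l' r - sQ k l r) / r :=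
    fun hl hl' => by simpa only [sub_div] using (memL2_sQ_div hk hl').sub (memL2_sQ_div hk hl)
  have hg := h.memH_remainder hk hl hm ht
  have hg' := h.memH_remainder hk hl' hm' ht
  have i1 := (hQ hl hl').const_mul k
  have i2 := (hQ hm hm').const_mul k
  have i3 := hg.memL2_deriv
  rw [pC, ← toX_const_mul _ (hQ hl hl'), ← toX_const_mul _ (hQ hm hm'), ← toX_sub i3 i1,
    ← toX_add (i3.sub i1) i2]
  refine toX_congr ?_ ((i3.sub i1).add i2)
  filter_upwards [hg.ae_deriv_sub hg',
    (memH_twoBubble (k := k) hk hl' hm').ae_deriv_sub (memH_twoBubble hk hl hm)] with r h1 h2 hr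
  have e : (fun r => remainder k l m (ψ t) r - remainder k l' m' (ψ t) r)
      = fun r => twoBubble k l' m' r - twoBubble k l m r := by
    funext r; simp only [remainder_eq]; ring
  have h1' := h1 hr
  rw [e, h2 hr, deriv_twoBubble hl hm hr, deriv_twoBubble hl' hm' hr] at h1'
  have : deriv (remainder k l' m' (ψ t)) r = deriv (remainder k l m (ψ t)) r
    - (k * (sQ k l' r - sQ k m' r) / r - k * (sQ k l r - sQ k m r) / r) := by linarith
  rw [this]; ring

lemma continuousOn_toX_remainder_div (h : IsWaveMap k J ψ ψt) (hJ : J.OrdConnected) (hk : 2 ≤ k)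
    (ha : IsScale J a a') (hb : IsScale J b b') :
    ContinuousOn (fun t => toX fun r => remainder k (a t) (b t) (ψ t) r / r) J := by
  intro t0 ht0
  have hk0 : k ≠ 0 := by omega
  have h1 := (((h.continuousOn_zC hk0 (ha.pos t0 ht0) (hb.pos t0 ht0)) t0 ht0).sub
    (hasDerivWithinAt_toX_Q_div hk hJ ha ht0).continuousWithinAt).add
    (hasDerivWithinAt_toX_Q_div hk hJ hb ht0).continuousWithinAt
  have e := fun t ht => h.toX_remainder_div_sub hk0 (ha.pos t0 ht0) (hb.pos t0 ht0) (ha.pos t ht)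
    (hb.pos t ht) ht
  exact h1.congr e (e t0 ht0)

lemma continuousOn_toX_deriv_remainder (h : IsWaveMap k J ψ ψt) (hJ : J.OrdConnected) (hk : 2 ≤ k)
    (ha : IsScale J a a') (hb : IsScale J b b') :
    ContinuousOn (fun t => toX (deriv (remainder k (a t) (b t) (ψ t)))) J := by
  intro t0 ht0
  have hk0 : k ≠ 0 := by omega
  have h1 := (((h.continuousOn_pC hk0 (ha.pos t0 ht0) (hb.pos t0 ht0)) t0 ht0).sub
    ((hasDerivWithinAt_toX_sQ_div hk hJ ha ht0).continuousWithinAt.const_smul (k:ℝ))).add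
    ((hasDerivWithinAt_toX_sQ_div hk hJ hb ht0).continuousWithinAt.const_smul (k:ℝ))
  have e := fun t ht => h.toX_deriv_remainder_sub hk0 (ha.pos t0 ht0) (hb.pos t0 ht0) (ha.pos t ht)
    (hb.pos t ht) ht
  exact h1.congr e (e t0 ht0)

/-- The remainder `g(t) = ψ(t) - (Q_{a(t)} - Q_{b(t)})` satisfies
`∂_t g = ψ_t + (a'/a) (ΛQ)_a - (b'/b) (ΛQ)_b` in `L²(r dr)`. -/
lemma hasDerivWithinAt_toX_remainder (h : IsWaveMap k J ψ ψt) (hJ : J.OrdConnected) (hk : 2 ≤ k)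
    (ha : IsScale J a a') (hb : IsScale J b b')
    (ht0 : t0 ∈ J) :
    (∀ t ∈ J, MemL2 fun r => remainder k (a t) (b t) (ψ t) r - remainder k (a t0) (b t0) (ψ t0) r) ∧
    HasDerivWithinAt (fun t => toX fun r => remainder k (a t) (b t) (ψ t) r
        - remainder k (a t0) (b t0) (ψ t0) r)
      (vC ψt t0 + (k * a' t0 / a t0) • toX (sQ k (a t0)) - (k * b' t0 / b t0) • toX (sQ k (b t0)))
      J t0 := by
  have hQ : ∀ {c c' : ℝ → ℝ}, IsScale J c c' → ∀ t ∈ J,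
      MemL2 fun r => Q k (r / c t) - Q k (r / c t0) := fun {c c'} hc t ht => by
    refine (memL2_sQ hk (hc.pos t ht)).of_abs_le
      (|1 - (c t / c t0) ^ k| * (1 + 1 / (c t / c t0) ^ k)) (by fun_prop) fun r hr => ?_
    rw [abs_of_pos (sQ_pos (hc.pos t ht) hr)]
    exact abs_twoBubble_le (hc.pos t ht) (hc.pos t0 ht0) hr
  have hψ := fun t ht => h.memL2_sub hJ ht0 (s' := t) ht
  have e : ∀ t, (fun r => remainder k (a t) (b t) (ψ t) r - remainder k (a t0) (b t0) (ψ t0) r)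
      = fun r => (ψ t r - ψ t0 r) - (Q k (r / a t) - Q k (r / a t0))
        + (Q k (r / b t) - Q k (r / b t0)) := fun t => by
    funext r; simp only [remainder_eq, twoBubble]; ring
  refine ⟨fun t ht => by rw [e]; exact ((hψ t ht).sub (hQ ha t ht)).add (hQ hb t ht), ?_⟩
  have h1 := ((h.hasDerivWithinAt_toX_sub hJ ht0).sub (hasDerivWithinAt_toX_Q hk hJ ha ht0)).add
    (hasDerivWithinAt_toX_Q hk hJ hb ht0)
  have h2 : ∀ t ∈ J, toX (fun r => remainder k (a t) (b t) (ψ t) r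
      - remainder k (a t0) (b t0) (ψ t0) r) = toX (fun r => ψ t r - ψ t0 r)
      - toX (fun r => Q k (r / a t) - Q k (r / a t0))
      + toX (fun r => Q k (r / b t) - Q k (r / b t0)) := fun t ht => by
    rw [e, ← toX_sub (hψ t ht) (hQ ha t ht), ← toX_add ((hψ t ht).sub (hQ ha t ht)) (hQ hb t ht)]
  refine (h1.congr h2 (h2 t0 ht0)).congr_deriv ?_
  rw [neg_smul, neg_smul]; abel

/-- The time derivative of `⟨Θ(t) | g(t)⟩`. -/
lemma hasDerivWithinAt_pair_remainder (h : IsWaveMap k J ψ ψt) (hJ : J.OrdConnected) (hk : 2 ≤ k)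
    (ha : IsScale J a a') (hb : IsScale J b b')
    {Θ : ℝ → ℝ → ℝ} {Ξ : RadL2} (ht0 : t0 ∈ J)
    (hΘ : ∀ t ∈ J, MemL2 (Θ t)) (hΘr : ∀ t ∈ J, MemL2 fun r => r * Θ t r)
    (hc : ContinuousWithinAt (fun t => toX (Θ t)) J t0)
    (hd : HasDerivWithinAt (fun t => toX fun r => r * Θ t r) Ξ J t0) :
    HasDerivWithinAt (fun t => pair (Θ t) (remainder k (a t) (b t) (ψ t)))
      (inner ℝ (toX (Θ t0)) (vC ψt t0 + (k * a' t0 / a t0) • toX (sQ k (a t0))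
          - (k * b' t0 / b t0) • toX (sQ k (b t0)))
        + inner ℝ Ξ (toX fun r => remainder k (a t0) (b t0) (ψ t0) r / r)) J t0 := by
  have hk0 : k ≠ 0 := by omega
  obtain ⟨h1, h2⟩ := h.hasDerivWithinAt_toX_remainder hJ hk ha hb ht0
  have hz := (h.memH_remainder hk0 (ha.pos t0 ht0) (hb.pos t0 ht0) ht0).memL2_div
  have h3 := hasDerivWithinAt_inner_of_eq_zero hc h2 (by simpa using toX_const_mul 0 (hΘ t0 ht0))
  have h4 := h3.add (hd.inner ℝ (hasDerivWithinAt_const t0 J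
    (toX fun r => remainder k (a t0) (b t0) (ψ t0) r / r)))
  have e : ∀ t ∈ J, pair (Θ t) (remainder k (a t) (b t) (ψ t)) = inner ℝ (toX (Θ t))
      (toX fun r => remainder k (a t) (b t) (ψ t) r - remainder k (a t0) (b t0) (ψ t0) r)
      + inner ℝ (toX fun r => r * Θ t r) (toX fun r => remainder k (a t0) (b t0) (ψ t0) r / r) :=
    fun t ht => by
    rw [inner_toX (hΘ t ht) (h1 t ht), inner_toX (hΘr t ht) hz, pair, pair, pair,
      ← integral_add ((hΘ t ht).integrable_mul (h1 t ht)) ((hΘr t ht).integrable_mul hz)]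
    refine integral_congr_Ioi fun r hr => ?_
    field_simp; ring
  refine (h4.congr e (e t0 ht0)).congr_deriv ?_
  rw [inner_zero_right, zero_add]

end IsWaveMap
end MovingScales

/-! ### The modulation equations -/

section ModulationEquations
variable {k : ℕ} {J : Set ℝ} {t0 l m c r y C A B D ρ : ℝ} {a a' b b' w w' F f Z : ℝ → ℝ}
  {ψ ψt : ℝ → ℝ → ℝ}

lemma abs_inner_le {X : Type*} [NormedAddCommGroup X] [InnerProductSpace ℝ X] {x y : X} {a b : ℝ}
    (hx : ‖x‖ ≤ a) (hy : ‖y‖ ≤ b) : |inner ℝ x y| ≤ a * b :=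
  (abs_real_inner_le_norm _ _).trans (mul_le_mul hx hy (norm_nonneg _) ((norm_nonneg _).trans hx))

lemma abs_integral_le_of_supp (hρ : 0 ≤ ρ) (hD : ∀ r, 0 < r → r ≤ ρ → |F r| ≤ D)
    (h0 : ∀ r, ρ < r → F r = 0) : |∫ r in Ioi (0:ℝ), F r| ≤ D * ρ := by
  rw [setIntegral_eq_of_subset_of_forall_sdiff_eq_zero measurableSet_Ioi Ioc_subset_Ioi_self
    fun r hr => h0 r (not_le.1 fun hh => hr.2 ⟨hr.1, hh⟩)]
  have := norm_setIntegral_le_of_norm_le_const (μ := volume) (s := Ioc (0:ℝ) ρ) (f := F) (C := D)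
    measure_Ioc_lt_top fun r hr => hD r hr.1 hr.2
  simpa [hρ] using this

lemma norm_toX_le_of_supp (hf : MemL2 f) (hρ : 0 ≤ ρ) (hC : 0 ≤ C)
    (hD : ∀ r, 0 < r → r ≤ ρ → f r ^ 2 * r * ρ ≤ C ^ 2) (h0 : ∀ r, ρ < r → f r = 0) :
    ‖toX f‖ ≤ C := by
  refine abs_le_of_sq_le_sq' ?_ hC |>.2
  rw [norm_toX_sq hf, l2Sq]
  rcases hρ.eq_or_lt with rfl | hρ
  · rw [setIntegral_eq_zero_of_forall_eq_zero fun r hr => by rw [h0 r hr]; ring]; positivity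
  · have := abs_integral_le_of_supp (F := fun r => f r ^ 2 * r) (D := C ^ 2 / ρ) hρ.le
      (fun r hr hr' => by rw [abs_of_nonneg (by positivity), le_div_iff₀ hρ]; exact hD r hr hr')
      (fun r hr => by rw [h0 r hr]; ring)
    rw [div_mul_cancel₀ _ hρ.ne'] at this
    exact (le_abs_self _).trans this

lemma uniqueDiffOn_of_nontrivial (hJ : J.OrdConnected) (hJ' : J.Nontrivial) : UniqueDiffOn ℝ J := by
  obtain ⟨x, hx, y, hy, hxy⟩ := hJ'
  have key : ∀ {x y}, x ∈ J → y ∈ J → x < y → (interior J).Nonempty := fun {x y} hx hy h => by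
    obtain ⟨z, hz⟩ := nonempty_Ioo.2 h
    exact ⟨z, mem_interior.2 ⟨Ioo x y, Ioo_subset_Icc_self.trans (hJ.out hx hy), isOpen_Ioo, hz⟩⟩
  refine uniqueDiffOn_convex hJ.convex ?_
  exact hxy.lt_or_gt.elim (key hx hy) (key hy hx)

/-- Bounds on the modulation profile: `B` bounds its support, `A` its size. -/
structure ProfileBounds (Z : ℝ → ℝ) (A B : ℝ) : Prop extends BddSupp Z A B where
  abs_le_mul : ∀ y, 0 < y → |Z y| ≤ A * y
  abs_deriv_le : ∀ y, 0 < y → |y * deriv (fun y => y * Z y) y| ≤ A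
  deriv_eq_zero : ∀ y, B < y → deriv (fun y => y * Z y) y = 0

lemma IsModulationProfile.exists_profileBounds (h : IsModulationProfile k Z) (hk : 1 ≤ k) :
    ∃ A B, ProfileBounds Z A B := by
  obtain ⟨A, B, hZ⟩ := exists_bddSupp h.contDiff.continuous h.hasCompactSupport
  obtain ⟨M, hM⟩ := h.vanishing
  have hcd : ContDiff ℝ 1 fun y => y * Z y := contDiff_id.mul (h.contDiff.of_le (by norm_cast))
  obtain ⟨C, hC⟩ := exists_isProfile hcd (A := B) fun y hy => by rw [hZ.eq_zero y hy, mul_zero]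
  have hA := hZ.nonneg
  have hC0 := hC.nonneg
  refine ⟨A + |M| + C, B, ⟨hZ.continuous, fun r => ?_, hZ.eq_zero, hZ.pos⟩, fun y hy => ?_,
    fun y hy => ?_, fun y hy => ?_⟩
  · linarith [hZ.abs_le r, abs_nonneg M]
  · rcases le_total y 1 with h1 | h1
    · have h2 := hM y hy h1
      rw [abs_div, abs_of_pos (pow_pos hy k), div_le_iff₀ (pow_pos hy k)] at h2
      have h3 : y ^ k ≤ y := by simpa using pow_le_pow_of_le_one hy.le h1 hk
      have : M ≤ A + |M| + C := by linarith [le_abs_self M]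
      exact h2.trans (by gcongr)
    · have : 0 ≤ A + |M| + C := by positivity
      nlinarith [abs_nonneg M, hZ.abs_le y]
  · have := hC.isWeight.abs_deriv_le y hy
    linarith [abs_nonneg M]
  · have : (fun y => y * Z y) =ᶠ[𝓝 y] fun _ => 0 := by
      filter_upwards [Ioi_mem_nhds hy] with x hx
      rw [hZ.eq_zero x (le_of_lt hx), mul_zero]
    rw [this.deriv_eq, deriv_const]

lemma IsModulationProfile.exists_isProfile (h : IsModulationProfile k Z) :
    (∃ C, IsProfile Z (deriv Z) C) ∧
      ∃ C, IsProfile (fun y => y * Z y) (deriv fun y => y * Z y) C := by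
  obtain ⟨A, B, hZ⟩ := exists_bddSupp h.contDiff.continuous h.hasCompactSupport
  have h1 : ContDiff ℝ 1 Z := h.contDiff.of_le (by norm_cast)
  exact ⟨WaveMapTwoBubble.exists_isProfile h1 hZ.eq_zero,
    WaveMapTwoBubble.exists_isProfile (contDiff_id.mul h1) fun y hy => by
      rw [hZ.eq_zero y hy, mul_zero]⟩

lemma isWeight_one : IsWeight (fun _ => 1) (fun _ => 0) 1 1 where
  hasDerivAt r _ := hasDerivAt_const r 1
  continuousOn := continuousOn_const
  abs_le _ _ := by simp
  abs_deriv_le _ _ := by simp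

/-- The time derivative of a rescaled profile. -/
lemma hasDerivWithinAt_toX_comp (hJ : J.OrdConnected) (ha : IsScale J a a') (hw : IsProfile w w' C)
    (ht0 : t0 ∈ J) : HasDerivWithinAt (fun t => toX fun r => w (r / a t))
      (toX fun r => -(a' t0 / a t0) * (r / a t0 * w' (r / a t0))) J t0 := by
  simpa using hasDerivWithinAt_toX_comp_mul_comp hJ ha ha hw isWeight_one ht0

lemma IsProfile.memL2_comp (hw : IsProfile w w' C) (hl : 0 < l) : MemL2 fun r => w (r / l) := by
  simpa using hw.memL2_comp_mul isWeight_one hl one_pos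

lemma IsProfile.memL2_deriv_comp (hw : IsProfile w w' C) (hl : 0 < l) :
    MemL2 fun r => r / l * w' (r / l) := by
  simpa using memL2_comp_mul_comp (continuousOn_id_mul hw.continuousOn) continuousOn_const
    hw.abs_deriv_le (fun _ _ => (abs_one (α := ℝ)).le) hl one_pos (g := fun _ => 1)

/-- Differentiating the orthogonality condition `⟨Z_c | g⟩ = 0` for a scale `c`. -/
lemma IsWaveMap.modulation_eq {c c' : ℝ → ℝ} (h : IsWaveMap k J ψ ψt) (hJ : J.OrdConnected)
    (hJ' : J.Nontrivial) (hk : 2 ≤ k) (ha : IsScale J a a') (hb : IsScale J b b')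
    (hc : IsScale J c c') (hZ : IsModulationProfile k Z)
    (horth : ∀ t ∈ J, pair (rescaleL2 (c t) Z) (remainder k (a t) (b t) (ψ t)) = 0) (ht0 : t0 ∈ J) :
    inner ℝ (toX (rescaleL2 (c t0) Z)) (vC ψt t0)
      + k * a' t0 / a t0 * pair (rescaleL2 (c t0) Z) (sQ k (a t0))
      - k * b' t0 / b t0 * pair (rescaleL2 (c t0) Z) (sQ k (b t0))
      - c' t0 / c t0 * inner ℝ (toX fun r => r / c t0 * deriv (fun y => y * Z y) (r / c t0))
        (toX fun r => remainder k (a t0) (b t0) (ψ t0) r / r) = 0 := by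
  obtain ⟨⟨C, hC⟩, C', hC'⟩ := hZ.exists_isProfile
  have hmem : ∀ t ∈ J, MemL2 (rescaleL2 (c t) Z) := fun t ht =>
    (hC.memL2_comp (hc.pos t ht)).const_mul (1 / c t)
  have e : ∀ t ∈ J, ∀ r, 0 < r → r * rescaleL2 (c t) Z r = r / c t * Z (r / c t) :=
    fun t ht r hr => by rw [rescaleL2]; ring
  have hmem1 : ∀ t ∈ J, MemL2 fun r => r / c t * Z (r / c t) := fun t ht =>
    hC'.memL2_comp (hc.pos t ht)
  have e1 : ∀ t ∈ J, toX (rescaleL2 (c t) Z) = (1 / c t) • toX fun r => Z (r / c t) :=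
    fun t ht => toX_const_mul _ (hC.memL2_comp (hc.pos t ht))
  have e2 := fun t ht => toX_congr (ae_of_all _ (e t ht)) (hmem1 t ht)
  have h1 := h.hasDerivWithinAt_pair_remainder hJ hk ha hb ht0 hmem
    (fun t ht => (hmem1 t ht).congr (ae_of_all _ (e t ht)))
    (((continuousWithinAt_const.div (hc.continuousOn t0 ht0) (hc.pos t0 ht0).ne').smul
      (hasDerivWithinAt_toX_comp hJ hc hC ht0).continuousWithinAt).congr e1 (e1 t0 ht0))
    ((hasDerivWithinAt_toX_comp hJ hc hC' ht0).congr e2 (e2 t0 ht0))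
  have h2 : HasDerivWithinAt (fun t => pair (rescaleL2 (c t) Z) (remainder k (a t) (b t) (ψ t))) 0
      J t0 := (hasDerivWithinAt_const t0 J 0).congr horth (horth t0 ht0)
  have h3 := (uniqueDiffOn_of_nontrivial hJ hJ' t0 ht0).eq_deriv _ h1 h2
  rw [toX_const_mul _ (hC'.memL2_deriv_comp (hc.pos t0 ht0)), inner_sub_right, inner_add_right,
    inner_smul_right, inner_smul_right, inner_smul_left,
    inner_toX (hmem t0 ht0) (memL2_sQ hk (ha.pos t0 ht0)),
    inner_toX (hmem t0 ht0) (memL2_sQ hk (hb.pos t0 ht0)), conj_trivial] at h3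
  rw [← h3]; ring

lemma ProfileBounds.norm_rescaleL2_le (hZ : ProfileBounds Z A B) (hc : 0 < c)
    (hm : MemL2 (rescaleL2 c Z)) : ‖toX (rescaleL2 c Z)‖ ≤ A * B := by
  have hA := hZ.nonneg
  have hB := hZ.pos
  refine norm_toX_le_of_supp hm (ρ := B * c) (by positivity) (by positivity) (fun r hr hr' => ?_)
    fun r hr => ?_
  · have h1 := sq_le_sq' (abs_le.1 (hZ.abs_le (r / c))).1 (abs_le.1 (hZ.abs_le (r / c))).2
    calc rescaleL2 c Z r ^ 2 * r * (B * c) ≤ (1 / c) ^ 2 * A ^ 2 * (B * c) * (B * c) := by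
          rw [rescaleL2, mul_pow]; gcongr
      _ = _ := by field_simp
  · rw [rescaleL2, hZ.eq_zero _ ((le_div_iff₀ hc).2 hr.le), mul_zero]

lemma ProfileBounds.norm_deriv_le (hZ : ProfileBounds Z A B) (hc : 0 < c)
    (hm : MemL2 fun r => r / c * deriv (fun y => y * Z y) (r / c)) :
    ‖toX fun r => r / c * deriv (fun y => y * Z y) (r / c)‖ ≤ A * B * c := by
  have hA := hZ.nonneg
  have hB := hZ.pos
  refine norm_toX_le_of_supp hm (ρ := B * c) (by positivity) (by positivity) (fun r hr hr' => ?_)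
    fun r hr => ?_
  · have h1 : (r / c * deriv (fun y => y * Z y) (r / c)) ^ 2 ≤ A ^ 2 := by
      rw [← sq_abs]; gcongr; exact hZ.abs_deriv_le _ (by positivity)
    calc _ ≤ A ^ 2 * (B * c) * (B * c) := by gcongr
      _ = _ := by ring
  · rw [hZ.deriv_eq_zero _ ((lt_div_iff₀ hc).2 hr), mul_zero]

lemma ProfileBounds.abs_pair_le (hZ : ProfileBounds Z A B) (hl : 0 < l) :
    |pair (rescaleL2 l Z) (sQ k m)| ≤ A * B ^ 2 * l := by
  have hA := hZ.nonneg
  have hB := hZ.pos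
  have := abs_integral_le_of_supp (F := fun r => rescaleL2 l Z r * sQ k m r * r) (D := A * B)
    (ρ := B * l) (by positivity) (fun r hr hr' => ?_) fun r hr => ?_
  · calc _ ≤ A * B * (B * l) := this
      _ = _ := by ring
  · rw [rescaleL2, abs_mul, abs_mul, abs_mul, abs_of_pos hr, abs_of_pos (by positivity)]
    calc 1 / l * |Z (r / l)| * |sQ k m r| * r ≤ 1 / l * A * 1 * (B * l) := by
          have h1 := hZ.abs_le (r / l)
          have h2 := abs_sQ_le k m r
          gcongr
      _ = _ := by field_simp
  · rw [rescaleL2, hZ.eq_zero _ ((le_div_iff₀ hl).2 hr.le)]; ring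

lemma ProfileBounds.abs_pair_le' (hZ : ProfileBounds Z A B) (hk : 2 ≤ k) (hl : 0 < l) (hm : 0 < m) :
    |pair (rescaleL2 m Z) (sQ k l)| ≤ 2 * A * B * (l ^ 2 / m) := by
  have hA := hZ.nonneg
  have hB := hZ.pos
  have := abs_integral_le_of_supp (F := fun r => rescaleL2 m Z r * sQ k l r * r)
    (D := 2 * A * (l ^ 2 / m ^ 2)) (ρ := B * m) (by positivity) (fun r hr hr' => ?_) fun r hr => ?_
  · calc _ ≤ 2 * A * (l ^ 2 / m ^ 2) * (B * m) := this
      _ = _ := by field_simp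
  · rw [rescaleL2, abs_mul, abs_mul, abs_mul, abs_of_pos hr, abs_of_pos (by positivity),
      abs_of_pos (sQ_pos hl hr)]
    calc 1 / m * |Z (r / m)| * sQ k l r * r ≤ 1 / m * (A * (r / m)) * (2 * (l / r) ^ 2) * r := by
          have h1 := hZ.abs_le_mul (r / m) (by positivity)
          have h2 := sQ_le_two_mul_inv_pow hk hl hr
          have h3 := sQ_pos (k := k) hl hr
          gcongr
      _ = _ := by field_simp
  · rw [rescaleL2, hZ.eq_zero _ ((le_div_iff₀ hm).2 hr.le)]; ring

lemma pair_rescaleL2_sQ_self (hl : 0 < l) :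
    k * pair (rescaleL2 l Z) (sQ k l) = l * pair Z (LambdaQ k) := by
  rw [pair_rescaleL2, mul_left_comm, integral_rescale_sQ hl]
  field_simp

lemma norm_toX_remainder_div_le (hg : MemH f) (hk : 1 ≤ k) :
    ‖toX fun r => f r / r‖ ≤ √(hSq k f) := by
  rw [norm_toX hg.memL2_div]; exact Real.sqrt_le_sqrt (hg.l2Sq_div_le hk)

lemma norm_toX_deriv_le (hg : MemH f) (k : ℕ) : ‖toX (deriv f)‖ ≤ √(hSq k f) := by
  rw [norm_toX hg.memL2_deriv]; exact Real.sqrt_le_sqrt (hg.l2Sq_deriv_le k)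

/-- The scales move no faster than `‖ψ_t‖`: the derivatives of the orthogonality conditions form a
linear system for `a'` and `b'` that is diagonally dominant when `a / b` and `g` are small. -/
theorem exists_abs_deriv_scales_le (hk : 2 ≤ k) (hZ : IsModulationProfile k Z) :
    ∃ A E : ℝ, 0 < A ∧ 0 < E ∧ ∀ (J : Set ℝ) (ψ ψt : ℝ → ℝ → ℝ) (a a' b b' : ℝ → ℝ),
      J.OrdConnected → J.Nontrivial → IsWaveMap k J ψ ψt → IsScale J a a' → IsScale J b b' →
      (∀ t ∈ J, pair (rescaleL2 (a t) Z) (remainder k (a t) (b t) (ψ t)) = 0) →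
      (∀ t ∈ J, pair (rescaleL2 (b t) Z) (remainder k (a t) (b t) (ψ t)) = 0) →
      ∀ t ∈ J, E * (a t / b t + √(hSq k (remainder k (a t) (b t) (ψ t)))) ≤ 1 →
        |a' t| + |b' t| ≤ A * ‖vC ψt t‖ := by
  obtain ⟨A, B, hAB⟩ := hZ.exists_profileBounds (by omega)
  obtain ⟨⟨C, hC⟩, C', hC'⟩ := hZ.exists_isProfile
  have hN := hZ.pair_pos
  set N := pair Z (LambdaQ k)
  have hA := hAB.nonneg
  have hB := hAB.pos
  have hk0 : (0:ℝ) ≤ k := Nat.cast_nonneg k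
  refine ⟨4 * (A * B) / N + 1, 2 * (A * B + k * A * B ^ 2 + 2 * k * A * B) / N + 1, by positivity,
    by positivity, fun J ψ ψt a a' b b' hJ hJ' h ha hb hoa hob t ht hsm => ?_⟩
  have hl := ha.pos t ht
  have hm := hb.pos t ht
  have hg := h.memH_remainder (by omega : k ≠ 0) hl hm ht
  have eq1 := h.modulation_eq hJ hJ' hk ha hb ha hZ hoa ht
  have eq2 := h.modulation_eq hJ hJ' hk ha hb hb hZ hob ht
  set g := remainder k (a t) (b t) (ψ t)
  set z := toX fun r => g r / r
  have hz : ‖z‖ ≤ √(hSq k g) := norm_toX_remainder_div_le hg (by omega)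
  set η := √(hSq k g)
  set l := a t
  set m := b t
  set v := vC ψt t
  have hη : 0 ≤ η := Real.sqrt_nonneg _
  have d1 : k * pair (rescaleL2 l Z) (sQ k l) = l * N := pair_rescaleL2_sQ_self hl
  have d2 : k * pair (rescaleL2 m Z) (sQ k m) = m * N := pair_rescaleL2_sQ_self hm
  have hmem : ∀ {c : ℝ}, 0 < c → MemL2 (rescaleL2 c Z) := fun hc =>
    (hC.memL2_comp hc).const_mul _
  have bv : ∀ {c : ℝ}, 0 < c → |inner ℝ (toX (rescaleL2 c Z)) v| ≤ A * B * ‖v‖ := fun hc =>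
    abs_inner_le (hAB.norm_rescaleL2_le hc (hmem hc)) le_rfl
  have bz : ∀ {c : ℝ}, 0 < c → |inner ℝ (toX fun r => r / c * deriv (fun y => y * Z y) (r / c)) z|
      ≤ A * B * c * η := fun hc =>
    abs_inner_le (hAB.norm_deriv_le hc (hC'.memL2_deriv_comp hc)) hz
  have o1 := hAB.abs_pair_le (k := k) (m := m) hl
  have o2 := hAB.abs_pair_le' hk hl hm
  have b1 := bv hl; have b2 := bv hm; have b3 := bz hl; have b4 := bz hm
  generalize inner ℝ (toX (rescaleL2 l Z)) v = V1 at *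
  generalize inner ℝ (toX (rescaleL2 m Z)) v = V2 at *
  generalize inner ℝ (toX fun r => r / l * deriv (fun y => y * Z y) (r / l)) z = W1 at *
  generalize inner ℝ (toX fun r => r / m * deriv (fun y => y * Z y) (r / m)) z = W2 at *
  generalize pair (rescaleL2 l Z) (sQ k m) = P1 at *
  generalize pair (rescaleL2 m Z) (sQ k l) = P2 at *
  generalize pair (rescaleL2 l Z) (sQ k l) = P3 at *
  generalize pair (rescaleL2 m Z) (sQ k m) = P4 at *
  have f1 : N * a' t = -V1 + b' t * (k * (P1 / m)) + a' t * (W1 / l) := by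
    linear_combination eq1 - a' t / l * d1 - a' t * N * mul_inv_cancel₀ hl.ne'
  have f2 : N * b' t = V2 + a' t * (k * (P2 / l)) - b' t * (W2 / m) := by
    linear_combination -eq2 - b' t / m * d2 - b' t * N * mul_inv_cancel₀ hm.ne'
  have g1 : |k * (P1 / m)| ≤ k * A * B ^ 2 * (l / m) := by
    refine (abs_mul_le (abs_of_nonneg hk0).le (abs_div_le hm o1)).trans_eq (by ring)
  have g2 : |k * (P2 / l)| ≤ 2 * k * A * B * (l / m) := by
    refine (abs_mul_le (abs_of_nonneg hk0).le (abs_div_le hl o2)).trans_eq (by field_simp)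
  have g3 : |W1 / l| ≤ A * B * η := (abs_div_le hl b3).trans_eq (by field_simp)
  have g4 : |W2 / m| ≤ A * B * η := (abs_div_le hm b4).trans_eq (by field_simp)
  have hs : 0 < l / m := by positivity
  set s := l / m
  have k1 : N * |a' t| ≤ A * B * ‖v‖ + |b' t| * (k * A * B ^ 2 * s) + |a' t| * (A * B * η) := by
    rw [← abs_of_pos hN, ← abs_mul, f1]
    exact (abs_add_three _ _ _).trans (add_le_add (add_le_add ((abs_neg V1).trans_le b1)
      (abs_mul_le le_rfl g1)) (abs_mul_le le_rfl g3))
  have k2 : N * |b' t| ≤ A * B * ‖v‖ + |a' t| * (2 * k * A * B * s) + |b' t| * (A * B * η) := by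
    rw [← abs_of_pos hN, ← abs_mul, f2]
    exact (abs_sub _ _).trans (add_le_add ((abs_add_le _ _).trans (add_le_add b2
      (abs_mul_le le_rfl g2))) (abs_mul_le le_rfl g4))
  have hx : 0 ≤ |a' t| := abs_nonneg _
  have hy : 0 ≤ |b' t| := abs_nonneg _
  generalize |a' t| = x at *
  generalize |b' t| = y at *
  have hE : (A * B + k * A * B ^ 2 + 2 * k * A * B) * (s + η) ≤ N / 2 := by
    have : 2 * (A * B + k * A * B ^ 2 + 2 * k * A * B) / N * (s + η) ≤ 1 := by linarith
    rw [div_mul_eq_mul_div, div_le_iff₀ hN] at this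
    linarith
  have hsum : N * (x + y) ≤ 2 * (A * B) * ‖v‖
      + (A * B + k * A * B ^ 2 + 2 * k * A * B) * (s + η) * (x + y) := by
    have p1 : 0 ≤ A * B := by positivity
    have p2 : 0 ≤ k * A * B ^ 2 := by positivity
    have p3 : 0 ≤ 2 * k * A * B := by positivity
    generalize A * B = q1 at *
    generalize k * A * B ^ 2 = q2 at *
    generalize 2 * k * A * B = q3 at *
    have r1 : 0 ≤ q1 * s * (x + y) := by positivity
    have r2 : 0 ≤ q2 * η * (x + y) := by positivity
    have r3 : 0 ≤ q3 * η * (x + y) := by positivity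
    have r4 : 0 ≤ q2 * s * x := by positivity
    have r5 : 0 ≤ q3 * s * y := by positivity
    linarith
  have h5 := mul_le_mul_of_nonneg_right hE (add_nonneg hx hy)
  have h7 : x + y ≤ 4 * (A * B) / N * ‖v‖ := by rw [div_mul_eq_mul_div, le_div_iff₀ hN]; linarith
  linarith [norm_nonneg v]

end ModulationEquations

/-! ### The corrected scale `ζ` -/

section CorrectedScale
variable {k : ℕ} {J : Set ℝ} {t0 l m c r y C A B D ρ : ℝ} {a a' b b' w w' F f u χ : ℝ → ℝ}
  {ψ ψt : ℝ → ℝ → ℝ}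

/-- Bounds on the cutoff. -/
structure CutoffBounds (χ : ℝ → ℝ) (A : ℝ) : Prop where
  isProfile : IsProfile χ (deriv χ) A
  abs_one_sub_le : ∀ y, 0 < y → |1 - χ y| ≤ A
  one_sub_eq_zero : ∀ y, 0 < y → y ≤ 1 → 1 - χ y = 0
  eq_zero : ∀ y, 2 < y → χ y = 0
  deriv_eq_zero : ∀ y, 2 < y → deriv χ y = 0

lemma IsCutoff.exists_cutoffBounds (h : IsCutoff χ) : ∃ A, CutoffBounds χ A := by
  obtain ⟨C, hC⟩ := exists_isProfile (h.contDiff.of_le (by norm_cast)) h.eq_zero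
  have hC0 := hC.nonneg
  refine ⟨C + 1, ⟨hC.hasDerivAt, hC.continuousOn, fun y hy => (hC.abs_le y hy).trans ?_,
    fun y hy => (hC.abs_deriv_le y hy).trans ?_⟩, fun y hy => ?_, fun y hy h1 => ?_,
    fun y hy => h.eq_zero y hy.le, fun y hy => ?_⟩
  · exact mul_le_mul_of_nonneg_right (by linarith) (decay_pos 1 y).le
  · exact mul_le_mul_of_nonneg_right (by linarith) (decay_pos 1 y).le
  · refine (abs_sub _ _).trans ?_
    rw [abs_one]; linarith [hC.isWeight.abs_le y hy]
  · rw [h.eq_one y hy.le h1, sub_self]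
  · have : χ =ᶠ[𝓝 y] fun _ => 0 := by
      filter_upwards [Ioi_mem_nhds hy] with x hx using h.eq_zero x (le_of_lt hx)
    rw [this.deriv_eq, deriv_const]

lemma abs_deriv_mul_sQ_le (hy : 0 < y) :
    |y * (sQ k 1 y + y * (cQ k 1 y * (k * sQ k 1 y / y)))| ≤ (1 + k) * (y * sQ k 1 y) := by
  rw [show y * (sQ k 1 y + y * (cQ k 1 y * (k * sQ k 1 y / y)))
        = (1 + k * cQ k 1 y) * (y * sQ k 1 y) by field_simp,
    abs_mul, abs_of_pos (mul_pos hy (sQ_pos one_pos hy))]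
  refine mul_le_mul_of_nonneg_right ((abs_add_le _ _).trans ?_) (mul_pos hy (sQ_pos one_pos hy)).le
  rw [abs_one, abs_mul, Nat.abs_cast]
  linarith [mul_le_mul_of_nonneg_left (abs_cQ_le k 1 y) (Nat.cast_nonneg (α := ℝ) k)]

/-- The weight `y sin Q(y)`. -/
lemma isWeight_mul_sQ (hk : 2 ≤ k) : IsWeight (fun y => y * sQ k 1 y)
    (fun y => sQ k 1 y + y * (cQ k 1 y * (k * sQ k 1 y / y))) (2 * (1 + k)) (2 * (1 + k)) := by
  have hk0 : (0:ℝ) ≤ k := Nat.cast_nonneg k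
  have hb : ∀ y : ℝ, 0 < y → y * sQ k 1 y ≤ 2 := fun y hy => by
    have h1 := sQ_le_two_mul_inv_pow (j := 1) (by omega : 1 ≤ k) one_pos hy
    rw [pow_one, mul_one_div, le_div_iff₀ hy] at h1
    linarith
  refine ⟨fun y hy => ((hasDerivAt_id y).mul (hasDerivAt_sQ one_pos hy)).congr_deriv (by simp),
    (continuous_sQ k 1).continuousOn.add (continuousOn_id.mul (continuousOn_deriv_sQ k 1)),
    fun y hy => ?_, fun y hy => ?_⟩
  · rw [abs_of_pos (mul_pos hy (sQ_pos one_pos hy))]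
    linarith [hb y hy]
  · exact (abs_deriv_mul_sQ_le hy).trans (by nlinarith [hb y hy])

lemma norm_toX_cutoff_mul_le {E : ℝ} (hk : 2 ≤ k) (hl : 0 < l) (hm : 0 < m)
    (hf : ∀ y, 0 < y → |f y| ≤ A) (hf0 : ∀ y, 2 < y → f y = 0) (hE : 0 ≤ E)
    (hu : ∀ y, 0 < y → |u y| ≤ E * (y * sQ k 1 y))
    (hmem : MemL2 fun r => f (r / m) * u (r / l)) :
    ‖toX fun r => f (r / m) * u (r / l)‖ ≤ 3 * A * E * √(l * m) := by
  have hA : 0 ≤ A := (abs_nonneg _).trans (hf 1 one_pos)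
  refine norm_toX_le_of_supp hmem (ρ := 2 * m) (by positivity) (by positivity)
    (fun r hr hr' => ?_) fun r hr => ?_
  · have h1 := hf (r / m) (by positivity)
    have h2 := hu (r / l) (by positivity)
    rw [sQ_one_div] at h2
    have h3 := sQ_le_two_mul_inv_pow hk hl hr
    have h4 := sQ_le_two_mul_inv_pow (by omega : 1 ≤ k) hl hr
    rw [pow_one] at h4
    have hs := sQ_pos (k := k) hl hr
    have h5 : sQ k l r * sQ k l r ≤ 2 * (l / r) ^ 2 * (2 * (l / r)) := by gcongr
    calc _ ≤ (A * (E * (r / l * sQ k l r))) ^ 2 * r * (2 * m) := by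
          rw [← sq_abs (f _ * _)]; gcongr; exact abs_mul_le h1 h2
      _ = A ^ 2 * E ^ 2 * ((r / l) ^ 2 * r * (2 * m)) * (sQ k l r * sQ k l r) := by ring
      _ ≤ A ^ 2 * E ^ 2 * ((r / l) ^ 2 * r * (2 * m)) * (2 * (l / r) ^ 2 * (2 * (l / r))) := by gcongr
      _ = 8 * (A ^ 2 * E ^ 2 * (l * m)) := by field_simp; ring
      _ ≤ 9 * (A ^ 2 * E ^ 2 * (l * m)) := by gcongr; norm_num
      _ = _ := by rw [mul_pow, Real.sq_sqrt (by positivity)]; ring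
  · rw [hf0 _ ((lt_div_iff₀ hm).2 hr), zero_mul]

lemma kappa_eq_norm (hk : 2 ≤ k) (hl : 0 < l) : ‖toX (fun r => k / l * sQ k l r)‖ ^ 2 = kappa k := by
  have hm := (memL2_sQ hk hl).const_mul (k / l)
  have h := integral_comp_mul_left_Ioi (fun r => sQ k l r ^ 2 * r) 0 hl
  rw [mul_zero, smul_eq_mul] at h
  have e : ∀ x, sQ k l (l * x) = sQ k 1 x := fun x => by
    unfold sQ; rw [mul_div_cancel_left₀ _ hl.ne', div_one]
  simp only [e] at h
  have h2 : ∫ x in Ioi (0:ℝ), sQ k 1 x ^ 2 * (l * x) = l * ∫ x in Ioi (0:ℝ), sQ k 1 x ^ 2 * x := by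
    rw [← integral_const_mul]; congr 1; funext x; ring
  rw [h2] at h
  rw [norm_toX_sq hm, kappa_eq, l2Sq]
  have e3 : ∫ r in Ioi (0:ℝ), (k / l * sQ k l r) ^ 2 * r
      = (k / l) ^ 2 * ∫ r in Ioi (0:ℝ), sQ k l r ^ 2 * r := by
    rw [← integral_const_mul]; congr 1; funext x; ring
  have e4 : ∫ r in Ioi (0:ℝ), sQ k l r ^ 2 * r = l ^ 2 * ∫ x in Ioi (0:ℝ), sQ k 1 x ^ 2 * x := by
    rw [pow_two, mul_assoc, h]; field_simp
  rw [e3, e4]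
  field_simp

/-- The `L²` tail of `(ΛQ)_l` outside the ball of radius `ρ`. -/
lemma norm_toX_tail_le (hk : 2 ≤ k) (hl : 0 < l) (hρ : 0 < ρ) (hA : 0 ≤ A)
    (hm : AEMeasurable f (volume.restrict (Ioi (0:ℝ))))
    (hf : ∀ r, 0 < r → |f r| ≤ A * sQ k l r) (h0 : ∀ r, 0 < r → r ≤ ρ → f r = 0) :
    ‖toX f‖ ≤ 2 * A * (l ^ 2 / ρ) := by
  have hmem : MemL2 f := (memL2_sQ hk hl).of_abs_le A hm fun r hr => by
    rw [abs_of_pos (sQ_pos hl hr)]; exact hf r hr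
  refine abs_le_of_sq_le_sq' ?_ (by positivity) |>.2
  rw [norm_toX_sq hmem, l2Sq]
  have e : ∫ r in Ioi (0:ℝ), f r ^ 2 * r = ∫ r in Ioi ρ, f r ^ 2 * r :=
    setIntegral_eq_of_subset_of_forall_sdiff_eq_zero measurableSet_Ioi (Ioi_subset_Ioi hρ.le)
      fun r hr => by rw [h0 r hr.1 (not_lt.1 hr.2)]; ring
  have hi : IntegrableOn (fun r : ℝ => r ^ (-3:ℝ)) (Ioi ρ) :=
    integrableOn_Ioi_rpow_of_lt (by norm_num) hρ
  have hv : ∫ r in Ioi ρ, r ^ (-3:ℝ) = ρ ^ (-2:ℝ) / 2 := by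
    rw [integral_Ioi_rpow_of_lt (by norm_num) hρ]; norm_num
  rw [e]
  calc ∫ r in Ioi ρ, f r ^ 2 * r ≤ ∫ r in Ioi ρ, 4 * A ^ 2 * l ^ 4 * r ^ (-3:ℝ) := by
        refine setIntegral_mono_on (hmem.2.mono_set (Ioi_subset_Ioi hρ.le)) (hi.const_mul _)
          measurableSet_Ioi fun r (hr : ρ < r) => ?_
        have hr0 : 0 < r := hρ.trans hr
        have h1 := hf r hr0
        have h2 := sQ_le_two_mul_inv_pow hk hl hr0
        rw [show r ^ (-3:ℝ) = 1 / r ^ 3 by norm_num]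
        calc f r ^ 2 * r ≤ (A * (2 * (l / r) ^ 2)) ^ 2 * r := by
              rw [← sq_abs]; gcongr; exact h1.trans (by gcongr)
          _ = _ := by field_simp; ring
    _ = 2 * A ^ 2 * l ^ 4 * ρ ^ (-2:ℝ) := by rw [integral_const_mul, hv]; ring
    _ = 2 * A ^ 2 * (l ^ 2 / ρ) ^ 2 := by
        rw [Real.rpow_neg hρ.le]; norm_cast; field_simp
    _ ≤ _ := by
        have : 0 ≤ A ^ 2 * (l ^ 2 / ρ) ^ 2 := by positivity
        rw [mul_pow, mul_pow]; linarith

end CorrectedScale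

/-! ### The time derivative of `ζ` -/

section CorrectedScaleDerivative
variable {k : ℕ} {J : Set ℝ} {t0 l m A : ℝ} {a a' b b' f χ : ℝ → ℝ} {ψ ψt : ℝ → ℝ → ℝ}

/-- `χ_m (ΛQ)_l / l`, the function that is paired with the remainder in `ζ`. -/
noncomputable def cutLambda (k : ℕ) (χ : ℝ → ℝ) (l m r : ℝ) : ℝ :=
  rescale m χ r * rescaleL2 l (LambdaQ k) r

/-- The derivative of `r χ_m (ΛQ)_l / l` in `-log m`, without the factor `k`. -/
noncomputable def cutLambdaM (k : ℕ) (χ : ℝ → ℝ) (l m r : ℝ) : ℝ :=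
  r / m * deriv χ (r / m) * (r / l * sQ k 1 (r / l))

/-- The derivative of `r χ_m (ΛQ)_l / l` in `-log l`, without the factor `k`. -/
noncomputable def cutLambdaL (k : ℕ) (χ : ℝ → ℝ) (l m r : ℝ) : ℝ :=
  χ (r / m) * (r / l * (sQ k 1 (r / l)
    + r / l * (cQ k 1 (r / l) * (k * sQ k 1 (r / l) / (r / l)))))

lemma cutLambda_eq (hl : 0 < l) {r : ℝ} (hr : 0 < r) :
    cutLambda k χ l m r = k / l * (χ (r / m) * sQ k 1 (r / l)) := by
  rw [cutLambda, rescale, rescaleL2, LambdaQ_div hl hr, sQ_one_div]; ring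

lemma memL2_cut (hk : 2 ≤ k) (hχ : CutoffBounds χ A) (hl : 0 < l) (hm : 0 < m) :
    MemL2 fun r => χ (r / m) * sQ k 1 (r / l) :=
  hχ.isProfile.memL2_comp_mul (isProfile_sQ hk).isWeight hm hl

lemma memL2_cut' (hk : 2 ≤ k) (hχ : CutoffBounds χ A) (hl : 0 < l) (hm : 0 < m) :
    MemL2 fun r => χ (r / m) * (r / l * sQ k 1 (r / l)) :=
  hχ.isProfile.memL2_comp_mul (isWeight_mul_sQ hk) hm hl

lemma memL2_cutLambda (hk : 2 ≤ k) (hχ : CutoffBounds χ A) (hl : 0 < l) (hm : 0 < m) :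
    MemL2 (cutLambda k χ l m) :=
  ((memL2_cut hk hχ hl hm).const_mul (k / l)).congr (ae_of_all _ fun _ hr => cutLambda_eq hl hr)

lemma toX_cutLambda (hk : 2 ≤ k) (hχ : CutoffBounds χ A) (hl : 0 < l) (hm : 0 < m) :
    toX (cutLambda k χ l m) = (k / l) • toX fun r => χ (r / m) * sQ k 1 (r / l) := by
  rw [← toX_const_mul _ (memL2_cut hk hχ hl hm)]
  exact toX_congr (ae_of_all _ fun _ hr => cutLambda_eq hl hr) ((memL2_cut hk hχ hl hm).const_mul _)

lemma memL2_cutLambdaM (hk : 2 ≤ k) (hχ : CutoffBounds χ A) (hl : 0 < l) (hm : 0 < m) :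
    MemL2 (cutLambdaM k χ l m) :=
  memL2_comp_mul_comp (continuousOn_id_mul hχ.isProfile.continuousOn)
    (isWeight_mul_sQ hk).continuousOn' hχ.isProfile.abs_deriv_le (isWeight_mul_sQ hk).abs_le hm hl

lemma memL2_cutLambdaL (hk : 2 ≤ k) (hχ : CutoffBounds χ A) (hl : 0 < l) (hm : 0 < m) :
    MemL2 (cutLambdaL k χ l m) :=
  memL2_comp_mul_comp hχ.isProfile.isWeight.continuousOn'
    (continuousOn_id_mul (isWeight_mul_sQ hk).continuousOn) hχ.isProfile.abs_le
    (isWeight_mul_sQ hk).abs_deriv_le hm hl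

lemma norm_cutLambdaM_le (hk : 2 ≤ k) (hχ : CutoffBounds χ A) (hl : 0 < l) (hm : 0 < m) :
    ‖toX (cutLambdaM k χ l m)‖ ≤ 3 * A * 1 * √(l * m) :=
  norm_toX_cutoff_mul_le (f := fun y => y * deriv χ y) (u := fun y => y * sQ k 1 y) hk hl hm
    hχ.isProfile.isWeight.abs_deriv_le (fun y hy => by rw [hχ.deriv_eq_zero y hy, mul_zero])
    zero_le_one (fun y hy => by rw [one_mul, abs_of_pos (mul_pos hy (sQ_pos one_pos hy))])
    (memL2_cutLambdaM hk hχ hl hm)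

lemma norm_cutLambdaL_le (hk : 2 ≤ k) (hχ : CutoffBounds χ A) (hl : 0 < l) (hm : 0 < m) :
    ‖toX (cutLambdaL k χ l m)‖ ≤ 3 * A * (1 + k) * √(l * m) :=
  norm_toX_cutoff_mul_le (f := χ)
    (u := fun y => y * (sQ k 1 y + y * (cQ k 1 y * (k * sQ k 1 y / y)))) hk hl hm
    hχ.isProfile.isWeight.abs_le hχ.eq_zero (by positivity) (fun y hy => abs_deriv_mul_sQ_le hy)
    (memL2_cutLambdaL hk hχ hl hm)

lemma mul_cutLambda_eq (hl : 0 < l) {r : ℝ} (hr : 0 < r) :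
    r * cutLambda k χ l m r = k * (χ (r / m) * (r / l * sQ k 1 (r / l))) := by
  rw [cutLambda_eq hl hr]; ring

lemma memL2_mul_cutLambda (hk : 2 ≤ k) (hχ : CutoffBounds χ A) (hl : 0 < l) (hm : 0 < m) :
    MemL2 fun r => r * cutLambda k χ l m r :=
  ((memL2_cut' hk hχ hl hm).const_mul k).congr (ae_of_all _ fun _ hr => mul_cutLambda_eq hl hr)

lemma toX_mul_cutLambda (hk : 2 ≤ k) (hχ : CutoffBounds χ A) (hl : 0 < l) (hm : 0 < m) :
    toX (fun r => r * cutLambda k χ l m r)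
      = (k:ℝ) • toX fun r => χ (r / m) * (r / l * sQ k 1 (r / l)) := by
  rw [← toX_const_mul _ (memL2_cut' hk hχ hl hm)]
  exact toX_congr (ae_of_all _ fun _ => mul_cutLambda_eq hl) ((memL2_cut' hk hχ hl hm).const_mul _)

lemma norm_mul_cutLambda_le (hk : 2 ≤ k) (hχ : CutoffBounds χ A) (hl : 0 < l) (hm : 0 < m) :
    ‖toX fun r => r * cutLambda k χ l m r‖ ≤ k * (3 * A * 1 * √(l * m)) := by
  rw [toX_mul_cutLambda hk hχ hl hm, norm_smul, Real.norm_natCast]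
  gcongr
  exact norm_toX_cutoff_mul_le (f := χ) (u := fun y => y * sQ k 1 y) hk hl hm
    hχ.isProfile.isWeight.abs_le hχ.eq_zero zero_le_one
    (fun y hy => by rw [one_mul, abs_of_pos (mul_pos hy (sQ_pos one_pos hy))])
    (memL2_cut' hk hχ hl hm)

lemma continuousOn_toX_cutLambda (hk : 2 ≤ k) (ha : IsScale J a a') (hb : IsScale J b b')
    (hχ : CutoffBounds χ A) : ContinuousOn (fun t => toX (cutLambda k χ (a t) (b t))) J :=
  ((continuousOn_const.div ha.continuousOn fun t ht => (ha.pos t ht).ne').smul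
    (hχ.isProfile.continuousOn_toX_comp_mul (isProfile_sQ hk).isWeight hb ha)).congr
      fun t ht => toX_cutLambda hk hχ (ha.pos t ht) (hb.pos t ht)

/-- The time derivative of `⟨χ_b (ΛQ)_a / a | g⟩`. -/
noncomputable def cutPairDeriv (k : ℕ) (χ : ℝ → ℝ) (ψ ψt : ℝ → ℝ → ℝ) (a a' b b' : ℝ → ℝ) (t : ℝ) : ℝ :=
  inner ℝ (toX (cutLambda k χ (a t) (b t))) (vC ψt t + (k * a' t / a t) • toX (sQ k (a t))
      - (k * b' t / b t) • toX (sQ k (b t)))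
    - inner ℝ ((k * b' t / b t) • toX (cutLambdaM k χ (a t) (b t))
      + (k * a' t / a t) • toX (cutLambdaL k χ (a t) (b t)))
      (toX fun r => remainder k (a t) (b t) (ψ t) r / r)

namespace IsWaveMap

lemma hasDerivWithinAt_cutPair (h : IsWaveMap k J ψ ψt) (hJ : J.OrdConnected) (hk : 2 ≤ k)
    (ha : IsScale J a a') (hb : IsScale J b b') (hχ : CutoffBounds χ A) (ht0 : t0 ∈ J) :
    HasDerivWithinAt (fun t => pair (cutLambda k χ (a t) (b t)) (remainder k (a t) (b t) (ψ t)))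
      (cutPairDeriv k χ ψ ψt a a' b b' t0) J t0 := by
  have h1 := h.hasDerivWithinAt_pair_remainder hJ hk ha hb ht0
    (fun t ht => memL2_cutLambda hk hχ (ha.pos t ht) (hb.pos t ht))
    (fun t ht => memL2_mul_cutLambda hk hχ (ha.pos t ht) (hb.pos t ht))
    (continuousOn_toX_cutLambda hk ha hb hχ t0 ht0)
    (((hasDerivWithinAt_toX_comp_mul_comp hJ hb ha hχ.isProfile (isWeight_mul_sQ hk) ht0).const_smul
      (k:ℝ)).congr (fun t ht => toX_mul_cutLambda hk hχ (ha.pos t ht) (hb.pos t ht))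
      (toX_mul_cutLambda hk hχ (ha.pos t0 ht0) (hb.pos t0 ht0)))
  refine h1.congr_deriv ?_
  have m1 := memL2_cutLambdaM hk hχ (ha.pos t0 ht0) (hb.pos t0 ht0)
  have m2 := memL2_cutLambdaL hk hχ (ha.pos t0 ht0) (hb.pos t0 ht0)
  have e2 : toX (fun r => -(b' t0 / b t0) * (r / b t0 * deriv χ (r / b t0)) * (r / a t0 * sQ k 1 (r / a t0))
        + χ (r / b t0) * (-(a' t0 / a t0) * (r / a t0 * (sQ k 1 (r / a t0)
          + r / a t0 * (cQ k 1 (r / a t0) * (k * sQ k 1 (r / a t0) / (r / a t0)))))))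
      = -(b' t0 / b t0) • toX (cutLambdaM k χ (a t0) (b t0))
        + -(a' t0 / a t0) • toX (cutLambdaL k χ (a t0) (b t0)) := by
    rw [← toX_const_mul _ m1, ← toX_const_mul _ m2, ← toX_add (m1.const_mul _) (m2.const_mul _)]
    congr 1; funext r; rw [cutLambdaM, cutLambdaL]; ring
  have e3 : ∀ X Y : RadL2, (k:ℝ) • (-(b' t0 / b t0) • X + -(a' t0 / a t0) • Y)
      = -((k * b' t0 / b t0) • X + (k * a' t0 / a t0) • Y) := fun X Y => by module
  rw [e2, e3, inner_neg_left, ← sub_eq_add_neg]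
  rfl

lemma continuousOn_cutPairDeriv (h : IsWaveMap k J ψ ψt) (hJ : J.OrdConnected) (hk : 2 ≤ k)
    (ha : IsScale J a a') (hb : IsScale J b b') (hχ : CutoffBounds χ A) :
    ContinuousOn (cutPairDeriv k χ ψ ψt a a' b b') J := by
  have hM : ContinuousOn (fun t => toX (cutLambdaM k χ (a t) (b t))) J :=
    continuousOn_toX_comp_mul_comp (f := fun y => y * deriv χ y) (g := fun y => y * sQ k 1 y) hb ha
      (continuousOn_id_mul hχ.isProfile.continuousOn)
      (isWeight_mul_sQ hk).continuousOn' hχ.isProfile.abs_deriv_le (isWeight_mul_sQ hk).abs_le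
  have hL : ContinuousOn (fun t => toX (cutLambdaL k χ (a t) (b t))) J :=
    continuousOn_toX_comp_mul_comp (f := χ)
      (g := fun y => y * (sQ k 1 y + y * (cQ k 1 y * (k * sQ k 1 y / y)))) hb ha
      hχ.isProfile.isWeight.continuousOn' (continuousOn_id_mul (isWeight_mul_sQ hk).continuousOn)
      hχ.isProfile.abs_le (isWeight_mul_sQ hk).abs_deriv_le
  have hf : ∀ {c c' : ℝ → ℝ}, IsScale J c c' → ContinuousOn (fun t => k * c' t / c t) J :=
    fun hc => (continuousOn_const.mul hc.continuousOn_deriv).div hc.continuousOn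
      fun t ht => (hc.pos t ht).ne'
  have hs : ∀ {c c' : ℝ → ℝ}, IsScale J c c' →
      ContinuousOn (fun t => (k * c' t / c t) • toX (sQ k (c t))) J := fun {c c'} hc => by
    have : ContinuousOn (fun t => toX fun r => sQ k 1 (r / c t)) J := fun t ht =>
      (hasDerivWithinAt_toX_comp hJ hc (isProfile_sQ hk) ht).continuousWithinAt
    exact (hf hc).smul (by simpa only [sQ_one_div] using this)
  exact ((continuousOn_toX_cutLambda hk ha hb hχ).inner ((h.continuousOn_vC.add (hs ha)).sub (hs hb))
    (𝕜 := ℝ)).sub ((((hf hb).smul hM).add ((hf ha).smul hL)).inner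
      (h.continuousOn_toX_remainder_div hJ hk ha hb) (𝕜 := ℝ))

/-- `ζ` is continuously differentiable, with an explicit derivative. -/
lemma contDiffOn_zetaFun (h : IsWaveMap k J ψ ψt) (hJ : J.OrdConnected) (hJ' : J.Nontrivial)
    (hk : 2 ≤ k) (ha : IsScale J a a') (hb : IsScale J b b') (hχ : CutoffBounds χ A) :
    ContDiffOn ℝ 1 (zetaFun k χ ψ a b) J ∧ ∀ t ∈ J, derivWithin (zetaFun k χ ψ a b) J t
      = a' t - 1 / kappa k * cutPairDeriv k χ ψ ψt a a' b b' t := by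
  have hu := uniqueDiffOn_of_nontrivial hJ hJ'
  have hd : ∀ t ∈ J, HasDerivWithinAt (zetaFun k χ ψ a b)
      (a' t - 1 / kappa k * cutPairDeriv k χ ψ ψt a a' b b' t) J t := fun t ht =>
    (ha.hasDerivWithinAt t ht).sub ((h.hasDerivWithinAt_cutPair hJ hk ha hb hχ ht).const_mul _)
  have he : ∀ t ∈ J, derivWithin (zetaFun k χ ψ a b) J t
      = a' t - 1 / kappa k * cutPairDeriv k χ ψ ψt a a' b b' t :=
    fun t ht => (hd t ht).derivWithin (hu t ht)
  refine ⟨?_, he⟩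
  rw [show (1 : WithTop ℕ∞) = 0 + 1 from (zero_add 1).symm, contDiffOn_succ_iff_derivWithin hu]
  refine ⟨fun t ht => (hd t ht).differentiableWithinAt, by simp, contDiffOn_zero.2 ?_⟩
  exact (ha.continuousOn_deriv.sub (continuousOn_const.mul
    (h.continuousOn_cutPairDeriv hJ hk ha hb hχ))).congr he

end IsWaveMap

lemma abs_pair_cutLambda_sQ_le (hk : 2 ≤ k) (hχ : CutoffBounds χ A) (hl : 0 < l) (hm : 0 < m) :
    |pair (cutLambda k χ l m) (sQ k m)| ≤ 8 * k * A * l := by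
  have hA := hχ.isProfile.nonneg
  have := abs_integral_le_of_supp (F := fun r => cutLambda k χ l m r * sQ k m r * r)
    (D := 4 * k * A * (l / m)) (ρ := 2 * m) (by positivity) (fun r hr hr' => ?_) fun r hr => ?_
  · exact this.trans_eq (by field_simp; ring)
  · have h1 := hχ.isProfile.isWeight.abs_le (r / m) (by positivity)
    have h2 := sQ_le_two_mul_inv_pow hk hl hr
    have h3 := sQ_le_two_mul_div (by omega : 1 ≤ k) hm hr
    have h4 := sQ_pos (k := k) hl hr
    have h5 := sQ_pos (k := k) hm hr
    rw [cutLambda_eq hl hr, sQ_one_div, abs_mul, abs_mul, abs_mul, abs_mul, abs_of_pos hr,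
      abs_of_pos h4, abs_of_pos h5, abs_of_nonneg (by positivity)]
    calc _ ≤ k / l * (A * (2 * (l / r) ^ 2)) * (2 * (r / m)) * r := by gcongr
      _ = _ := by field_simp; ring
  · rw [cutLambda_eq hl (by linarith), hχ.eq_zero _ ((lt_div_iff₀ hm).2 hr)]; ring

lemma norm_sub_cutLambda_le (hk : 2 ≤ k) (hχ : CutoffBounds χ A) (hl : 0 < l) (hm : 0 < m) :
    ‖toX (fun r => k / l * sQ k l r) - toX (cutLambda k χ l m)‖ ≤ 2 * k * A * (l / m) := by
  have hA := hχ.isProfile.nonneg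
  have h1 := (memL2_sQ hk hl).const_mul (k / l)
  have h2 := memL2_cutLambda hk hχ hl hm
  rw [← toX_sub h1 h2]
  have hk0 : (0:ℝ) ≤ k := Nat.cast_nonneg k
  have e : ∀ r, 0 < r → k / l * sQ k l r - cutLambda k χ l m r
      = k / l * (1 - χ (r / m)) * sQ k l r := fun r hr => by
    rw [cutLambda_eq hl hr, sQ_one_div]; ring
  have := norm_toX_tail_le (f := fun r => k / l * sQ k l r - cutLambda k χ l m r) (A := k / l * A)
    hk hl hm (by positivity) (h1.aemeasurable.sub h2.aemeasurable) (fun r hr => ?_)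
    (fun r hr hr' => ?_)
  · exact this.trans_eq (by field_simp)
  · rw [e r hr]
    nth_rw 2 [← abs_of_pos (sQ_pos (k := k) hl hr)]
    exact abs_mul_le (abs_mul_le (abs_of_nonneg (by positivity)).le
      (hχ.abs_one_sub_le _ (by positivity))) le_rfl
  · rw [e r hr, hχ.one_sub_eq_zero _ (by positivity) ((div_le_one hm).2 hr')]; ring

end CorrectedScaleDerivative

/-! ### The operator `𝓐₀` and the size of `b` -/

section VirialMultipliers
variable {k : ℕ} {l m r c R K : ℝ} {q g : ℝ → ℝ}

/-- The coefficient of `g / r` in `𝓐₀ g`. -/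
noncomputable def virW (q : ℝ → ℝ) (y : ℝ) : ℝ := y * virB q y

/-- The derivative of `virW q`. -/
noncomputable def virWDeriv (q : ℝ → ℝ) (y : ℝ) : ℝ := virB q y + y * virBDeriv q y

lemma A0_eq (q : ℝ → ℝ) (hl : 0 < l) (g : ℝ → ℝ) (hr : 0 < r) :
    A0 q l g r = deriv q (r / l) * deriv g r + virW q (r / l) * (g r / r) := by
  rw [A0, virW, virB]; field_simp; ring

/-- The two coefficients of `𝓐₀` and their logarithmic derivatives are bounded by `D`. -/
structure MultiplierBounds (q : ℝ → ℝ) (D : ℝ) : Prop where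
  deriv : IsWeight (deriv q) (deriv (deriv q)) D D
  virW : IsWeight (virW q) (virWDeriv q) D D

namespace IsVirialWeight

lemma abs_virW_le (h : IsVirialWeight c R K q) {y : ℝ} (hy : 0 < y) : |virW q y| ≤ K * y := by
  rw [virW, abs_mul, abs_of_pos hy, mul_comm]
  gcongr; exact h.abs_virB_le hy

lemma deriv_eq_self (h : IsVirialWeight c R K q) {y : ℝ} (hy : 0 < y) (hyR : y < R) :
    deriv q y = y := by
  have := h.virM_eq_one hy hyR
  rwa [virM, div_eq_one_iff_eq hy.ne'] at this

lemma virW_eq_self (h : IsVirialWeight c R K q) {y : ℝ} (hy : 0 < y) (hyR : y < R) :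
    virW q y = y := by
  have h1 : deriv (deriv q) y = 1 := by
    have : deriv q =ᶠ[𝓝 y] fun x => x := by
      filter_upwards [Ioo_mem_nhds hy hyR] with x hx using h.deriv_eq_self hx.1 hx.2
    rw [this.deriv_eq, deriv_id'']
  rw [virW, virB, h1, h.deriv_eq_self hy hyR, div_self hy.ne']; ring

/-- The two coefficients of `𝓐₀` and their logarithmic derivatives are bounded and compactly
supported. -/
lemma exists_isWeight (h : IsVirialWeight c R K q) (hc : 0 < c) : ∃ R' D : ℝ, 0 < R' ∧ 0 < D ∧
    (∀ y, R' < y → deriv q y = 0 ∧ virW q y = 0) ∧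
    MultiplierBounds q D := by
  obtain ⟨R₀, -, hR⟩ := h.exists_deriv_eq_zero
  have hB := h.isWeight_virB hc one_pos
  simp only [div_one, mul_one] at hB
  set ε := (K + c + 1) * √c
  have hK := hB.nonneg.1
  have hε := hB.nonneg.2
  set R' := max R₀ 1
  have hR' : 1 ≤ R' := le_max_right _ _
  have hev : ∀ y, R' < y → deriv q =ᶠ[𝓝 y] fun _ => 0 := fun y hy => by
    filter_upwards [Ioi_mem_nhds hy] with x hx using hR x ((le_max_left _ _).trans_lt hx)
  have hq0 : ∀ y, R' < y → deriv q y = 0 := fun y hy => (hev y hy).eq_of_nhds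
  have hq0' : ∀ y, R' < y → deriv (deriv q) y = 0 := fun y hy => by
    rw [(hev y hy).deriv_eq, deriv_const]
  have hB0 : ∀ y, R' < y → virB q y = 0 := fun y hy => by
    rw [virB, hq0 y hy, hq0' y hy]; simp
  have hBd0 : ∀ y, R' < y → virBDeriv q y = 0 := fun y hy => by
    have h1 : virB q =ᶠ[𝓝 y] fun _ => 0 := by
      filter_upwards [Ioi_mem_nhds hy] with x hx using hB0 x hx
    have h2 := (hB.hasDerivAt y (by linarith)).deriv
    rw [← h2]; exact h1.deriv_eq.trans (deriv_const _ _)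
  have hb : ∀ {f : ℝ → ℝ} {C : ℝ}, 0 ≤ C → (∀ y, 0 < y → |f y| ≤ C * y) → (∀ y, R' < y → f y = 0) →
      C ≤ K + ε → ∀ y, 0 < y → |f y| ≤ (K + ε) * R' + 1 := by
    intro f C hC h1 h2 h3 y hy
    rcases le_or_gt y R' with hy' | hy'
    · linarith [h1 y hy, (by gcongr : C * y ≤ (K + ε) * R')]
    · rw [h2 y hy', abs_zero]; positivity
  refine ⟨R', (K + ε) * R' + 1, by linarith, by positivity,
    fun y hy => ⟨hq0 y hy, by rw [virW, hB0 y hy, mul_zero]⟩,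
    ⟨fun y hy => (h.hasDerivAt hy).2.1, h.continuousOn_deriv2, hb hK h.abs_deriv_le hq0 (by linarith),
      hb hK (fun y hy => ?_) (fun y hy => by rw [hq0' y hy, mul_zero]) (by linarith)⟩,
    ⟨fun y hy => ((hasDerivAt_id y).mul (hB.hasDerivAt y hy)).congr_deriv (by simp [virWDeriv]),
      hB.continuousOn'.add (continuousOn_id.mul hB.continuousOn),
      hb hK (fun y hy => h.abs_virW_le hy) (fun y hy => by rw [virW, hB0 y hy, mul_zero]) (by linarith),
      hb (by positivity) (fun y hy => ?_)
        (fun y hy => by rw [virWDeriv, hB0 y hy, hBd0 y hy]; ring) le_rfl⟩⟩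
  · rw [abs_mul, abs_of_pos hy, mul_comm]
    gcongr; exact h.abs_deriv2_le y hy
  · rw [abs_mul, abs_of_pos hy, mul_comm]
    gcongr; exact (abs_add_le _ _).trans (add_le_add (hB.abs_le y hy) (hB.abs_deriv_le y hy))

end IsVirialWeight

lemma IsWeight.memL2_comp_mul {w w' f : ℝ → ℝ} {D E : ℝ} (hw : IsWeight w w' D E) (hl : 0 < l)
    (hf : MemL2 f) : MemL2 fun r => w (r / l) * f r :=
  hf.bdd_mul (aemeasurable_comp_div hw.continuousOn' hl) fun _ hr => hw.abs_le _ (div_pos hr hl)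

lemma IsWeight.norm_toX_comp_mul_le {w w' f : ℝ → ℝ} {D E : ℝ} (hw : IsWeight w w' D E) (hl : 0 < l)
    (hf : MemL2 f) : ‖toX fun r => w (r / l) * f r‖ ≤ D * ‖toX f‖ :=
  norm_toX_le hf hw.nonneg.1 (hw.memL2_comp_mul hl hf).aemeasurable fun _ hr =>
    abs_mul_le_right _ (hw.abs_le _ (div_pos hr hl))

lemma memL2_A0 {D : ℝ} (hw : MultiplierBounds q D) (hl : 0 < l) (hg : MemH g) :
    MemL2 (A0 q l g) :=
  ((hw.deriv.memL2_comp_mul hl hg.memL2_deriv).add (hw.virW.memL2_comp_mul hl hg.memL2_div)).congr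
    (ae_of_all _ fun _ => A0_eq q hl g)

lemma toX_A0 {D : ℝ} (hw : MultiplierBounds q D) (hl : 0 < l) (hg : MemH g) :
    toX (A0 q l g) = toX (fun r => deriv q (r / l) * deriv g r)
      + toX (fun r => virW q (r / l) * (g r / r)) := by
  have h1 := hw.deriv.memL2_comp_mul hl hg.memL2_deriv
  have h2 := hw.virW.memL2_comp_mul hl hg.memL2_div
  rw [← toX_add h1 h2]
  exact toX_congr (ae_of_all _ fun _ hr => A0_eq q hl g hr) (h1.add h2)

lemma norm_toX_A0_le {D : ℝ} (hw : MultiplierBounds q D) (hk : 1 ≤ k) (hl : 0 < l) (hg : MemH g) :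
    ‖toX (A0 q l g)‖ ≤ 2 * D * √(hSq k g) := by
  rw [toX_A0 hw hl hg]
  refine (norm_add_le _ _).trans ?_
  have h1 := hw.deriv.norm_toX_comp_mul_le hl hg.memL2_deriv
  have h2 := hw.virW.norm_toX_comp_mul_le hl hg.memL2_div
  have h3 := mul_le_mul_of_nonneg_left (norm_toX_deriv_le hg k) hw.deriv.nonneg.1
  have h4 := mul_le_mul_of_nonneg_left (norm_toX_remainder_div_le hg hk) hw.deriv.nonneg.1
  linarith

end VirialMultipliers

section StaticEstimates
variable {k : ℕ} {J : Set ℝ} {t l m A Am Ce η : ℝ} {a a' b b' f χ : ℝ → ℝ} {ψ ψt : ℝ → ℝ → ℝ}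
  {q : ℝ → ℝ}

lemma sqrt_mul_eq (hl : 0 < l) (hm : 0 < m) : √(l * m) = m * √(l / m) := by
  rw [show l * m = m ^ 2 * (l / m) by field_simp, Real.sqrt_mul (by positivity), Real.sqrt_sq hm.le]

/-- `|ζ / λ - 1| ≲ (λ/μ)^{1/2}`. -/
lemma IsWaveMap.abs_zetaFun_sub_le (h : IsWaveMap k J ψ ψt) (hk : 2 ≤ k) (ha : IsScale J a a')
    (hb : IsScale J b b') (hχ : CutoffBounds χ A) (ht : t ∈ J)
    (hη : √(hSq k (remainder k (a t) (b t) (ψ t))) ≤ Ce * (a t / b t)) :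
    |zetaFun k χ ψ a b t / a t - 1| ≤ 3 * k * A * Ce / kappa k * √(a t / b t) := by
  have hl := ha.pos t ht
  have hm := hb.pos t ht
  have hκ : 0 < kappa k := lt_of_lt_of_le (by positivity) (le_kappa hk)
  have hA := hχ.isProfile.nonneg
  have hg := h.memH_remainder (by omega : k ≠ 0) hl hm ht
  have hz := norm_toX_remainder_div_le hg (by omega : 1 ≤ k)
  unfold zetaFun
  generalize remainder k (a t) (b t) (ψ t) = g at *
  have e : pair (fun r => rescale (b t) χ r * rescaleL2 (a t) (LambdaQ k) r) g
      = inner ℝ (toX fun r => r * cutLambda k χ (a t) (b t) r) (toX fun r => g r / r) := by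
    rw [inner_toX (memL2_mul_cutLambda hk hχ hl hm) hg.memL2_div]
    refine integral_congr_Ioi fun r hr => ?_
    simp only [cutLambda]; field_simp
  rw [e]
  have h1 := abs_inner_le (norm_mul_cutLambda_le hk hχ hl hm) (hz.trans hη)
  generalize inner ℝ (toX fun r => r * cutLambda k χ (a t) (b t) r) (toX fun r => g r / r) = I at *
  generalize a t = l at *
  generalize b t = m at *
  rw [show (l - 1 / kappa k * I) / l - 1 = -(I / (kappa k * l)) by field_simp; ring, abs_neg]
  refine (abs_div_le (by positivity) h1).trans_eq ?_
  rw [sqrt_mul_eq hl hm]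
  field_simp

lemma rescaleL2_LambdaQ (hl : 0 < l) {r : ℝ} (hr : 0 < r) :
    rescaleL2 l (LambdaQ k) r = k / l * sQ k l r := by
  rw [rescaleL2, LambdaQ_div hl hr]; ring

lemma memL2_rescaleL2_LambdaQ (hk : 2 ≤ k) (hl : 0 < l) : MemL2 (rescaleL2 l (LambdaQ k)) :=
  ((memL2_sQ hk hl).const_mul (k / l)).congr (ae_of_all _ fun _ hr => rescaleL2_LambdaQ hl hr)

lemma toX_rescaleL2_LambdaQ (hk : 2 ≤ k) (hl : 0 < l) :
    toX (rescaleL2 l (LambdaQ k)) = toX fun r => k / l * sQ k l r :=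
  toX_congr (ae_of_all _ fun _ hr => rescaleL2_LambdaQ hl hr) ((memL2_sQ hk hl).const_mul _)

lemma norm_rescaleL2_LambdaQ (hk : 2 ≤ k) (hl : 0 < l) :
    ‖toX (rescaleL2 l (LambdaQ k))‖ = √(kappa k) := by
  rw [toX_rescaleL2_LambdaQ hk hl, ← kappa_eq_norm hk hl, Real.sqrt_sq (norm_nonneg _)]

/-- `b` in terms of inner products. -/
lemma IsWaveMap.bFun_eq {D : ℝ} (h : IsWaveMap k J ψ ψt) (hk : 2 ≤ k) (ha : IsScale J a a')
    (hb : IsScale J b b') (hw : MultiplierBounds q D) (ht : t ∈ J) :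
    bFun k q ψ ψt a b t = -inner ℝ (toX (rescaleL2 (a t) (LambdaQ k))) (vC ψt t)
      - inner ℝ (vC ψt t) (toX (A0 q (a t) (remainder k (a t) (b t) (ψ t)))) := by
  have hl := ha.pos t ht
  have hg := h.memH_remainder (by omega : k ≠ 0) hl (hb.pos t ht) ht
  have hv := (h.memH0 t ht).memL2
  rw [bFun, vC, inner_toX (memL2_rescaleL2_LambdaQ hk hl) hv, inner_toX hv (memL2_A0 hw hl hg)]

lemma IsWaveMap.abs_bFun_le {D : ℝ} (h : IsWaveMap k J ψ ψt) (hk : 2 ≤ k) (ha : IsScale J a a')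
    (hb : IsScale J b b') (hw : MultiplierBounds q D) (ht : t ∈ J) :
    |bFun k q ψ ψt a b t| ≤ √(kappa k) * ‖vC ψt t‖
      + ‖vC ψt t‖ * (2 * D * √(hSq k (remainder k (a t) (b t) (ψ t)))) := by
  have hl := ha.pos t ht
  have hg := h.memH_remainder (by omega : k ≠ 0) hl (hb.pos t ht) ht
  rw [h.bFun_eq hk ha hb hw ht]
  refine (abs_sub _ _).trans (add_le_add ?_ ?_)
  · rw [abs_neg, ← norm_rescaleL2_LambdaQ hk hl]; exact abs_real_inner_le_norm _ _
  · exact abs_inner_le le_rfl (norm_toX_A0_le hw (by omega) hl hg)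

/-- `κ ζ' - b` is small: in `κ ζ'` the terms `κ a'` and `a' ⟨χ_b (ΛQ)_a / a | (ΛQ)_a / a⟩` cancel
up to a tail, and what remains is `-⟨χ_b (ΛQ)_a / a | ψ_t⟩`, the leading part of `b`. -/
lemma IsWaveMap.abs_kappa_mul_sub_bFun_le {D : ℝ} (h : IsWaveMap k J ψ ψt) (hJ : J.OrdConnected)
    (hJ' : J.Nontrivial) (hk : 2 ≤ k) (ha : IsScale J a a') (hb : IsScale J b b')
    (hχ : CutoffBounds χ A) (hw : MultiplierBounds q D) (ht : t ∈ J) (hCe : 0 ≤ Ce)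
    (hS : a t / b t ≤ 1) (hη : √(hSq k (remainder k (a t) (b t) (ψ t))) ≤ Ce * (a t / b t))
    (hab : |a' t| + |b' t| ≤ Am * ‖vC ψt t‖) :
    |kappa k * derivWithin (zetaFun k χ ψ a b) J t - bFun k q ψ ψt a b t|
      ≤ ‖vC ψt t‖ * ((2 * k * A * Am * √(kappa k) + 2 * k * A + 8 * k ^ 2 * A * Am
        + 3 * k * A * (1 + k) * Ce * Am) * √(a t / b t)
        + 2 * D * √(hSq k (remainder k (a t) (b t) (ψ t)))) := by
  have hl := ha.pos t ht
  have hm := hb.pos t ht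
  have hκ : 0 < kappa k := lt_of_lt_of_le (by positivity) (le_kappa hk)
  have hA := hχ.isProfile.nonneg
  have hg := h.memH_remainder (by omega : k ≠ 0) hl hm ht
  have hz := norm_toX_remainder_div_le hg (by omega : 1 ≤ k)
  have hA0 := norm_toX_A0_le hw (by omega : 1 ≤ k) hl hg
  rw [(h.contDiffOn_zetaFun hJ hJ' hk ha hb hχ).2 t ht, h.bFun_eq hk ha hb hw ht, cutPairDeriv]
  have n1 := norm_sub_cutLambda_le hk hχ hl hm
  have n2 := abs_pair_cutLambda_sQ_le hk hχ hl hm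
  have n3 := norm_cutLambdaM_le hk hχ hl hm
  have n4 := norm_cutLambdaL_le hk hχ hl hm
  have n5 := norm_rescaleL2_LambdaQ hk hl
  have n6 := kappa_eq_norm hk hl
  rw [← inner_toX (memL2_cutLambda hk hχ hl hm) (memL2_sQ hk hm)] at n2
  rw [← toX_rescaleL2_LambdaQ hk hl] at n1 n6
  have e1 : (k * a' t / a t) • toX (sQ k (a t)) = a' t • toX (rescaleL2 (a t) (LambdaQ k)) := by
    rw [toX_rescaleL2_LambdaQ hk hl, toX_const_mul _ (memL2_sQ hk hl), smul_smul]; congr 1; ring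
  rw [e1]
  generalize toX (rescaleL2 (a t) (LambdaQ k)) = Y at *
  generalize toX (cutLambda k χ (a t) (b t)) = T at *
  generalize toX (sQ k (b t)) = Sm at *
  generalize toX (cutLambdaM k χ (a t) (b t)) = XM at *
  generalize toX (cutLambdaL k χ (a t) (b t)) = XL at *
  generalize toX (A0 q (a t) (remainder k (a t) (b t) (ψ t))) = G at *
  generalize (toX fun r => remainder k (a t) (b t) (ψ t) r / r) = z at *
  generalize √(hSq k (remainder k (a t) (b t) (ψ t))) = η at *
  generalize vC ψt t = v at *
  have hη0 : 0 ≤ η := (norm_nonneg _).trans hz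
  have key : kappa k * (a' t - 1 / kappa k * (inner ℝ T (v + a' t • Y - (k * b' t / b t) • Sm)
      - inner ℝ ((k * b' t / b t) • XM + (k * a' t / a t) • XL) z)) - (-inner ℝ Y v - inner ℝ v G)
      = a' t * inner ℝ (Y - T) Y + inner ℝ (Y - T) v + b' t * (k / b t * inner ℝ T Sm)
        + (b' t * (k / b t * inner ℝ XM z) + a' t * (k / a t * inner ℝ XL z)) + inner ℝ v G := by
    have e3 : inner ℝ Y Y = kappa k := by rw [real_inner_self_eq_norm_sq, n6]
    simp only [inner_sub_right, inner_add_right, inner_smul_right, inner_add_left, inner_smul_left,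
      inner_sub_left, conj_trivial, e3]
    field_simp
    ring
  rw [key]
  generalize a t = l at *
  generalize b t = m at *
  set s := √(l / m) with hs
  have hs0 : 0 < s := by positivity
  have hs2 : l / m = s * s := (Real.mul_self_sqrt (by positivity)).symm
  have hs1 : s ≤ 1 := Real.sqrt_le_one.2 hS
  have hl_eq : l = m * (s * s) := by rw [← hs2]; field_simp
  rw [sqrt_mul_eq hl hm, ← hs] at n3 n4
  rw [hs2] at n1 hη
  have hss : s * s ≤ s := mul_le_of_le_one_left hs0.le hs1
  have hsss : s * s * s ≤ s := mul_le_of_le_one_left hs0.le (hss.trans hs1)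
  have p1 : |inner ℝ (Y - T) Y| ≤ 2 * k * A * s * √(kappa k) := abs_inner_le (n1.trans (by gcongr)) n5.le
  have p2 : |inner ℝ (Y - T) v| ≤ 2 * k * A * s * ‖v‖ := abs_inner_le (n1.trans (by gcongr)) le_rfl
  have p3 : |k / m * inner ℝ T Sm| ≤ 8 * k ^ 2 * A * s := by
    refine (abs_mul_le (abs_of_nonneg (by positivity)).le n2).trans ?_
    calc _ = 8 * k ^ 2 * A * (s * s) := by rw [hl_eq]; field_simp
      _ ≤ _ := by gcongr
  have p4 : |k / m * inner ℝ XM z| ≤ 3 * k * A * (1 + k) * Ce * s := by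
    refine (abs_mul_le (abs_of_nonneg (by positivity)).le (abs_inner_le n3 (hz.trans hη))).trans ?_
    calc _ = 3 * k * A * 1 * Ce * (s * s * s) := by field_simp
      _ ≤ 3 * k * A * (1 + k) * Ce * s := by gcongr; linarith [Nat.cast_nonneg (α := ℝ) k]
  have p5 : |k / l * inner ℝ XL z| ≤ 3 * k * A * (1 + k) * Ce * s := by
    refine (abs_mul_le (abs_of_nonneg (by positivity)).le (abs_inner_le n4 (hz.trans hη))).trans_eq ?_
    rw [hl_eq]; field_simp
  have ha1 : |a' t| ≤ Am * ‖v‖ := by linarith [abs_nonneg (b' t)]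
  have hb1 : |b' t| ≤ Am * ‖v‖ := by linarith [abs_nonneg (a' t)]
  have q1 := abs_mul_le ha1 p1
  have q3 := abs_mul_le hb1 p3
  have q4 := (abs_add_le _ _).trans (add_le_add (abs_mul_le (le_refl |b' t|) p4)
    (abs_mul_le (le_refl |a' t|) p5))
  have q5 := mul_le_mul_of_nonneg_right hab (by positivity : 0 ≤ 3 * k * A * (1 + k) * Ce * s)
  have q6 := abs_inner_le (le_refl ‖v‖) hA0
  refine (abs_add_le _ _).trans ((add_le_add ((abs_add_le _ _).trans (add_le_add
    ((abs_add_three _ _ _).trans (add_le_add (add_le_add q1 p2) q3)) q4)) q6).trans ?_)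
  linarith

end StaticEstimates

/-! ### The time derivative of `b` -/

section MovingMultipliers
variable {k : ℕ} {J : Set ℝ} {t0 l m c R R' K D : ℝ} {a a' b b' w w' q s : ℝ → ℝ} {P P₀ : ℝ → ℝ → ℝ}
  {ψ ψt : ℝ → ℝ → ℝ}

/-- The derivative of `w(r / a(t)) P(t) - w(r / a(t0)) P₀(t)`: no derivative of `P` is needed, only
one of the difference `P - P₀`. -/
lemma hasDerivWithinAt_toX_weight_mul (hJ : J.OrdConnected) (ha : IsScale J a a') (ht0 : t0 ∈ J)
    (hw : IsWeight w w' D D) (hP : ∀ t ∈ J, MemL2 (P t)) (hPc : ContinuousOn (fun t => toX (P t)) J)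
    (hP₀ : ∀ t ∈ J, MemL2 (P₀ t)) (hs : MemL2 s)
    (hS : HasDerivWithinAt (fun t => toX (P t) - toX (P₀ t)) (toX s) J t0) :
    HasDerivWithinAt (fun t => toX (fun r => w (r / a t) * P t r)
        - toX (fun r => w (r / a t0) * P₀ t r))
      (toX (fun r => -(a' t0 / a t0) * (r / a t0 * w' (r / a t0)) * P t0 r)
        + toX (fun r => w (r / a t0) * s r)) J t0 := by
  obtain ⟨L, -, hLe⟩ := ha.exists_bound ht0
  have hm := fun t (ht : t ∈ J) => aemeasurable_comp_div hw.continuousOn' (ha.pos t ht)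
  have hD : ∀ t ∈ J, ∀ r, 0 < r → |w (r / a t)| ≤ D :=
    fun t ht r hr => hw.abs_le _ (div_pos hr (ha.pos t ht))
  have h1 := hasDerivWithinAt_toX_mul (w := fun t r => w (r / a t))
    (w' := fun t r => -(a' t / a t) * (r / a t * w' (r / a t))) (C := L * D) hJ ht0 hm
    ((aemeasurable_comp_div (continuousOn_id_mul hw.continuousOn) (ha.pos t0 ht0)).const_mul _)
    hP hPc (fun t ht r hr => ha.hasDerivWithinAt_comp hw.hasDerivAt ht hr) (by
      filter_upwards [hLe] with t ht r hr
      exact abs_mul_le ((abs_neg _).trans_le ht.2.2.2) (hw.abs_deriv_le _ (div_pos hr (ha.pos t ht.1))))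
  have e : ∀ t ∈ J, toX (fun r => w (r / a t) * P t r) - toX (fun r => w (r / a t0) * P₀ t r)
      = toX (fun r => (w (r / a t) - w (r / a t0)) * P t r)
        + mulOp (fun r => w (r / a t0)) D (hm t0 ht0) (hD t0 ht0) (toX (P t) - toX (P₀ t)) :=
    fun t ht => by
    rw [map_sub, mulOp_toX _ _ (hP t ht), mulOp_toX _ _ (hP₀ t ht)]
    simp only [sub_mul]
    rw [toX_sub (hw.memL2_comp_mul (ha.pos t ht) (hP t ht)) (hw.memL2_comp_mul (ha.pos t0 ht0) (hP t ht))]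
    abel
  rw [← mulOp_toX (hm t0 ht0) (hD t0 ht0) hs]
  exact (h1.add ((mulOp _ D (hm t0 ht0) (hD t0 ht0)).hasFDerivAt.comp_hasDerivWithinAt t0 hS)).congr_of_mem
    e ht0

lemma memL2_cQ_mul_sQ (hk : 2 ≤ k) (hl : 0 < l) : MemL2 fun r => cQ k l r * sQ k l r :=
  (memL2_sQ hk hl).bdd_mul (by fun_prop) fun r _ => abs_cQ_le k l r

lemma hasDerivWithinAt_toX_LambdaQ (hk : 2 ≤ k) (hJ : J.OrdConnected) (ha : IsScale J a a')
    (ht0 : t0 ∈ J) : HasDerivWithinAt (fun t => toX (rescaleL2 (a t) (LambdaQ k)))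
      (-(a' t0 / a t0) • toX fun r => k / a t0 * (sQ k (a t0) r + k * (cQ k (a t0) r * sQ k (a t0) r)))
      J t0 := by
  have hl := ha.pos t0 ht0
  have e : ∀ t ∈ J, toX (rescaleL2 (a t) (LambdaQ k))
      = (k / a t) • toX fun r => sQ k 1 (r / a t) := fun t ht => by
    rw [toX_rescaleL2_LambdaQ hk (ha.pos t ht), toX_const_mul _ (memL2_sQ hk (ha.pos t ht))]
    simp only [sQ_one_div]
  have h2 := ((hasDerivWithinAt_const t0 J (k:ℝ)).div (ha.hasDerivWithinAt t0 ht0) hl.ne').smul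
    (hasDerivWithinAt_toX_comp hJ ha (isProfile_sQ hk) ht0)
  have i1 := memL2_sQ hk hl
  have i2 := memL2_cQ_mul_sQ hk hl
  refine (h2.congr_of_mem e ht0).congr_deriv ?_
  have hx : ∀ x : ℝ, toX (fun r => x * (r / a t0 * (cQ k 1 (r / a t0)
      * (k * sQ k 1 (r / a t0) / (r / a t0)))))
      = (x * k) • toX fun r => cQ k (a t0) r * sQ k (a t0) r := fun x => by
    rw [← toX_const_mul _ i2]
    refine toX_congr (ae_of_all _ fun r (hr : 0 < r) => ?_) (i2.const_mul _)
    rw [sQ_one_div, cQ_one_div]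
    field_simp
  rw [hx, show (toX fun r => sQ k 1 (r / a t0)) = toX (sQ k (a t0)) by simp only [sQ_one_div], toX_const_mul _ (i1.add (i2.const_mul (k:ℝ))), toX_add i1 (i2.const_mul (k:ℝ)),
    toX_const_mul _ i2, Pi.div_apply]
  module

/-- The derivative of `b`. With both scales frozen the time derivative is the virial integral; the
motion of the scales adds an error, small because `𝓐₀(λ)` agrees with the generator of scaling
in the region `r ≤ R λ`. -/
theorem IsWaveMap.exists_hasDerivWithinAt_bFun (h : IsWaveMap k J ψ ψt) (hJ : J.OrdConnected)
    (hk : 2 ≤ k) (ha : IsScale J a a') (hb : IsScale J b b') (ht0 : t0 ∈ J) (hc : 0 < c)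
    (hR : 0 < R) (hK : 0 < K) (hq : IsVirialWeight c R K q) (hR' : 0 < R')
    (hq0 : ∀ y, R' < y → deriv q y = 0 ∧ virW q y = 0)
    (hw : MultiplierBounds q D) :
    ∃ e : ℝ, HasDerivWithinAt (bFun k q ψ ψt a b)
      (1 / a t0 * virInt k q (a t0) (b t0) (remainder k (a t0) (b t0) (ψ t0)) + e) J t0 ∧
      |e| ≤ ‖vC ψt t0‖ * ((|a' t0| + |b' t0|) / a t0) * (4 * k * (K + 1) * (1 + k) / R
        + 2 * D * √(hSq k (remainder k (a t0) (b t0) (ψ t0)))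
        + K * k * (1 + k) * R' * (a t0 / b t0)) := by
  have hk0 : k ≠ 0 := by omega
  have hl := ha.pos t0 ht0
  have hm := hb.pos t0 ht0
  have hg := fun t (ht : t ∈ J) => h.memH_remainder hk0 (ha.pos t ht) (hb.pos t ht) ht
  have hg0 := fun t (ht : t ∈ J) => h.memH_remainder hk0 hl hm ht
  have hD := hw.deriv.nonneg.1
  have hΛ := hasDerivWithinAt_toX_LambdaQ hk hJ ha ht0
  have iS := fun {c : ℝ} (hc : 0 < c) => memL2_sQ_div hk0 (k := k) hc
  have iC := fun {c : ℝ} (hc : 0 < c) => memL2_sQ_mul_cQ_div hk0 (k := k) hc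
  have is1 := ((iC hl).const_mul (k * (a' t0 / a t0))).sub ((iC hm).const_mul (k * (b' t0 / b t0)))
  have is2 := ((iS hl).const_mul (k * (a' t0 / a t0))).sub ((iS hm).const_mul (k * (b' t0 / b t0)))
  have dS1 : HasDerivWithinAt (fun t => toX (deriv (remainder k (a t) (b t) (ψ t)))
      - toX (deriv (remainder k (a t0) (b t0) (ψ t)))) (toX _) J t0 :=
    ((((hasDerivWithinAt_toX_sQ_div hk hJ hb ht0).const_smul (k:ℝ)).sub
      ((hasDerivWithinAt_toX_sQ_div hk hJ ha ht0).const_smul (k:ℝ))).congr_of_mem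
      (fun t ht => by
        rw [h.toX_deriv_remainder_sub hk0 hl hm (ha.pos t ht) (hb.pos t ht) ht, pC]
        simp only [Pi.sub_apply, Pi.smul_apply]; abel) ht0).congr_deriv (by
      rw [toX_sub ((iC hl).const_mul (k * (a' t0 / a t0))) ((iC hm).const_mul (k * (b' t0 / b t0))),
        toX_const_mul _ (iC hl), toX_const_mul _ (iC hm)]
      module)
  have dS2 : HasDerivWithinAt (fun t => toX (fun r => remainder k (a t) (b t) (ψ t) r / r)
      - toX (fun r => remainder k (a t0) (b t0) (ψ t) r / r)) (toX _) J t0 :=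
    (((hasDerivWithinAt_toX_Q_div hk hJ hb ht0).sub (hasDerivWithinAt_toX_Q_div hk hJ ha ht0)).congr_of_mem
      (fun t ht => by
        rw [h.toX_remainder_div_sub hk0 hl hm (ha.pos t ht) (hb.pos t ht) ht, zC]
        simp only [Pi.sub_apply]; abel) ht0).congr_deriv (by
      rw [toX_sub ((iS hl).const_mul (k * (a' t0 / a t0))) ((iS hm).const_mul (k * (b' t0 / b t0))),
        toX_const_mul _ (iS hl), toX_const_mul _ (iS hm)]
      module)
  have hp := hasDerivWithinAt_toX_weight_mul hJ ha ht0 hw.deriv (fun t ht => (hg t ht).memL2_deriv)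
    (h.continuousOn_toX_deriv_remainder hJ hk ha hb) (fun t ht => (hg0 t ht).memL2_deriv) is1 dS1
  have hz := hasDerivWithinAt_toX_weight_mul hJ ha ht0 hw.virW (fun t ht => (hg t ht).memL2_div)
    (h.continuousOn_toX_remainder_div hJ hk ha hb) (fun t ht => (hg0 t ht).memL2_div) is2 dS2
  -- The correction to the multiplier that is paired with `ψ_t`; it vanishes at `t0`.
  set Δ : ℝ → RadL2 := fun t => toX (rescaleL2 (a t) (LambdaQ k)) - toX (rescaleL2 (a t0) (LambdaQ k))
      + toX (A0 q (a t) (remainder k (a t) (b t) (ψ t)))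
      - toX (A0 q (a t0) (remainder k (a t0) (b t0) (ψ t))) with hΔ_def
  have eΔ : ∀ t ∈ J, Δ t = toX (rescaleL2 (a t) (LambdaQ k)) - toX (rescaleL2 (a t0) (LambdaQ k))
      + (toX (fun r => deriv q (r / a t) * deriv (remainder k (a t) (b t) (ψ t)) r)
        - toX (fun r => deriv q (r / a t0) * deriv (remainder k (a t0) (b t0) (ψ t)) r))
      + (toX (fun r => virW q (r / a t) * (remainder k (a t) (b t) (ψ t) r / r))
        - toX (fun r => virW q (r / a t0) * (remainder k (a t0) (b t0) (ψ t) r / r))) := fun t ht => by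
    rw [hΔ_def]
    simp only
    rw [toX_A0 hw (ha.pos t ht) (hg t ht), toX_A0 hw hl (hg0 t ht)]
    abel
  have hΔ := (((hΛ.sub_const (toX (rescaleL2 (a t0) (LambdaQ k)))).add hp).add hz).congr_of_mem eΔ ht0
  have hin := hasDerivWithinAt_inner_of_eq_zero (h.continuousOn_vC t0 ht0) hΔ (by rw [hΔ_def]; abel_nf)
  have hβ := h.hasDerivWithinAt_frozen hJ hk hl hm ht0 hc hq
  have eb : ∀ t ∈ J, bFun k q ψ ψt a b t = (-pair (rescaleL2 (a t0) (LambdaQ k)) (ψt t)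
      - pair (ψt t) (A0 q (a t0) (remainder k (a t0) (b t0) (ψ t))))
      - inner ℝ (vC ψt t) (Δ t) := fun t ht => by
    have hv := (h.memH0 t ht).memL2
    rw [hΔ_def]
    simp only
    rw [h.bFun_eq hk ha hb hw ht, ← inner_toX (memL2_rescaleL2_LambdaQ hk hl) hv,
      ← inner_toX hv (memL2_A0 hw hl (hg0 t ht)), inner_sub_right, inner_add_right,
      inner_sub_right, ← vC, real_inner_comm (vC ψt t), real_inner_comm (vC ψt t)]
    ring
  refine ⟨_, ((hβ.sub hin).congr_of_mem eb ht0).congr_deriv (sub_eq_add_neg _ _), ?_⟩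
  rw [abs_neg]
  rw [mul_assoc]
  refine abs_inner_le le_rfl ?_
  clear hβ hin hΔ eb eΔ hp hz dS1 dS2 hΛ hΔ_def
  clear Δ
  have i1 := memL2_sQ hk hl
  have i2 := memL2_cQ_mul_sQ hk hl
  have hn1 := norm_toX_deriv_le (hg t0 ht0) k
  have hn2 := norm_toX_remainder_div_le (hg t0 ht0) (by omega : 1 ≤ k)
  have im1 := (hg t0 ht0).memL2_deriv
  have im2 := (hg t0 ht0).memL2_div
  generalize remainder k (a t0) (b t0) (ψ t0) = g at *
  clear hg hg0
  generalize a' t0 = x at *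
  generalize b' t0 = y at *
  generalize a t0 = l at *
  generalize b t0 = m at *
  generalize √(hSq k g) = η at *
  have hkr : (0:ℝ) < k := by exact_mod_cast (by omega : 0 < k)
  have hWD : ∀ {w w' f : ℝ → ℝ}, IsWeight w w' D D → MemL2 f → ‖toX f‖ ≤ η →
      ‖toX (fun r => -(x / l) * (r / l * w' (r / l)) * f r)‖ ≤ |x| / l * (D * η) :=
    fun {w w' f} hw hf hη => by
    refine (norm_toX_le hf (by positivity) (((aemeasurable_comp_div (continuousOn_id_mul
      hw.continuousOn) hl).const_mul _).mul hf.aemeasurable) (C := |x| / l * D) fun r hr =>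
      abs_mul_le_right _ (abs_mul_le (by rw [abs_neg, abs_div, abs_of_pos hl])
        (hw.abs_deriv_le _ (div_pos hr hl)))).trans ?_
    rw [mul_assoc]; gcongr
  have n1 := hWD hw.deriv im1 hn1
  have n2 := hWD hw.virW im2 hn2
  have hsm := fun {c : ℝ} (hc : 0 < c) (r : ℝ) (hr : 0 < r) => sQ_pos (k := k) hc hr
  -- The `λ'` part: exact cancellation for `r < R λ`.
  set T1 : ℝ → ℝ := fun r => k * sQ k l r * ((virW q (r / l) / r - 1 / l)
    + k * cQ k l r * (deriv q (r / l) / r - 1 / l)) with hT1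
  have eT1 : T1 = fun r => (-(k / l * (sQ k l r + k * (cQ k l r * sQ k l r))) + k * (deriv q (r / l) * (cQ k l r * (k * sQ k l r / r))))
      + k * (virW q (r / l) * (sQ k l r / r)) := by
    funext r; rw [hT1]; ring
  have j1 := (i1.add (i2.const_mul (k:ℝ))).const_mul (k / l)
  have j2 := fun {c : ℝ} (hc : 0 < c) => (hw.deriv.memL2_comp_mul hl (iC hc)).const_mul (k:ℝ)
  have j3 := fun {c : ℝ} (hc : 0 < c) => (hw.virW.memL2_comp_mul hl (iS hc)).const_mul (k:ℝ)
  have hq1 : ∀ r, 0 < r → |deriv q (r / l) / r| ≤ K / l := fun r hr =>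
    (abs_div_le hr (hq.abs_deriv_le _ (div_pos hr hl))).trans_eq (by field_simp)
  have hq2 : ∀ r, 0 < r → |virW q (r / l) / r| ≤ K / l := fun r hr =>
    (abs_div_le hr (hq.abs_virW_le (div_pos hr hl))).trans_eq (by field_simp)
  have hsub : ∀ {z : ℝ}, |z| ≤ K / l → |z - 1 / l| ≤ (K + 1) / l := fun {z} hz => by
    refine (abs_sub _ _).trans ?_
    rw [abs_of_pos (by positivity : 0 < 1 / l), add_div]; gcongr
  have hcq : ∀ {c z M : ℝ} (r : ℝ), |z| ≤ M → |k * cQ k c r * z| ≤ k * M := fun {c z M} r hz => by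
    simpa only [mul_one] using abs_mul_le (abs_mul_le (Nat.abs_cast k).le (abs_cQ_le k c r)) hz
  have b1 : ‖toX T1‖ ≤ 4 * k * (K + 1) * (1 + k) / R := by
    refine (norm_toX_tail_le hk hl (ρ := R * l / 2) (A := k * ((K + 1) / l + k * ((K + 1) / l)))
      (by positivity) (by positivity) ?_ (fun r hr => ?_) fun r hr hr' => ?_).trans_eq ?_
    · rw [eT1]
      exact ((j1.const_mul (-1)).add ((j2 hl).add (j3 hl))).aemeasurable.congr
        (ae_of_all _ fun r => by simp only; ring)
    · rw [hT1]
      simp only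
      rw [abs_mul, abs_of_pos (mul_pos hkr (hsm hl r hr))]
      exact (mul_le_mul_of_nonneg_left ((abs_add_le _ _).trans (add_le_add (hsub (hq2 r hr))
        (hcq r (hsub (hq1 r hr))))) (mul_pos hkr (hsm hl r hr)).le).trans_eq (by ring)
    · have hrl : r / l < R := by rw [div_lt_iff₀ hl]; nlinarith [mul_pos hR hl]
      rw [hT1]
      simp only
      rw [hq.deriv_eq_self (div_pos hr hl) hrl, hq.virW_eq_self (div_pos hr hl) hrl]
      rw [show r / l / r = 1 / l by field_simp]; ring
    · field_simp; ring
  -- The `μ'` part: the multiplier lives in `r ≲ λ`, where `ΛQ_μ` is small in `L²`.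
  set T2 : ℝ → ℝ := fun r => k * (deriv q (r / l) * (cQ k m r * (k * sQ k m r / r)))
    + k * (virW q (r / l) * (sQ k m r / r)) with hT2
  have b2 : ‖toX T2‖ ≤ K * k * (1 + k) * R' := by
    refine norm_toX_le_of_supp ((j2 hm).add (j3 hm)) (ρ := R' * l) (by positivity) (by positivity)
      (fun r hr hr' => ?_) fun r hr => ?_
    · have h1 : |T2 r| ≤ k * (K / l + k * (K / l)) := by
        rw [show T2 r = k * sQ k m r * (virW q (r / l) / r + k * cQ k m r * (deriv q (r / l) / r)) by
          rw [hT2]; ring]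
        simpa only [mul_one] using abs_mul_le (abs_mul_le (Nat.abs_cast k).le (abs_sQ_le k m r))
          ((abs_add_le _ _).trans (add_le_add (hq2 r hr) (hcq r (hq1 r hr))))
      calc T2 r ^ 2 * r * (R' * l) ≤ (k * (K / l + k * (K / l))) ^ 2 * (R' * l) * (R' * l) := by
            gcongr ?_ * ?_ * _
            rw [← sq_abs]; gcongr
        _ = _ := by field_simp
    · have hrl : R' < r / l := by rwa [lt_div_iff₀ hl]
      obtain ⟨z1, z2⟩ := hq0 _ hrl
      simp only [hT2, z1, z2]; ring
  have e1 : ∀ (u : ℝ → ℝ) {f g : ℝ → ℝ}, MemL2 (fun r => k * (u (r / l) * f r)) →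
      MemL2 (fun r => k * (u (r / l) * g r)) →
      toX (fun r => u (r / l) * (k * (x / l) * f r - k * (y / m) * g r))
        = (x / l) • toX (fun r => k * (u (r / l) * f r))
          - (y / m) • toX (fun r => k * (u (r / l) * g r)) := fun u f g hf hg => by
    rw [← toX_const_mul _ hf, ← toX_const_mul _ hg, ← toX_sub (hf.const_mul _) (hg.const_mul _)]
    congr 1; funext r; ring
  have e3 : toX T1 = (-1:ℝ) • toX (fun r => k / l * (sQ k l r + k * (cQ k l r * sQ k l r)))
      + (toX (fun r => k * (deriv q (r / l) * (cQ k l r * (k * sQ k l r / r))))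
        + toX (fun r => k * (virW q (r / l) * (sQ k l r / r)))) := by
    rw [← toX_const_mul _ j1, ← toX_add (j2 hl) (j3 hl),
      ← toX_add (j1.const_mul _) ((j2 hl).add (j3 hl)), eT1]
    congr 1; funext r; ring
  have e4 : toX T2 = toX (fun r => k * (deriv q (r / l) * (cQ k m r * (k * sQ k m r / r))))
      + toX (fun r => k * (virW q (r / l) * (sQ k m r / r))) := toX_add (j2 hm) (j3 hm)
  rw [e1 (deriv q) (j2 hl) (j2 hm), e1 (virW q) (j3 hl) (j3 hm)]
  generalize toX (fun r => -(x / l) * (r / l * deriv (deriv q) (r / l)) * deriv g r) = N1 at *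
  generalize toX (fun r => -(x / l) * (r / l * virWDeriv q (r / l)) * (g r / r)) = N2 at *
  have e5 : ∀ {A B B' C C' : RadL2}, -(x / l) • A + (N1 + ((x / l) • B - (y / m) • C))
      + (N2 + ((x / l) • B' - (y / m) • C')) = (x / l) • ((-1:ℝ) • A + (B + B')) + N1 + N2
        - (y / m) • (C + C') := by intros; module
  rw [e5, ← e3, ← e4]
  refine (norm_sub_le _ _).trans ((add_le_add (norm_add₃_le) le_rfl).trans ?_)
  rw [norm_smul, norm_smul, Real.norm_eq_abs, Real.norm_eq_abs, abs_div, abs_div, abs_of_pos hl,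
    abs_of_pos hm]
  have f1 : |x| / l * ‖toX T1‖ ≤ (|x| + |y|) / l * (4 * k * (K + 1) * (1 + k) / R) := by
    gcongr; linarith [abs_nonneg y]
  have f2 : |y| / m * ‖toX T2‖ ≤ (|x| + |y|) / l * (K * k * (1 + k) * R' * (l / m)) := by
    calc _ ≤ (|x| + |y|) / m * (K * k * (1 + k) * R') := by gcongr; linarith [abs_nonneg x]
      _ = _ := by field_simp
  have hη : 0 ≤ η := (norm_nonneg _).trans hn1
  have f3 : |x| / l * (D * η) ≤ (|x| + |y|) / l * (D * η) := by
    gcongr; linarith [abs_nonneg y]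
  linarith
end MovingMultipliers

/-! ### Uniform constants -/

lemma locallyLipschitzOn_of_hasDerivWithinAt {J : Set ℝ} (hJ : J.OrdConnected) {f f' B : ℝ → ℝ}
    (hf : ∀ t ∈ J, HasDerivWithinAt f (f' t) J t) (hB : ContinuousOn B J)
    (hle : ∀ t ∈ J, |f' t| ≤ B t) : LocallyLipschitzOn J f := by
  intro t0 ht0
  have h1 : ∀ᶠ t in 𝓝[J] t0, B t ≤ B t0 + 1 := by
    filter_upwards [(hB t0 ht0).eventually (gt_mem_nhds (lt_add_one (B t0)))] with t ht using ht.le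
  obtain ⟨s, hs, -, hsJ, hsc, hsp⟩ := exists_convex_of_eventually hJ h1 ht0
  have hB0 : 0 ≤ B t0 + 1 := by linarith [abs_nonneg (f' t0), hle t0 ht0]
  exact ⟨⟨B t0 + 1, hB0⟩, s, hs, hsc.lipschitzOnWith_of_nnnorm_hasDerivWithin_le
    (fun t ht => (hf t (hsJ ht)).mono hsJ) fun t ht => (hle t (hsJ ht)).trans (hsp t ht)⟩

/-- Powers of a number within `δ < 1 - 2^{-1/(k-1)}` of `1` lie within a factor `2` of `1`. -/
lemma pow_bounds_of_abs_sub_one_le {k : ℕ} (hk : 2 ≤ k) {δ x : ℝ} (hδ : 0 < δ)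
    (hδ' : δ < 1 - (2:ℝ) ^ (-(1 / ((k:ℝ) - 1)))) (hx : |x - 1| ≤ δ) :
    δ < 1 ∧ 0 < x ∧ 1 / 2 ≤ x ^ (k - 1) ∧ x ^ (k - 1) ≤ 2 ∧ 1 / 2 ≤ x ^ ((k:ℝ) / 2) := by
  have hk1 : ((k - 1 : ℕ) : ℝ) = (k:ℝ) - 1 := by push_cast [show 1 ≤ k by omega]; ring
  have hk2 : (2:ℝ) ≤ k := by exact_mod_cast hk
  set θ : ℝ := (2:ℝ) ^ (-(1 / ((k:ℝ) - 1))) with hθ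
  have hθ0 : 0 < θ := Real.rpow_pos_of_pos two_pos _
  have hθk : θ ^ (k - 1) = 1 / 2 := by
    have h1 : (k:ℝ) - 1 ≠ 0 := by linarith
    have h2 : -(1 / ((k:ℝ) - 1)) * ((k:ℝ) - 1) = -1 := by field_simp
    rw [hθ, ← Real.rpow_natCast, ← Real.rpow_mul two_pos.le, hk1, h2, Real.rpow_neg_one]
    norm_num
  obtain ⟨h1, h2⟩ := abs_le.1 hx
  have hx0 : θ ≤ x := by linarith
  have hx1 : 0 < x := hθ0.trans_le hx0
  have hlow : 1 / 2 ≤ x ^ (k - 1) := by rw [← hθk]; gcongr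
  refine ⟨by linarith, hx1, hlow, ?_, ?_⟩
  · have h3 : x ≤ θ⁻¹ := by rw [← one_div, le_div_iff₀ hθ0]; nlinarith
    calc x ^ (k - 1) ≤ θ⁻¹ ^ (k - 1) := by gcongr
      _ = 2 := by rw [inv_pow, hθk]; norm_num
  · rcases le_total 1 x with h4 | h4
    · have := Real.one_le_rpow h4 (by positivity : (0:ℝ) ≤ k / 2); linarith
    · rw [← Real.rpow_natCast, hk1] at hlow
      exact hlow.trans (Real.rpow_le_rpow_of_exponent_ge hx1 h4 (by linarith))

section Assembly
variable {k : ℕ} {J : Set ℝ} {t c R R' K D A Am Ce V τ δ : ℝ} {a a' b b' q χ : ℝ → ℝ}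
  {ψ ψt : ℝ → ℝ → ℝ}

/-- All the estimates at one time, in terms of `λ / μ ≤ τ²`. -/
lemma IsWaveMap.modulation_estimates (h : IsWaveMap k J ψ ψt) (hJ : J.OrdConnected)
    (hJ' : J.Nontrivial) (hk : 2 ≤ k) (ha : IsScale J a a') (hb : IsScale J b b') (ht : t ∈ J)
    (hχ : CutoffBounds χ A) (hc : 0 < c) (hR : 0 < R) (hK : 0 < K) (hq : IsVirialWeight c R K q)
    (hR' : 0 < R') (hq0 : ∀ y, R' < y → deriv q y = 0 ∧ virW q y = 0)
    (hw : MultiplierBounds q D)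
    (hAm : 0 ≤ Am) (hCe : 0 ≤ Ce) (hV : 0 ≤ V) (hτ : 0 < τ) (hτ1 : τ ≤ 1)
    (hs : a t / b t ≤ τ ^ 2)
    (hg : √(hSq k (remainder k (a t) (b t) (ψ t))) ≤ Ce * √((a t / b t) ^ k))
    (hv : ‖vC ψt t‖ ≤ V * √((a t / b t) ^ k))
    (hv' : √(kappa k) * ‖vC ψt t‖ ≤ (4 * √(kappa k * k) + δ / 2) * √((a t / b t) ^ k))
    (hab : |a' t| + |b' t| ≤ Am * ‖vC ψt t‖)
    (hvir : (8 * (k:ℝ) ^ 2 - δ / 2) * (a t / b t) ^ k ≤ virInt k q (a t) (b t)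
        (remainder k (a t) (b t) (ψ t)) ∧ virInt k q (a t) (b t) (remainder k (a t) (b t) (ψ t))
        ≤ (8 * (k:ℝ) ^ 2 + K * (16 * k + 1) + δ / 2) * (a t / b t) ^ k)
    (hM1 : 3 * k * A * Ce / kappa k * τ ≤ δ)
    (hM2 : V * (2 * k * A * Am * √(kappa k) + 2 * k * A + 8 * k ^ 2 * A * Am
      + 3 * k * A * (1 + k) * Ce * Am + 2 * D * Ce) * τ ≤ δ)
    (hM3 : V * (2 * D * Ce) * τ ≤ δ / 2)
    (hM4 : V ^ 2 * Am * (2 * D * Ce + K * k * (1 + k) * R') * τ ≤ δ / 4)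
    (hM5 : V ^ 2 * Am * (4 * k * (K + 1) * (1 + k) / R) ≤ δ / 4) :
    |zetaFun k χ ψ a b t / a t - 1| ≤ δ ∧
    |kappa k * derivWithin (zetaFun k χ ψ a b) J t - bFun k q ψ ψt a b t| ≤ δ * √((a t / b t) ^ k) ∧
    |bFun k q ψ ψt a b t| ≤ 4 * √(kappa k * k) * √((a t / b t) ^ k) + δ * √((a t / b t) ^ k) ∧
    ∃ B : ℝ, HasDerivWithinAt (bFun k q ψ ψt a b) B J t ∧
      (8 * (k:ℝ) ^ 2 - δ) * ((a t / b t) ^ k / a t) ≤ B ∧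
      B ≤ (8 * (k:ℝ) ^ 2 + K * (16 * k + 1) + δ) * ((a t / b t) ^ k / a t) := by
  have hl := ha.pos t ht
  have hm := hb.pos t ht
  have hκ : 0 < kappa k := lt_of_lt_of_le (by exact_mod_cast (by omega : 0 < k)) (le_kappa hk)
  have hA := hχ.isProfile.nonneg
  have hD := hw.deriv.nonneg.1
  have hsp : 0 < a t / b t := div_pos hl hm
  have hτ2 : τ ^ 2 ≤ τ := by nlinarith
  have hsτ : a t / b t ≤ τ := hs.trans hτ2
  have hsqτ : √(a t / b t) ≤ τ := Real.sqrt_le_iff.2 ⟨hτ.le, hs⟩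
  have hs1 : a t / b t ≤ 1 := hsτ.trans hτ1
  have hσs : √((a t / b t) ^ k) ≤ a t / b t :=
    Real.sqrt_le_iff.2 ⟨hsp.le, pow_le_pow_of_le_one hsp.le hs1 hk⟩
  have hg' := hg.trans (mul_le_mul_of_nonneg_left hσs hCe)
  have hgτ := hg'.trans (mul_le_mul_of_nonneg_left hsτ hCe)
  have z1 := h.abs_zetaFun_sub_le hk ha hb hχ ht hg'
  have z2 := h.abs_kappa_mul_sub_bFun_le hJ hJ' hk ha hb hχ hw ht hCe hs1 hg' hab
  have z3 := h.abs_bFun_le hk ha hb hw ht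
  obtain ⟨e, he, hle⟩ := h.exists_hasDerivWithinAt_bFun hJ hk ha hb ht hc hR hK hq hR' hq0 hw
  have hσ2 : √((a t / b t) ^ k) * √((a t / b t) ^ k) = (a t / b t) ^ k :=
    Real.mul_self_sqrt (by positivity)
  set σ := √((a t / b t) ^ k)
  refine ⟨z1.trans (le_trans (by gcongr) hM1), z2.trans ?_, z3.trans ?_, _, he, ?_⟩
  · calc _ ≤ (V * σ) * ((2 * k * A * Am * √(kappa k) + 2 * k * A + 8 * k ^ 2 * A * Am
        + 3 * k * A * (1 + k) * Ce * Am) * τ + 2 * D * (Ce * τ)) := by gcongr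
      _ = (V * (2 * k * A * Am * √(kappa k) + 2 * k * A + 8 * k ^ 2 * A * Am
        + 3 * k * A * (1 + k) * Ce * Am + 2 * D * Ce) * τ) * σ := by ring
      _ ≤ _ := by gcongr
  · have h1 : ‖vC ψt t‖ * (2 * D * √(hSq k (remainder k (a t) (b t) (ψ t)))) ≤ δ / 2 * σ := by
      calc _ ≤ (V * σ) * (2 * D * (Ce * τ)) := by gcongr
        _ = (V * (2 * D * Ce) * τ) * σ := by ring
        _ ≤ _ := by gcongr
    linarith
  · have hE : |e| ≤ δ / 2 * ((a t / b t) ^ k / a t) := by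
      calc |e| ≤ _ := hle
        _ ≤ (V * σ) * ((Am * (V * σ)) / a t)
            * (4 * k * (K + 1) * (1 + k) / R + 2 * D * (Ce * τ) + K * k * (1 + k) * R' * τ) := by
          gcongr
          exact hab.trans (by gcongr)
        _ = (V ^ 2 * Am * (4 * k * (K + 1) * (1 + k) / R)
            + V ^ 2 * Am * (2 * D * Ce + K * k * (1 + k) * R') * τ) * (σ * σ / a t) := by ring
        _ ≤ (δ / 4 + δ / 4) * (σ * σ / a t) := by gcongr
        _ = _ := by rw [hσ2]; ring
    have v1 := mul_le_mul_of_nonneg_left hvir.1 (by positivity : 0 ≤ 1 / a t)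
    have v2 := mul_le_mul_of_nonneg_left hvir.2 (by positivity : 0 ≤ 1 / a t)
    obtain ⟨e1, e2⟩ := abs_le.1 hE
    have r1 : ∀ x : ℝ, 1 / a t * (x * (a t / b t) ^ k) = x * ((a t / b t) ^ k / a t) := fun x => by
      ring
    rw [r1] at v1 v2
    constructor <;> linarith

lemma exists_pos_le_one_forall_mul_le (M₁ M₂ M₃ M₄ M₅ : ℝ) {ε : ℝ} (hε : 0 < ε) : ∃ τ : ℝ, 0 < τ ∧
    τ ≤ 1 ∧ M₁ * τ ≤ ε ∧ M₂ * τ ≤ ε ∧ M₃ * τ ≤ ε ∧ M₄ * τ ≤ ε ∧ M₅ * τ ≤ ε := by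
  set N := 1 + |M₁| + |M₂| + |M₃| + |M₄| + |M₅|
  have h1 := abs_nonneg M₁
  have h2 := abs_nonneg M₂
  have h3 := abs_nonneg M₃
  have h4 := abs_nonneg M₄
  have h5 := abs_nonneg M₅
  have hN : 0 < N := by positivity
  have key : ∀ M : ℝ, |M| ≤ N → M * min 1 (ε / N) ≤ ε := fun M hM => by
    have h0 : 0 < min 1 (ε / N) := by positivity
    exact (mul_le_mul ((le_abs_self M).trans hM) (min_le_right _ _) h0.le hN.le).trans_eq
      (by field_simp)
  refine ⟨min 1 (ε / N), by positivity, min_le_left _ _, key _ ?_, key _ ?_, key _ ?_, key _ ?_,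
    key _ ?_⟩ <;> simp only [N] <;> linarith

lemma IsModulation.isScale {Z : ℝ → ℝ} {C : ℝ} (hmod : IsModulation k Z C J ψ ψt a b)
    (hJ : J.OrdConnected) (hJ' : J.Nontrivial) :
    IsScale J a (derivWithin a J) ∧ IsScale J b (derivWithin b J) := by
  have hu := uniqueDiffOn_of_nontrivial hJ hJ'
  have key : ∀ {f : ℝ → ℝ}, ContDiffOn ℝ 1 f J → (∀ t ∈ J, 0 < f t) → IsScale J f (derivWithin f J) :=
    fun hf hp => ⟨hp, fun t ht => (hf.differentiableOn one_ne_zero t ht).hasDerivWithinAt,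
      hf.continuousOn_derivWithin hu le_rfl⟩
  exact ⟨key hmod.contDiffOn_lam hmod.lam_pos, key hmod.contDiffOn_mu hmod.mu_pos⟩

/-- The constants: quantitative control of `ζ`, `b` and `b'` for every solution that stays close to
the two-bubble family at the threshold energy. -/
theorem exists_modulation_control {Z : ℝ → ℝ} (hk : 2 ≤ k) (hK : 0 < K)
    (hZ : IsModulationProfile k Z) (hχ : IsCutoff χ) (hδ : 0 < δ) :
    ∃ c₁ R₁ : ℝ, 0 < c₁ ∧ 0 < R₁ ∧ ∀ c R : ℝ, 0 < c → c ≤ c₁ → R₁ ≤ R →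
      ∀ q : ℝ → ℝ, IsVirialWeight c R K q → ∀ C η₀ : ℝ, 0 < C → 0 < η₀ →
      ∃ η₁ : ℝ, 0 < η₁ ∧ η₁ < η₀ ∧ ∀ (J : Set ℝ) (ψ ψt : ℝ → ℝ → ℝ) (lam mu : ℝ → ℝ),
        J.OrdConnected → J.Nontrivial → IsWaveMap k J ψ ψt →
        (∀ t ∈ J, energy k (ψ t) (ψt t) = 2 * energy k (Q k) (fun _ => 0)) →
        (∀ t ∈ J, dPlus k (ψ t) (ψt t) ≤ η₁) → IsModulation k Z C J ψ ψt lam mu →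
        ∀ t ∈ J, 0 < lam t ∧ 0 < mu t ∧
          |zetaFun k χ ψ lam mu t / lam t - 1| ≤ δ ∧
          |kappa k * derivWithin (zetaFun k χ ψ lam mu) J t - bFun k q ψ ψt lam mu t|
            ≤ δ * √((lam t / mu t) ^ k) ∧
          |bFun k q ψ ψt lam mu t|
            ≤ 4 * √(kappa k * k) * √((lam t / mu t) ^ k) + δ * √((lam t / mu t) ^ k) ∧
          ∃ B : ℝ, HasDerivWithinAt (bFun k q ψ ψt lam mu) B J t ∧
            (8 * (k:ℝ) ^ 2 - δ) * ((lam t / mu t) ^ k / lam t) ≤ B ∧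
            B ≤ (8 * (k:ℝ) ^ 2 + K * (16 * k + 1) + δ) * ((lam t / mu t) ^ k / lam t) := by
  have hk1 : 1 ≤ k := by omega
  have hk0 : k ≠ 0 := by omega
  have hk2 : (2:ℝ) ≤ k := by exact_mod_cast hk
  have hκ := le_kappa hk
  obtain ⟨Ch, hCh, hen⟩ := exists_energy_control hk1 hZ.contDiff.continuous hZ.hasCompactSupport
    hZ.pair_pos
  obtain ⟨c₁, R₀, hc₁, hR₀, hvir⟩ := exists_virial_estimate hk1 hK hZ.contDiff.continuous
    hZ.hasCompactSupport hZ.pair_pos (half_pos hδ)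
  obtain ⟨Am, E, hAm, hE, hscales⟩ := exists_abs_deriv_scales_le hk hZ
  obtain ⟨A, hA⟩ := hχ.exists_cutoffBounds
  have hκ0 : 0 < kappa k := by linarith
  set V : ℝ := √(16 * k + 1) with hV
  have hV2 : V ^ 2 = 16 * k + 1 := Real.sq_sqrt (by positivity)
  -- `R₁` makes the tail `r ≥ R λ` of the moving multiplier harmless.
  set T := V ^ 2 * Am * (4 * k * (K + 1) * (1 + k)) with hT
  have hT0 : 0 < T := by positivity
  refine ⟨c₁, max R₀ (T / (δ / 4)), hc₁, lt_max_of_lt_left hR₀, fun c R hc hcc hRR q hq C η₀ hC hη₀ => ?_⟩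
  have hRT : T / (δ / 4) ≤ R := (le_max_right _ _).trans hRR
  have hRR0 : R₀ ≤ R := (le_max_left _ _).trans hRR
  have hR : 0 < R := hR₀.trans_le hRR0
  obtain ⟨ηv, hηv, hvir⟩ := hvir c R hc hcc hRR0 q hq
  obtain ⟨R', D, hR', hD, hq0, hw⟩ := hq.exists_isWeight hc
  -- `ν` is the loss in `‖ψ_t‖² ≤ (16 k + ν) (λ/μ)^k`.
  -- It is chosen so that `√(κ (16 k + ν)) ≤ 4 √(κ k) + δ / 2`.
  set ν : ℝ := min 1 ((δ / 2) ^ 2 / kappa k) with hν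
  have hν0 : 0 < ν := by positivity
  obtain ⟨ηe, hηe, hen⟩ := hen ν hν0
  set Ce := √Ch with hCe
  obtain ⟨τ, hτ, hτ1, hM1, hM2, hM3, hM4, hM5⟩ := exists_pos_le_one_forall_mul_le
    (3 * k * A * Ce / kappa k) (V * (2 * k * A * Am * √(kappa k) + 2 * k * A + 8 * k ^ 2 * A * Am
      + 3 * k * A * (1 + k) * Ce * Am + 2 * D * Ce)) (V * (2 * D * Ce))
    (V ^ 2 * Am * (2 * D * Ce + K * k * (1 + k) * R')) (E * (1 + Ce) * δ)
    (by positivity : 0 < δ / 4)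
  replace hM5 : E * (1 + Ce) * τ ≤ 1 := by
    exact le_of_mul_le_mul_left (by linarith) hδ
  -- `(λ/μ)^k ≤ η` then gives `λ/μ ≤ τ²`, so that both `λ/μ` and its square root are at most `τ`.
  set η := min ηv (min ηe ((τ ^ 2) ^ k)) with hη
  have hη0 : 0 < η := by positivity
  refine ⟨min (η₀ / 2) (η / C), by positivity, (min_le_left _ _).trans_lt (by linarith),
    fun J ψ ψt lam mu hJ hJ' h hE0 hd hmod t ht => ?_⟩
  obtain ⟨ha, hb⟩ := hmod.isScale hJ hJ'
  have hl := hmod.lam_pos t ht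
  have hm := hmod.mu_pos t ht
  have hb0 : hSq k (remainder k (lam t) (mu t) (ψ t)) + l2Sq (ψt t) + (lam t / mu t) ^ k ≤ η := by
    refine (hmod.bound t ht).trans ?_
    calc _ ≤ C * (η / C) := by gcongr; exact (hd t ht).trans (min_le_right _ _)
      _ = η := by field_simp
  have hS0 : 0 < (lam t / mu t) ^ k := by positivity
  have hh0 := hSq_nonneg k (remainder k (lam t) (mu t) (ψ t))
  have hv0 := l2Sq_nonneg (ψt t)
  have hηv' : η ≤ ηv := min_le_left _ _
  have hηe' : η ≤ ηe := (min_le_right _ _).trans (min_le_left _ _)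
  have hητ : η ≤ (τ ^ 2) ^ k := (min_le_right _ _).trans (min_le_right _ _)
  have hs : lam t / mu t ≤ τ ^ 2 := le_of_pow_le_pow_left₀ hk0 (by positivity) (by linarith)
  obtain ⟨g1, g2, g3⟩ := hen (lam t) (mu t) (ψ t) (ψt t) hl hm (h.memH0 t ht) (hE0 t ht)
    (hmod.orthogonal_lam t ht) (hmod.orthogonal_mu t ht) (by linarith) (by linarith)
  have hg : √(hSq k (remainder k (lam t) (mu t) (ψ t))) ≤ Ce * √((lam t / mu t) ^ k) := by
    rw [hCe, ← Real.sqrt_mul hCh.le]; exact Real.sqrt_le_sqrt g1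
  have hv2 : ‖vC ψt t‖ ≤ √(16 * k + ν) * √((lam t / mu t) ^ k) := by
    rw [vC, norm_toX (h.memH0 t ht).memL2, ← Real.sqrt_mul (by positivity)]
    exact Real.sqrt_le_sqrt (by linarith)
  have hv : ‖vC ψt t‖ ≤ V * √((lam t / mu t) ^ k) := by
    refine hv2.trans ?_
    rw [hV]; gcongr; exact min_le_left _ _
  have hv' : √(kappa k) * ‖vC ψt t‖ ≤ (4 * √(kappa k * k) + δ / 2) * √((lam t / mu t) ^ k) := by
    refine (mul_le_mul_of_nonneg_left hv2 (Real.sqrt_nonneg _)).trans ?_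
    rw [← mul_assoc, ← Real.sqrt_mul hκ0.le]
    gcongr
    refine Real.sqrt_le_iff.2 ⟨by positivity, ?_⟩
    have h1 : kappa k * ν ≤ (δ / 2) ^ 2 := by rw [mul_comm, ← le_div_iff₀ hκ0]; exact min_le_right _ _
    have h2 : √(kappa k * k) ^ 2 = kappa k * k := Real.sq_sqrt (by positivity)
    have h3 := mul_nonneg (Real.sqrt_nonneg (kappa k * k)) hδ.le
    linarith
  have hsp : 0 < lam t / mu t := div_pos hl hm
  have hτ2 : τ ^ 2 ≤ τ := pow_le_of_le_one hτ.le hτ1 two_ne_zero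
  have hσs : √((lam t / mu t) ^ k) ≤ lam t / mu t := Real.sqrt_le_iff.2
    ⟨hsp.le, pow_le_pow_of_le_one hsp.le (by linarith) hk⟩
  have hab := hscales J ψ ψt lam _ mu _ hJ hJ' h ha hb hmod.orthogonal_lam hmod.orthogonal_mu t ht (by
    calc _ ≤ E * (τ + Ce * τ) := by
          gcongr
          · linarith
          · exact hg.trans (by gcongr; linarith)
      _ = E * (1 + Ce) * τ := by ring
      _ ≤ 1 := hM5)
  exact ⟨hl, hm, h.modulation_estimates hJ hJ' hk ha hb ht hA hc hR hK hq hR' hq0 hw hAm.le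
    (Real.sqrt_nonneg _) (Real.sqrt_nonneg _) hτ hτ1 hs hg hv hv' hab
    (hvir (lam t) (mu t) (ψ t) (ψt t) hl hm (h.memH0 t ht) (hE0 t ht)
      (hmod.orthogonal_lam t ht) (hmod.orthogonal_mu t ht) (by linarith) (by linarith))
    (by linarith) (by linarith) (by linarith) hM4 (by
      rw [div_le_iff₀ (by positivity)] at hRT
      rw [← mul_div_assoc, div_le_iff₀ hR]; linarith)⟩

end Assembly
end WaveMapTwoBubble

theorem proposition3p4 (k : ℕ) (hk : 2 ≤ k) (K : ℝ) (hK : 0 < K) :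
    ∃ C₀ : ℝ, 0 < C₀ ∧
      ∀ Z : ℝ → ℝ, IsModulationProfile k Z →
      ∀ χ : ℝ → ℝ, IsCutoff χ →
      ∀ δ : ℝ, 0 < δ → δ < 1 - (2 : ℝ) ^ (-(1 / ((k : ℝ) - 1))) →
      ∃ c₁ R₁ : ℝ, 0 < c₁ ∧ 0 < R₁ ∧
      ∀ c R : ℝ, 0 < c → c ≤ c₁ → R₁ ≤ R →
      ∀ q : ℝ → ℝ, IsVirialWeight c R K q →
      ∀ C η₀ : ℝ, 0 < C → 0 < η₀ →
      ∃ η₁ : ℝ, 0 < η₁ ∧ η₁ < η₀ ∧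
      ∀ (J : Set ℝ) (ψ ψt : ℝ → ℝ → ℝ) (lam mu : ℝ → ℝ),
        J.OrdConnected → J.Nontrivial →
        IsWaveMap k J ψ ψt →
        (∀ t ∈ J, energy k (ψ t) (ψt t) = 2 * energy k (Q k) (fun _ => 0)) →
        (∀ t ∈ J, dPlus k (ψ t) (ψt t) ≤ η₁) →
        IsModulation k Z C J ψ ψt lam mu →
        let ζ : ℝ → ℝ := zetaFun k χ ψ lam mu
        let b : ℝ → ℝ := bFun k q ψ ψt lam mu
        let p : ℝ := (k : ℝ) / 2
        ContDiffOn ℝ 1 ζ J ∧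
        (∀ t ∈ J,
          |ζ t / lam t - 1| ≤ δ ∧
          |kappa k * derivWithin ζ J t - b t| ≤ δ * (lam t ^ p / mu t ^ p) ∧
          δ * (lam t ^ p / mu t ^ p) ≤ 2 * δ * (ζ t ^ p / mu t ^ p) ∧
          |b t| ≤ 4 * √(kappa k * k) * (lam t / mu t) ^ p + δ * (lam t ^ p / mu t ^ p) ∧
          4 * √(kappa k * k) * (lam t / mu t) ^ p + δ * (lam t ^ p / mu t ^ p)
            ≤ 10 * √(kappa k * k) * (ζ t ^ p / mu t ^ p)) ∧
        LocallyLipschitzOn J b ∧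
        (∀ᵐ t : ℝ, t ∈ J → DifferentiableWithinAt ℝ b J t) ∧
        (∀ t ∈ J, DifferentiableWithinAt ℝ b J t →
          |derivWithin b J t| ≤ C₀ * (lam t ^ (k - 1) / mu t ^ k) ∧
          C₀ * (lam t ^ (k - 1) / mu t ^ k) ≤ 2 * C₀ * (ζ t ^ (k - 1) / mu t ^ k) ∧
          8 * (k : ℝ) ^ 2 * (lam t ^ (k - 1) / mu t ^ k) - δ * (lam t ^ (k - 1) / mu t ^ k)
            ≤ derivWithin b J t ∧
          2 * (k : ℝ) ^ 2 * (ζ t ^ (k - 1) / mu t ^ k)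
            ≤ 8 * (k : ℝ) ^ 2 * (lam t ^ (k - 1) / mu t ^ k)
              - δ * (lam t ^ (k - 1) / mu t ^ k)) := by
  have hk2 : (2:ℝ) ≤ k := by exact_mod_cast hk
  have hκ := le_kappa hk
  refine ⟨8 * (k:ℝ) ^ 2 + K * (16 * k + 1) + 1, by positivity, fun Z hZ χ hχ δ hδ hδ' => ?_⟩
  obtain ⟨A, hA⟩ := hχ.exists_cutoffBounds
  obtain ⟨c₁, R₁, hc₁, hR₁, main⟩ := exists_modulation_control hk hK hZ hχ hδ
  refine ⟨c₁, R₁, hc₁, hR₁, fun c R hc hcc hRR q hq C η₀ hC hη₀ => ?_⟩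
  obtain ⟨η₁, hη₁, hη₁', main⟩ := main c R hc hcc hRR q hq C η₀ hC hη₀
  refine ⟨η₁, hη₁, hη₁', fun J ψ ψt lam mu hJ hJ' h hE0 hd hmod => ?_⟩
  intro ζ b p
  obtain ⟨ha, hb⟩ := hmod.isScale hJ hJ'
  have hu := uniqueDiffOn_of_nontrivial hJ hJ'
  replace main := main J ψ ψt lam mu hJ hJ' h hE0 hd hmod
  choose! hl hm h1 h2 h3 B hB hB1 hB2 using main
  have hδ1 : ∀ t ∈ J, _ := fun t ht => pow_bounds_of_abs_sub_one_le hk hδ hδ' (h1 t ht)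
  -- The scales enter through `λ/μ` only.
  have e1 : ∀ t ∈ J, lam t ^ p / mu t ^ p = √((lam t / mu t) ^ k) ∧
      (lam t / mu t) ^ p = √((lam t / mu t) ^ k) ∧
      ζ t ^ p / mu t ^ p = (ζ t / lam t) ^ p * √((lam t / mu t) ^ k) ∧
      lam t ^ (k - 1) / mu t ^ k = (lam t / mu t) ^ k / lam t ∧
      ζ t ^ (k - 1) / mu t ^ k = (ζ t / lam t) ^ (k - 1) * ((lam t / mu t) ^ k / lam t) := by
    intro t ht
    have hl := hl t ht
    have hm := hm t ht
    have hz := (hδ1 t ht).2.1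
    have e0 : (lam t / mu t) ^ p = √((lam t / mu t) ^ k) := by
      rw [Real.sqrt_eq_rpow, ← Real.rpow_natCast, ← Real.rpow_mul (by positivity)]
      congr 1; simp only [p]; ring
    have e2 : lam t ^ p / mu t ^ p = √((lam t / mu t) ^ k) := by
      rw [← e0, Real.div_rpow hl.le hm.le]
    have e3 : ζ t = ζ t / lam t * lam t := by field_simp
    have e4 : lam t ^ (k - 1) / mu t ^ k = (lam t / mu t) ^ k / lam t := by
      obtain ⟨j, rfl⟩ : ∃ j, k = j + 1 := ⟨k - 1, by omega⟩
      rw [div_pow, Nat.add_sub_cancel, pow_succ (lam t)]; field_simp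
    refine ⟨e2, e0, ?_, e4, ?_⟩
    · rw [← e2]
      nth_rw 1 [e3]
      rw [Real.mul_rpow hz.le hl.le, mul_div_assoc]
    · rw [← e4]
      nth_rw 1 [e3]
      rw [mul_pow, mul_div_assoc]
  have hBabs : ∀ t ∈ J, |B t| ≤ (8 * (k:ℝ) ^ 2 + K * (16 * k + 1) + 1)
      * (lam t ^ (k - 1) / mu t ^ k) := fun t ht => by
    have hδ1 := (hδ1 t ht).1
    have hX : 0 < (lam t / mu t) ^ k / lam t := by have := hl t ht; have := hm t ht; positivity
    rw [(e1 t ht).2.2.2.1, abs_le]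
    have hB1 := hB1 t ht
    have hB2 := hB2 t ht
    have h8 : 0 ≤ 8 * (k:ℝ) ^ 2 - δ := by nlinarith
    have h9 := mul_nonneg h8 hX.le
    have h10 : 0 ≤ (8 * (k:ℝ) ^ 2 + K * (16 * k + 1) + 1) * ((lam t / mu t) ^ k / lam t) := by
      positivity
    exact ⟨by linarith, hB2.trans (by gcongr)⟩
  refine ⟨(h.contDiffOn_zetaFun hJ hJ' hk ha hb hA).1, fun t ht => ?_,
    locallyLipschitzOn_of_hasDerivWithinAt hJ hB (B := fun t =>
      (8 * (k:ℝ) ^ 2 + K * (16 * k + 1) + 1) * (lam t ^ (k - 1) / mu t ^ k))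
      (continuousOn_const.mul ((ha.continuousOn.pow _).div (hb.continuousOn.pow _)
        fun t ht => (pow_pos (hm t ht) k).ne')) hBabs,
    ae_of_all _ fun t ht => (hB t ht).differentiableWithinAt, fun t ht _ => ?_⟩
  · obtain ⟨e2, e3, e4, -, -⟩ := e1 t ht
    obtain ⟨d1, d2, -, -, d5⟩ := hδ1 t ht
    rw [e2, e3, e4]
    have hσ : 0 ≤ √((lam t / mu t) ^ k) := Real.sqrt_nonneg _
    have hp : 1 / 2 * √((lam t / mu t) ^ k) ≤ (ζ t / lam t) ^ p * √((lam t / mu t) ^ k) :=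
      mul_le_mul_of_nonneg_right d5 hσ
    have hκk : 2 ≤ √(kappa k * k) := Real.le_sqrt_of_sq_le (by nlinarith)
    refine ⟨h1 t ht, h2 t ht, ?_, h3 t ht, ?_⟩
    · have := mul_le_mul_of_nonneg_left hp hδ.le
      linarith
    · have q1 := mul_le_mul_of_nonneg_left hp (by positivity : 0 ≤ 10 * √(kappa k * k))
      have q2 := mul_le_mul_of_nonneg_right (by linarith : δ ≤ √(kappa k * k)) hσ
      linarith
  · obtain ⟨-, -, -, e5, e6⟩ := e1 t ht
    obtain ⟨d1, d2, d3, d4, -⟩ := hδ1 t ht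
    have hX : 0 < (lam t / mu t) ^ k / lam t := by have := hl t ht; have := hm t ht; positivity
    have hBt := hBabs t ht
    rw [(hB t ht).derivWithin (hu t ht)]
    rw [e5] at hBt ⊢
    rw [e6]
    have hB1 := hB1 t ht
    have q1 := mul_le_mul_of_nonneg_right d3 hX.le
    have q2 := mul_le_mul_of_nonneg_right d4 hX.le
    refine ⟨hBt, ?_, by linarith, ?_⟩
    · have := mul_le_mul_of_nonneg_left q1 (by positivity :
        0 ≤ 8 * (k:ℝ) ^ 2 + K * (16 * k + 1) + 1)
      linarith
    · have q3 := mul_le_mul_of_nonneg_left q2 (by positivity : 0 ≤ 2 * (k:ℝ) ^ 2)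
      have q4 := mul_le_mul_of_nonneg_right (by nlinarith : δ ≤ 4 * (k:ℝ) ^ 2) hX.le
      linarith
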